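/- **Setting.** Let $d,b\in\mathbb N$, let $\mathbf n^{(1)},\dots,\mathbf n^{(b)}\in\mathbb Z^d$ be distinct "tangential sites", one of them $0$ and not all of them $0$; put $\mathbb Z^d_1=\mathbb Z^d\setminus\{\mathbf n^{(i)}\}$, $C_1=\max_i|\mathbf n^{(i)}|$ (Euclidean length) and $\pi(k)=\sum_i k_i\mathbf n^{(i)}$, $|k|=\sum_i|k_i|$ for $k\in\mathbb Z^b$. Fix $\tau_0>\max(d+b,12)$, $\tau_1=(4d)^{d+1}(\tau_0+1)$ and $\rho>0$. *Functions and norms.* Functions $f(I,\vartheta,z,\bar z;\xi)$ ($I,\vartheta\in\mathbb C^b$, $z=(z_j)_{j\in\mathbb Z^d_1}$, $\xi$ in a parameter set $\mathcal O\subset\mathbb R^b$) are identified with their series $\sum f_{k,l,\alpha,\beta}(\xi)\,e^{i\langle k,\vartheta\rangle}I^lz^\alpha\bar z^\beta$. Put $\|z\|_\rho=\sum_j|z_j|e^{\rho|j|}|j|^{d+1}$, $|c|_{\mathcal O}=\sup_{\xi\in\mathcal O}(|c|+|\partial_\xi c|)$, $$\|f\|_{r,s}=\sup_{\|z\|_\rho,\|\bar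 z\|_\rho<r}\sum|f_{k,l,\alpha,\beta}|_{\mathcal O}\,r^{2|l|}e^{s|k|}|z^\alpha||\bar z^\beta|,$$ for a vector $G=(G_j)_{j\in\mathbb Z_1^d}$ of functions let $\|G\|_{r,s}$ be the supremum over the same $z,\bar z$ of $\sum_j e^{\rho|j|}|j|^{d+1}\sum|(G_j)_{k,l,\alpha,\beta}|_{\mathcal O}r^{2|l|}e^{s|k|}|z^\alpha||\bar z^\beta|$, and let $$\|X_f\|_{r,s}=\sum_i\|\partial_{I_i}f\|_{r,s}+r^{-2}\sum_i\|\partial_{\vartheta_i}f\|_{r,s}+r^{-1}(\|\partial_zf\|_{r,s}+\|\partial_{\bar z}f\|_{r,s}).$$ $\mathcal A_{r,s}$ is the set of $f$ with coefficients $C^1$ on $\mathcal O$, with $\|X_f\|_{r,s}<\infty$, and with momentum conservation: $f_{k,l,\alpha,\beta}=0$ unless $\pi(k,\alpha,\beta):=\pi(k)+\sum_j j(\alpha_j-\beta_j)=0$. The Poisson bracket is $\{f,g\}=\sum_i(f_{I_i}g_{\vartheta_i}-f_{\vartheta_i}g_{I_i})+i\sum_j(f_{\bar z_j}g_{z_j}-f_{z_j}g_{\bar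 z_j})$. *Cuts.* For $N\in\mathbb N$ let $B_N=\{v\in\mathbb Z^d\setminus\{0\}:|v|<C_1N\}$. An $N$-presentation of an affine subspace $A\subset\mathbb R^d$ of codimension $\ell$ is $A=[v_i;p_i]_\ell:=\{x:v_i\cdot x=p_i,\ 1\le i\le\ell\}$ with $v_i\in B_N$ linearly independent and $p_i\in\mathbb Z$. Order the vectors $(p_1,\dots,p_\ell;v_1,\dots,v_\ell)\in\mathbb Z^{\ell(d+1)}$ by $a\prec a'$ if $(|a_i|)_i<(|a_i'|)_i$ lexicographically, or $(|a_i|)_i=(|a'_i|)_i$ and $a>a'$ lexicographically; the $N$-optimal presentation is the minimal one. A point $m$ with $N$-optimal presentation $[v_i;p_i]_d$ has a cut at $\ell$ with parameters $(N,\theta,\mu,\tau)$, with associated affine space $[v_i;p_i]_\ell$, if $p_\ell<\mu N^\tau$ and $p_{\ell+1}>\theta N^{4d\tau}$ (where $p_0=0$, $p_{d+1}=\infty$). *Quasi-Töplitz functions.* Writing $z_m^+=z_m$, $z_m^-=\bar z_m$, a monomial $e^{i\langle k,\vartheta\rangle}I^lz^\alpha\bar z^\beta z_m^\sigma z_{m'}^{\sigma'}$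 is $(N,\theta,\mu,\tau)$-bilinear if it conserves momentum, $|k|<N$, $|m|,|m'|>\theta N^{\tau_1}$, $\sum_j|j|(\alpha_j+\beta_j)<\mu N^3$, and $m,m'$ both have a cut at some common $0<\ell<d$ with these parameters. $\Pi_{(N,\theta,\mu,\tau)}$ is the projection on these monomials. $\mathbb F(N,\theta,\mu,\tau)$ is the set of $\mathcal F\in\mathcal A_{r,s}$ supported on bilinear monomials whose coefficients, when $m$ is the point whose cut has the $\preceq$-smaller presentation, depend on $m,m'$ only through the affine space $A$ of the cut of $m$ (and on $k,l,\alpha,\beta,\sigma,\sigma',\xi$). For parameters $(K,\theta,\mu)$, $$\|X_f\|^T_{r,s}=\sup_{\substack{N\in\mathbb N,\,N\ge K\\ \tau_0\le\tau\le\tau_1/4d}}\ \inf_{\mathcal F\in\mathbb F(N,\theta,\mu,\tau)}\max\bigl(\|X_f\|_{r,s},\|X_{\mathcal F}\|_{r,s},\|X_{N^{4d\tau}(\Pi_{(N,\theta,\mu,\tau)}f-\mathcal F)}\|_{r,s}\bigr),$$ and $f\in\mathcal A_{r,s}$ is quasi-Töplitz with parameters $(K,\theta,\mu)$ on $D(r,s)\times\mathcal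 O$ if $\|X_f\|^T_{r,s}<\infty$. *Hypotheses.* Let $M,L,\gamma>0$ with $LM<\frac12$. Let $\mathcal O\subset\mathbb R^b$ be open and bounded and let $H=\mathcal N+P$, $\mathcal N=\langle\omega(\xi),I\rangle+\sum_j\Omega_j(\xi)z_j\bar z_j$, where: (A1) $\omega:\mathcal O\to\mathbb R^b$ is a $C^1$ diffeomorphism onto its image with $|\omega|_{C^1},|\nabla\omega^{-1}|\le M$; (A2) $\Omega_j=|j|^2+\tilde\Omega_j$ with $\tilde\Omega_j$ real, $C^1$, $|\tilde\Omega_j|_{C^1}\le L$; (A3)–(A4) $P\in\mathcal A_{r,s}$, and $P$ and $\sum_j\tilde\Omega_j|z_j|^2$ are quasi-Töplitz on $D(r,s)\times\mathcal O$ with parameters $(K,\theta,\mu)$, $\frac12<\theta,\mu<4$, $(\mu-\frac12)K^{\tau_0},(4-\theta)K^{4d\tau_0}>5K^4$, and with quasi-Töplitz norms at most $\varepsilon$ and $L$ respectively. *The KAM step.* Let $R$ be the part of $P$ with $2|l|+|\alpha|+|\beta|\le2$, $\Pi_{\le K}R$ its part with $|k|\le K$, $\langle R\rangle=\sum_iP_{0,e_i,0,0}I_i+\sum_jP_{0,0,e_j,e_j}|z_j|^2$,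 and let $F$ be the solution of $\{\mathcal N,F\}=\Pi_{\le K}R-\langle R\rangle$ (modulo the constant $P_{0,0,0,0}$) with the monomials of $\Pi_{\le K}R$ and without those with $k=0,\alpha=\beta$. Put $$P_+=e^{\{F,\cdot\}}H-\mathcal N-\langle R\rangle,\qquad \tilde\Omega_j^+=\tilde\Omega_j+P_{0,0,e_j,e_j},\qquad r_+=\tfrac14\varepsilon^{1/3}r .$$ $\mathcal O_+$ is the set of $\xi\in\mathcal O$ such that, for all $k\in\mathbb Z^b$ with $|k|\le K$: (i) $|\langle\omega,k\rangle+h|>2\gamma K^{-\tau_0}$ for all $h\in\mathbb Z$, $(k,h)\ne0$; (ii) $|\langle\omega,k\rangle+\Omega\cdot l|>2\gamma K^{-\tau_0}$ for all $l\in\mathbb Z^{\mathbb Z^d_1}$ with $|l|=1$, $\pi(k)+\sum_jjl_j=0$; (iii) $|\langle\omega,k\rangle+\Omega\cdot l|>2\gamma K^{-2d\tau_1}$ for all $l$ with $|l|=2$, $\pi(k)+\sum_jjl_j=0$ which are not of the form $e_m-e_{m'}$ with $\max(|m|,|m'|)>8K^{\tau_1}$; (iv) if $k\ne0$, for all $N\in\mathbb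 N$ with $K\le N\le2K^{\tau_1/\tau_0}$ and all affine spaces with $N$-optimal presentation $[v_i;p_i]_\ell$, $1\le\ell<d$, $|p_\ell|<\frac12N^{\tau_1/4d}$, with non-empty good portion $$[v_i;p_i]^g_\ell=\{x\in\mathbb Z_1^d\cap[v_i;p_i]_\ell:|x|>4N^{\tau_1},\ |v\cdot x|\ge4\max(N^{4d\tau_0},2^{4d}|p_\ell|^{4d})\ \forall v\in B_N\setminus\mathrm{Span}(v_1,\dots,v_\ell)\},$$ $|\langle\omega,k\rangle+\Omega_{m^g}-\Omega_{m^g+\pi(k)}|>2\gamma\min(N^{-2d\tau_0},2^{-4d}|p_\ell|^{-2d})$, where $m^g$ is an arbitrary fixed choice of a point of the good portion. **Proposition 2.** There is $K_0=K_0(d,b,\mathbf n^{(i)},\tau_0,M,L,\gamma)$, and for all $0<s_+<s$ there is $c>0$ depending only on the same data and on $s,s_+$, such that whenever $K\ge K_0$ and $0<\varepsilon\le c\,(\gamma^2K^{-3\tau_1^2/\tau_0})^3$, for every $H$ as above and every choice of the points $m^g$: the coefficients of the Lie series $e^{\{F,\cdot\}}H$ converge for $\xi\in\mathcal O_+$,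 and for all $\theta<\theta_+<4$, $\frac12<\mu_+<\mu$ the functions $P_+$ and $\sum_j\tilde\Omega_j^+|z_j|^2$ are quasi-Töplitz on $D(r_+,s_+)\times\mathcal O_+$ with parameters $(K_+,\theta_+,\mu_+)$ for every $K_+\ge K$ such that $$4K_+<\sqrt{\mu-\mu_+}\,K_+^{3/2},\qquad4\mu_+K_+^4<(\theta_+-\theta)K_+^{4d\tau_0-1};$$ moreover these inequalities hold for all sufficiently large $K_+$. -/

import Mathlib

open scoped ENNReal

noncomputable section

namespace QT

/-! ### Lattice points, monomials, momentum -/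

/-- Euclidean length of an integer vector. -/
def len {d : ℕ} (m : Fin d → ℤ) : ℝ := Real.sqrt (∑ i, (m i : ℝ) ^ 2)

/-- `|k| = ∑ |k_i|` for Fourier indices. -/
def absK {b : ℕ} (k : Fin b → ℤ) : ℝ := ∑ i, |(k i : ℝ)|

/-- The parameter space `ℝ^b`. -/
abbrev Par (b : ℕ) : Type := EuclideanSpace ℝ (Fin b)

/-- Normal sites: lattice points that are not tangential sites. -/
abbrev NSite {d b : ℕ} (n : Fin b → Fin d → ℤ) : Type := {m : Fin d → ℤ // m ∉ Set.range n}

/-- Exponents `(k, l, α, β)` of the monomials `e^{i⟨k,ϑ⟩} I^l z^α z̄^β`. -/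
abbrev Mon {d b : ℕ} (n : Fin b → Fin d → ℤ) : Type :=
  (Fin b → ℤ) × (Fin b → ℕ) × (NSite n →₀ ℕ) × (NSite n →₀ ℕ)

/-- A Hamiltonian depending on parameters, given by its Taylor–Fourier coefficients
`F_{k,l,α,β}(ξ)`. -/
abbrev Ham {d b : ℕ} (n : Fin b → Fin d → ℤ) : Type := Mon n → Par b → ℂ

section Basic

variable {d b : ℕ} {n : Fin b → Fin d → ℤ}

/-- The monomial `I_i`. -/
def monI (i : Fin b) : Mon n := (0, Pi.single i 1, 0, 0)

/-- The monomial `z_j`. -/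
def monZ (j : NSite n) : Mon n := (0, 0, Finsupp.single j 1, 0)

/-- The monomial `z̄_j`. -/
def monZb (j : NSite n) : Mon n := (0, 0, 0, Finsupp.single j 1)

/-- The variable `z_j^σ`, with `true` for `+` and `false` for `-`. -/
def monS (j : NSite n) (σ : Bool) : Mon n := if σ then monZ j else monZb j

/-- Degree `2|l| + |α| + |β|`. -/
def deg (ν : Mon n) : ℕ :=
  2 * (∑ i, ν.2.1 i) + (ν.2.2.1.sum fun _ a => a) + (ν.2.2.2.sum fun _ a => a)

variable (n) in
/-- `π(k) = ∑ k_i n^{(i)}`. -/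
def piK (k : Fin b → ℤ) : Fin d → ℤ := ∑ i, k i • n i

/-- `π(k, α, β)`. -/
def mom (ν : Mon n) : Fin d → ℤ :=
  piK n ν.1 + (ν.2.2.1.sum fun j a => (a : ℤ) • j.1) - (ν.2.2.2.sum fun j a => (a : ℤ) • j.1)

/-! ### Derivatives, products and Poisson brackets on coefficients -/

def dI (i : Fin b) (f : Ham n) : Ham n := fun ν ξ => ((ν.2.1 i : ℂ) + 1) * f (ν + monI i) ξ

def dTheta (i : Fin b) (f : Ham n) : Ham n := fun ν ξ => Complex.I * (ν.1 i : ℂ) * f ν ξ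

def dZ (j : NSite n) (f : Ham n) : Ham n := fun ν ξ => ((ν.2.2.1 j : ℂ) + 1) * f (ν + monZ j) ξ

def dZb (j : NSite n) (f : Ham n) : Ham n := fun ν ξ => ((ν.2.2.2 j : ℂ) + 1) * f (ν + monZb j) ξ

/-- Product of two series. -/
def mulH (f g : Ham n) : Ham n :=
  fun ν ξ => ∑' p : {p : Mon n × Mon n // p.1 + p.2 = ν}, f p.1.1 ξ * g p.1.2 ξ

/-- Poisson bracket of the symplectic form `dI ∧ dϑ + i dz ∧ dz̄`. -/
def poisson (f g : Ham n) : Ham n := fun ν ξ =>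
  (∑ i, (mulH (dI i f) (dTheta i g) ν ξ - mulH (dTheta i f) (dI i g) ν ξ)) +
    Complex.I * ∑' j, (mulH (dZb j f) (dZ j g) ν ξ - mulH (dZ j f) (dZb j g) ν ξ)

/-- `j`-th term of the Lie series `e^{{F,·}} H`. -/
def lieTerm (F H : Ham n) (j : ℕ) : Ham n :=
  fun ν ξ => ((j.factorial : ℂ))⁻¹ * ((poisson F)^[j] H) ν ξ

/-- `e^{{F,·}} H`. -/
def lieExp (F H : Ham n) : Ham n := fun ν ξ => ∑' j, lieTerm F H j ν ξ

/-! ### Majorant norms and the space `𝒜_{r,s}` -/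

/-- `|c|_𝒪 = sup_{ξ ∈ 𝒪} (|c| + |∂_ξ c|)`. -/
def coefNorm (O : Set (Par b)) (c : Par b → ℂ) : ℝ≥0∞ :=
  ⨆ ξ ∈ O, (‖c ξ‖ₑ + ‖fderiv ℝ c ξ‖ₑ)

/-- The weight `e^{ρ|m|} |m|^{d+1}`. -/
def weight (ρ : ℝ) (m : NSite n) : ℝ≥0∞ :=
  ENNReal.ofReal (Real.exp (ρ * len m.1) * len m.1 ^ (d + 1))

/-- `‖z‖_ρ`. -/
def seqNorm (ρ : ℝ) (z : NSite n → ℂ) : ℝ≥0∞ := ∑' m, ‖z m‖ₑ * weight ρ m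

/-- `∑ |f_ν|_𝒪 r^{2|l|} e^{s|k|} |z^α| |z̄^β|`; `z` and `w = z̄` are independent. -/
def majorant (O : Set (Par b)) (r s : ℝ) (f : Ham n) (z w : NSite n → ℂ) : ℝ≥0∞ :=
  ∑' ν : Mon n, coefNorm O (f ν) * ENNReal.ofReal (r ^ (2 * ∑ i, ν.2.1 i) * Real.exp (absK ν.1 * s))
    * (ν.2.2.1.prod fun j a => ‖z j‖ₑ ^ a) * (ν.2.2.2.prod fun j a => ‖w j‖ₑ ^ a)

/-- Norm of a scalar function on `D(r,s) × 𝒪`. -/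
def fnNorm (ρ : ℝ) (O : Set (Par b)) (r s : ℝ) (f : Ham n) : ℝ≥0∞ :=
  ⨆ (z : NSite n → ℂ) (w : NSite n → ℂ) (_ : seqNorm ρ z < ENNReal.ofReal r)
    (_ : seqNorm ρ w < ENNReal.ofReal r), majorant O r s f z w

/-- Norm of an `ℓ_ρ`-valued function on `D(r,s) × 𝒪`. -/
def vecNorm (ρ : ℝ) (O : Set (Par b)) (r s : ℝ) (G : NSite n → Ham n) : ℝ≥0∞ :=
  ⨆ (z : NSite n → ℂ) (w : NSite n → ℂ) (_ : seqNorm ρ z < ENNReal.ofReal r)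
    (_ : seqNorm ρ w < ENNReal.ofReal r), ∑' j, majorant O r s (G j) z w * weight ρ j

/-- `‖X_f‖_{r,s}`. -/
def XNorm (ρ : ℝ) (O : Set (Par b)) (r s : ℝ) (f : Ham n) : ℝ≥0∞ :=
  (∑ i, fnNorm ρ O r s (dI i f)) + ENNReal.ofReal (r ^ 2)⁻¹ * (∑ i, fnNorm ρ O r s (dTheta i f)) +
    ENNReal.ofReal r⁻¹ *
      (vecNorm ρ O r s (fun j => dZ j f) + vecNorm ρ O r s (fun j => dZb j f))

/-- Membership in `𝒜_{r,s}` over the (open) parameter set `𝒪`. -/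
structure InA (ρ : ℝ) (O : Set (Par b)) (r s : ℝ) (f : Ham n) : Prop where
  contDiff : ∀ ν, ContDiffOn ℝ 1 (f ν) O
  momentum : ∀ ν, mom ν ≠ 0 → ∀ ξ ∈ O, f ν ξ = 0
  finite : XNorm ρ O r s f < ⊤

end Basic

/-! ### Affine subspaces, optimal presentations, cuts -/

/-- Data `(p_1, …, p_ℓ; v_1, …, v_ℓ)`. -/
structure Pres (d ℓ : ℕ) where
  p : Fin ℓ → ℤ
  v : Fin ℓ → Fin d → ℤ

namespace Pres

variable {d ℓ : ℕ}

/-- The affine subspace `[v_i; p_i]_ℓ` of `ℝ^d`. -/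
def toSet (P : Pres d ℓ) : Set (Fin d → ℝ) := {x | ∀ i, ∑ j, (P.v i j : ℝ) * x j = P.p i}

/-- The entries `(p_1, …, p_ℓ, v_1, …, v_ℓ)` in one list. -/
def vec (P : Pres d ℓ) : List ℤ :=
  List.ofFn P.p ++ (List.ofFn fun i => List.ofFn (P.v i)).flatten

/-- The first `j` equations. -/
def take (P : Pres d ℓ) {j : ℕ} (h : j ≤ ℓ) : Pres d j :=
  ⟨fun i => P.p (Fin.castLE h i), fun i => P.v (Fin.castLE h i)⟩

/-- `p_ℓ`, and `p_0 = 0`. -/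
def lastP (P : Pres d ℓ) : ℤ := if h : 0 < ℓ then P.p ⟨ℓ - 1, Nat.sub_one_lt_of_lt h⟩ else 0

/-- The vectors `v_i`, in `ℝ^d`. -/
def span (P : Pres d ℓ) : Submodule ℝ (Fin d → ℝ) :=
  Submodule.span ℝ (Set.range fun i => fun j => (P.v i j : ℝ))

end Pres

/-- Sign-lexicographical order (strict): absolute values lexicographically, ties resolved by the
reversed lexicographical order. -/
def SLexLT (a b : List ℤ) : Prop :=
  a.map Int.natAbs < b.map Int.natAbs ∨ (a.map Int.natAbs = b.map Int.natAbs ∧ b < a)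

/-- `P ≼ Q` for presentations. -/
def PresLE {d ℓ : ℕ} (P Q : Pres d ℓ) : Prop := P.vec = Q.vec ∨ SLexLT P.vec Q.vec

section Cuts

variable {d b : ℕ} (n : Fin b → Fin d → ℤ)

/-- `C_1 = max_i |n^{(i)}|`. -/
def C1 : ℝ := ⨆ i, len (n i)

/-- `B_N`. -/
def ballB (N : ℕ) : Set (Fin d → ℤ) := {x | x ≠ 0 ∧ len x < C1 n * N}

/-- `P` presents `A`, with all `v_i` in `B_N`. -/
def IsPres (N : ℕ) {ℓ : ℕ} (P : Pres d ℓ) (A : Set (Fin d → ℝ)) : Prop :=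
  (∀ i, P.v i ∈ ballB n N) ∧ LinearIndependent ℝ (fun i => fun j => (P.v i j : ℝ)) ∧ P.toSet = A

/-- `P` is the `N`-optimal presentation of `A`. -/
def IsOptimal (N : ℕ) {ℓ : ℕ} (P : Pres d ℓ) (A : Set (Fin d → ℝ)) : Prop :=
  IsPres n N P A ∧ ∀ Q : Pres d ℓ, IsPres n N Q A → PresLE P Q

/-- The point `m` has a cut at `ℓ` with parameters `(N, θ, μ, τ)`, and `Q` is the presentation
of the affine space associated with it. The equations of a presentation are numbered from `0`,
so `p_ℓ` is `P.p (ℓ-1)` and `p_{ℓ+1}` is `P.p ℓ`; the conventions `p_0 = 0` and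
`p_{d+1} = ∞` make the respective condition void. -/
def IsCut (N : ℕ) (θ μ τ : ℝ) (m : Fin d → ℤ) (ℓ : ℕ) (Q : Pres d ℓ) : Prop :=
  ∃ (P : Pres d d) (h : ℓ ≤ d), IsOptimal n N P {fun j => (m j : ℝ)} ∧
    (∀ i : Fin d, i.val + 1 = ℓ → (P.p i : ℝ) < μ * (N : ℝ) ^ τ) ∧
    (∀ i : Fin d, i.val = ℓ → θ * (N : ℝ) ^ (4 * d * τ) < (P.p i : ℝ)) ∧
    Q = P.take h

variable (d) in
/-- `τ_1 = (4d)^{d+1} (τ_0 + 1)`. -/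
def tau1 (τ₀ : ℝ) : ℝ := (4 * d : ℝ) ^ (d + 1) * (τ₀ + 1)

/-- The `N`-good portion `[v_i; p_i]_ℓ^g` (with `c = 1/2`, `C = 4`), in the normal sites. -/
def goodPortion (τ₀ : ℝ) (N : ℕ) {ℓ : ℕ} (Q : Pres d ℓ) : Set (NSite n) :=
  {x | (fun j => (x.1 j : ℝ)) ∈ Q.toSet ∧ 4 * (N : ℝ) ^ tau1 d τ₀ < len x.1 ∧
    ∀ v ∈ ballB n N, (fun j => (v j : ℝ)) ∉ Q.span →
      4 * max ((N : ℝ) ^ (4 * d * τ₀)) (2 ^ (4 * d) * |(Q.lastP : ℝ)| ^ (4 * d)) ≤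
        |∑ j, (v j : ℝ) * (x.1 j : ℝ)|}

end Cuts

/-! ### Bilinear monomials, piecewise Töplitz and quasi-Töplitz functions -/

section Toplitz

variable {d b : ℕ} {n : Fin b → Fin d → ℤ}

/-- `e^{i⟨k,ϑ⟩} I^l z^α z̄^β z_m^σ z_{m'}^{σ'}` with `w = (k,l,α,β)` is `(N,θ,μ,τ)`-bilinear, with
cuts of `m`, `m'` at the common index `ℓ` given by `Q`, `Q'`. -/
structure BilinAt (τ₀ : ℝ) (N : ℕ) (θ μ τ : ℝ) (w : Mon n) (m : NSite n) (σ : Bool)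
    (m' : NSite n) (σ' : Bool) (ℓ : ℕ) (Q Q' : Pres d ℓ) : Prop where
  momentum : mom (w + monS m σ + monS m' σ') = 0
  freq : absK w.1 < N
  high : θ * (N : ℝ) ^ tau1 d τ₀ < len m.1
  high' : θ * (N : ℝ) ^ tau1 d τ₀ < len m'.1
  low : (w.2.2.1.sum fun j a => len j.1 * a) + (w.2.2.2.sum fun j a => len j.1 * a) <
    μ * (N : ℝ) ^ 3
  pos : 0 < ℓ
  lt : ℓ < d
  cut : IsCut n N θ μ τ m.1 ℓ Q
  cut' : IsCut n N θ μ τ m'.1 ℓ Q'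

/-- `(N,θ,μ,τ)`-bilinear monomials. -/
def IsBilin (τ₀ : ℝ) (N : ℕ) (θ μ τ : ℝ) (ν : Mon n) : Prop :=
  ∃ w m σ m' σ' ℓ Q Q', ν = w + monS m σ + monS m' σ' ∧
    BilinAt τ₀ N θ μ τ w m σ m' σ' ℓ Q Q'

open Classical in
/-- The projection `Π_{(N,θ,μ,τ)}`. -/
def bilinProj (τ₀ : ℝ) (N : ℕ) (θ μ τ : ℝ) (f : Ham n) : Ham n :=
  fun ν ξ => if IsBilin τ₀ N θ μ τ ν then f ν ξ else 0

/-- Piecewise Töplitz functions `𝔽(N,θ,μ,τ) ⊂ 𝒜_{r,s}`: bilinear functions for which the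
coefficient of `e^{i⟨k,ϑ⟩} I^l z^α z̄^β z_m^σ z_{m'}^{σ'}` (`m` being the point with the smaller
cut) depends on `m`, `m'` only through the affine space of the cut; the value
`σ m + σ' m' = -π(k,α,β)` is determined by `w = (k,l,α,β)`. -/
structure PiecewiseToplitz (ρ τ₀ : ℝ) (O : Set (Par b)) (r s : ℝ) (N : ℕ) (θ μ τ : ℝ)
    (G : Ham n) : Prop where
  mem : InA ρ O r s G
  bilin : ∀ ν, ¬ IsBilin τ₀ N θ μ τ ν → ∀ ξ ∈ O, G ν ξ = 0
  toplitz : ∃ g : Mon n → Bool → Bool → Set (Fin d → ℝ) → Par b → ℂ,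
    ∀ w m σ m' σ' ℓ Q Q', BilinAt τ₀ N θ μ τ w m σ m' σ' ℓ Q Q' → PresLE Q Q' →
      ∀ ξ ∈ O, G (w + monS m σ + monS m' σ') ξ = g w σ σ' Q.toSet ξ

/-- `f̄ = N^{4dτ} (Π_{(N,θ,μ,τ)} f - 𝓕)`. -/
def defect (τ₀ : ℝ) (N : ℕ) (θ μ τ : ℝ) (f G : Ham n) : Ham n :=
  fun ν ξ => (((N : ℝ) ^ (4 * d * τ) : ℝ) : ℂ) * (bilinProj τ₀ N θ μ τ f ν ξ - G ν ξ)

/-- The quasi-Töplitz norm `‖X_f‖^T_{r,s}` for the parameters `(K,θ,μ)`. -/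
def TNorm (ρ τ₀ : ℝ) (O : Set (Par b)) (r s K θ μ : ℝ) (f : Ham n) : ℝ≥0∞ :=
  ⨆ (N : ℕ) (_ : K ≤ N) (τ : ℝ) (_ : τ₀ ≤ τ) (_ : τ ≤ tau1 d τ₀ / (4 * d)),
    ⨅ (G : Ham n) (_ : PiecewiseToplitz ρ τ₀ O r s N θ μ τ G),
      max (XNorm ρ O r s f) (max (XNorm ρ O r s G) (XNorm ρ O r s (defect τ₀ N θ μ τ f G)))

/-- `f` is quasi-Töplitz with parameters `(K,θ,μ)` on `D(r,s) × 𝒪`. -/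
def QuasiToplitz (ρ τ₀ : ℝ) (O : Set (Par b)) (r s K θ μ : ℝ) (f : Ham n) : Prop :=
  InA ρ O r s f ∧ TNorm ρ τ₀ O r s K θ μ f < ⊤

end Toplitz

/-! ### The KAM step -/

section Step

variable {d b : ℕ} {n : Fin b → Fin d → ℤ}

open Classical in
/-- `∑ ω_i I_i + ∑ Ω_j z_j z̄_j`. -/
def normalForm (ω : Fin b → Par b → ℂ) (Ω : NSite n → Par b → ℂ) : Ham n := fun ν ξ =>
  (∑ i, if ν = monI i then ω i ξ else 0) +
    ∑ j ∈ ν.2.2.1.support, if ν = monZ j + monZb j then Ω j ξ else 0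

/-- `∑ Q_j z_j z̄_j`. -/
def diagQ (Q : NSite n → Par b → ℂ) : Ham n := normalForm (fun _ _ => 0) Q

/-- `Ω_j = |j|² + Ω̃_j`. -/
def freqN (Ωt : NSite n → Par b → ℝ) (j : NSite n) (ξ : Par b) : ℝ := len j.1 ^ 2 + Ωt j ξ

/-- `𝒩 = ⟨ω, I⟩ + ∑ Ω_j z_j z̄_j`. -/
def Nham (ω : Par b → Par b) (Ωt : NSite n → Par b → ℝ) : Ham n :=
  normalForm (fun i ξ => ((ω ξ i : ℝ) : ℂ)) (fun j ξ => ((freqN Ωt j ξ : ℝ) : ℂ))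

open Classical in
/-- `Π_{≤K} R`: the part of `P` of degree at most two with `|k| ≤ K`. -/
def truncR (K : ℝ) (P : Ham n) : Ham n := fun ν ξ => if deg ν ≤ 2 ∧ absK ν.1 ≤ K then P ν ξ else 0

/-- `⟨R⟩ = ∑ P_{0,e_i,0,0} I_i + ∑ P_{0,0,e_j,e_j} z_j z̄_j`. -/
def avgR (P : Ham n) : Ham n := normalForm (fun i => P (monI i)) (fun j => P (monZ j + monZb j))

/-- `⟨ω, k⟩ + Ω · l`. -/
def divisor (ω : Par b → Par b) (Ωt : NSite n → Par b → ℝ) (k : Fin b → ℤ) (l : NSite n →₀ ℤ)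
    (ξ : Par b) : ℝ :=
  (∑ i, ω ξ i * (k i : ℝ)) + l.sum fun j a => freqN Ωt j ξ * (a : ℝ)

/-- `α - β`, as an integer vector. -/
def diffAB (ν : Mon n) : NSite n →₀ ℤ :=
  ν.2.2.1.mapRange (Nat.cast : ℕ → ℤ) Nat.cast_zero - ν.2.2.2.mapRange (Nat.cast : ℕ → ℤ) Nat.cast_zero

open Classical in
/-- The generating function `F`: the solution of `{𝒩, F} = Π_{≤K} R - ⟨R⟩` (up to the constant
term of `P`, which does not contribute to vector fields), without resonant terms. -/
def genF (ω : Par b → Par b) (Ωt : NSite n → Par b → ℝ) (K : ℝ) (P : Ham n) : Ham n := fun ν ξ =>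
  if deg ν ≤ 2 ∧ absK ν.1 ≤ K ∧ ¬ (ν.1 = 0 ∧ ν.2.2.1 = ν.2.2.2) then
    P ν ξ / (Complex.I * (divisor ω Ωt ν.1 (diffAB ν) ξ : ℂ)) else 0

/-- `P_+ = e^{{F,·}} (𝒩 + P) - 𝒩_+`, where `𝒩_+ = 𝒩 + ⟨R⟩`. -/
def Pplus (ω : Par b → Par b) (Ωt : NSite n → Par b → ℝ) (K : ℝ) (P : Ham n) : Ham n :=
  lieExp (genF ω Ωt K P) (Nham ω Ωt + P) - (Nham ω Ωt + avgR P)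

/-- `Ω̃^+_j = Ω̃_j + P_{0,0,e_j,e_j}`. -/
def OmegaPlus (Ωt : NSite n → Par b → ℝ) (P : Ham n) (j : NSite n) (ξ : Par b) : ℂ :=
  (Ωt j ξ : ℂ) + P (monZ j + monZb j) ξ

/-- `mg` selects a point of every non-empty good portion. -/
def IsChoice (τ₀ : ℝ) (mg : ℕ → (ℓ : ℕ) → Pres d ℓ → NSite n) : Prop :=
  ∀ N ℓ (Q : Pres d ℓ), (goodPortion n τ₀ N Q).Nonempty → mg N ℓ Q ∈ goodPortion n τ₀ N Q

/-- Momentum of `(k, l)`, `l` an integer vector over the normal sites. -/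
def momKL (k : Fin b → ℤ) (l : NSite n →₀ ℤ) : Fin d → ℤ := piK n k + l.sum fun j a => a • j.1

/-- `|l|`. -/
def absL (l : NSite n →₀ ℤ) : ℤ := l.sum fun _ a => |a|

/-- The set `𝒪_+` of non-resonant parameters. -/
structure InOplus (τ₀ γ K : ℝ) (O : Set (Par b)) (ω : Par b → Par b)
    (Ωt : NSite n → Par b → ℝ) (mg : ℕ → (ℓ : ℕ) → Pres d ℓ → NSite n) (ξ : Par b) : Prop where
  mem : ξ ∈ O
  zeroth : ∀ (k : Fin b → ℤ) (h : ℤ), absK k ≤ K → (k ≠ 0 ∨ h ≠ 0) →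
    2 * γ * K ^ (-τ₀) < |(∑ i, ω ξ i * (k i : ℝ)) + h|
  first : ∀ (k : Fin b → ℤ) (l : NSite n →₀ ℤ), absK k ≤ K → absL l = 1 → momKL k l = 0 →
    2 * γ * K ^ (-τ₀) < |divisor ω Ωt k l ξ|
  second : ∀ (k : Fin b → ℤ) (l : NSite n →₀ ℤ), absK k ≤ K → absL l = 2 → momKL k l = 0 →
    (∀ m m' : NSite n, l = Finsupp.single m 1 - Finsupp.single m' 1 →
      max (len m.1) (len m'.1) ≤ 8 * K ^ tau1 d τ₀) →
    2 * γ * K ^ (-(2 * d * tau1 d τ₀)) < |divisor ω Ωt k l ξ|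
  good : ∀ (N : ℕ), K ≤ N → (N : ℝ) ≤ 2 * K ^ (tau1 d τ₀ / τ₀) →
    ∀ (ℓ : ℕ) (Q : Pres d ℓ), 1 ≤ ℓ → ℓ < d → IsOptimal n N Q Q.toSet →
    |(Q.lastP : ℝ)| < (1 / 2) * (N : ℝ) ^ (tau1 d τ₀ / (4 * d)) → (goodPortion n τ₀ N Q).Nonempty →
    ∀ (k : Fin b → ℤ), absK k ≤ K → k ≠ 0 →
    ∀ m' : NSite n, m'.1 = (mg N ℓ Q).1 + piK n k →
    2 * γ / max ((N : ℝ) ^ (2 * d * τ₀)) (2 ^ (4 * d) * |(Q.lastP : ℝ)| ^ (2 * d)) <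
      |(∑ i, ω ξ i * (k i : ℝ)) + freqN Ωt (mg N ℓ Q) ξ - freqN Ωt m' ξ|

/-- `𝒪_+`. -/
def Oplus (τ₀ γ K : ℝ) (O : Set (Par b)) (ω : Par b → Par b)
    (Ωt : NSite n → Par b → ℝ) (mg : ℕ → (ℓ : ℕ) → Pres d ℓ → NSite n) : Set (Par b) :=
  {ξ | InOplus τ₀ γ K O ω Ωt mg ξ}

/-- The hypotheses of the KAM step on `𝒩 + P` on `D(r,s) × 𝒪` with the bounds `M`, `L`, `ε` and the
quasi-Töplitz parameters `(K,θ,μ)`. -/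
structure KAMHyp (ρ τ₀ : ℝ) (O : Set (Par b)) (r s M L ε K θ μ : ℝ) (ω : Par b → Par b)
    (Ωt : NSite n → Par b → ℝ) (P : Ham n) : Prop where
  isOpen : IsOpen O
  bounded : Bornology.IsBounded O
  omega_contDiff : ContDiffOn ℝ 1 ω O
  omega_inj : Set.InjOn ω O
  omega_bound : ∀ ξ ∈ O, ‖ω ξ‖ + ‖fderiv ℝ ω ξ‖ ≤ M
  omega_inv : ∀ ξ ∈ O, ∃ e : Par b ≃L[ℝ] Par b,
    (e : Par b →L[ℝ] Par b) = fderiv ℝ ω ξ ∧ ‖(e.symm : Par b →L[ℝ] Par b)‖ ≤ M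
  Omega_contDiff : ∀ j, ContDiffOn ℝ 1 (Ωt j) O
  Omega_bound : ∀ j, ∀ ξ ∈ O, |Ωt j ξ| + ‖fderiv ℝ (Ωt j) ξ‖ ≤ L
  theta_mem : θ ∈ Set.Ioo (1 / 2 : ℝ) 4
  mu_mem : μ ∈ Set.Ioo (1 / 2 : ℝ) 4
  mu_gap : 5 * K ^ (4 : ℕ) < (μ - 1 / 2) * K ^ τ₀
  theta_gap : 5 * K ^ (4 : ℕ) < (4 - θ) * K ^ (4 * d * τ₀)
  P_qt : QuasiToplitz ρ τ₀ O r s K θ μ P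
  P_bound : TNorm ρ τ₀ O r s K θ μ P ≤ ENNReal.ofReal ε
  Omega_qt : QuasiToplitz ρ τ₀ O r s K θ μ (diagQ fun j ξ => (Ωt j ξ : ℂ))
  Omega_qt_bound : TNorm ρ τ₀ O r s K θ μ (diagQ fun j ξ => (Ωt j ξ : ℂ)) ≤ ENNReal.ofReal L

/-- The compatibility inequalities between old and new parameters. -/
def Compat (d : ℕ) (τ₀ θ μ K' θ' μ' : ℝ) : Prop :=
  4 * K' < Real.sqrt (μ - μ') * K' ^ (3 / 2 : ℝ) ∧
    4 * μ' * K' ^ (4 : ℕ) < (θ' - θ) * K' ^ (4 * d * τ₀ - 1)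

end Step

section Homological

variable {d b : ℕ} {n : Fin b → Fin d → ℤ}

theorem mulH_of_supp (f g : Ham n) (m₀ m₂ : Mon n) (ξ : Par b)
    (hf : ∀ ν, ν ≠ m₀ → f ν ξ = 0) : mulH f g (m₀ + m₂) ξ = f m₀ ξ * g m₂ ξ := by
  unfold mulH
  rw [tsum_eq_single (⟨(m₀, m₂), rfl⟩ : {p : Mon n × Mon n // p.1 + p.2 = m₀ + m₂})]
  rintro ⟨⟨p, q⟩, hpq⟩ hne
  by_cases hp : p = m₀
  · subst hp
    exact absurd (by simpa using hpq) (fun h : q = m₂ => hne (by subst h; rfl))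
  · simp [hf p hp]

theorem mulH_of_supp_zero (f g : Ham n) (m₀ ν : Mon n) (ξ : Par b)
    (hf : ∀ ν, ν ≠ m₀ → f ν ξ = 0) (hν : ∀ m₂, ν ≠ m₀ + m₂) : mulH f g ν ξ = 0 := by
  unfold mulH
  convert tsum_zero with p
  obtain ⟨⟨p, q⟩, hpq⟩ := p
  have : p ≠ m₀ := by rintro rfl; exact hν q hpq.symm
  simp [hf p this]

theorem normalForm_monI (ω : Fin b → Par b → ℂ) (Ω : NSite n → Par b → ℂ) (i : Fin b)
    (ξ : Par b) : normalForm ω Ω (monI i) ξ = ω i ξ := by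
  classical
  unfold normalForm
  rw [Finset.sum_eq_single i]
  · simp [monI]
  · intro j _ hj
    rw [if_neg]
    intro h
    have := congrFun (congrArg (fun ν : Mon n => ν.2.1) h) i
    simp [monI, hj.symm] at this
  · simp

theorem normalForm_monZZ (ω : Fin b → Par b → ℂ) (Ω : NSite n → Par b → ℂ) (j : NSite n)
    (ξ : Par b) : normalForm ω Ω (monZ j + monZb j) ξ = Ω j ξ := by
  classical
  unfold normalForm
  rw [Finset.sum_eq_zero, Finset.sum_eq_single j]
  · simp
  · intro j' _ hj
    rw [if_neg]
    intro h
    have := DFunLike.congr_fun (congrArg (fun ν : Mon n => ν.2.2.1) h) j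
    simp [monZ, monZb, hj] at this
  · simp [monZ, monZb]
  · intro i _
    rw [if_neg]
    intro h
    have := DFunLike.congr_fun (congrArg (fun ν : Mon n => ν.2.2.1) h) j
    simp [monZ, monZb, monI] at this

theorem normalForm_zero (ω : Fin b → Par b → ℂ) (Ω : NSite n → Par b → ℂ) (ν : Mon n)
    (ξ : Par b) (h1 : ∀ i, ν ≠ monI i) (h2 : ∀ j, ν ≠ monZ j + monZb j) :
    normalForm ω Ω ν ξ = 0 := by
  classical
  simp [normalForm, h1, h2]

theorem mon_sub_Z (ν : Mon n) (j : NSite n) (h : 0 < ν.2.2.1 j) : ∃ m₂, ν = monZ j + m₂ := by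
  refine ⟨(ν.1, ν.2.1, ν.2.2.1 - Finsupp.single j 1, ν.2.2.2), ?_⟩
  simp only [monZ, Prod.mk_add_mk, zero_add]
  rw [add_tsub_cancel_of_le]
  intro i
  by_cases hi : j = i
  · subst hi; simpa [Nat.one_le_iff_ne_zero, Nat.pos_iff_ne_zero] using h
  · simp [hi]

theorem mon_sub_Zb (ν : Mon n) (j : NSite n) (h : 0 < ν.2.2.2 j) : ∃ m₂, ν = monZb j + m₂ := by
  refine ⟨(ν.1, ν.2.1, ν.2.2.1, ν.2.2.2 - Finsupp.single j 1), ?_⟩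
  simp only [monZb, Prod.mk_add_mk, zero_add]
  rw [add_tsub_cancel_of_le]
  intro i
  by_cases hi : j = i
  · subst hi; simpa [Nat.one_le_iff_ne_zero, Nat.pos_iff_ne_zero] using h
  · simp [hi]

theorem mulH_dI_normalForm (ω : Fin b → Par b → ℂ) (Ω : NSite n → Par b → ℂ) (g : Ham n)
    (i : Fin b) (ν : Mon n) (ξ : Par b) :
    mulH (dI i (normalForm ω Ω)) g ν ξ = ω i ξ * g ν ξ := by
  have h0 := mulH_of_supp (dI i (normalForm ω Ω)) g 0 ν ξ ?_
  · rw [zero_add] at h0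
    rw [h0]
    simp [dI, normalForm_monI]
  · intro ν' hν'
    unfold dI
    rw [normalForm_zero, mul_zero]
    · intro i' h
      apply hν'
      by_cases hi : i' = i
      · subst hi; exact add_right_cancel (h.trans (zero_add _).symm)
      · have := congrFun (congrArg (fun ν : Mon n => ν.2.1) h) i
        simp [monI, Ne.symm hi] at this
    · intro j h
      have := congrFun (congrArg (fun ν : Mon n => ν.2.1) h) i
      simp [monI, monZ, monZb] at this

theorem mulH_dTheta_normalForm (ω : Fin b → Par b → ℂ) (Ω : NSite n → Par b → ℂ) (g : Ham n)
    (i : Fin b) (ν : Mon n) (ξ : Par b) :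
    mulH (dTheta i (normalForm ω Ω)) g ν ξ = 0 := by
  have : ∀ ν' : Mon n, dTheta i (normalForm ω Ω) ν' ξ = 0 := by
    intro ν'
    unfold dTheta
    by_cases h : ν'.1 i = 0
    · simp [h]
    · rw [normalForm_zero, mul_zero]
      · rintro i' rfl; exact h rfl
      · rintro j rfl; exact h (by simp [monZ, monZb])
  unfold mulH
  simp [this]

theorem mulH_dZb_normalForm (ω : Fin b → Par b → ℂ) (Ω : NSite n → Par b → ℂ) (g : Ham n)
    (j : NSite n) (ν : Mon n) (ξ : Par b) :
    mulH (dZb j (normalForm ω Ω)) (dZ j g) ν ξ = Ω j ξ * (ν.2.2.1 j : ℂ) * g ν ξ := by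
  have hs : ∀ ν' : Mon n, ν' ≠ monZ j → dZb j (normalForm ω Ω) ν' ξ = 0 := by
    intro ν' hν'
    unfold dZb
    rw [normalForm_zero, mul_zero]
    · intro i h
      have := DFunLike.congr_fun (congrArg (fun ν : Mon n => ν.2.2.2) h) j
      simp [monI, monZb] at this
    · intro j' h
      by_cases hj : j' = j
      · subst hj; exact hν' (add_right_cancel h)
      · have := DFunLike.congr_fun (congrArg (fun ν : Mon n => ν.2.2.2) h) j
        simp [monZ, monZb, hj] at this
  by_cases h : 0 < ν.2.2.1 j
  · obtain ⟨m₂, rfl⟩ := mon_sub_Z ν j h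
    rw [mulH_of_supp _ _ _ _ _ hs]
    have h1 : dZb j (normalForm ω Ω) (monZ j) ξ = Ω j ξ := by
      unfold dZb
      rw [normalForm_monZZ]
      simp [monZ]
    rw [h1, dZ, add_comm m₂]
    simp only [monZ, Prod.fst_add, Prod.snd_add, Finsupp.add_apply, Finsupp.single_eq_same]
    push_cast
    ring
  · rw [mulH_of_supp_zero _ _ (monZ j) _ _ hs]
    · have : ν.2.2.1 j = 0 := by omega
      simp [this]
    · rintro m₂ rfl
      simp [monZ] at h

theorem mulH_dZ_normalForm (ω : Fin b → Par b → ℂ) (Ω : NSite n → Par b → ℂ) (g : Ham n)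
    (j : NSite n) (ν : Mon n) (ξ : Par b) :
    mulH (dZ j (normalForm ω Ω)) (dZb j g) ν ξ = Ω j ξ * (ν.2.2.2 j : ℂ) * g ν ξ := by
  have hs : ∀ ν' : Mon n, ν' ≠ monZb j → dZ j (normalForm ω Ω) ν' ξ = 0 := by
    intro ν' hν'
    unfold dZ
    rw [normalForm_zero, mul_zero]
    · intro i h
      have := DFunLike.congr_fun (congrArg (fun ν : Mon n => ν.2.2.1) h) j
      simp [monI, monZ] at this
    · intro j' h
      by_cases hj : j' = j
      · subst hj; exact hν' (add_right_cancel (h.trans (add_comm _ _)))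
      · have := DFunLike.congr_fun (congrArg (fun ν : Mon n => ν.2.2.1) h) j
        simp [monZ, monZb, hj] at this
  by_cases h : 0 < ν.2.2.2 j
  · obtain ⟨m₂, rfl⟩ := mon_sub_Zb ν j h
    rw [mulH_of_supp _ _ _ _ _ hs]
    have h1 : dZ j (normalForm ω Ω) (monZb j) ξ = Ω j ξ := by
      unfold dZ
      rw [add_comm (monZb j), normalForm_monZZ]
      simp [monZb]
    rw [h1, dZb, add_comm m₂]
    simp only [monZb, Prod.snd_add, Finsupp.add_apply, Finsupp.single_eq_same]
    push_cast
    ring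
  · rw [mulH_of_supp_zero _ _ (monZb j) _ _ hs]
    · have : ν.2.2.2 j = 0 := by omega
      simp [this]
    · rintro m₂ rfl
      simp [monZb] at h

/-- `{𝒩, f}` multiplies the coefficient of a monomial by `i (⟨ω,k⟩ + Ω·(α-β))`. -/
theorem poisson_Nham (ω : Par b → Par b) (Ωt : NSite n → Par b → ℝ) (f : Ham n) (ν : Mon n)
    (ξ : Par b) : poisson (Nham ω Ωt) f ν ξ =
      Complex.I * (divisor ω Ωt ν.1 (diffAB ν) ξ : ℂ) * f ν ξ := by
  have hsum : (∑' j, ((freqN Ωt j ξ : ℂ) * (ν.2.2.1 j : ℂ) * f ν ξ -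
      (freqN Ωt j ξ : ℂ) * (ν.2.2.2 j : ℂ) * f ν ξ)) =
      (((diffAB ν).sum fun j a => freqN Ωt j ξ * (a : ℝ) : ℝ) : ℂ) * f ν ξ := by
    rw [tsum_eq_sum (s := (diffAB ν).support)]
    · rw [Finsupp.sum, Complex.ofReal_sum, Finset.sum_mul]
      refine Finset.sum_congr rfl fun j _ => ?_
      simp [diffAB]
      ring
    · intro j hj
      have : (ν.2.2.1 j : ℤ) = ν.2.2.2 j := by
        have := Finsupp.notMem_support_iff.1 hj
        simp [diffAB] at this
        omega
      have h2 : (ν.2.2.1 j : ℂ) = (ν.2.2.2 j : ℂ) := by exact_mod_cast this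
      rw [h2, sub_self]
  unfold poisson Nham
  simp only [mulH_dI_normalForm, mulH_dTheta_normalForm, mulH_dZb_normalForm, mulH_dZ_normalForm,
    sub_zero]
  rw [hsum]
  simp only [dTheta, divisor]
  push_cast
  rw [mul_add, add_mul, Finset.mul_sum, Finset.sum_mul]
  congr 1
  · exact Finset.sum_congr rfl fun i _ => by ring
  · ring

/-- The homological equation: `{𝒩, F} = Π_{≤K} R - ⟨R⟩`, the constant term excepted, at the
parameters where no divisor vanishes. -/
theorem genF_homological (ω : Par b → Par b) (Ωt : NSite n → Par b → ℝ) (K : ℝ) (hK : 0 ≤ K)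
    (P : Ham n) (ξ : Par b)
    (hdiv : ∀ ν : Mon n, deg ν ≤ 2 → absK ν.1 ≤ K → ¬ (ν.1 = 0 ∧ ν.2.2.1 = ν.2.2.2) →
      P ν ξ ≠ 0 → divisor ω Ωt ν.1 (diffAB ν) ξ ≠ 0) (ν : Mon n) (hν : ν ≠ 0) :
    poisson (Nham ω Ωt) (genF ω Ωt K P) ν ξ = truncR K P ν ξ - avgR P ν ξ := by
  classical
  rw [poisson_Nham]
  unfold genF truncR
  by_cases hres : ν.1 = 0 ∧ ν.2.2.1 = ν.2.2.2
  · obtain ⟨k, l, α, β⟩ := ν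
    obtain ⟨rfl, rfl⟩ : k = 0 ∧ α = β := hres
    have hk : absK (0 : Fin b → ℤ) ≤ K := by simpa [absK] using hK
    rw [if_neg (by simp), mul_zero]
    by_cases hd : deg ((0, l, α, α) : Mon n) ≤ 2
    · rw [if_pos ⟨hd, hk⟩, eq_comm, sub_eq_zero]
      have hd' : (∑ i, l i) + (α.sum fun _ a => a) ≤ 1 := by
        unfold deg at hd; simp only at hd; omega
      by_cases hl : l = 0
      · subst hl
        have hα : α ≠ 0 := by rintro rfl; exact hν rfl
        obtain ⟨j, hj⟩ := Finsupp.support_nonempty_iff.2 hα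
        have hj0 : α j ≠ 0 := Finsupp.mem_support_iff.1 hj
        have hsum : (α.sum fun _ a => a) ≤ 1 := by omega
        have hα1 : α = Finsupp.single j 1 := by
          have hle : α j ≤ α.sum fun _ a => a :=
            Finset.single_le_sum (f := fun i => α i) (fun _ _ => Nat.zero_le _) hj
          ext i
          by_cases hi : j = i
          · subst hi; simp; omega
          · rw [Finsupp.single_eq_of_ne (Ne.symm hi)]
            by_contra hne
            have hi' : i ∈ α.support := Finsupp.mem_support_iff.2 hne
            have : α j + α i ≤ α.sum fun _ a => a := by
              rw [Finsupp.sum, ← Finset.sum_pair hi]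
              exact Finset.sum_le_sum_of_subset (by
                intro x hx; simp at hx; rcases hx with rfl | rfl <;> assumption)
            omega
        subst hα1
        have : ((0, 0, Finsupp.single j 1, Finsupp.single j 1) : Mon n) = monZ j + monZb j := by
          simp [monZ, monZb]
        rw [this, avgR, normalForm_monZZ]
      · obtain ⟨i, hi⟩ := Function.ne_iff.1 hl
        have hi0 : l i ≠ 0 := hi
        have hle : l i ≤ ∑ i, l i := Finset.single_le_sum (fun _ _ => Nat.zero_le _) (Finset.mem_univ i)
        have hα : α = 0 := by
          by_contra hne
          obtain ⟨j, hj⟩ := Finsupp.support_nonempty_iff.2 hne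
          have hj0 : α j ≠ 0 := Finsupp.mem_support_iff.1 hj
          have hle : α j ≤ α.sum fun _ a => a :=
            Finset.single_le_sum (f := fun i => α i) (fun _ _ => Nat.zero_le _) hj
          omega
        have hl1 : l = Pi.single i 1 := by
          ext i'
          by_cases h : i' = i
          · subst h; simp; omega
          · rw [Pi.single_eq_of_ne h]
            by_contra hne
            have : l i + l i' ≤ ∑ i, l i := by
              rw [← Finset.sum_pair (Ne.symm h)]
              exact Finset.sum_le_sum_of_subset (Finset.subset_univ _)
            omega
        subst hα hl1
        have : ((0, Pi.single i 1, 0, 0) : Mon n) = monI i := rfl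
        rw [this, avgR, normalForm_monI]
    · rw [if_neg (fun h => hd h.1), avgR, normalForm_zero, sub_zero]
      · intro i h
        apply hd
        rw [h]; simp [deg, monI]
      · intro j h
        apply hd
        rw [h]; simp [deg, monZ, monZb, Finsupp.sum_single_index]
  · have havg : avgR P ν ξ = 0 := by
      rw [avgR, normalForm_zero]
      · rintro i rfl; exact hres ⟨rfl, rfl⟩
      · rintro j rfl; exact hres (by simp [monZ, monZb])
    rw [havg, sub_zero]
    by_cases h : deg ν ≤ 2 ∧ absK ν.1 ≤ K
    · rw [if_pos ⟨h.1, h.2, hres⟩, if_pos h]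
      by_cases hP : P ν ξ = 0
      · simp [hP]
      · have := hdiv ν h.1 h.2 hres hP
        have h2 : (divisor ω Ωt ν.1 (diffAB ν) ξ : ℂ) ≠ 0 := by exact_mod_cast this
        field_simp [Complex.I_ne_zero]
    · rw [if_neg (fun h' => h ⟨h'.1, h'.2.1⟩), if_neg h, mul_zero]

end Homological

end QT

end

noncomputable section

namespace QT
/-! ### Majorant series with coefficients in `[0, ∞]` -/

section Hat

variable {d b : ℕ} {n : Fin b → Fin d → ℤ}

/-- The variables `ϑ_i`, `I_i`, `z_j`, `z̄_j`. -/
abbrev Var {d b : ℕ} (n : Fin b → Fin d → ℤ) : Type := (Fin b ⊕ Fin b) ⊕ (NSite n ⊕ NSite n)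

abbrev vTh (i : Fin b) : Var n := Sum.inl (Sum.inl i)
abbrev vI (i : Fin b) : Var n := Sum.inl (Sum.inr i)
abbrev vZ (j : NSite n) : Var n := Sum.inr (Sum.inl j)
abbrev vZb (j : NSite n) : Var n := Sum.inr (Sum.inr j)

/-- The conjugate variable. -/
def dual : Var n → Var n
  | Sum.inl v => Sum.inl v.swap
  | Sum.inr v => Sum.inr v.swap

/-- Majorant series. -/
abbrev Hat {d b : ℕ} (n : Fin b → Fin d → ℤ) : Type := Mon n → ℝ≥0∞

/-- The exponents of a monomial, `|k_i|` for `ϑ_i`. -/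
def cntF (ν : Mon n) : Var n →₀ ℕ :=
  Finsupp.sumElim
    (Finsupp.sumElim (Finsupp.equivFunOnFinite.symm fun i => (ν.1 i).natAbs)
      (Finsupp.equivFunOnFinite.symm ν.2.1))
    (Finsupp.sumElim ν.2.2.1 ν.2.2.2)

@[simp] theorem cntF_th (ν : Mon n) (i : Fin b) : cntF ν (vTh i) = (ν.1 i).natAbs := rfl
@[simp] theorem cntF_I (ν : Mon n) (i : Fin b) : cntF ν (vI i) = ν.2.1 i := rfl
@[simp] theorem cntF_Z (ν : Mon n) (j : NSite n) : cntF ν (vZ j) = ν.2.2.1 j := rfl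
@[simp] theorem cntF_Zb (ν : Mon n) (j : NSite n) : cntF ν (vZb j) = ν.2.2.2 j := rfl

/-- The monomial of a variable (`1` for angles). -/
def mon : Var n → Mon n
  | Sum.inl (Sum.inl _) => 0
  | Sum.inl (Sum.inr i) => monI i
  | Sum.inr (Sum.inl j) => monZ j
  | Sum.inr (Sum.inr j) => monZb j

/-- Derivative of a majorant series. -/
def hd : Var n → Hat n → Hat n
  | Sum.inl (Sum.inl i), a => fun ν => ((ν.1 i).natAbs : ℝ≥0∞) * a ν
  | Sum.inl (Sum.inr i), a => fun ν => ((ν.2.1 i : ℝ≥0∞) + 1) * a (ν + monI i)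
  | Sum.inr (Sum.inl j), a => fun ν => ((ν.2.2.1 j : ℝ≥0∞) + 1) * a (ν + monZ j)
  | Sum.inr (Sum.inr j), a => fun ν => ((ν.2.2.2 j : ℝ≥0∞) + 1) * a (ν + monZb j)

def IsAngle : Var n → Prop
  | Sum.inl (Sum.inl _) => True
  | _ => False

theorem angle_cases (v : Var n) : (∃ i, v = vTh i) ∨ ¬ IsAngle v := by
  rcases v with (i | i) | (j | j) <;> simp [IsAngle]

theorem hd_of_not_angle {v : Var n} (hv : ¬ IsAngle v) (a : Hat n) (ν : Mon n) :
    hd v a ν = ((cntF ν v : ℝ≥0∞) + 1) * a (ν + mon v) := by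
  rcases v with (i | i) | (j | j)
  · exact absurd trivial hv
  all_goals rfl

theorem hd_th (i : Fin b) (a : Hat n) (ν : Mon n) :
    hd (vTh i) a ν = (cntF ν (vTh i) : ℝ≥0∞) * a ν := rfl

theorem cntF_add_mon {v : Var n} (hv : ¬ IsAngle v) (ν : Mon n) :
    cntF (ν + mon v) = cntF ν + Finsupp.single v 1 := by
  classical
  ext v'
  rcases v with (i | i) | (j | j)
  · exact absurd trivial hv
  all_goals
    rcases v' with (i' | i') | (j' | j') <;>
      simp [mon, monI, monZ, monZb, Finsupp.single_apply, Pi.single_apply, eq_comm]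

theorem cntF_add_of_not_angle {v : Var n} (hv : ¬ IsAngle v) (ν ν' : Mon n) :
    cntF (ν + ν') v = cntF ν v + cntF ν' v := by
  rcases v with (i | i) | (j | j)
  · exact absurd trivial hv
  all_goals simp

theorem cntF_add_le (v : Var n) (ν ν' : Mon n) :
    cntF (ν + ν') v ≤ cntF ν v + cntF ν' v := by
  rcases angle_cases v with ⟨i, rfl⟩ | hv
  · simpa using Int.natAbs_add_le _ _
  · exact (cntF_add_of_not_angle hv ν ν').le

theorem exists_eq_add_mon {v : Var n} (hv : ¬ IsAngle v) {ν : Mon n} (h : cntF ν v ≠ 0) :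
    ∃ ν', ν = ν' + mon v := by
  rcases v with (i | i) | (j | j)
  · exact absurd trivial hv
  · refine ⟨(ν.1, ν.2.1 - Pi.single i 1, ν.2.2.1, ν.2.2.2), ?_⟩
    simp only [mon, monI, Prod.mk_add_mk, add_zero]
    rw [tsub_add_cancel_of_le]
    intro i'
    by_cases hi : i' = i
    · subst hi; simpa [Nat.one_le_iff_ne_zero] using h
    · simp [hi]
  · obtain ⟨m, hm⟩ := mon_sub_Z ν j (Nat.pos_of_ne_zero h)
    exact ⟨m, by rw [hm, add_comm]; rfl⟩
  · obtain ⟨m, hm⟩ := mon_sub_Zb ν j (Nat.pos_of_ne_zero h)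
    exact ⟨m, by rw [hm, add_comm]; rfl⟩

/-- Product of majorant series. -/
def hmul (a c : Hat n) : Hat n :=
  fun ν => ∑' p : {p : Mon n × Mon n // p.1 + p.2 = ν}, a p.1.1 * c p.1.2

/-- The Poisson bracket with all signs positive. -/
def hbr (a c : Hat n) : Hat n := fun ν => ∑' v : Var n, hmul (hd v a) (hd (dual v) c) ν

@[simp] theorem dual_dual (v : Var n) : dual (dual v) = v := by
  rcases v with (i | i) | (j | j) <;> rfl

def dualEquiv : Var n ≃ Var n := ⟨dual, dual, dual_dual, dual_dual⟩

/-- Value of a monomial at a point. -/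
def wt (u : Var n → ℝ≥0∞) (ν : Mon n) : ℝ≥0∞ := (cntF ν).prod fun v a => u v ^ a

/-- Value of a majorant series at a point. -/
def hE (a : Hat n) (u : Var n → ℝ≥0∞) : ℝ≥0∞ := ∑' ν, a ν * wt u ν

theorem wt_eq_prod (u : Var n → ℝ≥0∞) (ν : Mon n) {S : Finset (Var n)}
    (hS : (cntF ν).support ⊆ S) : wt u ν = ∏ v ∈ S, u v ^ cntF ν v :=
  Finsupp.prod_of_support_subset _ hS _ (by simp)

theorem wt_mono {u u' : Var n → ℝ≥0∞} (h : u ≤ u') (ν : Mon n) : wt u ν ≤ wt u' ν :=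
  Finset.prod_le_prod' fun v _ => pow_le_pow_left' (h v) _

theorem hE_mono {a a' : Hat n} (ha : a ≤ a') {u u' : Var n → ℝ≥0∞} (h : u ≤ u') :
    hE a u ≤ hE a' u' :=
  ENNReal.tsum_le_tsum fun ν => mul_le_mul' (ha ν) (wt_mono h ν)

theorem wt_add_le {u : Var n → ℝ≥0∞} (hu : ∀ i, 1 ≤ u (vTh i)) (ν ν' : Mon n) :
    wt u (ν + ν') ≤ wt u ν * wt u ν' := by
  classical
  set S := (cntF (ν + ν')).support ∪ ((cntF ν).support ∪ (cntF ν').support)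
  rw [wt_eq_prod u (ν + ν') (S := S) (by simp [S]),
    wt_eq_prod u ν (S := S) (by intro x hx; simp only [S, Finset.mem_union]; tauto),
    wt_eq_prod u ν' (S := S) (by intro x hx; simp only [S, Finset.mem_union]; tauto),
    ← Finset.prod_mul_distrib]
  refine Finset.prod_le_prod' fun v _ => ?_
  rw [← pow_add]
  rcases angle_cases v with ⟨i, rfl⟩ | hv
  · exact pow_le_pow_right₀ (hu i) (cntF_add_le _ _ _)
  · rw [cntF_add_of_not_angle hv]

theorem hE_hmul (a c : Hat n) (u : Var n → ℝ≥0∞) :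
    hE (hmul a c) u = ∑' p : Mon n × Mon n, a p.1 * c p.2 * wt u (p.1 + p.2) := by
  unfold hE hmul
  rw [← (Equiv.sigmaFiberEquiv fun p : Mon n × Mon n => p.1 + p.2).tsum_eq, ENNReal.tsum_sigma']
  refine tsum_congr fun ν => ?_
  rw [← ENNReal.tsum_mul_right]
  refine tsum_congr fun p => ?_
  obtain ⟨p, rfl⟩ := p
  rfl

theorem hE_hmul_le (a c : Hat n) {u : Var n → ℝ≥0∞} (hu : ∀ i, 1 ≤ u (vTh i)) :
    hE (hmul a c) u ≤ hE a u * hE c u := by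
  rw [hE_hmul, ENNReal.tsum_prod', hE, ← ENNReal.tsum_mul_right]
  refine ENNReal.tsum_le_tsum fun p => ?_
  rw [hE, ← ENNReal.tsum_mul_left]
  refine ENNReal.tsum_le_tsum fun q => ?_
  calc a p * c q * wt u (p + q) ≤ a p * c q * (wt u p * wt u q) := by
        gcongr; exact wt_add_le hu p q
    _ = _ := by ring

theorem pow_add_ge (x h : ℝ≥0∞) (k : ℕ) : x ^ k + k * x ^ (k - 1) * h ≤ (x + h) ^ k := by
  induction k with
  | zero => simp
  | succ k ih =>
    rw [pow_succ (x + h)]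
    refine le_trans ?_ (mul_le_mul' ih le_rfl)
    rw [add_mul, mul_add, mul_add, Nat.add_sub_cancel]
    rcases k with _ | k
    · simp
    · have h1 : x ^ (k + 1 + 1) + ((k + 1 + 1 : ℕ) : ℝ≥0∞) * x ^ (k + 1) * h =
        x ^ (k + 1) * x + x ^ (k + 1) * h + ((k + 1 : ℕ) : ℝ≥0∞) * x ^ k * h * x := by
        push_cast; ring
      rw [h1, Nat.add_sub_cancel, ← add_assoc]
      exact le_self_add

theorem prod_pow_add_ge {ι : Type*} [DecidableEq ι] (S : Finset ι) (u h : ι → ℝ≥0∞) (c : ι → ℕ) :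
    (∏ v ∈ S, u v ^ c v) + ∑ v ∈ S, c v * u v ^ (c v - 1) * h v * ∏ w ∈ S.erase v, u w ^ c w ≤
      ∏ v ∈ S, (u v + h v) ^ c v := by
  induction S using Finset.induction_on with
  | empty => simp
  | insert x S hx ih =>
    rw [Finset.prod_insert hx, Finset.prod_insert hx, Finset.sum_insert hx,
      Finset.erase_insert hx]
    refine le_trans ?_ (mul_le_mul' (pow_add_ge (u x) (h x) (c x)) ih)
    have h1 : ∀ v ∈ S, c v * u v ^ (c v - 1) * h v * ∏ w ∈ (insert x S).erase v, u w ^ c w =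
        u x ^ c x * (c v * u v ^ (c v - 1) * h v * ∏ w ∈ S.erase v, u w ^ c w) := by
      intro v hv
      have hxv : x ≠ v := by rintro rfl; exact hx hv
      rw [Finset.erase_insert_of_ne hxv, Finset.prod_insert (by simp [hx])]
      ring
    rw [Finset.sum_congr rfl h1, ← Finset.mul_sum, add_mul, mul_add, mul_add, ← add_assoc,
      ← add_assoc]
    set A := u x ^ c x * ∏ v ∈ S, u v ^ c v
    set B := (c x : ℝ≥0∞) * u x ^ (c x - 1) * h x * ∏ v ∈ S, u v ^ c v
    rw [add_right_comm]
    exact le_self_add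

/-- The point reached from `u` in the direction `h`; angles enter through exponentials. -/
def move (u h : Var n → ℝ≥0∞) : Var n → ℝ≥0∞
  | Sum.inl (Sum.inl i) => u (vTh i) + u (vTh i) * h (vTh i)
  | v => u v + h v

open Classical in
/-- The derivative of a monomial. -/
def dwt (u : Var n → ℝ≥0∞) (v : Var n) (ν : Mon n) : ℝ≥0∞ :=
  cntF ν v * u v ^ (cntF ν v - 1) * ∏ w ∈ (cntF ν).support.erase v, u w ^ cntF ν w

open Classical in
theorem hE_hd_le (a : Hat n) (u h : Var n → ℝ≥0∞) (v : Var n) :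
    h v * hE (hd v a) u ≤
      ∑' ν, a ν * ((if IsAngle v then u v * h v else h v) * dwt u v ν) := by
  rcases angle_cases v with ⟨i, rfl⟩ | hv
  · rw [if_pos (show IsAngle (vTh i : Var n) from trivial), hE, ← ENNReal.tsum_mul_left]
    refine ENNReal.tsum_le_tsum fun ν => le_of_eq ?_
    rw [hd_th, dwt]
    by_cases h0 : cntF ν (vTh i) = 0
    · simp [h0]
    · have hs : vTh i ∈ (cntF ν).support := Finsupp.mem_support_iff.2 h0
      have : wt u ν = u (vTh i) ^ (cntF ν (vTh i) - 1) * u (vTh i) *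
          ∏ w ∈ (cntF ν).support.erase (vTh i), u w ^ cntF ν w := by
        rw [wt, Finsupp.prod, ← Finset.mul_prod_erase _ _ hs, pow_sub_one_mul h0]
      rw [this]; ring
  · rw [if_neg hv, hE, ← ENNReal.tsum_mul_left]
    have hinj : Function.Injective fun ν : Mon n => ν + mon v := fun x y hxy =>
      add_right_cancel hxy
    refine le_trans (le_of_eq (tsum_congr fun ν => ?_))
      (ENNReal.tsum_comp_le_tsum_of_injective hinj fun ν => a ν * (h v * dwt u v ν))
    rw [hd_of_not_angle hv, dwt, cntF_add_mon hv]
    let c' : Var n →₀ ℕ := cntF ν + Finsupp.single v 1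
    have hc : ∀ w, w ≠ v → c' w = cntF ν w := fun w hw => by
      simp [c', hw.symm]
    have h1 : wt u ν = u v ^ cntF ν v * ∏ w ∈ c'.support.erase v, u w ^ c' w := by
      rw [wt_eq_prod u ν (S := insert v (c'.support.erase v)), Finset.prod_insert (by simp)]
      · congr 1
        exact Finset.prod_congr rfl fun w hw => by rw [hc w (Finset.mem_erase.1 hw).1]
      · intro w hw
        by_cases hwv : w = v
        · simp [hwv]
        · simp only [Finset.mem_insert, Finset.mem_erase, Finsupp.mem_support_iff] at hw ⊢
          exact Or.inr ⟨hwv, by rwa [hc w hwv]⟩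
    have h2 : c' v = cntF ν v + 1 := by simp [c']
    change h v * (_ * wt u ν) = a (ν + mon v) * (h v * ((c' v : ℝ≥0∞) * u v ^ (c' v - 1) *
      ∏ w ∈ c'.support.erase v, u w ^ c' w))
    rw [h1, h2, Nat.add_sub_cancel]
    push_cast
    ring

theorem hE_taylor (a : Hat n) (u h : Var n → ℝ≥0∞) :
    ∑' v, h v * hE (hd v a) u ≤ hE a (move u h) := by
  classical
  refine (ENNReal.tsum_le_tsum fun v => hE_hd_le a u h v).trans ?_
  rw [ENNReal.tsum_comm]
  refine ENNReal.tsum_le_tsum fun ν => ?_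
  rw [ENNReal.tsum_mul_left]
  refine mul_le_mul' le_rfl ?_
  set h' : Var n → ℝ≥0∞ := fun v => if IsAngle v then u v * h v else h v
  have hm : move u h = fun v => u v + h' v := by
    funext v
    rcases v with (i | i) | (j | j) <;> simp [move, h', IsAngle]
  rw [hm, wt, Finsupp.prod, tsum_eq_sum (s := (cntF ν).support)]
  · refine le_trans ?_ (prod_pow_add_ge (cntF ν).support u h' (cntF ν))
    refine le_trans (Finset.sum_le_sum fun v _ => le_of_eq ?_) le_add_self
    simp only [dwt, h']
    ring
  · intro v hv
    simp [dwt, Finsupp.notMem_support_iff.1 hv]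

theorem hd_comm (v v' : Var n) (a : Hat n) : hd v (hd v' a) = hd v' (hd v a) := by
  classical
  funext ν
  by_cases hvv : v = v'
  · rw [hvv]
  rcases angle_cases v with ⟨i, rfl⟩ | hv <;> rcases angle_cases v' with ⟨i', rfl⟩ | hv'
  · simp only [hd_th]; ring
  · rw [hd_th, hd_of_not_angle hv', hd_of_not_angle hv', hd_th, cntF_add_mon hv']
    simp only [Finsupp.add_apply, Finsupp.single_apply, if_neg (Ne.symm hvv), add_zero]
    ring
  · rw [hd_th, hd_of_not_angle hv, hd_of_not_angle hv, hd_th, cntF_add_mon hv]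
    simp only [Finsupp.add_apply, Finsupp.single_apply, if_neg hvv, add_zero]
    ring
  · simp only [hd_of_not_angle hv, hd_of_not_angle hv', cntF_add_mon hv, cntF_add_mon hv']
    simp only [Finsupp.add_apply, Finsupp.single_apply, if_neg hvv, if_neg (Ne.symm hvv), add_zero,
      add_right_comm ν (mon v)]
    ring

/-- Exchange of the two factors of a monomial. -/
def swapFiber (ν : Mon n) :
    {p : Mon n × Mon n // p.1 + p.2 = ν} ≃ {p : Mon n × Mon n // p.1 + p.2 = ν} where
  toFun p := ⟨p.1.swap, by simpa [add_comm] using p.2⟩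
  invFun p := ⟨p.1.swap, by simpa [add_comm] using p.2⟩
  left_inv p := by simp
  right_inv p := by simp

theorem hmul_comm (a c : Hat n) : hmul a c = hmul c a := by
  funext ν
  unfold hmul
  rw [← (swapFiber ν).tsum_eq]
  exact tsum_congr fun p => mul_comm _ _

theorem hmul_hd_shift {v : Var n} (hv : ¬ IsAngle v) (a c : Hat n) (ν : Mon n) :
    (∑' p : {p : Mon n × Mon n // p.1 + p.2 = ν + mon v},
      (cntF p.1.1 v : ℝ≥0∞) * a p.1.1 * c p.1.2) = hmul (hd v a) c ν := by
  let φ : {p : Mon n × Mon n // p.1 + p.2 = ν} → {p : Mon n × Mon n // p.1 + p.2 = ν + mon v} :=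
    fun p => ⟨(p.1.1 + mon v, p.1.2), (add_right_comm _ _ _).trans (congrArg (· + mon v) p.2)⟩
  have hφ : Function.Injective φ := by
    rintro ⟨⟨p, q⟩, h⟩ ⟨⟨p', q'⟩, h'⟩ heq
    simp only [φ, Subtype.mk.injEq, Prod.mk.injEq] at heq
    obtain ⟨h1, h2⟩ := heq
    simp [add_right_cancel h1, h2]
  rw [← hφ.tsum_eq]
  · refine tsum_congr fun p => ?_
    simp only [φ, hd_of_not_angle hv, cntF_add_mon hv]
    simp
  · rintro ⟨⟨p, q⟩, h⟩ hne
    have h0 : cntF p v ≠ 0 := by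
      rintro h0
      simp [h0] at hne
    obtain ⟨p', rfl⟩ := exists_eq_add_mon hv h0
    refine ⟨⟨(p', q), ?_⟩, rfl⟩
    apply add_right_cancel (b := mon v)
    rw [← h]; exact add_right_comm _ _ _

theorem hd_hmul_le (v : Var n) (a c : Hat n) :
    hd v (hmul a c) ≤ hmul (hd v a) c + hmul a (hd v c) := by
  intro ν
  rw [Pi.add_apply]
  rcases angle_cases v with ⟨i, rfl⟩ | hv
  · rw [hd_th, hmul, hmul, hmul, ← ENNReal.tsum_mul_left, ← ENNReal.tsum_add]
    refine ENNReal.tsum_le_tsum ?_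
    rintro ⟨⟨p, q⟩, rfl⟩
    simp only [hd_th]
    have : (cntF (p + q) (vTh i) : ℝ≥0∞) ≤ cntF p (vTh i) + cntF q (vTh i) := by
      exact_mod_cast cntF_add_le _ _ _
    calc _ ≤ ((cntF p (vTh i) : ℝ≥0∞) + cntF q (vTh i)) * (a p * c q) := mul_le_mul' this le_rfl
      _ = _ := by ring
  · rw [← hmul_hd_shift hv, hmul_comm a (hd v c), ← hmul_hd_shift hv, hd_of_not_angle hv, hmul,
      ← ENNReal.tsum_mul_left]
    have : (∑' p : {p : Mon n × Mon n // p.1 + p.2 = ν + mon v},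
        (cntF p.1.1 v : ℝ≥0∞) * c p.1.1 * a p.1.2) =
        ∑' p : {p : Mon n × Mon n // p.1 + p.2 = ν + mon v},
        (cntF p.1.2 v : ℝ≥0∞) * c p.1.2 * a p.1.1 := by
      rw [← (swapFiber _).tsum_eq]
      exact tsum_congr fun p => rfl
    rw [this, ← ENNReal.tsum_add]
    refine ENNReal.tsum_le_tsum ?_
    rintro ⟨⟨p, q⟩, h⟩
    have h1 : cntF ν v + 1 = cntF p v + cntF q v := by
      rw [← cntF_add_of_not_angle hv]
      simp only at h
      rw [h, cntF_add_mon hv]; simp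
    have h2 : (cntF ν v : ℝ≥0∞) + 1 = cntF p v + cntF q v := by exact_mod_cast h1
    simp only [h2]
    exact le_of_eq (by ring)

theorem hd_tsum {ι : Type*} (v : Var n) (f : ι → Hat n) :
    hd v (fun ν => ∑' i, f i ν) = fun ν => ∑' i, hd v (f i) ν := by
  funext ν
  rcases angle_cases v with ⟨i, rfl⟩ | hv
  · simp only [hd_th, ENNReal.tsum_mul_left]
  · simp only [hd_of_not_angle hv, ENNReal.tsum_mul_left]

theorem hbr_comm (a c : Hat n) : hbr a c = hbr c a := by
  funext ν
  unfold hbr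
  rw [← dualEquiv.tsum_eq]
  refine tsum_congr fun v => ?_
  rw [hmul_comm]
  simp [dualEquiv]

theorem hd_hbr_le (v : Var n) (a c : Hat n) :
    hd v (hbr a c) ≤ hbr (hd v a) c + hbr a (hd v c) := by
  unfold hbr
  rw [hd_tsum]
  intro ν
  rw [Pi.add_apply, ← ENNReal.tsum_add]
  refine ENNReal.tsum_le_tsum fun v' => ?_
  rw [hd_comm v' v, hd_comm (dual v') v]
  exact hd_hmul_le v _ _ ν

theorem hE_hbr_le (a c : Hat n) {u : Var n → ℝ≥0∞} (hu : ∀ i, 1 ≤ u (vTh i)) :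
    hE (hbr a c) u ≤ ∑' v, hE (hd (dual v) c) u * hE (hd v a) u := by
  unfold hbr
  rw [hE]
  simp_rw [← ENNReal.tsum_mul_right]
  rw [ENNReal.tsum_comm]
  refine ENNReal.tsum_le_tsum fun v => ?_
  rw [mul_comm]
  exact hE_hmul_le _ _ hu

theorem hE_add (a c : Hat n) (u : Var n → ℝ≥0∞) : hE (a + c) u = hE a u + hE c u := by
  simp [hE, add_mul, ENNReal.tsum_add]

/-- Cauchy estimate for a bracket: the derivative in a direction is bounded by the value at the
displaced point. -/
theorem hE_hbr_cauchy (a c : Hat n) {u : Var n → ℝ≥0∞} (hu : ∀ i, 1 ≤ u (vTh i)) (t : ℝ≥0∞)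
    (ht0 : t ≠ 0) (ht : t ≠ ⊤) :
    hE (hbr a c) u ≤ t⁻¹ * hE a (move u fun v => t * hE (hd (dual v) c) u) := by
  refine (hE_hbr_le a c hu).trans ?_
  refine le_trans (le_of_eq ?_) (mul_le_mul' le_rfl (hE_taylor a u _))
  rw [← ENNReal.tsum_mul_left]
  refine tsum_congr fun v => ?_
  rw [← mul_assoc, ← mul_assoc, ENNReal.inv_mul_cancel ht0 ht, one_mul]

theorem hE_hd_hbr (v : Var n) (a c : Hat n) {u : Var n → ℝ≥0∞} (hu : ∀ i, 1 ≤ u (vTh i))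
    (t t' : ℝ≥0∞) (ht0 : t ≠ 0) (ht : t ≠ ⊤) (ht0' : t' ≠ 0) (ht' : t' ≠ ⊤) :
    hE (hd v (hbr a c)) u ≤ t⁻¹ * hE (hd v a) (move u fun v => t * hE (hd (dual v) c) u) +
      t'⁻¹ * hE (hd v c) (move u fun v => t' * hE (hd (dual v) a) u) := by
  refine (hE_mono (hd_hbr_le v a c) le_rfl).trans ?_
  rw [hE_add, hbr_comm a]
  exact add_le_add (hE_hbr_cauchy _ _ hu t ht0 ht) (hE_hbr_cauchy _ _ hu t' ht0' ht')

end Hat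

section HatNorm

variable {d b : ℕ} {n : Fin b → Fin d → ℤ}

/-- The point with `|I_i| = r²`, `|Im ϑ_i| = s`. -/
def pt (r s : ℝ) (z w : NSite n → ℝ≥0∞) : Var n → ℝ≥0∞
  | Sum.inl (Sum.inl _) => ENNReal.ofReal (Real.exp s)
  | Sum.inl (Sum.inr _) => ENNReal.ofReal (r ^ 2)
  | Sum.inr (Sum.inl j) => z j
  | Sum.inr (Sum.inr j) => w j

theorem one_le_pt_th {r s : ℝ} (hs : 0 ≤ s) (z w : NSite n → ℝ≥0∞) (i : Fin b) :
    1 ≤ pt r s z w (vTh i) := by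
  simp only [pt]
  exact ENNReal.one_le_ofReal.2 (Real.one_le_exp hs)

theorem pt_mono {r r' s s' : ℝ} (hr : 0 ≤ r) (h : r ≤ r') (hs : s ≤ s')
    {z w z' w' : NSite n → ℝ≥0∞} (hz : z ≤ z') (hw : w ≤ w') : pt r s z w ≤ pt r' s' z' w' := by
  intro v
  rcases v with (i | i) | (j | j)
  · exact ENNReal.ofReal_le_ofReal (Real.exp_le_exp.2 hs)
  · exact ENNReal.ofReal_le_ofReal (pow_le_pow_left₀ hr h 2)
  · exact hz j
  · exact hw j

theorem absK_eq (k : Fin b → ℤ) : absK k = ((∑ i, (k i).natAbs : ℕ) : ℝ) := by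
  simp [absK, Nat.cast_natAbs]

theorem wt_pt (r s : ℝ) (z w : NSite n → ℝ≥0∞) (ν : Mon n) :
    wt (pt r s z w) ν =
      ENNReal.ofReal (Real.exp (absK ν.1 * s)) * ENNReal.ofReal (r ^ 2) ^ (∑ i, ν.2.1 i) *
      ((ν.2.2.1.prod fun j a => z j ^ a) * ν.2.2.2.prod fun j a => w j ^ a) := by
  unfold wt cntF
  rw [Finsupp.prod_sumElim, Finsupp.prod_sumElim, Finsupp.prod_sumElim]
  congr 1
  · congr 1
    · rw [Finsupp.prod_fintype _ _ (by simp), absK_eq, Real.exp_nat_mul,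
        ENNReal.ofReal_pow (Real.exp_pos _).le, ← Finset.prod_pow_eq_pow_sum]
      rfl
    · rw [Finsupp.prod_fintype _ _ (by simp), ← Finset.prod_pow_eq_pow_sum]
      rfl

/-- `‖z‖_ρ < r`. -/
def dom (ρ r : ℝ) (z : NSite n → ℝ≥0∞) : Prop := ∑' m, z m * weight ρ m < ENNReal.ofReal r

/-- Weighted sums of components of a majorant vector field. -/
def hcomp (ρ r s : ℝ) {ι : Type} (W : ι → ℝ≥0∞) (V : ι → Var n) (a : Hat n) : ℝ≥0∞ :=
  ⨆ (z : NSite n → ℝ≥0∞) (w : NSite n → ℝ≥0∞) (_ : dom ρ r z) (_ : dom ρ r w),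
    ∑' j, hE (hd (V j) a) (pt r s z w) * W j

theorem le_hcomp {ρ r s : ℝ} {ι : Type} {W : ι → ℝ≥0∞} {V : ι → Var n} {a : Hat n}
    {z w : NSite n → ℝ≥0∞} (hz : dom ρ r z) (hw : dom ρ r w) :
    ∑' j, hE (hd (V j) a) (pt r s z w) * W j ≤ hcomp ρ r s W V a :=
  le_iSup_of_le z (le_iSup_of_le w (le_iSup_of_le hz (le_iSup_of_le hw le_rfl)))

theorem hcomp_le {ρ r s : ℝ} {ι : Type} {W : ι → ℝ≥0∞} {V : ι → Var n} {a : Hat n} {B : ℝ≥0∞}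
    (h : ∀ z w : NSite n → ℝ≥0∞, dom ρ r z → dom ρ r w →
      ∑' j, hE (hd (V j) a) (pt r s z w) * W j ≤ B) : hcomp ρ r s W V a ≤ B :=
  iSup_le fun z => iSup_le fun w => iSup_le fun hz => iSup_le fun hw => h z w hz hw

theorem dom_mono {ρ r r' : ℝ} (h : r ≤ r') {z : NSite n → ℝ≥0∞} (hz : dom ρ r z) : dom ρ r' z :=
  lt_of_lt_of_le hz (ENNReal.ofReal_le_ofReal h)

/-- The norm of a majorant vector field. -/
def XN (ρ r s : ℝ) (a : Hat n) : ℝ≥0∞ :=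
  (∑ i : Fin b, hcomp ρ r s (fun _ : Unit => 1) (fun _ => vI i) a) +
    ENNReal.ofReal (r ^ 2)⁻¹ * (∑ i : Fin b, hcomp ρ r s (fun _ : Unit => 1) (fun _ => vTh i) a) +
    ENNReal.ofReal r⁻¹ * (hcomp ρ r s (weight ρ) vZ a + hcomp ρ r s (weight ρ) vZb a)

theorem hd_mono (v : Var n) {a c : Hat n} (h : a ≤ c) : hd v a ≤ hd v c := by
  intro ν
  rcases angle_cases v with ⟨i, rfl⟩ | hv
  · exact mul_le_mul' le_rfl (h _)
  · rw [hd_of_not_angle hv, hd_of_not_angle hv]; exact mul_le_mul' le_rfl (h _)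

theorem hd_add (v : Var n) (a c : Hat n) : hd v (a + c) = hd v a + hd v c := by
  funext ν
  rcases angle_cases v with ⟨i, rfl⟩ | hv
  · simp only [hd_th, Pi.add_apply, mul_add]
  · simp only [hd_of_not_angle hv, Pi.add_apply, mul_add]

theorem hd_smul (v : Var n) (q : ℝ≥0∞) (a : Hat n) :
    hd v (fun ν => q * a ν) = fun ν => q * hd v a ν := by
  funext ν
  rcases angle_cases v with ⟨i, rfl⟩ | hv
  · simp only [hd_th]; ring
  · simp only [hd_of_not_angle hv]; ring

theorem hE_smul (q : ℝ≥0∞) (a : Hat n) (u : Var n → ℝ≥0∞) :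
    hE (fun ν => q * a ν) u = q * hE a u := by
  simp only [hE, mul_assoc, ENNReal.tsum_mul_left]

/-- Comparison principle for norms of vector fields. -/
theorem XN_le_of_comp₂ {ρ r s r' s' : ℝ} {a a₁ a₂ : Hat n} {q₁ q₂ : ℝ≥0∞} (hr : 0 < r)
    (hr' : r ≤ r') (h : ∀ (ι : Type) (W : ι → ℝ≥0∞) (V : ι → Var n),
      hcomp ρ r s W V a ≤ q₁ * hcomp ρ r' s' W V a₁ + q₂ * hcomp ρ r' s' W V a₂) :
    XN ρ r s a ≤ ENNReal.ofReal ((r' / r) ^ 2) * (q₁ * XN ρ r' s' a₁ + q₂ * XN ρ r' s' a₂) := by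
  have hr0 : 0 < r' := hr.trans_le hr'
  have h1 : 1 ≤ r' / r := (one_le_div hr).2 hr'
  have e2 : ENNReal.ofReal (r ^ 2)⁻¹ = ENNReal.ofReal ((r' / r) ^ 2) * ENNReal.ofReal (r' ^ 2)⁻¹ := by
    rw [← ENNReal.ofReal_mul (by positivity)]; congr 1; field_simp
  have e1 : ENNReal.ofReal r⁻¹ ≤ ENNReal.ofReal ((r' / r) ^ 2) * ENNReal.ofReal r'⁻¹ := by
    rw [← ENNReal.ofReal_mul (by positivity)]
    apply ENNReal.ofReal_le_ofReal
    calc r⁻¹ = (r' / r) * r'⁻¹ := by field_simp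
      _ ≤ (r' / r) ^ 2 * r'⁻¹ := by
        gcongr
        exact le_self_pow₀ h1 (by norm_num)
  have e0 : (1 : ℝ≥0∞) ≤ ENNReal.ofReal ((r' / r) ^ 2) :=
    ENNReal.one_le_ofReal.2 (one_le_pow₀ h1)
  have hsum : ∀ V : Fin b → Unit → Var n, ∑ i, hcomp ρ r s (fun _ : Unit => 1) (V i) a ≤
      q₁ * (∑ i, hcomp ρ r' s' (fun _ : Unit => 1) (V i) a₁) +
        q₂ * ∑ i, hcomp ρ r' s' (fun _ : Unit => 1) (V i) a₂ := by
    intro V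
    rw [Finset.mul_sum, Finset.mul_sum, ← Finset.sum_add_distrib]
    exact Finset.sum_le_sum fun i _ => h _ _ _
  unfold XN
  refine (add_le_add (add_le_add ((hsum _).trans (le_mul_of_one_le_left zero_le e0))
    (mul_le_mul' e2.le (hsum _)))
    (mul_le_mul' e1 (add_le_add (h _ _ _) (h _ _ _)))).trans (le_of_eq ?_)
  ring

theorem XN_le_of_comp {ρ r s r' s' : ℝ} {a a' : Hat n} {q : ℝ≥0∞} (hr : 0 < r) (hr' : r ≤ r')
    (h : ∀ (ι : Type) (W : ι → ℝ≥0∞) (V : ι → Var n),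
      hcomp ρ r s W V a ≤ q * hcomp ρ r' s' W V a') :
    XN ρ r s a ≤ ENNReal.ofReal ((r' / r) ^ 2) * q * XN ρ r' s' a' := by
  have := XN_le_of_comp₂ (a₁ := a') (a₂ := a') (q₁ := q) (q₂ := 0) hr hr'
    (fun ι W V => by simpa using h ι W V)
  simpa [mul_assoc] using this

theorem hcomp_mono_dom {ρ r s r' s' : ℝ} {a a' : Hat n} (ha : a ≤ a') (hr : 0 ≤ r) (hr' : r ≤ r')
    (hs : s ≤ s') {ι : Type} (W : ι → ℝ≥0∞) (V : ι → Var n) :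
    hcomp ρ r s W V a ≤ hcomp ρ r' s' W V a' :=
  hcomp_le fun _ _ hz hw => le_trans
    (ENNReal.tsum_le_tsum fun _ => mul_le_mul'
      (hE_mono (hd_mono _ ha) (pt_mono hr hr' hs le_rfl le_rfl)) le_rfl)
    (le_hcomp (dom_mono hr' hz) (dom_mono hr' hw))

theorem XN_scale {ρ r s r' s' : ℝ} (a : Hat n) (hr : 0 < r) (hr' : r ≤ r') (hs : s ≤ s') :
    XN ρ r s a ≤ ENNReal.ofReal ((r' / r) ^ 2) * XN ρ r' s' a := by
  have := XN_le_of_comp (ρ := ρ) (s := s) (s' := s') (a := a) (a' := a) (q := 1) hr hr'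
    (fun ι W V => by rw [one_mul]; exact hcomp_mono_dom le_rfl hr.le hr' hs W V)
  simpa using this

theorem hcomp_add_le {ρ r s : ℝ} {ι : Type} (W : ι → ℝ≥0∞) (V : ι → Var n) (a c : Hat n) :
    hcomp ρ r s W V (a + c) ≤ hcomp ρ r s W V a + hcomp ρ r s W V c := by
  refine hcomp_le fun z w hz hw => ?_
  simp only [hd_add, hE_add, add_mul]
  rw [ENNReal.tsum_add]
  exact add_le_add (le_hcomp hz hw) (le_hcomp hz hw)

theorem hcomp_smul_le {ρ r s : ℝ} {ι : Type} (W : ι → ℝ≥0∞) (V : ι → Var n) (q : ℝ≥0∞)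
    (a : Hat n) : hcomp ρ r s W V (fun ν => q * a ν) ≤ q * hcomp ρ r s W V a := by
  refine hcomp_le fun z w hz hw => ?_
  simp only [hd_smul, hE_smul, mul_assoc]
  rw [ENNReal.tsum_mul_left]
  exact mul_le_mul' le_rfl (le_hcomp hz hw)

theorem hE_tsum {ι : Type*} (f : ι → Hat n) (u : Var n → ℝ≥0∞) :
    hE (fun ν => ∑' i, f i ν) u = ∑' i, hE (f i) u := by
  simp only [hE, ← ENNReal.tsum_mul_right]
  exact ENNReal.tsum_comm

theorem hcomp_tsum_le {ρ r s : ℝ} {ι κ : Type} (W : ι → ℝ≥0∞) (V : ι → Var n) (f : κ → Hat n) :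
    hcomp ρ r s W V (fun ν => ∑' i, f i ν) ≤ ∑' i, hcomp ρ r s W V (f i) := by
  refine hcomp_le fun z w hz hw => ?_
  simp only [hd_tsum, hE_tsum, ← ENNReal.tsum_mul_right]
  rw [ENNReal.tsum_comm]
  exact ENNReal.tsum_le_tsum fun i => le_hcomp hz hw

theorem XN_mono {ρ r s : ℝ} {a c : Hat n} (h : a ≤ c) : XN ρ r s a ≤ XN ρ r s c := by
  have key : ∀ {ι : Type} (W : ι → ℝ≥0∞) (V : ι → Var n),
      hcomp ρ r s W V a ≤ hcomp ρ r s W V c := fun W V =>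
    hcomp_le fun z w hz hw => le_trans (ENNReal.tsum_le_tsum fun j => mul_le_mul'
      (hE_mono (hd_mono _ h) le_rfl) le_rfl) (le_hcomp hz hw)
  unfold XN
  gcongr <;> exact key _ _

theorem XN_add_le (ρ r s : ℝ) (a c : Hat n) : XN ρ r s (a + c) ≤ XN ρ r s a + XN ρ r s c := by
  unfold XN
  calc _ ≤ (∑ i : Fin b, (hcomp ρ r s (fun _ : Unit => 1) (fun _ => vI i) a +
        hcomp ρ r s (fun _ : Unit => 1) (fun _ => vI i) c)) +
      ENNReal.ofReal (r ^ 2)⁻¹ * (∑ i : Fin b, (hcomp ρ r s (fun _ : Unit => 1) (fun _ => vTh i) a +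
        hcomp ρ r s (fun _ : Unit => 1) (fun _ => vTh i) c)) +
      ENNReal.ofReal r⁻¹ * ((hcomp ρ r s (weight ρ) vZ a + hcomp ρ r s (weight ρ) vZ c) +
        (hcomp ρ r s (weight ρ) vZb a + hcomp ρ r s (weight ρ) vZb c)) := by
        gcongr <;> exact hcomp_add_le _ _ _ _
    _ = _ := by rw [Finset.sum_add_distrib, Finset.sum_add_distrib]; ring

theorem XN_smul_le (ρ r s : ℝ) (q : ℝ≥0∞) (a : Hat n) :
    XN ρ r s (fun ν => q * a ν) ≤ q * XN ρ r s a := by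
  unfold XN
  calc _ ≤ (∑ i : Fin b, q * hcomp ρ r s (fun _ : Unit => 1) (fun _ => vI i) a) +
      ENNReal.ofReal (r ^ 2)⁻¹ * (∑ i : Fin b, q * hcomp ρ r s (fun _ : Unit => 1) (fun _ => vTh i) a) +
      ENNReal.ofReal r⁻¹ * (q * hcomp ρ r s (weight ρ) vZ a + q * hcomp ρ r s (weight ρ) vZb a) := by
        gcongr <;> exact hcomp_smul_le _ _ _ _
    _ = _ := by rw [← Finset.mul_sum, ← Finset.mul_sum]; ring

theorem XN_tsum_le {κ : Type} (ρ r s : ℝ) (f : κ → Hat n) :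
    XN ρ r s (fun ν => ∑' i, f i ν) ≤ ∑' i, XN ρ r s (f i) := by
  have hsum : ∀ (g : Fin b → κ → ℝ≥0∞), ∑ i, ∑' k, g i k = ∑' k, ∑ i, g i k := fun g =>
    (Summable.tsum_finsetSum fun i _ => ENNReal.summable).symm
  unfold XN
  rw [ENNReal.tsum_add, ENNReal.tsum_add, ENNReal.tsum_mul_left, ENNReal.tsum_mul_left,
    ENNReal.tsum_add, ← hsum, ← hsum]
  gcongr <;> exact hcomp_tsum_le _ _ _

/-- Gain from high Fourier modes. -/
theorem XN_ultraviolet {ρ r s s' N : ℝ} (hr : 0 < r) {a a' : Hat n} (ha : a' ≤ a)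
    (hN : ∀ ν, absK ν.1 < N → a' ν = 0) (hs : s ≤ s') :
    XN ρ r s a' ≤ ENNReal.ofReal (Real.exp (-(N * (s' - s)))) * XN ρ r s' a := by
  have hk : ∀ (v : Var n) (ν : Mon n), (ν + mon v).1 = ν.1 := by
    intro v ν
    rcases v with (i | i) | (j | j) <;> simp [mon, monI, monZ, monZb]
  have := XN_le_of_comp (ρ := ρ) (s := s) (s' := s') (a := a') (a' := a)
    (q := ENNReal.ofReal (Real.exp (-(N * (s' - s))))) hr le_rfl
    (fun ι W V => hcomp_le fun z w hz hw => ?_)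
  · simpa [hr.ne'] using this
  · refine le_trans ?_ (mul_le_mul' le_rfl (le_hcomp hz hw))
    rw [← ENNReal.tsum_mul_left]
    refine ENNReal.tsum_le_tsum fun j => ?_
    rw [← mul_assoc]
    refine mul_le_mul' ?_ le_rfl
    rw [hE, hE, ← ENNReal.tsum_mul_left]
    refine ENNReal.tsum_le_tsum fun ν => ?_
    by_cases hν : absK ν.1 < N
    · have : hd (V j) a' ν = 0 := by
        rcases angle_cases (V j) with ⟨i, hi⟩ | hv
        · rw [hi, hd_th, hN ν hν, mul_zero]
        · rw [hd_of_not_angle hv, hN _ (by rwa [hk]), mul_zero]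
      rw [this, zero_mul]; exact zero_le
    · have h1 : wt (pt r s z w) ν ≤
          ENNReal.ofReal (Real.exp (-(N * (s' - s)))) * wt (pt r s' z w) ν := by
        rw [wt_pt, wt_pt, ← mul_assoc (ENNReal.ofReal _), ← mul_assoc (ENNReal.ofReal _)]
        refine mul_le_mul' (mul_le_mul' ?_ le_rfl) le_rfl
        rw [← ENNReal.ofReal_mul (Real.exp_pos _).le, ← Real.exp_add]
        apply ENNReal.ofReal_le_ofReal
        apply Real.exp_le_exp.2
        have : N * (s' - s) ≤ absK ν.1 * (s' - s) :=
          mul_le_mul_of_nonneg_right (not_lt.1 hν) (by linarith)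
        linarith
      calc _ ≤ hd (V j) a ν * (ENNReal.ofReal (Real.exp (-(N * (s' - s)))) * wt (pt r s' z w) ν) :=
            mul_le_mul' (hd_mono _ ha ν) h1
        _ = _ := by ring

theorem XN_unit_I_le {ρ r s : ℝ} {a : Hat n} {z w : NSite n → ℝ≥0∞} (hz : dom ρ r z)
    (hw : dom ρ r w) : ∑ i, hE (hd (vI i) a) (pt r s z w) ≤ XN ρ r s a := by
  refine le_trans (Finset.sum_le_sum fun i _ => ?_) (le_add_right le_self_add)
  simpa using le_hcomp (W := fun _ : Unit => 1) (V := fun _ => vI i) (a := a) (s := s) hz hw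

theorem XN_unit_th_le {ρ r s : ℝ} (hr : 0 < r) {a : Hat n} {z w : NSite n → ℝ≥0∞}
    (hz : dom ρ r z) (hw : dom ρ r w) :
    ∑ i, hE (hd (vTh i) a) (pt r s z w) ≤ ENNReal.ofReal (r ^ 2) * XN ρ r s a := by
  have h1 : ∑ i, hE (hd (vTh i) a) (pt r s z w) ≤
      ∑ i : Fin b, hcomp ρ r s (fun _ : Unit => 1) (fun _ => vTh i) a :=
    Finset.sum_le_sum fun i _ => by
      simpa using le_hcomp (W := fun _ : Unit => 1) (V := fun _ => vTh i) (a := a) (s := s) hz hw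
  have h2 : ENNReal.ofReal (r ^ 2)⁻¹ *
      (∑ i : Fin b, hcomp ρ r s (fun _ : Unit => 1) (fun _ => vTh i) a) ≤ XN ρ r s a :=
    le_add_right le_add_self
  calc _ ≤ ENNReal.ofReal (r ^ 2) * (ENNReal.ofReal (r ^ 2)⁻¹ *
      (∑ i : Fin b, hcomp ρ r s (fun _ : Unit => 1) (fun _ => vTh i) a)) := by
        rw [← mul_assoc, ← ENNReal.ofReal_mul (by positivity), mul_inv_cancel₀ (by positivity)]
        simpa using h1
    _ ≤ _ := mul_le_mul' le_rfl h2

theorem XN_site_le {ρ r s : ℝ} (hr : 0 < r) {a : Hat n} {z w : NSite n → ℝ≥0∞}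
    (hz : dom ρ r z) (hw : dom ρ r w) :
    (∑' j, hE (hd (vZ j) a) (pt r s z w) * weight ρ j) +
      (∑' j, hE (hd (vZb j) a) (pt r s z w) * weight ρ j) ≤ ENNReal.ofReal r * XN ρ r s a := by
  have h1 := add_le_add (le_hcomp (W := weight ρ) (V := vZ) (a := a) (s := s) hz hw)
    (le_hcomp (W := weight ρ) (V := vZb) (a := a) (s := s) hz hw)
  have h2 : ENNReal.ofReal r⁻¹ * (hcomp ρ r s (weight ρ) vZ a + hcomp ρ r s (weight ρ) vZb a) ≤
      XN ρ r s a := le_add_self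
  calc _ ≤ ENNReal.ofReal r * (ENNReal.ofReal r⁻¹ *
      (hcomp ρ r s (weight ρ) vZ a + hcomp ρ r s (weight ρ) vZb a)) := by
        rw [← mul_assoc, ← ENNReal.ofReal_mul hr.le, mul_inv_cancel₀ hr.ne']
        simpa using h1
    _ ≤ _ := mul_le_mul' le_rfl h2

theorem move_le_pt {ρ r s δ : ℝ} (hr : 0 < r) (hδ : 0 ≤ δ) {c : Hat n} {t X : ℝ≥0∞}
    (hX : XN ρ r s c ≤ X) (ht : t * X ≤ ENNReal.ofReal δ) {z w : NSite n → ℝ≥0∞}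
    (hz : dom ρ r z) (hw : dom ρ r w) :
    ∃ z' w' : NSite n → ℝ≥0∞, dom ρ ((1 + δ) * r) z' ∧ dom ρ ((1 + δ) * r) w' ∧
      move (pt r s z w) (fun v => t * hE (hd (dual v) c) (pt r s z w)) ≤
        pt ((1 + δ) * r) (s + δ) z' w' := by
  have htX : t * XN ρ r s c ≤ ENNReal.ofReal δ := (mul_le_mul' le_rfl hX).trans ht
  have hdom : ∀ (x g : NSite n → ℝ≥0∞), dom ρ r x →
      ∑' j, g j * weight ρ j ≤ ENNReal.ofReal r * XN ρ r s c →
      dom ρ ((1 + δ) * r) (fun j => x j + t * g j) := by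
    intro x g hx hg
    unfold dom
    have : ∑' m, (x m + t * g m) * weight ρ m =
        (∑' m, x m * weight ρ m) + t * ∑' m, g m * weight ρ m := by
      rw [← ENNReal.tsum_mul_left, ← ENNReal.tsum_add]
      exact tsum_congr fun m => by ring
    rw [this, add_mul, one_mul, ENNReal.ofReal_add hr.le (by positivity)]
    refine ENNReal.add_lt_add_of_lt_of_le ?_ hx ?_
    · refine ne_top_of_le_ne_top ?_ (mul_le_mul' (le_refl t) hg)
      rw [mul_left_comm]
      exact ENNReal.mul_ne_top ENNReal.ofReal_ne_top
        (ne_top_of_le_ne_top ENNReal.ofReal_ne_top htX)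
    · calc _ ≤ t * (ENNReal.ofReal r * XN ρ r s c) := mul_le_mul' le_rfl hg
        _ = ENNReal.ofReal r * (t * XN ρ r s c) := by ring
        _ ≤ ENNReal.ofReal r * ENNReal.ofReal δ := mul_le_mul' le_rfl htX
        _ = _ := by rw [← ENNReal.ofReal_mul hr.le, mul_comm]
  have hsite := XN_site_le (s := s) hr (a := c) hz hw
  refine ⟨fun j => z j + t * hE (hd (vZb j) c) (pt r s z w),
    fun j => w j + t * hE (hd (vZ j) c) (pt r s z w),
    hdom _ _ hz (le_trans le_add_self hsite), hdom _ _ hw (le_trans le_self_add hsite), ?_⟩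
  intro v
  rcases v with (i | i) | (j | j)
  · have h1 : hE (hd (vI i) c) (pt r s z w) ≤ XN ρ r s c :=
      (Finset.single_le_sum (f := fun i => hE (hd (vI i) c) (pt r s z w))
        (fun _ _ => zero_le) (Finset.mem_univ i)).trans (XN_unit_I_le hz hw)
    change ENNReal.ofReal (Real.exp s) + ENNReal.ofReal (Real.exp s) *
      (t * hE (hd (vI i) c) (pt r s z w)) ≤ ENNReal.ofReal (Real.exp (s + δ))
    calc _ ≤ ENNReal.ofReal (Real.exp s) + ENNReal.ofReal (Real.exp s) * ENNReal.ofReal δ := by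
          gcongr
          exact (mul_le_mul' le_rfl h1).trans htX
      _ = ENNReal.ofReal (Real.exp s * (1 + δ)) := by
          rw [← ENNReal.ofReal_mul (Real.exp_pos _).le, ← ENNReal.ofReal_add (Real.exp_pos _).le
            (by positivity)]
          congr 1; ring
      _ ≤ _ := by
          apply ENNReal.ofReal_le_ofReal
          rw [Real.exp_add]
          gcongr
          linarith [Real.add_one_le_exp δ]
  · have h1 : hE (hd (vTh i) c) (pt r s z w) ≤ ENNReal.ofReal (r ^ 2) * XN ρ r s c :=
      (Finset.single_le_sum (f := fun i => hE (hd (vTh i) c) (pt r s z w))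
        (fun _ _ => zero_le) (Finset.mem_univ i)).trans (XN_unit_th_le hr hz hw)
    change ENNReal.ofReal (r ^ 2) + t * hE (hd (vTh i) c) (pt r s z w) ≤
      ENNReal.ofReal (((1 + δ) * r) ^ 2)
    calc _ ≤ ENNReal.ofReal (r ^ 2) + ENNReal.ofReal (r ^ 2) * ENNReal.ofReal δ := by
          refine add_le_add le_rfl ?_
          calc _ ≤ t * (ENNReal.ofReal (r ^ 2) * XN ρ r s c) := mul_le_mul' le_rfl h1
            _ = ENNReal.ofReal (r ^ 2) * (t * XN ρ r s c) := by ring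
            _ ≤ _ := mul_le_mul' le_rfl htX
      _ = ENNReal.ofReal (r ^ 2 * (1 + δ)) := by
          rw [← ENNReal.ofReal_mul (by positivity), ← ENNReal.ofReal_add (by positivity)
            (by positivity)]
          congr 1; ring
      _ ≤ _ := by
          apply ENNReal.ofReal_le_ofReal
          nlinarith [sq_nonneg r, mul_nonneg hδ (sq_nonneg r), mul_nonneg (mul_nonneg hδ hδ) (sq_nonneg r)]
  · exact le_rfl
  · exact le_rfl

theorem hcomp_hbr_le {ρ r s δ : ℝ} (hr : 0 < r) (hs : 0 ≤ s) (hδ : 0 ≤ δ) {a c : Hat n}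
    {t t' X X' : ℝ≥0∞} (ht0 : t ≠ 0) (ht : t ≠ ⊤) (ht0' : t' ≠ 0) (ht' : t' ≠ ⊤)
    (hX : XN ρ r s c ≤ X) (htX : t * X ≤ ENNReal.ofReal δ)
    (hX' : XN ρ r s a ≤ X') (htX' : t' * X' ≤ ENNReal.ofReal δ)
    {ι : Type} (W : ι → ℝ≥0∞) (V : ι → Var n) :
    hcomp ρ r s W V (hbr a c) ≤ t⁻¹ * hcomp ρ ((1 + δ) * r) (s + δ) W V a +
      t'⁻¹ * hcomp ρ ((1 + δ) * r) (s + δ) W V c := by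
  refine hcomp_le fun z w hz hw => ?_
  obtain ⟨z₁, w₁, hz₁, hw₁, h₁⟩ := move_le_pt hr hδ hX htX hz hw
  obtain ⟨z₂, w₂, hz₂, hw₂, h₂⟩ := move_le_pt hr hδ hX' htX' hz hw
  calc _ ≤ ∑' j, (t⁻¹ * (hE (hd (V j) a) (pt ((1 + δ) * r) (s + δ) z₁ w₁) * W j) +
        t'⁻¹ * (hE (hd (V j) c) (pt ((1 + δ) * r) (s + δ) z₂ w₂) * W j)) := by
        refine ENNReal.tsum_le_tsum fun j => ?_
        rw [← mul_assoc, ← mul_assoc, ← add_mul]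
        refine mul_le_mul' ?_ le_rfl
        refine (hE_hd_hbr (V j) a c (one_le_pt_th hs z w) t t' ht0 ht ht0' ht').trans ?_
        exact add_le_add (mul_le_mul' le_rfl (hE_mono le_rfl h₁))
          (mul_le_mul' le_rfl (hE_mono le_rfl h₂))
    _ ≤ _ := by
        rw [ENNReal.tsum_add, ENNReal.tsum_mul_left, ENNReal.tsum_mul_left]
        exact add_le_add (mul_le_mul' le_rfl (le_hcomp hz₁ hw₁))
          (mul_le_mul' le_rfl (le_hcomp hz₂ hw₂))

/-- Estimate of the Poisson bracket. -/
theorem XN_hbr_le {ρ r s δ A C : ℝ} (hr : 0 < r) (hs : 0 ≤ s) (hδ : 0 < δ) (hδ1 : δ ≤ 1)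
    (hA : 0 < A) (hC : 0 < C) {a c : Hat n}
    (ha : XN ρ ((1 + δ) * r) (s + δ) a ≤ ENNReal.ofReal A)
    (hc : XN ρ ((1 + δ) * r) (s + δ) c ≤ ENNReal.ofReal C) :
    XN ρ r s (hbr a c) ≤ ENNReal.ofReal (32 / δ * A * C) := by
  have hrr : r ≤ (1 + δ) * r := by nlinarith
  have hq : ((1 + δ) * r / r) ^ 2 ≤ 4 := by
    rw [mul_div_assoc, div_self hr.ne', mul_one]; nlinarith
  have hsc : ∀ {e : Hat n} {B : ℝ}, XN ρ ((1 + δ) * r) (s + δ) e ≤ ENNReal.ofReal B →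
      XN ρ r s e ≤ ENNReal.ofReal (4 * B) := by
    intro e B he
    refine (XN_scale e hr hrr (by linarith : s ≤ s + δ)).trans ?_
    rw [ENNReal.ofReal_mul (by norm_num)]
    exact mul_le_mul' (ENNReal.ofReal_le_ofReal hq) he
  have ht : ∀ {B : ℝ}, 0 < B → ENNReal.ofReal (δ / (4 * B)) * ENNReal.ofReal (4 * B) ≤
      ENNReal.ofReal δ := by
    intro B hB
    rw [← ENNReal.ofReal_mul (by positivity), div_mul_cancel₀ _ (by positivity)]
  have hcmp := fun (ι : Type) (W : ι → ℝ≥0∞) (V : ι → Var n) =>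
    hcomp_hbr_le hr hs hδ.le (t := ENNReal.ofReal (δ / (4 * C))) (t' := ENNReal.ofReal (δ / (4 * A)))
    (by simp; positivity) ENNReal.ofReal_ne_top (by simp; positivity) ENNReal.ofReal_ne_top
    (hsc hc) (ht hC) (hsc ha) (ht hA) W V
  have inv_eq : ∀ {B : ℝ}, 0 < B → (ENNReal.ofReal (δ / (4 * B)))⁻¹ = ENNReal.ofReal (4 * B / δ) := by
    intro B hB
    rw [← ENNReal.ofReal_inv_of_pos (by positivity), inv_div]
  have h2 : XN ρ r s (hbr a c) ≤ ENNReal.ofReal (((1 + δ) * r / r) ^ 2) *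
      (ENNReal.ofReal (4 * C / δ) * XN ρ ((1 + δ) * r) (s + δ) a +
        ENNReal.ofReal (4 * A / δ) * XN ρ ((1 + δ) * r) (s + δ) c) := by
    rw [inv_eq hC, inv_eq hA] at hcmp
    exact XN_le_of_comp₂ hr hrr hcmp
  refine h2.trans ?_
  calc _ ≤ ENNReal.ofReal 4 * (ENNReal.ofReal (4 * C / δ) * ENNReal.ofReal A +
        ENNReal.ofReal (4 * A / δ) * ENNReal.ofReal C) := by gcongr
    _ = _ := by
      rw [← ENNReal.ofReal_mul (by positivity), ← ENNReal.ofReal_mul (by positivity),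
        ← ENNReal.ofReal_add (by positivity) (by positivity), ← ENNReal.ofReal_mul (by positivity)]
      congr 1; field_simp; ring

/-- Value of a bracket. -/
theorem hE_hbr_pt_le {ρ r s : ℝ} (hr : 0 < r) (hs : 0 ≤ s) (hwt : ∀ m : NSite n, 1 ≤ weight ρ m)
    (a c : Hat n) {z w : NSite n → ℝ≥0∞} (hz : dom ρ r z) (hw : dom ρ r w) :
    hE (hbr a c) (pt r s z w) ≤ ENNReal.ofReal (4 * r ^ 2) * (XN ρ r s a * XN ρ r s c) := by
  refine (hE_hbr_le a c (one_le_pt_th hs z w)).trans ?_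
  set u := pt r s z w
  have hprod : ∀ {ι : Type} (f g : ι → ℝ≥0∞), ∑' j, f j * g j ≤ (∑' j, f j) * ∑' j, g j := by
    intro ι f g
    rw [← ENNReal.tsum_mul_right]
    exact ENNReal.tsum_le_tsum fun j => mul_le_mul' le_rfl (ENNReal.le_tsum j)
  have hsite : ∀ (f : NSite n → ℝ≥0∞), ∑' j, f j ≤ ∑' j, f j * weight ρ j := fun f =>
    ENNReal.tsum_le_tsum fun j => le_mul_of_one_le_right zero_le (hwt j)
  have hr2 : ENNReal.ofReal (r ^ 2) = ENNReal.ofReal r * ENNReal.ofReal r := by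
    rw [← ENNReal.ofReal_mul hr.le, sq]
  have split : ∀ f : Var n → ℝ≥0∞, ∑' v, f v = ((∑' i, f (vTh i)) + ∑' i, f (vI i)) +
      ((∑' j, f (vZ j)) + ∑' j, f (vZb j)) := by
    intro f
    rw [Summable.tsum_sum (f := f) ENNReal.summable ENNReal.summable,
      Summable.tsum_sum (f := fun x => f (Sum.inl x)) ENNReal.summable ENNReal.summable,
      Summable.tsum_sum (f := fun x => f (Sum.inr x)) ENNReal.summable ENNReal.summable]
  have hI : ∀ e : Hat n, ∑' i, hE (hd (vI i) e) u ≤ XN ρ r s e := fun e => by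
    rw [tsum_fintype]; exact XN_unit_I_le hz hw
  have hT : ∀ e : Hat n, ∑' i, hE (hd (vTh i) e) u ≤ ENNReal.ofReal (r ^ 2) * XN ρ r s e :=
    fun e => by rw [tsum_fintype]; exact XN_unit_th_le hr hz hw
  have hZ : ∀ e : Hat n, ∑' j, hE (hd (vZ j) e) u ≤ ENNReal.ofReal r * XN ρ r s e := fun e =>
    (hsite _).trans (le_self_add.trans (XN_site_le hr hz hw))
  have hZb : ∀ e : Hat n, ∑' j, hE (hd (vZb j) e) u ≤ ENNReal.ofReal r * XN ρ r s e := fun e =>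
    (hsite _).trans (le_add_self.trans (XN_site_le hr hz hw))
  rw [split]
  set A := XN ρ r s a
  set C := XN ρ r s c
  calc _ ≤ (C * (ENNReal.ofReal (r ^ 2) * A) + (ENNReal.ofReal (r ^ 2) * C) * A) +
        ((ENNReal.ofReal r * C) * (ENNReal.ofReal r * A) +
          (ENNReal.ofReal r * C) * (ENNReal.ofReal r * A)) :=
        add_le_add (add_le_add ((hprod _ _).trans (mul_le_mul' (hI c) (hT a)))
          ((hprod _ _).trans (mul_le_mul' (hT c) (hI a))))
          (add_le_add ((hprod _ _).trans (mul_le_mul' (hZb c) (hZ a)))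
            ((hprod _ _).trans (mul_le_mul' (hZ c) (hZb a))))
    _ = _ := by
        rw [ENNReal.ofReal_mul (by norm_num), hr2, ENNReal.ofReal_ofNat]; ring

theorem exists_pos_dom {ρ r : ℝ} (hr : 0 < r) (hwt : ∀ m : NSite n, 1 ≤ weight ρ m) :
    ∃ z : NSite n → ℝ≥0∞, dom ρ r z ∧ ∀ j, z j ≠ 0 := by
  obtain ⟨ε, hε, hsum⟩ := ENNReal.exists_pos_sum_of_countable
    (ε := ENNReal.ofReal r) (by simpa using hr) (NSite n)
  refine ⟨fun j => ε j / weight ρ j, ?_, fun j => ?_⟩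
  · refine lt_of_le_of_lt (ENNReal.tsum_le_tsum fun j => ?_) hsum
    rw [ENNReal.div_mul_cancel (fun h => by have := hwt j; simp [h] at this) (by simp [weight])]
  · have : weight ρ j ≠ ⊤ := by simp [weight]
    simp [ENNReal.div_eq_zero_iff, this, (hε j).ne']

theorem exists_coef_le {ρ r s : ℝ} (hr : 0 < r) (hwt : ∀ m : NSite n, 1 ≤ weight ρ m)
    (ν : Mon n) : ∃ (z : NSite n → ℝ≥0∞) (q : ℝ≥0∞), dom ρ r z ∧ q ≠ ⊤ ∧
      ∀ a : Hat n, a ν ≤ q * hE a (pt r s z z) := by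
  obtain ⟨z, hz, hz0⟩ := exists_pos_dom (n := n) hr hwt
  have h0 : wt (pt r s z z) ν ≠ 0 := by
    rw [wt, Finsupp.prod, Finset.prod_ne_zero_iff]
    intro v _
    apply pow_ne_zero
    rcases v with (i | i) | (j | j)
    · simp [pt, Real.exp_pos]
    · simp [pt]; positivity
    · exact hz0 j
    · exact hz0 j
  have htop : wt (pt r s z z) ν ≠ ⊤ := by
    rw [wt, Finsupp.prod]
    refine ENNReal.prod_ne_top fun v _ => ENNReal.pow_ne_top ?_
    have hzt : ∀ j, z j ≠ ⊤ := fun j h => by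
      have h1 : z j * weight ρ j ≤ ∑' m, z m * weight ρ m := ENNReal.le_tsum j
      rw [h, ENNReal.top_mul (by have := hwt j; intro h0; simp [h0] at this)] at h1
      exact absurd (lt_of_le_of_lt h1 hz) (by simp)
    rcases v with (i | i) | (j | j)
    · simp [pt]
    · simp [pt]
    · exact hzt j
    · exact hzt j
  refine ⟨z, (wt (pt r s z z) ν)⁻¹, hz, ENNReal.inv_ne_top.2 h0, fun a => ?_⟩
  have : a ν * wt (pt r s z z) ν ≤ hE a (pt r s z z) := ENNReal.le_tsum (f := fun ν => a ν * wt _ ν) ν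
  calc a ν = (wt (pt r s z z) ν)⁻¹ * (a ν * wt (pt r s z z) ν) := by
        rw [mul_comm (a ν), ← mul_assoc, ENNReal.inv_mul_cancel h0 htop, one_mul]
    _ ≤ _ := mul_le_mul' le_rfl this

theorem hbr_ne_top {ρ r s : ℝ} (hr : 0 < r) (hs : 0 ≤ s) (hwt : ∀ m : NSite n, 1 ≤ weight ρ m)
    {a c : Hat n} (ha : XN ρ r s a < ⊤) (hc : XN ρ r s c < ⊤) (ν : Mon n) : hbr a c ν ≠ ⊤ := by
  obtain ⟨z, q, hz, hq, h⟩ := exists_coef_le (s := s) hr hwt ν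
  refine ne_top_of_le_ne_top (ENNReal.mul_ne_top hq ?_) (h _)
  exact ne_top_of_le_ne_top (ENNReal.mul_ne_top ENNReal.ofReal_ne_top
    (ENNReal.mul_ne_top ha.ne hc.ne)) (hE_hbr_pt_le hr hs hwt a c hz hz)

/-- Coefficients of `z_m z̄_m`. -/
theorem coef_diag_le {ρ r s : ℝ} (hr : 0 < r) (hwt : ∀ m : NSite n, 1 ≤ weight ρ m) (a : Hat n)
    (m : NSite n) : a (monZ m + monZb m) ≤ 2 * XN ρ r s a := by
  classical
  set x : ℝ≥0∞ := ENNReal.ofReal (r / 2) / weight ρ m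
  have hwm : weight ρ m ≠ ⊤ := by simp [weight]
  have hw0 : weight ρ m ≠ 0 := fun h => by have := hwt m; simp [h] at this
  have hx : x * weight ρ m = ENNReal.ofReal (r / 2) := ENNReal.div_mul_cancel hw0 hwm
  have hz : dom ρ r (0 : NSite n → ℝ≥0∞) := by simp [dom, hr]
  have hw : dom ρ r (Pi.single m x : NSite n → ℝ≥0∞) := by
    unfold dom
    rw [tsum_eq_single m (by intro m' hm; simp [hm]), Pi.single_eq_same, hx]
    exact (ENNReal.ofReal_lt_ofReal_iff hr).2 (by linarith)
  have h1 := le_self_add.trans (XN_site_le (s := s) hr (a := a) hz hw)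
  have h2 := (ENNReal.le_tsum (f := fun j => hE (hd (vZ j) a)
    (pt r s 0 (Pi.single m x)) * weight ρ j) m).trans h1
  have h3 : a (monZ m + monZb m) * x ≤ hE (hd (vZ m) a) (pt r s 0 (Pi.single m x)) := by
    refine le_trans (le_of_eq ?_) (ENNReal.le_tsum (f := fun ν => hd (vZ m) a ν * wt _ ν) (monZb m))
    rw [wt_pt]
    simp [hd, monZb, monZ, absK, Finsupp.prod_single_index, add_comm]
  have h4 : a (monZ m + monZb m) * ENNReal.ofReal (r / 2) ≤ ENNReal.ofReal r * XN ρ r s a := by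
    rw [← hx, ← mul_assoc]
    exact (mul_le_mul' h3 le_rfl).trans h2
  have h5 : ENNReal.ofReal r = 2 * ENNReal.ofReal (r / 2) := by
    rw [← ENNReal.ofReal_ofNat, ← ENNReal.ofReal_mul (by norm_num)]; congr 1; ring
  rw [h5, mul_comm, mul_right_comm, mul_comm (2 * _)] at h4
  refine (ENNReal.mul_le_mul_iff_right (a := ENNReal.ofReal (r / 2)) (by simp; positivity) (by simp)).1
    ?_
  exact h4

end HatNorm

/-! ### The norm `|c|_𝒪` of coefficients -/

section Coef

variable {b : ℕ} {O : Set (Par b)}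

theorem le_coefNorm (c : Par b → ℂ) {ξ : Par b} (hξ : ξ ∈ O) :
    ‖c ξ‖ₑ + ‖fderiv ℝ c ξ‖ₑ ≤ coefNorm O c :=
  le_iSup₂_of_le (f := fun ξ (_ : ξ ∈ O) => ‖c ξ‖ₑ + ‖fderiv ℝ c ξ‖ₑ) ξ hξ le_rfl

theorem enorm_le_coefNorm (c : Par b → ℂ) {ξ : Par b} (hξ : ξ ∈ O) : ‖c ξ‖ₑ ≤ coefNorm O c :=
  le_self_add.trans (le_coefNorm c hξ)

theorem coefNorm_le {c : Par b → ℂ} {B : ℝ≥0∞} (h : ∀ ξ ∈ O, ‖c ξ‖ₑ + ‖fderiv ℝ c ξ‖ₑ ≤ B) :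
    coefNorm O c ≤ B := iSup₂_le h

theorem coefNorm_mono {O' : Set (Par b)} (h : O ⊆ O') (c : Par b → ℂ) :
    coefNorm O c ≤ coefNorm O' c := coefNorm_le fun _ hξ => le_coefNorm c (h hξ)

theorem coefNorm_congr (hO : IsOpen O) {c c' : Par b → ℂ} (h : Set.EqOn c c' O) :
    coefNorm O c = coefNorm O c' := by
  unfold coefNorm
  refine iSup_congr fun ξ => iSup_congr fun hξ => ?_
  rw [h hξ, Filter.EventuallyEq.fderiv_eq (h.eventuallyEq_of_mem (hO.mem_nhds hξ))]

theorem clm_enorm_add_le (A B : Par b →L[ℝ] ℂ) : ‖A + B‖ₑ ≤ ‖A‖ₑ + ‖B‖ₑ := by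
  rw [← ofReal_norm, ← ofReal_norm, ← ofReal_norm,
    ← ENNReal.ofReal_add (norm_nonneg _) (norm_nonneg _)]
  exact ENNReal.ofReal_le_ofReal (norm_add_le A B)

theorem clm_enorm_tsum_le {ι : Type*} (A : ι → Par b →L[ℝ] ℂ) : ‖∑' i, A i‖ₑ ≤ ∑' i, ‖A i‖ₑ := by
  by_cases h : Summable fun i => ‖A i‖
  · have h1 : ∀ i, ‖A i‖ₑ = ENNReal.ofReal ‖A i‖ := fun i => (ofReal_norm _).symm
    simp only [h1]
    rw [← ENNReal.ofReal_tsum_of_nonneg (fun i => norm_nonneg _) h, ← ofReal_norm]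
    exact ENNReal.ofReal_le_ofReal (norm_tsum_le_tsum_norm h)
  · have h1 : ∑' i, ‖A i‖ₑ = ⊤ := by
      by_contra h2
      exact h (by simpa using ENNReal.summable_toReal h2)
    rw [h1]; exact le_top

@[simp] theorem coefNorm_zero : coefNorm O (fun _ => (0 : ℂ)) = 0 := by
  have h : ∀ ξ, ‖fderiv ℝ (fun _ : Par b => (0 : ℂ)) ξ‖ₑ = 0 := fun ξ => by
    rw [← ofReal_norm]; simp
  simp [coefNorm, h, -fderiv_fun_const]

theorem coefNorm_const_mul (q : ℂ) (c : Par b → ℂ) :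
    coefNorm O (fun ξ => q * c ξ) = ‖q‖ₑ * coefNorm O c := by
  unfold coefNorm
  simp only [ENNReal.mul_iSup]
  refine iSup_congr fun ξ => iSup_congr fun _ => ?_
  have : fderiv ℝ (fun ξ => q * c ξ) ξ = q • fderiv ℝ c ξ := by
    have := congrFun (fderiv_const_smul_field (𝕜 := ℝ) (f := c) q) ξ
    exact this
  rw [this, enorm_mul, enorm_smul, mul_add]

theorem diffAt {c : Par b → ℂ} (hO : IsOpen O) (hc : ContDiffOn ℝ 1 c O) {ξ : Par b} (hξ : ξ ∈ O) :
    DifferentiableAt ℝ c ξ :=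
  (hc.differentiableOn (by simp)).differentiableAt (hO.mem_nhds hξ)

theorem coefNorm_add_le (hO : IsOpen O) {c c' : Par b → ℂ} (hc : ContDiffOn ℝ 1 c O)
    (hc' : ContDiffOn ℝ 1 c' O) :
    coefNorm O (fun ξ => c ξ + c' ξ) ≤ coefNorm O c + coefNorm O c' := by
  refine coefNorm_le fun ξ hξ => ?_
  rw [fderiv_fun_add (diffAt hO hc hξ) (diffAt hO hc' hξ)]
  refine (add_le_add (enorm_add_le _ _) (clm_enorm_add_le _ _)).trans ?_
  rw [add_add_add_comm]
  exact add_le_add (le_coefNorm c hξ) (le_coefNorm c' hξ)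

theorem coefNorm_neg (c : Par b → ℂ) : coefNorm O (fun ξ => -c ξ) = coefNorm O c := by
  have := coefNorm_const_mul (O := O) (-1) c
  simpa using this

theorem coefNorm_sub_le (hO : IsOpen O) {c c' : Par b → ℂ} (hc : ContDiffOn ℝ 1 c O)
    (hc' : ContDiffOn ℝ 1 c' O) :
    coefNorm O (fun ξ => c ξ - c' ξ) ≤ coefNorm O c + coefNorm O c' := by
  have := coefNorm_add_le hO hc hc'.neg
  simpa only [← sub_eq_add_neg, coefNorm_neg] using this

theorem coefNorm_mul_le (hO : IsOpen O) {c c' : Par b → ℂ} (hc : ContDiffOn ℝ 1 c O)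
    (hc' : ContDiffOn ℝ 1 c' O) :
    coefNorm O (fun ξ => c ξ * c' ξ) ≤ coefNorm O c * coefNorm O c' := by
  refine coefNorm_le fun ξ hξ => ?_
  rw [fderiv_fun_mul (diffAt hO hc hξ) (diffAt hO hc' hξ), enorm_mul]
  refine le_trans ?_ (mul_le_mul' (le_coefNorm c hξ) (le_coefNorm c' hξ))
  calc _ ≤ ‖c ξ‖ₑ * ‖c' ξ‖ₑ + (‖c ξ‖ₑ * ‖fderiv ℝ c' ξ‖ₑ + ‖c' ξ‖ₑ * ‖fderiv ℝ c ξ‖ₑ) := by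
        refine add_le_add le_rfl ((clm_enorm_add_le _ _).trans ?_)
        rw [enorm_smul, enorm_smul]
    _ ≤ ‖c ξ‖ₑ * ‖c' ξ‖ₑ + (‖c ξ‖ₑ * ‖fderiv ℝ c' ξ‖ₑ + ‖c' ξ‖ₑ * ‖fderiv ℝ c ξ‖ₑ) +
        ‖fderiv ℝ c ξ‖ₑ * ‖fderiv ℝ c' ξ‖ₑ := le_self_add
    _ = _ := by ring

theorem summable_of_coefNorm {ι : Type*} {c : ι → Par b → ℂ}
    (hsum : ∑' i, coefNorm O (c i) ≠ ⊤) {ξ : Par b} (hξ : ξ ∈ O) : Summable fun i => c i ξ := by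
  have h1 : Summable fun i => (coefNorm O (c i)).toReal := ENNReal.summable_toReal hsum
  refine Summable.of_norm_bounded h1 fun i => ?_
  have := ENNReal.toReal_mono (ENNReal.ne_top_of_tsum_ne_top hsum i) (enorm_le_coefNorm (c i) hξ)
  simpa using this

theorem coefNorm_tsum {ι : Type*} (hO : IsOpen O) {c : ι → Par b → ℂ}
    (hc : ∀ i, ContDiffOn ℝ 1 (c i) O) (hsum : ∑' i, coefNorm O (c i) ≠ ⊤) :
    ContDiffOn ℝ 1 (fun ξ => ∑' i, c i ξ) O ∧
      coefNorm O (fun ξ => ∑' i, c i ξ) ≤ ∑' i, coefNorm O (c i) := by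
  set u : ι → ℝ := fun i => (coefNorm O (c i)).toReal
  have hu : Summable u := ENNReal.summable_toReal hsum
  have hb : ∀ i, ∀ ξ ∈ O, ‖fderiv ℝ (c i) ξ‖ ≤ u i := by
    intro i ξ hξ
    have h : ‖fderiv ℝ (c i) ξ‖ₑ ≤ coefNorm O (c i) := le_add_self.trans (le_coefNorm (c i) hξ)
    simpa using ENNReal.toReal_mono (ENNReal.ne_top_of_tsum_ne_top hsum i) h
  have hder : ∀ ξ ∈ O, HasFDerivAt (fun ξ => ∑' i, c i ξ) (∑' i, fderiv ℝ (c i) ξ) ξ := by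
    intro ξ hξ
    obtain ⟨ε, hε, hball⟩ := Metric.isOpen_iff.1 hO ξ hξ
    exact hasFDerivAt_tsum_of_isPreconnected hu Metric.isOpen_ball
      (convex_ball ξ ε).isPreconnected
      (fun i x hx => (diffAt hO (hc i) (hball hx)).hasFDerivAt) (fun i x hx => hb i x (hball hx))
      (Metric.mem_ball_self hε) (summable_of_coefNorm hsum hξ) (Metric.mem_ball_self hε)
  constructor
  · have h1 : (1 : WithTop ℕ∞) = 0 + 1 := by simp
    rw [h1, contDiffOn_succ_iff_fderiv_of_isOpen hO]
    refine ⟨fun ξ hξ => (hder ξ hξ).differentiableAt.differentiableWithinAt, by simp, ?_⟩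
    rw [contDiffOn_zero]
    have : ContinuousOn (fun ξ => ∑' i, fderiv ℝ (c i) ξ) O := by
      refine continuousOn_tsum (fun i => ?_) hu hb
      have := hc i
      rw [h1, contDiffOn_succ_iff_fderiv_of_isOpen hO] at this
      exact this.2.2.continuousOn
    exact this.congr fun ξ hξ => (hder ξ hξ).fderiv
  · refine coefNorm_le fun ξ hξ => ?_
    rw [(hder ξ hξ).fderiv]
    refine (add_le_add enorm_tsum_le_tsum_enorm (clm_enorm_tsum_le _)).trans ?_
    rw [← ENNReal.tsum_add]
    exact ENNReal.tsum_le_tsum fun i => le_coefNorm (c i) hξ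

theorem coefNorm_sum_le {ι : Type*} (hO : IsOpen O) (S : Finset ι) {c : ι → Par b → ℂ}
    (hc : ∀ i ∈ S, ContDiffOn ℝ 1 (c i) O) :
    coefNorm O (fun ξ => ∑ i ∈ S, c i ξ) ≤ ∑ i ∈ S, coefNorm O (c i) := by
  classical
  induction S using Finset.induction_on with
  | empty => simp
  | insert x S hx ih =>
    simp only [Finset.sum_insert hx]
    refine (coefNorm_add_le hO (hc x (Finset.mem_insert_self _ _)) ?_).trans ?_
    · exact ContDiffOn.sum fun i hi => hc i (Finset.mem_insert_of_mem hi)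
    · exact add_le_add le_rfl (ih fun i hi => hc i (Finset.mem_insert_of_mem hi))

end Coef

/-! ### Hamiltonians and their majorants -/

section Maj

variable {d b : ℕ} {n : Fin b → Fin d → ℤ} {O : Set (Par b)}

/-- The majorant of a Hamiltonian. -/
def hat (O : Set (Par b)) (f : Ham n) : Hat n := fun ν => coefNorm O (f ν)

/-- All coefficients are `C¹` on `O`. -/
def C1On (O : Set (Par b)) (f : Ham n) : Prop := ∀ ν, ContDiffOn ℝ 1 (f ν) O

theorem one_le_len {m : Fin d → ℤ} (hm : m ≠ 0) : 1 ≤ len m := by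
  obtain ⟨i, hi⟩ := Function.ne_iff.1 hm
  unfold len
  rw [Real.one_le_sqrt]
  have h1 : (1 : ℝ) ≤ (m i : ℝ) ^ 2 := by
    have : (1 : ℤ) ≤ (m i) ^ 2 := by
      have : 0 < (m i) ^ 2 := by have : m i ≠ 0 := hi; positivity
      linarith
    exact_mod_cast this
  exact h1.trans (Finset.single_le_sum (f := fun i => (m i : ℝ) ^ 2) (fun _ _ => sq_nonneg _)
    (Finset.mem_univ i))

theorem one_le_weight (hz : ∃ i, n i = 0) {ρ : ℝ} (hρ : 0 < ρ) (m : NSite n) :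
    1 ≤ weight ρ m := by
  have hm : m.1 ≠ 0 := by
    obtain ⟨i, hi⟩ := hz
    intro h
    exact m.2 ⟨i, by rw [hi, h]⟩
  have h1 := one_le_len hm
  unfold weight
  apply ENNReal.one_le_ofReal.2
  have h2 : 1 ≤ Real.exp (ρ * len m.1) := Real.one_le_exp (by positivity)
  have h3 : 1 ≤ len m.1 ^ (d + 1) := one_le_pow₀ h1
  nlinarith

theorem natCast_add_one_enorm (k : ℕ) : ‖(k : ℂ) + 1‖ₑ = (k : ℝ≥0∞) + 1 := by
  have : (k : ℂ) + 1 = ((k + 1 : ℕ) : ℂ) := by push_cast; rfl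
  rw [this, ← ofReal_norm, Complex.norm_natCast, ENNReal.ofReal_natCast]; push_cast; rfl

theorem hat_dI (i : Fin b) (f : Ham n) : hat O (dI i f) = hd (vI i) (hat O f) := by
  funext ν
  unfold hat dI
  rw [coefNorm_const_mul, natCast_add_one_enorm]; rfl

theorem hat_dZ (j : NSite n) (f : Ham n) : hat O (dZ j f) = hd (vZ j) (hat O f) := by
  funext ν
  unfold hat dZ
  rw [coefNorm_const_mul, natCast_add_one_enorm]; rfl

theorem hat_dZb (j : NSite n) (f : Ham n) : hat O (dZb j f) = hd (vZb j) (hat O f) := by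
  funext ν
  unfold hat dZb
  rw [coefNorm_const_mul, natCast_add_one_enorm]; rfl

theorem hat_dTheta (i : Fin b) (f : Ham n) : hat O (dTheta i f) = hd (vTh i) (hat O f) := by
  funext ν
  unfold hat dTheta
  rw [coefNorm_const_mul]
  have : ‖Complex.I * (ν.1 i : ℂ)‖ₑ = ((ν.1 i).natAbs : ℝ≥0∞) := by
    rw [← ofReal_norm, norm_mul, Complex.norm_I, one_mul, Complex.norm_intCast,
      ← Int.cast_abs, Int.abs_eq_natAbs, Int.cast_natCast, ENNReal.ofReal_natCast]
  rw [this]; rfl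

theorem majorant_eq {r s : ℝ} (hr : 0 ≤ r) (f : Ham n) (z w : NSite n → ℂ) :
    majorant O r s f z w = hE (hat O f) (pt r s (fun j => ‖z j‖ₑ) fun j => ‖w j‖ₑ) := by
  unfold majorant hE
  refine tsum_congr fun ν => ?_
  rw [wt_pt, ENNReal.ofReal_mul (by positivity), pow_mul, ENNReal.ofReal_pow (by positivity)]
  unfold hat
  ring

theorem exists_complex {ρ r : ℝ} (hwt : ∀ m : NSite n, 1 ≤ weight ρ m) {z : NSite n → ℝ≥0∞}
    (hz : dom ρ r z) : ∃ z' : NSite n → ℂ, (∀ j, ‖z' j‖ₑ = z j) ∧ seqNorm ρ z' < ENNReal.ofReal r := by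
  have h : ∀ j, ‖((z j).toReal : ℂ)‖ₑ = z j := by
    intro j
    have h1 : z j * weight ρ j ≤ ∑' m, z m * weight ρ m := ENNReal.le_tsum j
    have hzt : z j ≠ ⊤ := fun h => by
      rw [h, ENNReal.top_mul (by have := hwt j; intro h0; simp [h0] at this)] at h1
      exact absurd (lt_of_le_of_lt h1 hz) (by simp)
    rw [← ofReal_norm, Complex.norm_real, Real.norm_of_nonneg ENNReal.toReal_nonneg,
      ENNReal.ofReal_toReal hzt]
  exact ⟨fun j => ((z j).toReal : ℂ), h, by simp only [seqNorm, h]; exact hz⟩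

theorem iSup_dom_eq {ρ r : ℝ} (hwt : ∀ m : NSite n, 1 ≤ weight ρ m)
    (Φ : (NSite n → ℝ≥0∞) → (NSite n → ℝ≥0∞) → ℝ≥0∞) :
    (⨆ (z : NSite n → ℂ) (w : NSite n → ℂ) (_ : seqNorm ρ z < ENNReal.ofReal r)
      (_ : seqNorm ρ w < ENNReal.ofReal r), Φ (fun j => ‖z j‖ₑ) fun j => ‖w j‖ₑ) =
    ⨆ (z : NSite n → ℝ≥0∞) (w : NSite n → ℝ≥0∞) (_ : dom ρ r z) (_ : dom ρ r w), Φ z w := by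
  apply le_antisymm
  · refine iSup_le fun z => iSup_le fun w => iSup_le fun hz => iSup_le fun hw => ?_
    exact le_iSup_of_le _ (le_iSup_of_le _ (le_iSup_of_le (show dom ρ r (fun j => ‖z j‖ₑ) from hz)
      (le_iSup_of_le (show dom ρ r (fun j => ‖w j‖ₑ) from hw) le_rfl)))
  · refine iSup_le fun z => iSup_le fun w => iSup_le fun hz => iSup_le fun hw => ?_
    obtain ⟨z', hz', hzn⟩ := exists_complex hwt hz
    obtain ⟨w', hw', hwn⟩ := exists_complex hwt hw
    refine le_iSup_of_le z' (le_iSup_of_le w' (le_iSup_of_le hzn (le_iSup_of_le hwn ?_)))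
    simp only [hz', hw', le_refl]

theorem XNorm_eq {ρ r s : ℝ} (hr : 0 ≤ r) (hwt : ∀ m : NSite n, 1 ≤ weight ρ m) (f : Ham n) :
    XNorm ρ O r s f = XN ρ r s (hat O f) := by
  have hfn : ∀ (g : Ham n) (v : Var n), hat O g = hd v (hat O f) →
      fnNorm ρ O r s g = hcomp ρ r s (fun _ : Unit => 1) (fun _ => v) (hat O f) := by
    intro g v hg
    unfold fnNorm hcomp
    simp only [majorant_eq hr, hg]
    rw [iSup_dom_eq hwt fun z w => hE (hd v (hat O f)) (pt r s z w)]
    simp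
  have hvec : ∀ (g : NSite n → Ham n) (v : NSite n → Var n),
      (∀ j, hat O (g j) = hd (v j) (hat O f)) →
      vecNorm ρ O r s g = hcomp ρ r s (weight ρ) v (hat O f) := by
    intro g v hg
    unfold vecNorm hcomp
    simp only [majorant_eq hr, hg]
    rw [iSup_dom_eq hwt fun z w => ∑' j, hE (hd (v j) (hat O f)) (pt r s z w) * weight ρ j]
  unfold XNorm XN
  simp only [hfn _ _ (hat_dI _ f), hfn _ _ (hat_dTheta _ f), hvec _ _ (hat_dZ · f),
    hvec _ _ (hat_dZb · f)]

/-! ### Poisson brackets -/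

theorem mulH_hat (hO : IsOpen O) {f g : Ham n} (hf : C1On O f) (hg : C1On O g) {ν : Mon n}
    (h : hmul (hat O f) (hat O g) ν ≠ ⊤) :
    ContDiffOn ℝ 1 (mulH f g ν) O ∧ coefNorm O (mulH f g ν) ≤ hmul (hat O f) (hat O g) ν ∧
      ∀ ξ ∈ O, Summable fun p : {p : Mon n × Mon n // p.1 + p.2 = ν} => f p.1.1 ξ * g p.1.2 ξ := by
  have hle : ∀ p : {p : Mon n × Mon n // p.1 + p.2 = ν},
      coefNorm O (fun ξ => f p.1.1 ξ * g p.1.2 ξ) ≤ hat O f p.1.1 * hat O g p.1.2 := fun p =>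
    coefNorm_mul_le hO (hf _) (hg _)
  have hs : ∑' p : {p : Mon n × Mon n // p.1 + p.2 = ν},
      coefNorm O (fun ξ => f p.1.1 ξ * g p.1.2 ξ) ≤ hmul (hat O f) (hat O g) ν :=
    ENNReal.tsum_le_tsum hle
  have ht := ne_top_of_le_ne_top h hs
  obtain ⟨h1, h2⟩ := coefNorm_tsum hO
    (c := fun (p : {p : Mon n × Mon n // p.1 + p.2 = ν}) ξ => f p.1.1 ξ * g p.1.2 ξ)
    (fun p => (hf _).mul (hg _)) ht
  exact ⟨h1, h2.trans hs, fun ξ hξ => summable_of_coefNorm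
    (c := fun (p : {p : Mon n × Mon n // p.1 + p.2 = ν}) ξ => f p.1.1 ξ * g p.1.2 ξ) ht hξ⟩

theorem C1On_dI (i : Fin b) {f : Ham n} (hf : C1On O f) : C1On O (dI i f) := fun _ =>
  contDiffOn_const.mul (hf _)
theorem C1On_dTheta (i : Fin b) {f : Ham n} (hf : C1On O f) : C1On O (dTheta i f) := fun _ =>
  contDiffOn_const.mul (hf _)
theorem C1On_dZ (j : NSite n) {f : Ham n} (hf : C1On O f) : C1On O (dZ j f) := fun _ =>
  contDiffOn_const.mul (hf _)
theorem C1On_dZb (j : NSite n) {f : Ham n} (hf : C1On O f) : C1On O (dZb j f) := fun _ =>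
  contDiffOn_const.mul (hf _)

theorem tsum_var (f : Var n → ℝ≥0∞) : ∑' v, f v = ((∑ i, f (vTh i)) + ∑ i, f (vI i)) +
    ((∑' j, f (vZ j)) + ∑' j, f (vZb j)) := by
  rw [Summable.tsum_sum (f := f) ENNReal.summable ENNReal.summable,
    Summable.tsum_sum (f := fun x => f (Sum.inl x)) ENNReal.summable ENNReal.summable,
    Summable.tsum_sum (f := fun x => f (Sum.inr x)) ENNReal.summable ENNReal.summable,
    tsum_fintype, tsum_fintype]

/-- Convergence of the sums in a coefficient of a bracket. -/
structure BrSummable (f g : Ham n) (ν : Mon n) (ξ : Par b) : Prop where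
  action : ∀ i, Summable fun p : {p : Mon n × Mon n // p.1 + p.2 = ν} =>
    dI i f p.1.1 ξ * dTheta i g p.1.2 ξ
  angle : ∀ i, Summable fun p : {p : Mon n × Mon n // p.1 + p.2 = ν} =>
    dTheta i f p.1.1 ξ * dI i g p.1.2 ξ
  siteb : ∀ j, Summable fun p : {p : Mon n × Mon n // p.1 + p.2 = ν} =>
    dZb j f p.1.1 ξ * dZ j g p.1.2 ξ
  site : ∀ j, Summable fun p : {p : Mon n × Mon n // p.1 + p.2 = ν} =>
    dZ j f p.1.1 ξ * dZb j g p.1.2 ξ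
  sites : Summable fun j => mulH (dZb j f) (dZ j g) ν ξ - mulH (dZ j f) (dZb j g) ν ξ

theorem poisson_hat (hO : IsOpen O) {f g : Ham n} (hf : C1On O f) (hg : C1On O g) {ν : Mon n}
    (h : hbr (hat O f) (hat O g) ν ≠ ⊤) :
    ContDiffOn ℝ 1 (poisson f g ν) O ∧ coefNorm O (poisson f g ν) ≤ hbr (hat O f) (hat O g) ν ∧
      ∀ ξ ∈ O, BrSummable f g ν ξ := by
  have hv : ∀ v, hmul (hd v (hat O f)) (hd (dual v) (hat O g)) ν ≠ ⊤ := fun v =>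
    ENNReal.ne_top_of_tsum_ne_top h v
  have hsplit : hbr (hat O f) (hat O g) ν = _ := tsum_var _
  have hI := fun i => mulH_hat hO (C1On_dI i hf) (C1On_dTheta i hg) (ν := ν)
    (by rw [hat_dI, hat_dTheta]; exact hv (vI i))
  have hT := fun i => mulH_hat hO (C1On_dTheta i hf) (C1On_dI i hg) (ν := ν)
    (by rw [hat_dI, hat_dTheta]; exact hv (vTh i))
  have hZ := fun j => mulH_hat hO (C1On_dZ j hf) (C1On_dZb j hg) (ν := ν)
    (by rw [hat_dZ, hat_dZb]; exact hv (vZ j))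
  have hZb := fun j => mulH_hat hO (C1On_dZb j hf) (C1On_dZ j hg) (ν := ν)
    (by rw [hat_dZ, hat_dZb]; exact hv (vZb j))
  simp only [hat_dI, hat_dTheta, hat_dZ, hat_dZb] at hI hT hZ hZb
  rw [hsplit] at h ⊢
  set SZ : ℝ≥0∞ := ∑' j, hmul (hd (vZ j) (hat O f)) (hd (dual (vZ j)) (hat O g)) ν
  set SZb : ℝ≥0∞ := ∑' j, hmul (hd (vZb j) (hat O f)) (hd (dual (vZb j)) (hat O g)) ν
  have hjle : ∑' j, coefNorm O (fun ξ => mulH (dZb j f) (dZ j g) ν ξ - mulH (dZ j f) (dZb j g) ν ξ) ≤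
      SZ + SZb := by
    rw [add_comm SZ, ← ENNReal.tsum_add]
    exact ENNReal.tsum_le_tsum fun j => (coefNorm_sub_le hO (hZb j).1 (hZ j).1).trans
      (add_le_add (hZb j).2.1 (hZ j).2.1)
  have hjt := ne_top_of_le_ne_top (ENNReal.add_ne_top.1 h).2 hjle
  obtain ⟨hj1, hj2⟩ := coefNorm_tsum hO (c := fun j ξ =>
    mulH (dZb j f) (dZ j g) ν ξ - mulH (dZ j f) (dZb j g) ν ξ)
    (fun j => (hZb j).1.sub (hZ j).1) hjt
  have hi1 : ∀ i : Fin b, ContDiffOn ℝ 1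
      (fun ξ => mulH (dI i f) (dTheta i g) ν ξ - mulH (dTheta i f) (dI i g) ν ξ) O :=
    fun i => (hI i).1.sub (hT i).1
  refine ⟨?_, ?_, fun ξ hξ => ⟨fun i => (hI i).2.2 ξ hξ, fun i => (hT i).2.2 ξ hξ,
    fun j => (hZb j).2.2 ξ hξ, fun j => (hZ j).2.2 ξ hξ, summable_of_coefNorm (c := fun j ξ =>
      mulH (dZb j f) (dZ j g) ν ξ - mulH (dZ j f) (dZb j g) ν ξ) hjt hξ⟩⟩
  · exact (ContDiffOn.sum fun i _ => hi1 i).add (contDiffOn_const.mul hj1)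
  · refine (coefNorm_add_le hO (ContDiffOn.sum fun i _ => hi1 i) (contDiffOn_const.mul hj1)).trans ?_
    refine add_le_add ?_ ?_
    · refine (coefNorm_sum_le hO _ fun i _ => hi1 i).trans ?_
      rw [← Finset.sum_add_distrib]
      refine Finset.sum_le_sum fun i _ => (coefNorm_sub_le hO (hI i).1 (hT i).1).trans ?_
      rw [add_comm]
      exact add_le_add (hT i).2.1 (hI i).2.1
    · rw [coefNorm_const_mul]
      have : ‖Complex.I‖ₑ = 1 := by rw [← ofReal_norm]; simp
      rw [this, one_mul]
      exact hj2.trans hjle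

theorem mulH_comm (f g : Ham n) (ν : Mon n) (ξ : Par b) : mulH f g ν ξ = mulH g f ν ξ := by
  unfold mulH
  rw [← (swapFiber ν).tsum_eq]
  exact tsum_congr fun p => mul_comm _ _

theorem poisson_antisymm (f g : Ham n) (ν : Mon n) (ξ : Par b) :
    poisson f g ν ξ = -poisson g f ν ξ := by
  unfold poisson
  rw [neg_add, ← mul_neg, ← tsum_neg, ← Finset.sum_neg_distrib]
  congr 1
  · refine Finset.sum_congr rfl fun i _ => ?_
    rw [mulH_comm (dI i f), mulH_comm (dTheta i f)]; ring
  · congr 1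
    refine tsum_congr fun j => ?_
    rw [mulH_comm (dZb j f), mulH_comm (dZ j f)]; ring

theorem mon_th (i : Fin b) : mon (vTh i : Var n) = 0 := rfl
theorem mon_I (i : Fin b) : mon (vI i : Var n) = monI i := rfl
theorem mon_Z (j : NSite n) : mon (vZ j) = monZ j := rfl
theorem mon_Zb (j : NSite n) : mon (vZb j) = monZb j := rfl
theorem dual_th (i : Fin b) : dual (vTh i : Var n) = vI i := rfl
theorem dual_I (i : Fin b) : dual (vI i : Var n) = vTh i := rfl
theorem dual_Z (j : NSite n) : dual (vZ j) = vZb j := rfl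
theorem dual_Zb (j : NSite n) : dual (vZb j) = vZ j := rfl

theorem poisson_congr {f f' g g' : Ham n} {ν : Mon n} {ξ : Par b}
    (h : ∀ (v : Var n) (p q : Mon n), p + q = ν → f (p + mon v) ξ * g (q + mon (dual v)) ξ =
      f' (p + mon v) ξ * g' (q + mon (dual v)) ξ) :
    poisson f g ν ξ = poisson f' g' ν ξ := by
  have key : ∀ {F G F' G' : Ham n}, (∀ p q, p + q = ν → F p ξ * G q ξ = F' p ξ * G' q ξ) →
      mulH F G ν ξ = mulH F' G' ν ξ := fun hh => tsum_congr fun p => hh _ _ p.2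
  unfold poisson
  congr 1
  · refine Finset.sum_congr rfl fun i _ => ?_
    congr 1
    · refine key fun p q hpq => ?_
      have := h (vI i) p q hpq
      simp only [mon_I, mon_th, dual_I, add_zero] at this
      simp only [dI, dTheta]
      linear_combination ((p.2.1 i : ℂ) + 1) * (Complex.I * (q.1 i : ℂ)) * this
    · refine key fun p q hpq => ?_
      have := h (vTh i) p q hpq
      simp only [mon_I, mon_th, dual_th, add_zero] at this
      simp only [dI, dTheta]
      linear_combination ((q.2.1 i : ℂ) + 1) * (Complex.I * (p.1 i : ℂ)) * this
  · congr 1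
    refine tsum_congr fun j => ?_
    congr 1
    · refine key fun p q hpq => ?_
      have := h (vZb j) p q hpq
      simp only [mon_Z, mon_Zb, dual_Zb] at this
      simp only [dZ, dZb]
      linear_combination ((p.2.2.2 j : ℂ) + 1) * ((q.2.2.1 j : ℂ) + 1) * this
    · refine key fun p q hpq => ?_
      have := h (vZ j) p q hpq
      simp only [mon_Z, mon_Zb, dual_Z] at this
      simp only [dZ, dZb]
      linear_combination ((p.2.2.1 j : ℂ) + 1) * ((q.2.2.2 j : ℂ) + 1) * this

theorem poisson_add_left {f f' g : Ham n} {ν : Mon n} {ξ : Par b} (h : BrSummable f g ν ξ)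
    (h' : BrSummable f' g ν ξ) :
    poisson (f + f') g ν ξ = poisson f g ν ξ + poisson f' g ν ξ := by
  have key : ∀ {F F' F'' G : Ham n}, (∀ p, F'' p ξ = F p ξ + F' p ξ) →
      (Summable fun p : {p : Mon n × Mon n // p.1 + p.2 = ν} => F p.1.1 ξ * G p.1.2 ξ) →
      (Summable fun p : {p : Mon n × Mon n // p.1 + p.2 = ν} => F' p.1.1 ξ * G p.1.2 ξ) →
      mulH F'' G ν ξ = mulH F G ν ξ + mulH F' G ν ξ := by
    intro F F' F'' G hF hs hs'
    unfold mulH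
    rw [← hs.tsum_add hs']
    exact tsum_congr fun p => by rw [hF, add_mul]
  have e1 : ∀ i, mulH (dI i (f + f')) (dTheta i g) ν ξ =
      mulH (dI i f) (dTheta i g) ν ξ + mulH (dI i f') (dTheta i g) ν ξ := fun i =>
    key (fun p => by simp [dI, mul_add]) (h.action i) (h'.action i)
  have e2 : ∀ i, mulH (dTheta i (f + f')) (dI i g) ν ξ =
      mulH (dTheta i f) (dI i g) ν ξ + mulH (dTheta i f') (dI i g) ν ξ := fun i =>
    key (fun p => by simp [dTheta, mul_add]) (h.angle i) (h'.angle i)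
  have e3 : ∀ j, mulH (dZb j (f + f')) (dZ j g) ν ξ =
      mulH (dZb j f) (dZ j g) ν ξ + mulH (dZb j f') (dZ j g) ν ξ := fun j =>
    key (fun p => by simp [dZb, mul_add]) (h.siteb j) (h'.siteb j)
  have e4 : ∀ j, mulH (dZ j (f + f')) (dZb j g) ν ξ =
      mulH (dZ j f) (dZb j g) ν ξ + mulH (dZ j f') (dZb j g) ν ξ := fun j =>
    key (fun p => by simp [dZ, mul_add]) (h.site j) (h'.site j)
  unfold poisson
  simp only [e1, e2, e3, e4]
  have : ∀ j, mulH (dZb j f) (dZ j g) ν ξ + mulH (dZb j f') (dZ j g) ν ξ -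
      (mulH (dZ j f) (dZb j g) ν ξ + mulH (dZ j f') (dZb j g) ν ξ) =
      (mulH (dZb j f) (dZ j g) ν ξ - mulH (dZ j f) (dZb j g) ν ξ) +
      (mulH (dZb j f') (dZ j g) ν ξ - mulH (dZ j f') (dZb j g) ν ξ) := fun j => by ring
  simp only [this]
  rw [h.sites.tsum_add h'.sites]
  simp only [add_sub_add_comm, Finset.sum_add_distrib]
  ring

theorem BrSummable.swap {f g : Ham n} {ν : Mon n} {ξ : Par b} (h : BrSummable f g ν ξ) :
    BrSummable g f ν ξ := by
  have key : ∀ {F G : Ham n},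
      (Summable fun p : {p : Mon n × Mon n // p.1 + p.2 = ν} => F p.1.1 ξ * G p.1.2 ξ) →
      Summable fun p : {p : Mon n × Mon n // p.1 + p.2 = ν} => G p.1.1 ξ * F p.1.2 ξ := by
    intro F G hs
    rw [← (swapFiber ν).summable_iff] at hs
    refine hs.congr fun p => ?_
    simp [swapFiber, mul_comm]
  refine ⟨fun i => key (h.angle i), fun i => key (h.action i), fun j => key (h.site j),
    fun j => key (h.siteb j), h.sites.neg.congr fun j => ?_⟩
  rw [mulH_comm (dZb j g), mulH_comm (dZ j g)]; ring

theorem poisson_add_right {f g g' : Ham n} {ν : Mon n} {ξ : Par b} (h : BrSummable f g ν ξ)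
    (h' : BrSummable f g' ν ξ) :
    poisson f (g + g') ν ξ = poisson f g ν ξ + poisson f g' ν ξ := by
  rw [poisson_antisymm, poisson_add_left h.swap h'.swap, poisson_antisymm f g, poisson_antisymm f g',
    neg_add]

theorem poisson_smul_left (q : ℂ) (f g : Ham n) (ν : Mon n) (ξ : Par b) :
    poisson (fun ν ξ => q * f ν ξ) g ν ξ = q * poisson f g ν ξ := by
  have key : ∀ {F F' G : Ham n}, (∀ p, F' p ξ = q * F p ξ) →
      mulH F' G ν ξ = q * mulH F G ν ξ := by
    intro F F' G hF
    unfold mulH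
    rw [← tsum_mul_left]
    exact tsum_congr fun p => by rw [hF, mul_assoc]
  unfold poisson
  have e1 : ∀ i, mulH (dI i (fun ν ξ => q * f ν ξ)) (dTheta i g) ν ξ =
      q * mulH (dI i f) (dTheta i g) ν ξ := fun i => key fun p => by simp only [dI]; ring
  have e2 : ∀ i, mulH (dTheta i (fun ν ξ => q * f ν ξ)) (dI i g) ν ξ =
      q * mulH (dTheta i f) (dI i g) ν ξ := fun i => key fun p => by simp only [dTheta]; ring
  have e3 : ∀ j, mulH (dZb j (fun ν ξ => q * f ν ξ)) (dZ j g) ν ξ =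
      q * mulH (dZb j f) (dZ j g) ν ξ := fun j => key fun p => by simp only [dZb]; ring
  have e4 : ∀ j, mulH (dZ j (fun ν ξ => q * f ν ξ)) (dZb j g) ν ξ =
      q * mulH (dZ j f) (dZb j g) ν ξ := fun j => key fun p => by simp only [dZ]; ring
  simp only [e1, e2, e3, e4, ← mul_sub, ← Finset.mul_sum, tsum_mul_left]
  ring

theorem poisson_smul_right (q : ℂ) (f g : Ham n) (ν : Mon n) (ξ : Par b) :
    poisson f (fun ν ξ => q * g ν ξ) ν ξ = q * poisson f g ν ξ := by
  rw [poisson_antisymm, poisson_smul_left, poisson_antisymm f g, mul_neg]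

@[simp] theorem mom_add (ν ν' : Mon n) : mom (ν + ν') = mom ν + mom ν' := by
  have hpi : piK n (ν.1 + ν'.1) = piK n ν.1 + piK n ν'.1 := by
    simp [piK, add_smul, Finset.sum_add_distrib]
  have hs : ∀ α β : NSite n →₀ ℕ, ((α + β).sum fun j a => (a : ℤ) • j.1) =
      (α.sum fun j a => (a : ℤ) • j.1) + β.sum fun j a => (a : ℤ) • j.1 := fun α β =>
    Finsupp.sum_add_index' (by simp) (by intros; push_cast; rw [add_smul])
  simp only [mom, Prod.fst_add, Prod.snd_add, hpi, hs]
  abel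

theorem mom_mon_dual (v : Var n) : mom (mon v) + mom (mon (dual v)) = 0 := by
  rcases v with (i | i) | (j | j) <;>
    simp [mon, dual, mom, monI, monZ, monZb, piK, Finsupp.sum_single_index]

theorem poisson_momentum {f g : Ham n} {ξ : Par b} (hf : ∀ ν, mom ν ≠ 0 → f ν ξ = 0)
    (hg : ∀ ν, mom ν ≠ 0 → g ν ξ = 0) {ν : Mon n} (hν : mom ν ≠ 0) : poisson f g ν ξ = 0 := by
  have h0 : poisson (0 : Ham n) g ν ξ = 0 := by
    have := poisson_smul_left 0 (0 : Ham n) g ν ξ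
    rw [zero_mul] at this
    rw [← this]
    congr 1
    funext; simp
  rw [← h0]
  refine poisson_congr fun v p q hpq => ?_
  by_cases h1 : mom (p + mon v) = 0
  · have h2 : mom (q + mon (dual v)) ≠ 0 := by
      intro h2
      apply hν
      rw [← hpq]
      have : mom (p + mon v) + mom (q + mon (dual v)) = 0 := by rw [h1, h2, add_zero]
      simp only [mom_add] at this ⊢
      have h3 := mom_mon_dual v
      calc mom p + mom q = (mom p + mom (mon v)) + (mom q + mom (mon (dual v))) -
          (mom (mon v) + mom (mon (dual v))) := by abel
        _ = 0 := by rw [this, h3, sub_zero]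
    rw [hg _ h2]; simp
  · rw [hf _ h1]; simp

end Maj

/-! ### Lattice vectors -/

section Lattice

variable {d : ℕ}

/-- An integer vector as a real vector. -/
def toR (x : Fin d → ℤ) : Fin d → ℝ := fun j => (x j : ℝ)

/-- The scalar product of integer vectors. -/
def idot (u x : Fin d → ℤ) : ℤ := ∑ j, u j * x j

theorem idot_cast (u x : Fin d → ℤ) : (idot u x : ℝ) = toR u ⬝ᵥ toR x := by
  simp [idot, toR, dotProduct]

theorem toR_injective : Function.Injective (toR (d := d)) := fun x y h => by
  funext j
  have := congrFun h j
  simpa [toR] using this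

theorem toR_add (x y : Fin d → ℤ) : toR (x + y) = toR x + toR y := by
  funext j; simp [toR]

theorem toR_neg (x : Fin d → ℤ) : toR (-x) = -toR x := by
  funext j; simp [toR]

theorem toR_sub (x y : Fin d → ℤ) : toR (x - y) = toR x - toR y := by
  funext j; simp [toR]

theorem len_eq_norm (x : Fin d → ℤ) : len x = ‖(WithLp.toLp 2 (toR x) : EuclideanSpace ℝ (Fin d))‖ := by
  rw [EuclideanSpace.norm_eq]
  simp [len, toR]

theorem len_nonneg (x : Fin d → ℤ) : 0 ≤ len x := Real.sqrt_nonneg _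

theorem len_add_le (x y : Fin d → ℤ) : len (x + y) ≤ len x + len y := by
  simp only [len_eq_norm, toR_add, WithLp.toLp_add]
  exact norm_add_le _ _

@[simp] theorem len_neg (x : Fin d → ℤ) : len (-x) = len x := by
  simp [len]

@[simp] theorem len_zero : len (0 : Fin d → ℤ) = 0 := by simp [len]

theorem len_sub_le (x y : Fin d → ℤ) : len (x - y) ≤ len x + len y := by
  rw [sub_eq_add_neg]; simpa using len_add_le x (-y)

theorem len_smul (k : ℤ) (x : Fin d → ℤ) : len (k • x) = |(k : ℝ)| * len x := by
  have : toR (k • x) = (k : ℝ) • toR x := by funext j; simp [toR]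
  rw [len_eq_norm, len_eq_norm, this, WithLp.toLp_smul, norm_smul, Real.norm_eq_abs]

theorem len_sum_le {ι : Type*} (s : Finset ι) (f : ι → Fin d → ℤ) :
    len (∑ i ∈ s, f i) ≤ ∑ i ∈ s, len (f i) := by
  classical
  induction s using Finset.induction_on with
  | empty => simp
  | insert a s ha ih =>
    rw [Finset.sum_insert ha, Finset.sum_insert ha]
    exact (len_add_le _ _).trans (add_le_add le_rfl ih)

theorem len_sq (x : Fin d → ℤ) : len x ^ 2 = (idot x x : ℝ) := by
  rw [len, Real.sq_sqrt (Finset.sum_nonneg fun _ _ => sq_nonneg _), idot]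
  push_cast
  exact Finset.sum_congr rfl fun i _ => sq _

theorem abs_coord_le_len (x : Fin d → ℤ) (j : Fin d) : |(x j : ℝ)| ≤ len x := by
  rw [len, ← Real.sqrt_sq_eq_abs]
  exact Real.sqrt_le_sqrt (Finset.single_le_sum (f := fun i => (x i : ℝ) ^ 2)
    (fun _ _ => sq_nonneg _) (Finset.mem_univ j))

theorem idot_neg_left (u x : Fin d → ℤ) : idot (-u) x = -idot u x := by simp [idot]
theorem idot_neg_right (u x : Fin d → ℤ) : idot u (-x) = -idot u x := by simp [idot]
theorem idot_add_right (u x y : Fin d → ℤ) : idot u (x + y) = idot u x + idot u y := by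
  simp [idot, mul_add, Finset.sum_add_distrib]
theorem idot_sub_right (u x y : Fin d → ℤ) : idot u (x - y) = idot u x - idot u y := by
  simp [idot, mul_sub, Finset.sum_sub_distrib]
theorem idot_comm (u x : Fin d → ℤ) : idot u x = idot x u := by
  simp [idot, mul_comm]

theorem abs_idot_le (u x : Fin d → ℤ) : |(idot u x : ℝ)| ≤ len u * len x := by
  have h : ∀ u x : Fin d → ℤ, (idot u x : ℝ) ≤ len u * len x := by
    intro u x
    rw [idot]; push_cast
    exact Real.sum_mul_le_sqrt_mul_sqrt _ _ _
  rw [abs_le']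
  refine ⟨h u x, ?_⟩
  have := h (-u) x
  rw [idot_neg_left, len_neg] at this
  exact_mod_cast this

theorem finite_len_lt (R : ℝ) : {x : Fin d → ℤ | len x < R}.Finite := by
  refine (Set.finite_Icc (fun _ => -⌈R⌉ : Fin d → ℤ) (fun _ => ⌈R⌉)).subset fun x hx => ?_
  have h : ∀ j, |(x j : ℝ)| ≤ (⌈R⌉ : ℝ) := fun j =>
    (abs_coord_le_len x j).trans ((le_of_lt hx).trans (Int.le_ceil R))
  constructor
  · intro j
    have := (abs_le.1 (h j)).1
    exact_mod_cast this
  · intro j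
    have := (abs_le.1 (h j)).2
    exact_mod_cast this

end Lattice

/-! ### The order of presentations -/

theorem append_lt_append_iff {α : Type*} [LinearOrder α] {a a' : List α} (h : a.length = a'.length)
    (x x' : List α) : a ++ x < a' ++ x' ↔ a < a' ∨ a = a' ∧ x < x' := by
  induction a generalizing a' with
  | nil =>
    obtain rfl : a' = [] := List.length_eq_zero_iff.1 h.symm
    simp
  | cons c a ih =>
    rcases a' with _ | ⟨c', a'⟩
    · simp at h
    · simp only [List.length_cons, add_left_inj] at h
      rw [List.cons_append, List.cons_append, List.cons_lt_cons_iff, List.cons_lt_cons_iff, ih h]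
      simp only [List.cons.injEq]
      tauto

theorem ofFn_append_lt {α : Type*} [LinearOrder α] {ℓ : ℕ} {f g : Fin ℓ → α} (i : Fin ℓ)
    (h : ∀ j < i, f j = g j) (hi : f i < g i) (x y : List α) :
    List.ofFn f ++ x < List.ofFn g ++ y := by
  rw [append_lt_append_iff (by simp)]
  left
  rw [List.lt_iff_exists]
  right
  refine ⟨i, by simp, by simp, fun j hj => ?_, by simpa using hi⟩
  simpa using h ⟨j, hj.trans i.2⟩ hj

namespace Pres

variable {d ℓ : ℕ}

theorem vec_injective {P Q : Pres d ℓ} (h : P.vec = Q.vec) : P = Q := by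
  unfold vec at h
  obtain ⟨h1, h2⟩ := List.append_inj h (by simp)
  have hp : P.p = Q.p := List.ofFn_injective h1
  have h3 := List.eq_iff_flatten_eq.2 ⟨h2, by simp [List.map_ofFn, Function.comp_def]⟩
  have h4 := List.ofFn_injective h3
  have hv : P.v = Q.v := funext fun i => List.ofFn_injective (congrFun h4 i)
  cases P; cases Q; simp_all

end Pres

theorem SLexLT.asymm {a c : List ℤ} (h : SLexLT a c) (h' : SLexLT c a) : False := by
  rcases h with h | ⟨h, h1⟩ <;> rcases h' with h' | ⟨h', h2⟩
  · exact lt_asymm h h'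
  · exact absurd h (by rw [h']; exact lt_irrefl _)
  · exact absurd h' (by rw [h]; exact lt_irrefl _)
  · exact lt_asymm h1 h2

theorem SLexLT.irrefl (a : List ℤ) : ¬ SLexLT a a := fun h => h.asymm h

theorem SLexLT.total (a c : List ℤ) : a = c ∨ SLexLT a c ∨ SLexLT c a := by
  rcases lt_trichotomy (a.map Int.natAbs) (c.map Int.natAbs) with h | h | h
  · exact Or.inr (Or.inl (Or.inl h))
  · rcases lt_trichotomy a c with h' | h' | h'
    · exact Or.inr (Or.inr (Or.inr ⟨h.symm, h'⟩))
    · exact Or.inl h'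
    · exact Or.inr (Or.inl (Or.inr ⟨h, h'⟩))
  · exact Or.inr (Or.inr (Or.inl h))

theorem PresLE.total {d ℓ : ℕ} (P Q : Pres d ℓ) : PresLE P Q ∨ PresLE Q P := by
  rcases SLexLT.total P.vec Q.vec with h | h | h
  · exact Or.inl (Or.inl h)
  · exact Or.inl (Or.inr h)
  · exact Or.inr (Or.inr h)

theorem PresLE.antisymm {d ℓ : ℕ} {P Q : Pres d ℓ} (h : PresLE P Q) (h' : PresLE Q P) : P = Q := by
  rcases h with h | h
  · exact Pres.vec_injective h
  · rcases h' with h' | h'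
    · exact Pres.vec_injective h'.symm
    · exact (h.asymm h').elim

theorem PresLE.not_lt {d ℓ : ℕ} {P Q : Pres d ℓ} (h : PresLE P Q) : ¬ SLexLT Q.vec P.vec := by
  intro h'
  rcases h with h | h
  · rw [h] at h'; exact SLexLT.irrefl _ h'
  · exact h.asymm h'

section Present

variable {d b : ℕ} {n : Fin b → Fin d → ℤ} {N : ℕ} {ℓ : ℕ}

/-- The presentation by given normals of the affine space through a point. -/
def mkPres (v : Fin ℓ → Fin d → ℤ) (m : Fin d → ℤ) : Pres d ℓ := ⟨fun i => idot (v i) m, v⟩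

theorem Pres.eq_mkPres {P : Pres d ℓ} {m : Fin d → ℤ} (hm : toR m ∈ P.toSet) :
    P = mkPres P.v m := by
  have : P.p = fun i => idot (P.v i) m := by
    funext i
    have := hm i
    have h2 := idot_cast (P.v i) m
    have h3 : ((idot (P.v i) m : ℤ) : ℝ) = P.p i := by rw [h2]; exact this
    exact_mod_cast h3.symm
  cases P; simp_all [mkPres]

theorem Pres.p_eq {P : Pres d ℓ} {m : Fin d → ℤ} (hm : toR m ∈ P.toSet) (i : Fin ℓ) :
    P.p i = idot (P.v i) m := congrFun (congrArg Pres.p (Pres.eq_mkPres hm)) i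

theorem Pres.span_eq (P : Pres d ℓ) :
    P.span = Submodule.span ℝ (Set.range fun i => toR (P.v i)) := rfl

theorem Pres.toSet_eq {P : Pres d ℓ} {m : Fin d → ℤ} (hm : toR m ∈ P.toSet) :
    P.toSet = {x | ∀ u ∈ P.span, u ⬝ᵥ x = u ⬝ᵥ toR m} := by
  ext x
  constructor
  · intro hx u hu
    rw [Pres.span_eq] at hu
    induction hu using Submodule.span_induction with
    | mem u hu => obtain ⟨i, rfl⟩ := hu; exact (hx i).trans (hm i).symm
    | zero => simp
    | add u v _ _ h1 h2 => rw [add_dotProduct, add_dotProduct, h1, h2]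
    | smul c u _ h1 => rw [smul_dotProduct, smul_dotProduct, h1]
  · intro hx i
    exact (hx _ (Submodule.subset_span ⟨i, rfl⟩)).trans (hm i)

theorem mem_toSet_mkPres (v : Fin ℓ → Fin d → ℤ) (m : Fin d → ℤ) : toR m ∈ (mkPres v m).toSet :=
  fun i => (idot_cast (v i) m).symm

theorem Pres.toSet_congr {ℓ' : ℕ} {P : Pres d ℓ} {Q : Pres d ℓ'} {m : Fin d → ℤ}
    (hm : toR m ∈ P.toSet) (hm' : toR m ∈ Q.toSet) (h : P.span = Q.span) : P.toSet = Q.toSet := by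
  rw [Pres.toSet_eq hm, Pres.toSet_eq hm', h]

theorem Pres.span_le_of_toSet {ℓ' : ℕ} {P : Pres d ℓ} {Q : Pres d ℓ'} {x : Fin d → ℝ}
    (hx : x ∈ P.toSet) (h : P.toSet = Q.toSet) : Q.span ≤ P.span := by
  rw [Pres.span_eq, Submodule.span_le]
  rintro _ ⟨i, rfl⟩
  have key := mem_span_of_iInf_ker_le_ker (𝕜 := ℝ)
    (L := fun i => dotProductEquiv ℝ (Fin d) (toR (P.v i)))
    (K := dotProductEquiv ℝ (Fin d) (toR (Q.v i))) ?_
  · have h1 : Set.range (fun i => dotProductEquiv ℝ (Fin d) (toR (P.v i))) =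
        (dotProductEquiv ℝ (Fin d)).toLinearMap '' Set.range fun i => toR (P.v i) := by
      rw [← Set.range_comp]; rfl
    rw [h1, ← Submodule.map_span] at key
    obtain ⟨u, hu, hu'⟩ := key
    have : u = toR (Q.v i) := (dotProductEquiv ℝ (Fin d)).injective hu'
    change toR (Q.v i) ∈ P.span
    rw [← this]; exact hu
  · intro w hw
    have hw' : ∀ i, toR (P.v i) ⬝ᵥ w = 0 := by
      intro i
      have := (Submodule.mem_iInf _).1 hw i
      simpa using this
    have h2 : x + w ∈ P.toSet := fun i => by
      have := hx i
      change toR (P.v i) ⬝ᵥ (x + w) = _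
      rw [dotProduct_add, hw' i, add_zero]; exact this
    rw [h] at hx h2
    have h3 : toR (Q.v i) ⬝ᵥ (x + w) = toR (Q.v i) ⬝ᵥ x := (h2 i).trans (hx i).symm
    rw [dotProduct_add] at h3
    simpa using h3

theorem Pres.span_eq_of_toSet {ℓ' : ℕ} {P : Pres d ℓ} {Q : Pres d ℓ'} {x : Fin d → ℝ}
    (hx : x ∈ P.toSet) (h : P.toSet = Q.toSet) : P.span = Q.span :=
  le_antisymm (Pres.span_le_of_toSet (h ▸ hx) h.symm) (Pres.span_le_of_toSet hx h)

theorem finrank_span_of_indep {P : Pres d ℓ}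
    (h : LinearIndependent ℝ (fun i => toR (P.v i))) : Module.finrank ℝ P.span = ℓ := by
  rw [Pres.span_eq, finrank_span_eq_card h, Fintype.card_fin]

theorem indep_of_span_eq {v v' : Fin ℓ → Fin d → ℤ}
    (h : LinearIndependent ℝ (fun i => toR (v i)))
    (hs : Submodule.span ℝ (Set.range fun i => toR (v' i)) =
      Submodule.span ℝ (Set.range fun i => toR (v i))) :
    LinearIndependent ℝ (fun i => toR (v' i)) := by
  rw [linearIndependent_iff_card_eq_finrank_span] at h ⊢
  rw [h, Set.finrank, Set.finrank, hs]

theorem isPres_mkPres {P : Pres d ℓ} {A : Set (Fin d → ℝ)} (hP : IsPres n N P A) {m : Fin d → ℤ}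
    (hm : toR m ∈ A) {v' : Fin ℓ → Fin d → ℤ} (hv : ∀ i, v' i ∈ ballB n N)
    (hs : Submodule.span ℝ (Set.range fun i => toR (v' i)) = P.span) :
    IsPres n N (mkPres v' m) A := by
  obtain ⟨_, h2, rfl⟩ := hP
  exact ⟨hv, indep_of_span_eq h2 hs, Pres.toSet_congr (mem_toSet_mkPres _ _) hm hs⟩

theorem neg_mem_ballB {u : Fin d → ℤ} (h : u ∈ ballB n N) : -u ∈ ballB n N :=
  ⟨neg_ne_zero.2 h.1, by rw [len_neg]; exact h.2⟩

theorem map_natAbs_vec (P : Pres d ℓ) : P.vec.map Int.natAbs =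
    List.ofFn (fun i => (P.p i).natAbs) ++
      ((List.ofFn fun i => List.ofFn (P.v i)).flatten).map Int.natAbs := by
  simp [Pres.vec, List.map_ofFn, Function.comp_def]

theorem IsOptimal.p_nonneg {P : Pres d ℓ} {A : Set (Fin d → ℝ)} (h : IsOptimal n N P A)
    {m : Fin d → ℤ} (hm : toR m ∈ A) (i : Fin ℓ) : 0 ≤ P.p i := by
  by_contra hneg
  rw [not_le] at hneg
  have hmP : toR m ∈ P.toSet := by rw [h.1.2.2]; exact hm
  set v' : Fin ℓ → Fin d → ℤ := Function.update P.v i (-P.v i) with hv'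
  have hvi : v' i = -P.v i := Function.update_self ..
  have hvj : ∀ j, j ≠ i → v' j = P.v j := fun j hj => Function.update_of_ne hj ..
  have hpres : IsPres n N (mkPres v' m) A := by
    refine isPres_mkPres h.1 hm (fun j => ?_) ?_
    · by_cases hj : j = i
      · rw [hj, hvi]; exact neg_mem_ballB (h.1.1 i)
      · rw [hvj j hj]; exact h.1.1 j
    · rw [Pres.span_eq]
      apply le_antisymm <;> rw [Submodule.span_le] <;> rintro _ ⟨j, rfl⟩
      · by_cases hj : j = i
        · simp only [hj, hvi, toR_neg]
          exact Submodule.neg_mem _ (Submodule.subset_span ⟨i, rfl⟩)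
        · simp only [hvj j hj]
          exact Submodule.subset_span ⟨j, rfl⟩
      · by_cases hj : j = i
        · have : toR (P.v j) = -toR (v' i) := by rw [hvi, toR_neg, neg_neg, hj]
          simp only [this]
          exact Submodule.neg_mem _ (Submodule.subset_span ⟨i, rfl⟩)
        · have : toR (P.v j) = toR (v' j) := by rw [hvj j hj]
          simp only [this]
          exact Submodule.subset_span ⟨j, rfl⟩
  refine (h.2 _ hpres).not_lt (Or.inr ⟨?_, ?_⟩)
  · rw [map_natAbs_vec, map_natAbs_vec]
    congr 1
    · congr 1
      funext j
      rw [Pres.p_eq hmP]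
      by_cases hj : j = i
      · simp [mkPres, hj, hvi, idot_neg_left]
      · simp [mkPres, hvj j hj]
    · simp only [List.map_flatten, List.map_ofFn, Function.comp_def]
      congr 1
      congr 1
      funext j
      by_cases hj : j = i
      · simp [mkPres, hj, hvi]
      · simp [mkPres, hvj j hj]
  · refine ofFn_append_lt i (fun j hj => ?_) ?_ _ _
    · rw [Pres.p_eq hmP]; simp [mkPres, hvj j hj.ne]
    · have := Pres.p_eq hmP i
      simp only [mkPres, hvi, idot_neg_left, ← this]
      linarith

/-- The exchange property of optimal presentations. -/
theorem IsOptimal.exchange {P : Pres d ℓ} {A : Set (Fin d → ℝ)} (h : IsOptimal n N P A)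
    {m : Fin d → ℤ} (hm : toR m ∈ A) {u : Fin d → ℤ} (hu : u ∈ ballB n N) (hus : toR u ∈ P.span)
    (i : Fin ℓ) (hi : toR u ∉ Submodule.span ℝ ((fun j => toR (P.v j)) '' {j | j < i})) :
    (P.p i).natAbs ≤ (idot u m).natAbs := by
  by_contra hlt
  rw [not_le] at hlt
  have hmP : toR m ∈ P.toSet := by rw [h.1.2.2]; exact hm
  have hus' := hus
  rw [Pres.span_eq, Submodule.mem_span_range_iff_exists_fun] at hus
  obtain ⟨c, hc⟩ := hus
  obtain ⟨j, hij, hcj⟩ : ∃ j, i ≤ j ∧ c j ≠ 0 := by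
    by_contra hno
    push Not at hno
    apply hi
    rw [← hc]
    refine Submodule.sum_mem _ fun k _ => ?_
    by_cases hk : k < i
    · exact Submodule.smul_mem _ _ (Submodule.subset_span ⟨k, hk, rfl⟩)
    · rw [hno k (not_lt.1 hk), zero_smul]; exact Submodule.zero_mem _
  set v' : Fin ℓ → Fin d → ℤ := Function.update (fun k => P.v (Equiv.swap i j k)) i u with hv'
  have hvi : v' i = u := Function.update_self ..
  have hvk : ∀ k, k ≠ i → v' k = P.v (Equiv.swap i j k) := fun k hk => Function.update_of_ne hk ..
  have hpres : IsPres n N (mkPres v' m) A := by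
    refine isPres_mkPres h.1 hm (fun k => ?_) ?_
    · by_cases hk : k = i
      · rw [hk, hvi]; exact hu
      · rw [hvk k hk]; exact h.1.1 _
    · have hle1 : Submodule.span ℝ (Set.range fun k => toR (v' k)) ≤ P.span := by
        rw [Submodule.span_le]
        rintro _ ⟨k, rfl⟩
        by_cases hk : k = i
        · simp only [hk, hvi]; exact hus'
        · simp only [hvk k hk]; exact Submodule.subset_span ⟨_, rfl⟩
      refine le_antisymm hle1 ?_
      have hother : ∀ k, k ≠ j → toR (P.v k) ∈ Submodule.span ℝ (Set.range fun k => toR (v' k)) := by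
        intro k hk
        have hne : Equiv.swap i j k ≠ i := by
          intro he
          have := congrArg (Equiv.swap i j) he
          rw [Equiv.swap_apply_self, Equiv.swap_apply_left] at this
          exact hk this
        refine Submodule.subset_span ⟨Equiv.swap i j k, ?_⟩
        simp only [hvk _ hne, Equiv.swap_apply_self]
      rw [Pres.span_eq, Submodule.span_le]
      rintro _ ⟨k, rfl⟩
      by_cases hk : k = j
      · subst hk
        have h1 : toR (P.v k) = (c k)⁻¹ • (toR u - ∑ l ∈ Finset.univ.erase k, c l • toR (P.v l)) := by
          rw [← hc, ← Finset.add_sum_erase _ _ (Finset.mem_univ k), add_sub_cancel_right, smul_smul,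
            inv_mul_cancel₀ hcj, one_smul]
        simp only [h1]
        refine Submodule.smul_mem _ _ (Submodule.sub_mem _ ?_ (Submodule.sum_mem _ fun l hl => ?_))
        · exact Submodule.subset_span ⟨i, by simp only [hvi]⟩
        · exact Submodule.smul_mem _ _ (hother l (Finset.ne_of_mem_erase hl))
      · exact hother k hk
  refine (h.2 _ hpres).not_lt (Or.inl ?_)
  rw [map_natAbs_vec, map_natAbs_vec]
  refine ofFn_append_lt i (fun k hk => ?_) ?_ _ _
  · rw [Pres.p_eq hmP]
    have : Equiv.swap i j k = k := Equiv.swap_apply_of_ne_of_ne hk.ne (hk.trans_le hij).ne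
    simp [mkPres, hvk k hk.ne, this]
  · simpa [mkPres, hvi] using hlt

theorem IsOptimal.p_mono {P : Pres d ℓ} {A : Set (Fin d → ℝ)} (h : IsOptimal n N P A)
    {m : Fin d → ℤ} (hm : toR m ∈ A) {i j : Fin ℓ} (hij : i ≤ j) : P.p i ≤ P.p j := by
  have hmP : toR m ∈ P.toSet := by rw [h.1.2.2]; exact hm
  have hx := h.exchange hm (h.1.1 j) (Submodule.subset_span ⟨j, rfl⟩) i ?_
  · rw [← Pres.p_eq hmP] at hx
    have h1 := h.p_nonneg hm i
    have h2 := h.p_nonneg hm j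
    omega
  · exact h.1.2.1.notMem_span_image (s := {k | k < i}) (x := j) (by simpa using hij)

/-- The first equations from `Q`, the others from `P`. -/
def glue {ℓ' : ℕ} (Q : Pres d ℓ) (P : Pres d ℓ') : Pres d ℓ' :=
  ⟨fun i => if h : i.1 < ℓ then Q.p ⟨i, h⟩ else P.p i,
    fun i => if h : i.1 < ℓ then Q.v ⟨i, h⟩ else P.v i⟩

theorem ofFn_take_append {α : Type*} {ℓ ℓ' : ℕ} (h : ℓ ≤ ℓ') (f : Fin ℓ' → α) :
    List.ofFn f = List.ofFn (fun i : Fin ℓ => f (Fin.castLE h i)) ++ (List.ofFn f).drop ℓ := by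
  have : (List.ofFn f).take ℓ = List.ofFn (fun i : Fin ℓ => f (Fin.castLE h i)) :=
    List.ext_getElem (by simp [h]) fun i _ _ => by simp
  rw [← this, List.take_append_drop]

theorem glue_ofFn {α : Type*} {ℓ ℓ' : ℕ} (h : ℓ ≤ ℓ') (q : Fin ℓ → α) (f : Fin ℓ' → α) :
    List.ofFn (fun i : Fin ℓ' => if h : i.1 < ℓ then q ⟨i, h⟩ else f i) =
      List.ofFn q ++ (List.ofFn f).drop ℓ := by
  rw [ofFn_take_append h]
  congr 1
  · congr 1; funext i; simp
  · refine List.ext_getElem (by simp) fun i _ _ => by simp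

theorem glue_slex {ℓ' : ℕ} (h : ℓ ≤ ℓ') {Q : Pres d ℓ} {P : Pres d ℓ'}
    (hlt : SLexLT Q.vec (P.take h).vec) : SLexLT (glue Q P).vec P.vec := by
  set X := (List.ofFn P.p).drop ℓ
  set Y := ((List.ofFn fun i => List.ofFn (P.v i)).drop ℓ).flatten
  set A := List.ofFn (P.take h).p
  set B := (List.ofFn fun i => List.ofFn ((P.take h).v i)).flatten
  set A' := List.ofFn Q.p
  set B' := (List.ofFn fun i => List.ofFn (Q.v i)).flatten
  have hP : P.vec = A ++ (X ++ (B ++ Y)) := by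
    unfold Pres.vec
    rw [ofFn_take_append h P.p, ofFn_take_append h fun i => List.ofFn (P.v i), List.flatten_append,
      List.append_assoc]
    rfl
  have hG : (glue Q P).vec = A' ++ (X ++ (B' ++ Y)) := by
    unfold Pres.vec glue
    have h1 : (fun i : Fin ℓ' => List.ofFn (if h : i.1 < ℓ then Q.v ⟨i, h⟩ else P.v i)) =
        fun i : Fin ℓ' => if h : i.1 < ℓ then List.ofFn (Q.v ⟨i, h⟩) else List.ofFn (P.v i) := by
      funext i; split_ifs <;> rfl
    simp only [h1]
    rw [glue_ofFn h Q.p P.p, glue_ofFn h (fun i => List.ofFn (Q.v i)) (fun i => List.ofFn (P.v i)),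
      List.flatten_append, List.append_assoc]
  have hlA : A'.length = A.length := by simp [A, A']
  have hlB : B'.length = B.length := by
    simp [B, B', List.length_flatten, List.map_ofFn, Function.comp_def]
  have hQv : Q.vec = A' ++ B' := rfl
  have hTv : (P.take h).vec = A ++ B := rfl
  rw [hQv, hTv] at hlt
  rw [hP, hG]
  unfold SLexLT at hlt ⊢
  simp only [List.map_append] at hlt ⊢
  have hmA : (A'.map Int.natAbs).length = (A.map Int.natAbs).length := by
    rw [List.length_map, List.length_map, hlA]
  have hmB : (B'.map Int.natAbs).length = (B.map Int.natAbs).length := by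
    rw [List.length_map, List.length_map, hlB]
  rw [append_lt_append_iff hmA, append_lt_append_iff hlA.symm] at hlt ⊢
  rw [append_lt_append_iff (a := X.map Int.natAbs) rfl, append_lt_append_iff (a := X) rfl,
    append_lt_append_iff hmB, append_lt_append_iff hlB.symm]
  have hinj : A'.map Int.natAbs ++ B'.map Int.natAbs = A.map Int.natAbs ++ B.map Int.natAbs ↔
      A'.map Int.natAbs = A.map Int.natAbs ∧ B'.map Int.natAbs = B.map Int.natAbs :=
    ⟨fun h => List.append_inj h hmA, fun h => by rw [h.1, h.2]⟩
  rw [hinj] at hlt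
  rcases hlt with (h1 | ⟨h1, h2⟩) | ⟨⟨h1, h2⟩, h3⟩
  · exact Or.inl (Or.inl h1)
  · exact Or.inl (Or.inr ⟨h1, Or.inr ⟨rfl, Or.inl h2⟩⟩)
  · refine Or.inr ⟨by rw [h1, h2], ?_⟩
    rcases h3 with h3 | ⟨h3, h4⟩
    · exact Or.inl h3
    · exact Or.inr ⟨h3, Or.inr ⟨rfl, Or.inl h4⟩⟩

theorem mem_toSet_take {ℓ' : ℕ} (h : ℓ ≤ ℓ') {P : Pres d ℓ'} {x : Fin d → ℝ} (hx : x ∈ P.toSet) :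
    x ∈ (P.take h).toSet := fun i => hx (Fin.castLE h i)

theorem indep_take {ℓ' : ℕ} (h : ℓ ≤ ℓ') {P : Pres d ℓ'}
    (hP : LinearIndependent ℝ (fun i => toR (P.v i))) :
    LinearIndependent ℝ (fun i => toR ((P.take h).v i)) :=
  hP.comp (Fin.castLE h) (Fin.castLE_injective h)

/-- The first equations of an optimal presentation form an optimal presentation. -/
theorem IsOptimal.take {ℓ' : ℕ} {P : Pres d ℓ'} {A : Set (Fin d → ℝ)} (hP : IsOptimal n N P A)
    {m : Fin d → ℤ} (hm : toR m ∈ A) (h : ℓ ≤ ℓ') :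
    IsOptimal n N (P.take h) (P.take h).toSet := by
  have hmP : toR m ∈ P.toSet := by rw [hP.1.2.2]; exact hm
  have hmT := mem_toSet_take h hmP
  refine ⟨⟨fun i => hP.1.1 _, indep_take h hP.1.2.1, rfl⟩, fun Q hQ => ?_⟩
  rcases SLexLT.total (P.take h).vec Q.vec with he | hl | hg
  · exact Or.inl he
  · exact Or.inr hl
  exfalso
  have hspan : (P.take h).span = Q.span := Pres.span_eq_of_toSet hmT hQ.2.2.symm
  have hmQ : toR m ∈ Q.toSet := by rw [hQ.2.2]; exact hmT
  have hmk : glue Q P = mkPres (glue Q P).v m := by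
    apply Pres.eq_mkPres
    intro i
    by_cases hi : i.1 < ℓ
    · simpa [glue, hi] using hmQ ⟨i, hi⟩
    · simpa [glue, hi] using hmP i
  have hpres : IsPres n N (glue Q P) A := by
    rw [hmk]
    refine isPres_mkPres hP.1 hm (fun i => ?_) ?_
    · by_cases hi : i.1 < ℓ
      · simpa [glue, hi] using hQ.1 ⟨i, hi⟩
      · simpa [glue, hi] using hP.1.1 i
    · have hsubT : (P.take h).span ≤ P.span := by
        rw [Pres.span_eq, Submodule.span_le]
        rintro _ ⟨i, rfl⟩
        exact Submodule.subset_span ⟨Fin.castLE h i, rfl⟩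
      apply le_antisymm
      · rw [Submodule.span_le]
        rintro _ ⟨i, rfl⟩
        by_cases hi : i.1 < ℓ
        · have : toR (Q.v ⟨i, hi⟩) ∈ P.span := hsubT (hspan ▸ Submodule.subset_span ⟨_, rfl⟩)
          simpa [glue, hi] using this
        · have : toR (P.v i) ∈ P.span := Submodule.subset_span ⟨_, rfl⟩
          simpa [glue, hi] using this
      · rw [Pres.span_eq P, Submodule.span_le]
        rintro _ ⟨i, rfl⟩
        by_cases hi : i.1 < ℓ
        · have h1 : toR (P.v i) ∈ Q.span := by
            rw [← hspan]; exact Submodule.subset_span ⟨⟨i, hi⟩, rfl⟩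
          have h2 : Q.span ≤ Submodule.span ℝ (Set.range fun i => toR ((glue Q P).v i)) := by
            rw [Pres.span_eq, Submodule.span_le]
            rintro _ ⟨k, rfl⟩
            refine Submodule.subset_span ⟨Fin.castLE h k, ?_⟩
            simp [glue]
          exact h2 h1
        · refine Submodule.subset_span ⟨i, ?_⟩
          simp [glue, hi]
  exact (hP.2 _ hpres).not_lt (glue_slex h hg)

theorem IsOptimal.unique {P Q : Pres d ℓ} {A : Set (Fin d → ℝ)} (hP : IsOptimal n N P A)
    (hQ : IsOptimal n N Q A) : P = Q := (hP.2 Q hQ.1).antisymm (hQ.2 P hP.1)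

theorem len_le_C1 (i : Fin b) : len (n i) ≤ C1 n :=
  le_ciSup (f := fun i => len (n i)) (Set.finite_range _).bddAbove i

theorem one_le_C1 (hne : ∃ i, n i ≠ 0) : 1 ≤ C1 n := by
  obtain ⟨i, hi⟩ := hne
  exact (one_le_len hi).trans (len_le_C1 i)

theorem exists_optimal (hne : ∃ i, n i ≠ 0) (hN : 2 ≤ N) (m : Fin d → ℤ) :
    ∃ P : Pres d d, IsOptimal n N P {toR m} := by
  have hC := one_le_C1 hne
  let S : Set (Pres d d) := {P | IsPres n N P {toR m}}
  have hfinB : (ballB n N).Finite := (finite_len_lt (C1 n * N)).subset fun x hx => hx.2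
  have hSfin : S.Finite := by
    have hF : {v : Fin d → Fin d → ℤ | ∀ i, v i ∈ ballB n N}.Finite := by
      have := Set.Finite.pi (fun _ : Fin d => hfinB)
      simpa [Set.pi] using this
    refine (hF.image fun v => mkPres v m).subset fun P hP => ?_
    refine ⟨P.v, hP.1, (Pres.eq_mkPres ?_).symm⟩
    rw [hP.2.2]; rfl
  have hSne : S.Nonempty := by
    have hR : ∀ i : Fin d, toR (Pi.single i 1 : Fin d → ℤ) = Pi.single i 1 := by
      intro i; funext j
      by_cases h : j = i
      · subst h; simp [toR]
      · simp [toR, h]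
    refine ⟨mkPres (fun i => Pi.single i 1) m, fun i => ⟨?_, ?_⟩, ?_, ?_⟩
    · simp [mkPres]
    · have h1 : len (Pi.single i 1 : Fin d → ℤ) = 1 := by
        rw [len, Finset.sum_eq_single i] <;> simp +contextual
      simp only [mkPres, h1]
      have : (2 : ℝ) ≤ N := by exact_mod_cast hN
      nlinarith
    · have := (Pi.basisFun ℝ (Fin d)).linearIndependent
      convert this using 1
      funext i
      rw [Pi.basisFun_apply]
      exact hR i
    · ext x
      constructor
      · intro hx
        funext i
        have h1 := hx i
        have h2 := mem_toSet_mkPres (fun i : Fin d => (Pi.single i 1 : Fin d → ℤ)) m i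
        have h3 := h1.trans h2.symm
        change toR (Pi.single i 1) ⬝ᵥ x = toR (Pi.single i 1) ⬝ᵥ toR m at h3
        simpa [hR] using h3
      · rintro rfl
        exact mem_toSet_mkPres _ _
  obtain ⟨P, hP, hmin⟩ := Set.exists_min_image S
    (fun P => toLex (P.vec.map Int.natAbs, OrderDual.toDual P.vec)) hSfin hSne
  refine ⟨P, hP, fun Q hQ => ?_⟩
  have := hmin Q hQ
  rw [Prod.Lex.toLex_le_toLex] at this
  rcases this with h | ⟨h, h'⟩
  · exact Or.inr (Or.inl h)
  · have h'' : Q.vec ≤ P.vec := h'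
    rcases h''.lt_or_eq with h1 | h1
    · exact Or.inr (Or.inr ⟨h, h1⟩)
    · exact Or.inl h1.symm

end Present

/-! ### Intrinsic description of cuts -/

section CutV

variable {d b : ℕ} {n : Fin b → Fin d → ℤ} {N : ℕ} {ℓ : ℕ}

variable (n) in
/-- `V` is spanned by the vectors of `B_N` with small product with `x`, the others having a large
product with `x`. -/
def CutV (N : ℕ) (θ μ τ : ℝ) (x : Fin d → ℤ) (V : Submodule ℝ (Fin d → ℝ)) : Prop :=
  V = Submodule.span ℝ (toR '' {u | u ∈ ballB n N ∧ |(idot u x : ℝ)| < μ * (N : ℝ) ^ τ}) ∧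
    ∀ u ∈ ballB n N, toR u ∉ V → θ * (N : ℝ) ^ (4 * d * τ) < |(idot u x : ℝ)|

theorem IsCut.optimal {θ μ τ : ℝ} {m : Fin d → ℤ} {Q : Pres d ℓ} (h : IsCut n N θ μ τ m ℓ Q) :
    IsOptimal n N Q Q.toSet ∧ toR m ∈ Q.toSet ∧ Module.finrank ℝ Q.span = ℓ := by
  obtain ⟨P, hℓ, hP, _, _, rfl⟩ := h
  have hm : toR m ∈ ({toR m} : Set _) := rfl
  have hmP : toR m ∈ P.toSet := by rw [hP.1.2.2]; exact hm
  exact ⟨hP.take hm hℓ, mem_toSet_take hℓ hmP,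
    finrank_span_of_indep (indep_take hℓ hP.1.2.1)⟩

theorem span_take {ℓ' : ℕ} (P : Pres d ℓ') (h : ℓ < ℓ') :
    (P.take h.le).span =
      Submodule.span ℝ ((fun j => toR (P.v j)) '' {j | j < (⟨ℓ, h⟩ : Fin ℓ')}) := by
  rw [Pres.span_eq]
  congr 1
  ext x
  constructor
  · rintro ⟨i, rfl⟩
    exact ⟨Fin.castLE h.le i, i.2, rfl⟩
  · rintro ⟨i, hi, rfl⟩
    exact ⟨⟨i.1, hi⟩, rfl⟩

theorem span_top_of_optimal {P : Pres d d} {A : Set (Fin d → ℝ)} (h : IsOptimal n N P A) :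
    P.span = ⊤ := by
  apply Submodule.eq_top_of_finrank_eq
  rw [finrank_span_of_indep h.1.2.1, Module.finrank_fin_fun]

theorem IsOptimal.mem_span_of_lt {P : Pres d d} {m : Fin d → ℤ} (hP : IsOptimal n N P {toR m})
    (h : ℓ < d) {u : Fin d → ℤ} (hu : u ∈ ballB n N)
    (hlt : |(idot u m : ℝ)| < P.p ⟨ℓ, h⟩) : toR u ∈ (P.take h.le).span := by
  have hm : toR m ∈ ({toR m} : Set _) := rfl
  rw [span_take P h]
  by_contra hu'
  have := hP.exchange hm hu (by rw [span_top_of_optimal hP]; trivial) _ hu'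
  have h0 := hP.p_nonneg hm ⟨ℓ, h⟩
  rw [← Int.cast_abs] at hlt
  have hlt' : |idot u m| < P.p ⟨ℓ, h⟩ := by exact_mod_cast hlt
  rw [Int.abs_eq_natAbs] at hlt'
  omega

theorem IsCut.cutV {θ μ τ : ℝ} {m : Fin d → ℤ} {Q : Pres d ℓ} (h : IsCut n N θ μ τ m ℓ Q)
    (h0 : 0 < ℓ) (hd : ℓ < d) (hg : μ * (N : ℝ) ^ τ ≤ θ * (N : ℝ) ^ (4 * d * τ)) :
    CutV n N θ μ τ m Q.span := by
  obtain ⟨P, hℓ, hP, h1, h2, rfl⟩ := h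
  have hm : toR m ∈ ({toR m} : Set _) := rfl
  have hmP : toR m ∈ P.toSet := by rw [hP.1.2.2]; exact hm
  have hlast := h2 ⟨ℓ, hd⟩ rfl
  have key : ∀ u ∈ ballB n N, toR u ∉ (P.take hℓ).span →
      θ * (N : ℝ) ^ (4 * d * τ) < |(idot u m : ℝ)| := by
    intro u hu hu'
    by_contra hc
    exact hu' (hP.mem_span_of_lt hd hu ((not_lt.1 hc).trans_lt hlast))
  refine ⟨le_antisymm ?_ ?_, key⟩
  · rw [Pres.span_eq, Submodule.span_le]
    rintro _ ⟨i, rfl⟩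
    refine Submodule.subset_span ⟨_, ⟨hP.1.1 _, ?_⟩, rfl⟩
    rw [← Pres.p_eq hmP]
    have h3 := hP.p_nonneg hm (Fin.castLE hℓ i)
    have h4 := hP.p_mono hm (i := Fin.castLE hℓ i) (j := ⟨ℓ - 1, by omega⟩)
      (by rw [Fin.le_def]; simp; omega)
    have h5 := h1 ⟨ℓ - 1, by omega⟩ (by simp; omega)
    rw [abs_of_nonneg (by exact_mod_cast h3)]
    have h7 : (P.p (Fin.castLE hℓ i) : ℝ) ≤ P.p ⟨ℓ - 1, by omega⟩ := by exact_mod_cast h4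
    linarith
  · rw [Submodule.span_le]
    rintro _ ⟨u, ⟨hu, hu2⟩, rfl⟩
    by_contra hu'
    have := key u hu hu'
    linarith

theorem CutV.isCut (hne : ∃ i, n i ≠ 0) (hN : 2 ≤ N) {θ μ τ : ℝ} {m : Fin d → ℤ}
    {V : Submodule ℝ (Fin d → ℝ)} (h : CutV n N θ μ τ m V) (h0 : 0 < ℓ) (hd : ℓ < d)
    (hV : Module.finrank ℝ V = ℓ) : ∃ Q : Pres d ℓ, IsCut n N θ μ τ m ℓ Q ∧ Q.span = V := by
  obtain ⟨P, hP⟩ := exists_optimal hne hN m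
  have hm : toR m ∈ ({toR m} : Set _) := rfl
  have hmP : toR m ∈ P.toSet := by rw [hP.1.2.2]; exact hm
  have hfin : ∀ {j : ℕ} (hj : j ≤ d), Module.finrank ℝ (P.take hj).span = j := fun hj =>
    finrank_span_of_indep (indep_take hj hP.1.2.1)
  have hp : (P.p ⟨ℓ - 1, by omega⟩ : ℝ) < μ * (N : ℝ) ^ τ := by
    by_contra hc
    rw [not_lt] at hc
    have hℓ1 : ℓ - 1 < d := by omega
    have : V ≤ (P.take hℓ1.le).span := by
      rw [h.1, Submodule.span_le]
      rintro _ ⟨u, ⟨hu, hu2⟩, rfl⟩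
      exact hP.mem_span_of_lt hℓ1 hu (hu2.trans_le hc)
    have := Submodule.finrank_mono this
    rw [hfin, hV] at this
    omega
  have hmem : ∀ i : Fin d, i.1 < ℓ → toR (P.v i) ∈ V := by
    intro i hi
    rw [h.1]
    refine Submodule.subset_span ⟨_, ⟨hP.1.1 _, ?_⟩, rfl⟩
    rw [← Pres.p_eq hmP]
    have h3 := hP.p_nonneg hm i
    have h4 := hP.p_mono hm (i := i) (j := ⟨ℓ - 1, by omega⟩)
      (by rw [Fin.le_def]; simp; omega)
    rw [abs_of_nonneg (by exact_mod_cast h3)]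
    have h7 : (P.p i : ℝ) ≤ P.p ⟨ℓ - 1, by omega⟩ := by exact_mod_cast h4
    linarith
  have hspan : (P.take hd.le).span = V := by
    apply Submodule.eq_of_le_of_finrank_eq
    · rw [Pres.span_eq, Submodule.span_le]
      rintro _ ⟨i, rfl⟩
      exact hmem (Fin.castLE hd.le i) i.2
    · rw [hfin, hV]
  refine ⟨P.take hd.le, ⟨P, hd.le, hP, ?_, ?_, rfl⟩, hspan⟩
  · intro i hi
    have : i = ⟨ℓ - 1, by omega⟩ := Fin.ext (by simp; omega)
    rw [this]; exact hp
  · intro i hi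
    have hi' : i = ⟨ℓ, hd⟩ := Fin.ext hi
    have hnot : toR (P.v i) ∉ V := by
      rw [← hspan, span_take P hd, hi']
      exact hP.1.2.1.notMem_span_image (s := {k | k < (⟨ℓ, hd⟩ : Fin d)}) (x := ⟨ℓ, hd⟩) (by simp)
    have h5 := h.2 _ (hP.1.1 i) hnot
    rw [← Pres.p_eq hmP] at h5
    rwa [abs_of_nonneg (by exact_mod_cast hP.p_nonneg hm i)] at h5

theorem CutV.neg {θ μ τ : ℝ} {x : Fin d → ℤ} {V : Submodule ℝ (Fin d → ℝ)}
    (h : CutV n N θ μ τ x V) : CutV n N θ μ τ (-x) V := by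
  simpa [CutV, idot_neg_right] using h

/-- Points at a small distance have the same cut. -/
theorem CutV.near {θ μ θ' μ' τ Δ : ℝ} {x y : Fin d → ℤ} {V : Submodule ℝ (Fin d → ℝ)}
    (h : CutV n N θ' μ' τ x V) (hxy : len (y - x) ≤ Δ)
    (hμ : C1 n * N * Δ ≤ (μ - μ') * (N : ℝ) ^ τ)
    (hθ : C1 n * N * Δ ≤ (θ' - θ) * (N : ℝ) ^ (4 * d * τ))
    (hg : μ * (N : ℝ) ^ τ ≤ θ * (N : ℝ) ^ (4 * d * τ)) : CutV n N θ μ τ y V := by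
  have hdiff : ∀ u ∈ ballB n N, |(idot u y : ℝ) - idot u x| ≤ C1 n * N * Δ := by
    intro u hu
    have h1 := abs_idot_le u (y - x)
    rw [idot_sub_right] at h1
    push_cast at h1
    exact h1.trans (mul_le_mul hu.2.le hxy (len_nonneg _) ((len_nonneg u).trans hu.2.le))
  have key : ∀ u ∈ ballB n N, toR u ∉ V → θ * (N : ℝ) ^ (4 * d * τ) < |(idot u y : ℝ)| := by
    intro u hu hu'
    have h1 := h.2 u hu hu'
    have h2 := hdiff u hu
    have h3 := abs_sub_abs_le_abs_sub (idot u x : ℝ) (idot u y)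
    rw [abs_sub_comm] at h3
    linarith
  refine ⟨le_antisymm ?_ ?_, key⟩
  · rw [h.1]
    refine Submodule.span_mono (Set.image_mono ?_)
    rintro u ⟨hu, hu2⟩
    refine ⟨hu, ?_⟩
    have h2 := hdiff u hu
    have h3 := abs_sub_abs_le_abs_sub (idot u y : ℝ) (idot u x)
    linarith
  · rw [Submodule.span_le]
    rintro _ ⟨u, ⟨hu, hu2⟩, rfl⟩
    by_contra hu'
    have := key u hu hu'
    linarith

theorem CutV.near' {θ μ θ' μ' τ Δ : ℝ} {x y : Fin d → ℤ} {V : Submodule ℝ (Fin d → ℝ)}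
    (h : CutV n N θ' μ' τ x V) (hxy : len (y - x) ≤ Δ ∨ len (y + x) ≤ Δ)
    (hμ : C1 n * N * Δ ≤ (μ - μ') * (N : ℝ) ^ τ)
    (hθ : C1 n * N * Δ ≤ (θ' - θ) * (N : ℝ) ^ (4 * d * τ))
    (hg : μ * (N : ℝ) ^ τ ≤ θ * (N : ℝ) ^ (4 * d * τ)) : CutV n N θ μ τ y V := by
  rcases hxy with hxy | hxy
  · exact h.near hxy hμ hθ hg
  · exact h.neg.near (by rwa [sub_neg_eq_add]) hμ hθ hg

theorem CutV.unique {θ μ θ' μ' τ : ℝ} {x : Fin d → ℤ} {V V' : Submodule ℝ (Fin d → ℝ)}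
    (h : CutV n N θ μ τ x V) (h' : CutV n N θ' μ' τ x V') (hμ : μ' ≤ μ)
    (hf : Module.finrank ℝ V = Module.finrank ℝ V') : V = V' := by
  refine (Submodule.eq_of_le_of_finrank_eq ?_ hf.symm).symm
  rw [h.1, h'.1]
  refine Submodule.span_mono (Set.image_mono ?_)
  rintro u ⟨hu, hu2⟩
  exact ⟨hu, hu2.trans_le (mul_le_mul_of_nonneg_right hμ (by positivity))⟩

/-- Translations orthogonal to the span preserve the affine space. -/
theorem mem_toSet_of_orth {Q : Pres d ℓ} {x y : Fin d → ℤ} (hx : toR x ∈ Q.toSet)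
    (ht : ∀ u ∈ Q.span, u ⬝ᵥ toR (y - x) = 0) : toR y ∈ Q.toSet := by
  intro i
  have h1 := ht (toR (Q.v i)) (Submodule.subset_span ⟨i, rfl⟩)
  rw [toR_sub, dotProduct_sub, sub_eq_zero] at h1
  exact h1.trans (hx i)

theorem IsCut.eq_of_orth {θ μ τ : ℝ} {x y : Fin d → ℤ} {Q Q' : Pres d ℓ}
    (h : IsCut n N θ μ τ x ℓ Q) (h' : IsCut n N θ μ τ y ℓ Q') (hs : Q.span = Q'.span)
    (ht : ∀ u ∈ Q.span, u ⬝ᵥ toR (y - x) = 0) : Q = Q' := by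
  have h1 := mem_toSet_of_orth h.optimal.2.1 ht
  have h2 : Q.toSet = Q'.toSet := Pres.toSet_congr h1 h'.optimal.2.1 hs
  have h3 := h'.optimal.1
  rw [← h2] at h3
  exact h.optimal.1.unique h3

theorem Pres.orth_of_toSet_eq {ℓ' : ℕ} {Q : Pres d ℓ} {Q' : Pres d ℓ'} {x y : Fin d → ℤ}
    (hx : toR x ∈ Q.toSet) (hy : toR y ∈ Q'.toSet) (h : Q.toSet = Q'.toSet) :
    Q.span = Q'.span ∧ ∀ u ∈ Q.span, u ⬝ᵥ toR (y - x) = 0 := by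
  refine ⟨Pres.span_eq_of_toSet hx h, fun u hu => ?_⟩
  rw [← h] at hy
  rw [Pres.span_eq] at hu
  induction hu using Submodule.span_induction with
  | mem u hu =>
    obtain ⟨i, rfl⟩ := hu
    rw [toR_sub, dotProduct_sub, sub_eq_zero]
    exact (hy i).trans (hx i).symm
  | zero => simp
  | add u v _ _ h1 h2 => rw [add_dotProduct, h1, h2, add_zero]
  | smul c u _ h1 => rw [smul_dotProduct, h1, smul_zero]

end CutV

/-! ### Intrinsic description of bilinear monomials -/

section Bilinear

variable {d b : ℕ} {n : Fin b → Fin d → ℤ} {N : ℕ} {ℓ : ℕ}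

/-- `∑ |j| (α_j + β_j)`. -/
def lowM (w : Mon n) : ℝ :=
  (w.2.2.1.sum fun j a => len j.1 * a) + (w.2.2.2.sum fun j a => len j.1 * a)

/-- The sign of `z^σ`. -/
def sg (σ : Bool) : ℤ := if σ then 1 else -1

theorem sg_cases (σ : Bool) : sg σ = 1 ∨ sg σ = -1 := by cases σ <;> simp [sg]

theorem lowM_nonneg (w : Mon n) : 0 ≤ lowM w :=
  add_nonneg (Finset.sum_nonneg fun _ _ => mul_nonneg (len_nonneg _) (Nat.cast_nonneg _))
    (Finset.sum_nonneg fun _ _ => mul_nonneg (len_nonneg _) (Nat.cast_nonneg _))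

@[simp] theorem lowM_add (w w' : Mon n) : lowM (w + w') = lowM w + lowM w' := by
  have hs : ∀ α β : NSite n →₀ ℕ, ((α + β).sum fun j a => len j.1 * (a : ℝ)) =
      (α.sum fun j a => len j.1 * (a : ℝ)) + β.sum fun j a => len j.1 * (a : ℝ) := fun α β =>
    Finsupp.sum_add_index' (by simp) (by intros; push_cast; ring)
  simp only [lowM, Prod.snd_add, Prod.fst_add, hs]
  ring

@[simp] theorem lowM_monS (j : NSite n) (σ : Bool) : lowM (monS j σ) = len j.1 := by
  cases σ <;> simp [lowM, monS, monZ, monZb, Finsupp.sum_single_index]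

@[simp] theorem lowM_th (i : Fin b) : lowM (mon (vTh i) : Mon n) = 0 := by simp [lowM, mon]
@[simp] theorem lowM_I (i : Fin b) : lowM (monI i : Mon n) = 0 := by simp [lowM, monI]

@[simp] theorem mom_monS (j : NSite n) (σ : Bool) : mom (monS j σ) = sg σ • j.1 := by
  cases σ <;> simp [mom, monS, monZ, monZb, piK, sg, Finsupp.sum_single_index]

@[simp] theorem mom_th (i : Fin b) : mom (mon (vTh i) : Mon n) = 0 := by simp [mom, mon, piK]
@[simp] theorem mom_I (i : Fin b) : mom (monI i : Mon n) = 0 := by simp [mom, monI, piK]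

@[simp] theorem fst_monS (j : NSite n) (σ : Bool) : (monS j σ : Mon n).1 = 0 := by
  cases σ <;> rfl

theorem fst_mon (v : Var n) : (mon v : Mon n).1 = 0 := by
  rcases v with (i | i) | (j | j) <;> rfl

theorem absK_nonneg (k : Fin b → ℤ) : 0 ≤ absK k := Finset.sum_nonneg fun _ _ => abs_nonneg _

theorem len_piK_le (k : Fin b → ℤ) : len (piK n k) ≤ C1 n * absK k := by
  refine (len_sum_le _ _).trans ?_
  rw [absK, Finset.mul_sum]
  refine Finset.sum_le_sum fun i _ => ?_
  rw [len_smul, mul_comm]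
  exact mul_le_mul_of_nonneg_right (len_le_C1 i) (abs_nonneg _)

theorem len_mom_le (w : Mon n) : len (mom w) ≤ C1 n * absK w.1 + lowM w := by
  have hs : ∀ α : NSite n →₀ ℕ, len (α.sum fun j a => (a : ℤ) • j.1) ≤
      α.sum fun j a => len j.1 * (a : ℝ) := by
    intro α
    refine (len_sum_le _ _).trans (Finset.sum_le_sum fun j _ => ?_)
    rw [len_smul, mul_comm]
    simp
  have h1 := len_sub_le (piK n w.1 + (w.2.2.1.sum fun j a => (a : ℤ) • j.1))
    (w.2.2.2.sum fun j a => (a : ℤ) • j.1)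
  have h2 := len_add_le (piK n w.1) (w.2.2.1.sum fun j a => (a : ℤ) • j.1)
  have h3 := hs w.2.2.1
  have h4 := hs w.2.2.2
  have h5 := len_piK_le (n := n) w.1
  simp only [mom, lowM]
  linarith

/-- Bilinear monomials whose two distinguished sites have the cut `V`. -/
structure Bi (τ₀ : ℝ) (N : ℕ) (θ μ τ : ℝ) (w : Mon n) (m : NSite n) (σ : Bool)
    (m' : NSite n) (σ' : Bool) (V : Submodule ℝ (Fin d → ℝ)) : Prop where
  momentum : mom (w + monS m σ + monS m' σ') = 0
  freq : absK w.1 < N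
  high : θ * (N : ℝ) ^ tau1 d τ₀ < len m.1
  high' : θ * (N : ℝ) ^ tau1 d τ₀ < len m'.1
  low : lowM w < μ * (N : ℝ) ^ 3
  pos : 0 < Module.finrank ℝ V
  lt : Module.finrank ℝ V < d
  cut : CutV n N θ μ τ m.1 V
  cut' : CutV n N θ μ τ m'.1 V

structure Gap (n : Fin b → Fin d → ℤ) (τ₀ : ℝ) (N : ℕ) (τ θ₁ μ₁ θ₂ μ₂ : ℝ) : Prop where
  two_le : 2 ≤ N
  ne : ∃ i, n i ≠ 0
  cutμ : C1 n * N * (6 * (N : ℝ) ^ 3) ≤ (μ₁ - μ₂) * (N : ℝ) ^ τ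
  cutθ : C1 n * N * (6 * (N : ℝ) ^ 3) ≤ (θ₂ - θ₁) * (N : ℝ) ^ (4 * d * τ)
  sep₁ : μ₁ * (N : ℝ) ^ τ ≤ θ₁ * (N : ℝ) ^ (4 * d * τ)
  sep₂ : μ₂ * (N : ℝ) ^ τ ≤ θ₂ * (N : ℝ) ^ (4 * d * τ)
  lowgap : μ₂ * (N : ℝ) ^ 3 + C1 n * N ≤ μ₁ * (N : ℝ) ^ 3
  small : C1 n * N + μ₁ * (N : ℝ) ^ 3 ≤ 5 * (N : ℝ) ^ 3
  highgap : θ₁ * (N : ℝ) ^ tau1 d τ₀ + 5 * (N : ℝ) ^ 3 ≤ θ₂ * (N : ℝ) ^ tau1 d τ₀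
  far : 100 * (N : ℝ) ^ 3 + C1 n ≤ θ₁ * (N : ℝ) ^ tau1 d τ₀

variable {τ₀ τ θ₁ μ₁ θ₂ μ₂ θ μ : ℝ} {w : Mon n} {m m' : NSite n} {σ σ' : Bool}
  {V : Submodule ℝ (Fin d → ℝ)}

theorem BilinAt.symm {Q Q' : Pres d ℓ} (h : BilinAt τ₀ N θ μ τ w m σ m' σ' ℓ Q Q') :
    BilinAt τ₀ N θ μ τ w m' σ' m σ ℓ Q' Q :=
  ⟨by rw [add_right_comm]; exact h.momentum, h.freq, h.high', h.high, h.low, h.pos, h.lt, h.cut',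
    h.cut⟩

theorem mom_pair (w : Mon n) (m m' : NSite n) (σ σ' : Bool) :
    mom (w + monS m σ + monS m' σ') = mom w + sg σ • m.1 + sg σ' • m'.1 := by simp

/-- Two sites whose signed sum is small are close up to a sign. -/
theorem near_of_signed {x y : Fin d → ℤ} {σ σ' : Bool} {Δ : ℝ}
    (h : len (sg σ • x + sg σ' • y) ≤ Δ) :
    len (y + (sg σ * sg σ') • x) ≤ Δ := by
  have : y + (sg σ * sg σ') • x = sg σ' • (sg σ • x + sg σ' • y) := by
    rw [smul_add, smul_smul, smul_smul, mul_comm (sg σ') (sg σ), add_comm]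
    rcases sg_cases σ' with h | h <;> simp [h]
  rw [this, len_smul]
  rcases sg_cases σ' with h' | h' <;> simpa [h'] using h

theorem near_or_of_signed {x y : Fin d → ℤ} {σ σ' : Bool} {Δ : ℝ}
    (h : len (sg σ • x + sg σ' • y) ≤ Δ) : len (y - x) ≤ Δ ∨ len (y + x) ≤ Δ := by
  have := near_of_signed h
  rcases sg_cases σ with h1 | h1 <;> rcases sg_cases σ' with h2 | h2 <;>
    simp only [h1, h2, mul_one, mul_neg, neg_neg, neg_smul, one_smul,
      ← sub_eq_add_neg] at this
  exacts [Or.inr this, Or.inl this, Or.inl this, Or.inr this]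

theorem signed_le_of_mom {x : Fin d → ℤ} {y : Fin d → ℤ}
    (hfreq : absK w.1 ≤ N) (h : mom w + sg σ • x + sg σ' • y = 0) :
    len (sg σ • x + sg σ' • y) ≤ C1 n * N + lowM w := by
  have h1 : sg σ • x + sg σ' • y = -mom w := by
    rw [add_assoc] at h; exact (neg_eq_of_add_eq_zero_right h).symm
  rw [h1, len_neg]
  have hC : 0 ≤ C1 n := Real.iSup_nonneg fun i => len_nonneg _
  have := len_mom_le w
  nlinarith

theorem Gap.mu_le (hg : Gap n τ₀ N τ θ₁ μ₁ θ₂ μ₂) : μ₂ ≤ μ₁ := by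
  have h1 := hg.lowgap
  have hC : 0 ≤ C1 n := Real.iSup_nonneg fun i => len_nonneg _
  have hN : (0 : ℝ) < N := by exact_mod_cast (zero_lt_two.trans_le hg.two_le)
  have : μ₂ * (N : ℝ) ^ 3 ≤ μ₁ * (N : ℝ) ^ 3 := by nlinarith
  exact le_of_mul_le_mul_right this (by positivity)

theorem Gap.small₂ (hg : Gap n τ₀ N τ θ₁ μ₁ θ₂ μ₂) :
    C1 n * N + μ₂ * (N : ℝ) ^ 3 ≤ 5 * (N : ℝ) ^ 3 := by
  have h1 := mul_le_mul_of_nonneg_right hg.mu_le (show (0 : ℝ) ≤ (N : ℝ) ^ 3 by positivity)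
  have := hg.small
  linarith

theorem Bi.near (hg : Gap n τ₀ N τ θ₁ μ₁ θ₂ μ₂) (h : Bi τ₀ N θ₂ μ₂ τ w m σ m' σ' V) :
    len (m'.1 - m.1) ≤ 5 * (N : ℝ) ^ 3 ∨ len (m'.1 + m.1) ≤ 5 * (N : ℝ) ^ 3 := by
  have h1 := h.momentum
  rw [mom_pair] at h1
  refine near_or_of_signed ((signed_le_of_mom h.freq.le h1).trans ?_)
  have := hg.small₂
  have := h.low
  linarith

theorem Gap.cut_near (hg : Gap n τ₀ N τ θ₁ μ₁ θ₂ μ₂) {x y : Fin d → ℤ}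
    (h : CutV n N θ₂ μ₂ τ x V)
    (hxy : len (y - x) ≤ 5 * (N : ℝ) ^ 3 ∨ len (y + x) ≤ 5 * (N : ℝ) ^ 3) :
    CutV n N θ₁ μ₁ τ y V := by
  have hC : 0 ≤ C1 n := Real.iSup_nonneg fun i => len_nonneg _
  have h1 : C1 n * N * (5 * (N : ℝ) ^ 3) ≤ C1 n * N * (6 * (N : ℝ) ^ 3) := by
    have : (0 : ℝ) ≤ (N : ℝ) ^ 3 := by positivity
    gcongr; norm_num
  exact h.near' hxy (h1.trans hg.cutμ) (h1.trans hg.cutθ) hg.sep₁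

theorem Gap.cut_self (hg : Gap n τ₀ N τ θ₁ μ₁ θ₂ μ₂) {x : Fin d → ℤ}
    (h : CutV n N θ₂ μ₂ τ x V) : CutV n N θ₁ μ₁ τ x V :=
  hg.cut_near h (Or.inl (by rw [sub_self, len_zero]; positivity))

theorem Gap.theta_le (hg : Gap n τ₀ N τ θ₁ μ₁ θ₂ μ₂) : θ₁ ≤ θ₂ := by
  have h1 := hg.highgap
  have hN : (0 : ℝ) < N := by exact_mod_cast (zero_lt_two.trans_le hg.two_le)
  have h2 : (0 : ℝ) ≤ 5 * (N : ℝ) ^ 3 := by positivity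
  have : θ₁ * (N : ℝ) ^ tau1 d τ₀ ≤ θ₂ * (N : ℝ) ^ tau1 d τ₀ := by linarith
  exact le_of_mul_le_mul_right this (by positivity)

theorem BilinAt.bi (hg : Gap n τ₀ N τ θ₁ μ₁ θ₂ μ₂) {Q Q' : Pres d ℓ}
    (h : BilinAt τ₀ N θ₂ μ₂ τ w m σ m' σ' ℓ Q Q') :
    Q.span = Q'.span ∧ Bi τ₀ N θ₂ μ₂ τ w m σ m' σ' Q.span := by
  have h1 := h.momentum
  rw [mom_pair] at h1
  have hlow : lowM w < μ₂ * (N : ℝ) ^ 3 := h.low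
  have hnear : len (m'.1 - m.1) ≤ 5 * (N : ℝ) ^ 3 ∨ len (m'.1 + m.1) ≤ 5 * (N : ℝ) ^ 3 := by
    refine near_or_of_signed ((signed_le_of_mom h.freq.le h1).trans ?_)
    have := hg.small₂
    linarith
  have hc := h.cut.cutV h.pos h.lt hg.sep₂
  have hc' := h.cut'.cutV h.pos h.lt hg.sep₂
  have hf := h.cut.optimal.2.2
  have hf' := h.cut'.optimal.2.2
  have he := (hg.cut_near hc hnear).unique hc' hg.mu_le (hf.trans hf'.symm)
  exact ⟨he, h.momentum, h.freq, h.high, h.high', h.low, by rw [hf]; exact h.pos,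
    by rw [hf]; exact h.lt, hc, by rw [he]; exact hc'⟩

theorem Bi.bilinAt (hne : ∃ i, n i ≠ 0) (hN : 2 ≤ N) (h : Bi τ₀ N θ μ τ w m σ m' σ' V) :
    ∃ Q Q' : Pres d (Module.finrank ℝ V), BilinAt τ₀ N θ μ τ w m σ m' σ' _ Q Q' ∧ Q.span = V ∧
      Q'.span = V := by
  obtain ⟨Q, hQ, hQV⟩ := h.cut.isCut hne hN h.pos h.lt rfl
  obtain ⟨Q', hQ', hQV'⟩ := h.cut'.isCut hne hN h.pos h.lt rfl
  exact ⟨Q, Q', ⟨h.momentum, h.freq, h.high, h.high', h.low, h.pos, h.lt, hQ, hQ'⟩, hQV, hQV'⟩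

theorem isBilin_iff (hg : Gap n τ₀ N τ θ₁ μ₁ θ₂ μ₂) (ν : Mon n) :
    IsBilin τ₀ N θ₂ μ₂ τ ν ↔ ∃ w m σ m' σ' V, ν = w + monS m σ + monS m' σ' ∧
      Bi τ₀ N θ₂ μ₂ τ w m σ m' σ' V := by
  constructor
  · rintro ⟨w, m, σ, m', σ', ℓ, Q, Q', rfl, h⟩
    exact ⟨w, m, σ, m', σ', _, rfl, (h.bi hg).2⟩
  · rintro ⟨w, m, σ, m', σ', V, rfl, h⟩
    obtain ⟨Q, Q', h', _⟩ := h.bilinAt hg.ne hg.two_le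
    exact ⟨w, m, σ, m', σ', _, Q, Q', rfl, h'⟩

theorem Bi.isBilin (hne : ∃ i, n i ≠ 0) (hN : 2 ≤ N) (h : Bi τ₀ N θ μ τ w m σ m' σ' V) :
    IsBilin τ₀ N θ μ τ (w + monS m σ + monS m' σ') := by
  obtain ⟨Q, Q', h', _⟩ := h.bilinAt hne hN
  exact ⟨w, m, σ, m', σ', _, Q, Q', rfl, h'⟩

theorem Bi.mono (hg : Gap n τ₀ N τ θ₁ μ₁ θ₂ μ₂) (h : Bi τ₀ N θ₂ μ₂ τ w m σ m' σ' V) :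
    Bi τ₀ N θ₁ μ₁ τ w m σ m' σ' V where
  momentum := h.momentum
  freq := h.freq
  high := (mul_le_mul_of_nonneg_right hg.theta_le (by positivity)).trans_lt h.high
  high' := (mul_le_mul_of_nonneg_right hg.theta_le (by positivity)).trans_lt h.high'
  low := h.low.trans_le (mul_le_mul_of_nonneg_right hg.mu_le (by positivity))
  pos := h.pos
  lt := h.lt
  cut := hg.cut_self h.cut
  cut' := hg.cut_self h.cut'

theorem IsBilin.mono (hg₀ : Gap n τ₀ N τ θ₁ μ₁ θ₂ μ₂)
    {ν : Mon n} (h : IsBilin τ₀ N θ₂ μ₂ τ ν) : IsBilin τ₀ N θ₁ μ₁ τ ν := by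
  obtain ⟨w, m, σ, m', σ', V, rfl, h'⟩ := (isBilin_iff hg₀ ν).1 h
  exact (h'.mono hg₀).isBilin hg₀.ne hg₀.two_le

/-- Values at bilinear monomials are invariant under translations along the cut. -/
def TopInv (τ₀ : ℝ) (N : ℕ) (θ μ τ : ℝ) (O : Set (Par b)) (G : Ham n) : Prop :=
  ∀ w m σ m' σ' y y' V, Bi τ₀ N θ μ τ w m σ m' σ' V → Bi τ₀ N θ μ τ w y σ y' σ' V →
    (∀ u ∈ V, u ⬝ᵥ toR (y.1 - m.1) = 0) →
    ∀ ξ ∈ O, G (w + monS m σ + monS m' σ') ξ = G (w + monS y σ + monS y' σ') ξ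

theorem shift_snd {y y' : NSite n} (h : mom (w + monS m σ + monS m' σ') = 0)
    (h' : mom (w + monS y σ + monS y' σ') = 0) :
    y'.1 - m'.1 = -(sg σ * sg σ') • (y.1 - m.1) := by
  rw [mom_pair] at h h'
  have h1 : sg σ' • (y'.1 - m'.1) = -(sg σ • (y.1 - m.1)) := by
    rw [eq_neg_iff_add_eq_zero, smul_sub, smul_sub]
    calc _ = (mom w + sg σ • y.1 + sg σ' • y'.1) - (mom w + sg σ • m.1 + sg σ' • m'.1) := by abel
      _ = 0 := by rw [h, h', sub_zero]
  have h2 : sg σ' • sg σ' • (y'.1 - m'.1) = y'.1 - m'.1 := by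
    rcases sg_cases σ' with h | h <;> simp [h]
  rw [← h2, h1, neg_smul, smul_neg, smul_smul, mul_comm]

theorem orth_smul {x : Fin d → ℤ} (h : ∀ u ∈ V, u ⬝ᵥ toR x = 0) (k : ℤ) :
    ∀ u ∈ V, u ⬝ᵥ toR (k • x) = 0 := by
  intro u hu
  have : toR (k • x) = (k : ℝ) • toR x := by funext j; simp [toR]
  rw [this, dotProduct_smul, h u hu, smul_zero]

theorem PiecewiseToplitz.topInv {ρ r s : ℝ} {O : Set (Par b)} {G : Ham n} (hne : ∃ i, n i ≠ 0)
    (hN : 2 ≤ N) (h : PiecewiseToplitz ρ τ₀ O r s N θ μ τ G) : TopInv τ₀ N θ μ τ O G := by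
  intro w m σ m' σ' y y' V h1 h2 ht ξ hξ
  obtain ⟨g, hG⟩ := h.toplitz
  obtain ⟨Q, Q', hb, hQ, hQ'⟩ := h1.bilinAt hne hN
  obtain ⟨R, R', hb', hR, hR'⟩ := h2.bilinAt hne hN
  have e1 : Q = R := hb.cut.eq_of_orth hb'.cut (hQ.trans hR.symm) (by rw [hQ]; exact ht)
  have e2 : Q' = R' := hb.cut'.eq_of_orth hb'.cut' (hQ'.trans hR'.symm) (by
    rw [hQ', shift_snd h1.momentum h2.momentum]; exact orth_smul ht _)
  subst e1 e2
  rcases PresLE.total Q Q' with hle | hle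
  · rw [hG _ _ _ _ _ _ _ _ hb hle ξ hξ, hG _ _ _ _ _ _ _ _ hb' hle ξ hξ]
  · have a1 := hG _ _ _ _ _ _ _ _ hb.symm hle ξ hξ
    have a2 := hG _ _ _ _ _ _ _ _ hb'.symm hle ξ hξ
    rw [add_right_comm] at a1 a2
    rw [a1, a2]

open Classical in
theorem TopInv.toplitz {O : Set (Par b)} {G : Ham n} (hg : Gap n τ₀ N τ θ₁ μ₁ θ₂ μ₂)
    (h : TopInv τ₀ N θ₂ μ₂ τ O G) :
    ∃ g : Mon n → Bool → Bool → Set (Fin d → ℝ) → Par b → ℂ,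
      ∀ w m σ m' σ' ℓ Q Q', BilinAt τ₀ N θ₂ μ₂ τ w m σ m' σ' ℓ Q Q' → PresLE Q Q' →
        ∀ ξ ∈ O, G (w + monS m σ + monS m' σ') ξ = g w σ σ' Q.toSet ξ := by
  refine ⟨fun w σ σ' A ξ => if hx : ∃ x : NSite n × NSite n, ∃ ℓ, ∃ Q Q' : Pres d ℓ,
    BilinAt τ₀ N θ₂ μ₂ τ w x.1 σ x.2 σ' ℓ Q Q' ∧ Q.toSet = A then
      G (w + monS hx.choose.1 σ + monS hx.choose.2 σ') ξ else 0, ?_⟩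
  intro w m σ m' σ' ℓ Q Q' hb _ ξ hξ
  have hx : ∃ x : NSite n × NSite n, ∃ ℓ, ∃ R R' : Pres d ℓ,
    BilinAt τ₀ N θ₂ μ₂ τ w x.1 σ x.2 σ' ℓ R R' ∧ R.toSet = Q.toSet := ⟨(m, m'), ℓ, Q, Q', hb, rfl⟩
  simp only [dif_pos hx]
  obtain ⟨ℓ', R, R', hb', hR⟩ := hx.choose_spec
  obtain ⟨hs, ht⟩ := Pres.orth_of_toSet_eq hb.cut.optimal.2.1 hb'.cut.optimal.2.1 hR.symm
  have h2 := (hb'.bi hg).2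
  rw [← hs] at h2
  exact h _ _ _ _ _ _ _ _ (hb.bi hg).2 h2 ht ξ hξ

end Bilinear

/-! ### Permutations of the normal sites -/

section Perm

variable {d b : ℕ} {n : Fin b → Fin d → ℤ}

/-- The action of a permutation of sites on monomials. -/
def permM (Φ : Equiv.Perm (NSite n)) : Mon n ≃+ Mon n :=
  AddEquiv.prodCongr (AddEquiv.refl _) (AddEquiv.prodCongr (AddEquiv.refl _)
    (AddEquiv.prodCongr (Finsupp.domCongr Φ) (Finsupp.domCongr Φ)))

variable (Φ : Equiv.Perm (NSite n))

@[simp] theorem permM_fst (ν : Mon n) : (permM Φ ν).1 = ν.1 := rfl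
@[simp] theorem permM_act (ν : Mon n) : (permM Φ ν).2.1 = ν.2.1 := rfl
theorem permM_eq (ν : Mon n) :
    permM Φ ν = (ν.1, ν.2.1, Finsupp.domCongr Φ ν.2.2.1, Finsupp.domCongr Φ ν.2.2.2) := rfl

@[simp] theorem permM_alpha (ν : Mon n) (j : NSite n) :
    (permM Φ ν).2.2.1 (Φ j) = ν.2.2.1 j := by
  simp [permM_eq]
@[simp] theorem permM_beta (ν : Mon n) (j : NSite n) :
    (permM Φ ν).2.2.2 (Φ j) = ν.2.2.2 j := by
  simp [permM_eq]

@[simp] theorem permM_monI (i : Fin b) : permM Φ (monI i) = monI i := by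
  simp [permM_eq, monI]
@[simp] theorem permM_monZ (j : NSite n) : permM Φ (monZ j) = monZ (Φ j) := by
  simp [permM_eq, monZ]
@[simp] theorem permM_monZb (j : NSite n) : permM Φ (monZb j) = monZb (Φ j) := by
  simp [permM_eq, monZb]
@[simp] theorem permM_monS (j : NSite n) (σ : Bool) : permM Φ (monS j σ) = monS (Φ j) σ := by
  cases σ <;> simp [monS]

theorem permM_eq_self {ν : Mon n} (h : ∀ j, ν.2.2.1 j ≠ 0 ∨ ν.2.2.2 j ≠ 0 → Φ j = j) :
    permM Φ ν = ν := by
  have key : ∀ α : NSite n →₀ ℕ, (∀ j, α j ≠ 0 → Φ j = j) → Finsupp.domCongr Φ α = α := by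
    intro α hα
    ext j
    simp only [Finsupp.domCongr_apply, Finsupp.equivMapDomain_apply]
    by_cases h0 : α j = 0
    · by_contra h1
      rw [h0] at h1
      have := hα _ h1
      rw [Equiv.apply_symm_apply] at this
      rw [← this, h0] at h1
      exact h1 rfl
    · rw [(Equiv.symm_apply_eq Φ).2 (hα j h0).symm]
  obtain ⟨k, l, α, β⟩ := ν
  have h1 := key α fun j hj => h j (Or.inl hj)
  have h2 := key β fun j hj => h j (Or.inr hj)
  exact Prod.ext rfl (Prod.ext rfl (Prod.ext h1 h2))

theorem permM_symm_apply (ν : Mon n) : permM Φ.symm (permM Φ ν) = ν := by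
  change (permM Φ).symm (permM Φ ν) = ν
  exact (permM Φ).symm_apply_apply ν

theorem deg_permM (ν : Mon n) : deg (permM Φ ν) = deg ν := by
  have key : ∀ α : NSite n →₀ ℕ, ((Finsupp.domCongr Φ α).sum fun _ a => a) = α.sum fun _ a => a := by
    intro α
    simp [Finsupp.domCongr_apply, Finsupp.equivMapDomain_eq_mapDomain,
      Finsupp.sum_mapDomain_index]
  have h1 := key ν.2.2.1
  have h2 := key ν.2.2.2
  simp only [deg, permM_act]
  rw [← h1, ← h2]
  rfl

theorem mulH_perm (f g : Ham n) (ν : Mon n) (ξ : Par b) :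
    mulH f g (permM Φ ν) ξ = mulH (fun ν => f (permM Φ ν)) (fun ν => g (permM Φ ν)) ν ξ := by
  unfold mulH
  let e : {p : Mon n × Mon n // p.1 + p.2 = ν} ≃ {p : Mon n × Mon n // p.1 + p.2 = permM Φ ν} :=
    Equiv.subtypeEquiv (Equiv.prodCongr (permM Φ).toEquiv (permM Φ).toEquiv) (by
      rintro ⟨p, q⟩
      change p + q = ν ↔ permM Φ p + permM Φ q = permM Φ ν
      rw [← map_add, (permM Φ).injective.eq_iff])
  rw [← e.tsum_eq]
  rfl

theorem poisson_perm (f g : Ham n) (ν : Mon n) (ξ : Par b) :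
    poisson f g (permM Φ ν) ξ = poisson (fun ν => f (permM Φ ν)) (fun ν => g (permM Φ ν)) ν ξ := by
  have hI : ∀ (f : Ham n) i, (fun ν => dI i f (permM Φ ν)) = dI i (fun ν => f (permM Φ ν)) := by
    intro f i; funext ν ξ; simp [dI]
  have hT : ∀ (f : Ham n) i, (fun ν => dTheta i f (permM Φ ν)) =
      dTheta i (fun ν => f (permM Φ ν)) := by
    intro f i; funext ν ξ; simp [dTheta]
  have hZ : ∀ (f : Ham n) j, (fun ν => dZ (Φ j) f (permM Φ ν)) = dZ j (fun ν => f (permM Φ ν)) := by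
    intro f j; funext ν ξ; simp [dZ]
  have hZb : ∀ (f : Ham n) j, (fun ν => dZb (Φ j) f (permM Φ ν)) =
      dZb j (fun ν => f (permM Φ ν)) := by
    intro f j; funext ν ξ; simp [dZb]
  unfold poisson
  rw [← Equiv.tsum_eq Φ]
  simp only [mulH_perm, hI, hT, hZ, hZb]

theorem exists_perm_extending {α : Type*} {S : Set α} (hS : S.Finite) {φ : α → α}
    (hφ : Set.InjOn φ S) : ∃ Φ : Equiv.Perm α, ∀ x ∈ S, Φ x = φ x := by
  have := hS.fintype
  let e := (Fintype.equivFin S).symm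
  let x : Fin (Fintype.card S) ↪ α := ⟨fun i => (e i).1, fun i j h => e.injective (Subtype.ext h)⟩
  let y : Fin (Fintype.card S) ↪ α := ⟨fun i => φ (e i).1, fun i j h =>
    e.injective (Subtype.ext (hφ (e i).2 (e j).2 h))⟩
  have := Equiv.Perm.isMultiplyPretransitive α (Fintype.card S)
  obtain ⟨Φ, hΦ⟩ := MulAction.exists_smul_eq (Equiv.Perm α) x y
  refine ⟨Φ, fun z hz => ?_⟩
  have h1 : Φ (e (e.symm ⟨z, hz⟩)).1 = φ (e (e.symm ⟨z, hz⟩)).1 :=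
    DFunLike.congr_fun hΦ (e.symm ⟨z, hz⟩)
  simpa using h1

/-- `Φ` translates the points near `m` by `y - m`, those near `-m` by `m - y`, and fixes the low
sites. -/
structure Shift (N : ℕ) (Φ : Equiv.Perm (NSite n)) (m y : NSite n) : Prop where
  plus : ∀ j : NSite n, len (j.1 - m.1) ≤ 5 * (N : ℝ) ^ 3 → (Φ j).1 = j.1 + (y.1 - m.1)
  minus : ∀ j : NSite n, len (j.1 + m.1) ≤ 5 * (N : ℝ) ^ 3 → (Φ j).1 = j.1 - (y.1 - m.1)
  low : ∀ j : NSite n, len j.1 ≤ 20 * (N : ℝ) ^ 3 → Φ j = j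

theorem notMem_range_of_far {x m : Fin d → ℤ} {N : ℕ} (hm : 100 * (N : ℝ) ^ 3 + C1 n < len m)
    (h : len (x - m) ≤ 5 * (N : ℝ) ^ 3 ∨ len (x + m) ≤ 5 * (N : ℝ) ^ 3) :
    x ∉ Set.range n ∧ 95 * (N : ℝ) ^ 3 < len x := by
  have hx : len m ≤ len x + 5 * (N : ℝ) ^ 3 := by
    rcases h with h | h
    · have h1 := len_sub_le x (x - m)
      rw [sub_sub_cancel] at h1
      linarith
    · have h1 := len_sub_le (x + m) x
      rw [add_sub_cancel_left] at h1
      linarith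
  have hC : 0 ≤ C1 n := Real.iSup_nonneg fun i => len_nonneg _
  have hN : (0 : ℝ) ≤ (N : ℝ) ^ 3 := by positivity
  refine ⟨?_, by linarith⟩
  rintro ⟨i, rfl⟩
  have := len_le_C1 (n := n) i
  linarith

theorem exists_shift {N : ℕ} {m y : NSite n} (hm : 100 * (N : ℝ) ^ 3 + C1 n < len m.1)
    (hy : 100 * (N : ℝ) ^ 3 + C1 n < len y.1) : ∃ Φ, Shift N Φ m y := by
  classical
  have hC : 0 ≤ C1 n := Real.iSup_nonneg fun i => len_nonneg _
  have hN : (0 : ℝ) ≤ (N : ℝ) ^ 3 := by positivity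
  have e1 : ∀ x : Fin d → ℤ, x + (y.1 - m.1) - y.1 = x - m.1 := fun x => by abel
  have e2 : ∀ x : Fin d → ℤ, x - (y.1 - m.1) + y.1 = x + m.1 := fun x => by abel
  let φ : NSite n → NSite n := fun j =>
    if h : len (j.1 - m.1) ≤ 5 * (N : ℝ) ^ 3 then
      ⟨j.1 + (y.1 - m.1), (notMem_range_of_far hy (Or.inl (by rw [e1]; exact h))).1⟩
    else if h : len (j.1 + m.1) ≤ 5 * (N : ℝ) ^ 3 then
      ⟨j.1 - (y.1 - m.1), (notMem_range_of_far hy (Or.inr (by rw [e2]; exact h))).1⟩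
    else j
  have hp : ∀ j : NSite n, len (j.1 - m.1) ≤ 5 * (N : ℝ) ^ 3 → (φ j).1 = j.1 + (y.1 - m.1) := by
    intro j hj; simp only [φ, dif_pos hj]
  have hex : ∀ {m : NSite n}, 100 * (N : ℝ) ^ 3 + C1 n < len m.1 → ∀ x : Fin d → ℤ,
      len (x + m.1) ≤ 5 * (N : ℝ) ^ 3 → ¬ len (x - m.1) ≤ 5 * (N : ℝ) ^ 3 := by
    intro m hm x h1 h2
    have h3 := len_sub_le (x + m.1) (x - m.1)
    have h4 : x + m.1 - (x - m.1) = (2 : ℤ) • m.1 := by rw [two_smul]; abel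
    rw [h4, len_smul] at h3
    norm_num at h3
    linarith
  have hmi : ∀ j : NSite n, len (j.1 + m.1) ≤ 5 * (N : ℝ) ^ 3 → (φ j).1 = j.1 - (y.1 - m.1) := by
    intro j hj; simp only [φ, dif_neg (hex hm _ hj), dif_pos hj]
  have hlo : ∀ j : NSite n, len j.1 ≤ 20 * (N : ℝ) ^ 3 → φ j = j := by
    intro j hj
    have h1 : ¬ len (j.1 - m.1) ≤ 5 * (N : ℝ) ^ 3 := fun h => by
      have := (notMem_range_of_far hm (Or.inl h)).2
      linarith
    have h2 : ¬ len (j.1 + m.1) ≤ 5 * (N : ℝ) ^ 3 := fun h => by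
      have := (notMem_range_of_far hm (Or.inr h)).2
      linarith
    simp only [φ, dif_neg h1, dif_neg h2]
  let S : Set (NSite n) := {j | len (j.1 - m.1) ≤ 5 * (N : ℝ) ^ 3 ∨
    len (j.1 + m.1) ≤ 5 * (N : ℝ) ^ 3 ∨ len j.1 ≤ 20 * (N : ℝ) ^ 3}
  have hS : S.Finite := by
    refine Set.Finite.of_finite_image (f := Subtype.val)
      ((finite_len_lt (len m.1 + 20 * (N : ℝ) ^ 3 + 1)).subset ?_) Subtype.val_injective.injOn
    rintro _ ⟨j, hj, rfl⟩
    change len j.1 < _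
    have hm0 := len_nonneg m.1
    rcases hj with h | h | h
    · have := len_add_le (j.1 - m.1) m.1
      rw [sub_add_cancel] at this
      linarith
    · have := len_sub_le (j.1 + m.1) m.1
      rw [add_sub_cancel_right] at this
      linarith
    · linarith
  -- the three parts of the image are characterised by their position relative to `y`
  have hI : Set.InjOn φ S := by
    have c1 : ∀ j : NSite n, len (j.1 - m.1) ≤ 5 * (N : ℝ) ^ 3 →
        len ((φ j).1 - y.1) ≤ 5 * (N : ℝ) ^ 3 := fun j hj => by rw [hp j hj, e1]; exact hj
    have c2 : ∀ j : NSite n, len (j.1 + m.1) ≤ 5 * (N : ℝ) ^ 3 →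
        len ((φ j).1 + y.1) ≤ 5 * (N : ℝ) ^ 3 := fun j hj => by rw [hmi j hj, e2]; exact hj
    have c3 : ∀ j : NSite n, len j.1 ≤ 20 * (N : ℝ) ^ 3 →
        ¬ (len ((φ j).1 - y.1) ≤ 5 * (N : ℝ) ^ 3 ∨ len ((φ j).1 + y.1) ≤ 5 * (N : ℝ) ^ 3) := by
      intro j hj h
      rw [hlo j hj] at h
      have := (notMem_range_of_far hy h).2
      linarith
    intro i hi j hj hij
    rcases hi with hi | hi | hi <;> rcases hj with hj | hj | hj
    · exact Subtype.ext (add_right_cancel ((hp i hi).symm.trans ((congrArg _ hij).trans (hp j hj))))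
    · exact absurd (hij ▸ c1 i hi) (hex hy _ (c2 j hj))
    · exact absurd (Or.inl (hij ▸ c1 i hi)) (c3 j hj)
    · exact absurd (hij.symm ▸ c1 j hj) (hex hy _ (c2 i hi))
    · exact Subtype.ext (sub_left_injective
        ((hmi i hi).symm.trans ((congrArg _ hij).trans (hmi j hj))))
    · exact absurd (Or.inr (hij ▸ c2 i hi)) (c3 j hj)
    · exact absurd (Or.inl (hij.symm ▸ c1 j hj)) (c3 i hi)
    · exact absurd (Or.inr (hij.symm ▸ c2 j hj)) (c3 i hi)
    · rw [← hlo i hi, ← hlo j hj, hij]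
  obtain ⟨Φ, hΦ⟩ := exists_perm_extending hS hI
  exact ⟨Φ, fun j hj => by rw [hΦ j (Or.inl hj), hp j hj],
    fun j hj => by rw [hΦ j (Or.inr (Or.inl hj)), hmi j hj],
    fun j hj => by rw [hΦ j (Or.inr (Or.inr hj)), hlo j hj]⟩

theorem Shift.symm {N : ℕ} {Φ : Equiv.Perm (NSite n)} {m y : NSite n}
    (hm : 100 * (N : ℝ) ^ 3 + C1 n < len m.1) (h : Shift N Φ m y) : Shift N Φ.symm y m where
  plus j hj := by
    have e : j.1 - (y.1 - m.1) - m.1 = j.1 - y.1 := by abel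
    let i : NSite n := ⟨j.1 - (y.1 - m.1),
      (notMem_range_of_far hm (Or.inl (by rw [e]; exact hj))).1⟩
    have h1 : Φ i = j := Subtype.ext (by
      rw [h.plus i (by rw [e]; exact hj)]; simp [i])
    rw [(Equiv.symm_apply_eq Φ).2 h1.symm]
    simp only [i]; abel
  minus j hj := by
    have e : j.1 + (y.1 - m.1) + m.1 = j.1 + y.1 := by abel
    let i : NSite n := ⟨j.1 + (y.1 - m.1),
      (notMem_range_of_far hm (Or.inr (by rw [e]; exact hj))).1⟩
    have h1 : Φ i = j := Subtype.ext (by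
      rw [h.minus i (by rw [e]; exact hj)]; simp [i])
    rw [(Equiv.symm_apply_eq Φ).2 h1.symm]
    simp only [i]; abel
  low j hj := (Equiv.symm_apply_eq Φ).2 (h.low j hj).symm

end Perm

/-! ### The terms of a bracket that contribute to a bilinear monomial -/

section Structure

variable {d b : ℕ} {n : Fin b → Fin d → ℤ} {N : ℕ} {τ₀ τ θ₁ μ₁ θ₂ μ₂ θ μ : ℝ} {w : Mon n}
  {m m' : NSite n} {σ σ' : Bool} {V : Submodule ℝ (Fin d → ℝ)}

/-- Closeness up to sign, at the scale `N³`. -/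
def Near (N : ℕ) (x y : NSite n) : Prop :=
  len (x.1 - y.1) ≤ 5 * (N : ℝ) ^ 3 ∨ len (x.1 + y.1) ≤ 5 * (N : ℝ) ^ 3

/-- Monomials in low sites. -/
def Low (N : ℕ) (x : Mon n) : Prop := absK x.1 < N ∧ lowM x ≤ 20 * (N : ℝ) ^ 3

/-- Low monomials, and bilinear monomials near `m` with the cut `V`. -/
def Nice (τ₀ : ℝ) (N : ℕ) (θ μ τ : ℝ) (m : NSite n) (V : Submodule ℝ (Fin d → ℝ)) (x : Mon n) :
    Prop :=
  Low N x ∨ ∃ w a σa c σc, x = w + monS a σa + monS c σc ∧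
    Bi τ₀ N θ μ τ w a σa c σc V ∧ Near N a m ∧ Near N c m

theorem site_cases (v : Var n) :
    (∃ j σ, mon v = monS j σ ∧ mon (dual v) = monS j (!σ)) ∨
      (mom (mon v) = 0 ∧ mom (mon (dual v)) = 0) := by
  rcases v with (i | i) | (j | j)
  · exact Or.inr ⟨mom_th i, mom_I i⟩
  · exact Or.inr ⟨mom_I i, mom_th i⟩
  · exact Or.inl ⟨j, true, rfl, rfl⟩
  · exact Or.inl ⟨j, false, rfl, rfl⟩

theorem lowM_mon (v : Var n) : lowM (mon v) = len (mom (mon v)) := by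
  have h : ∀ (j : NSite n) σ, lowM (monS j σ) = len (mom (monS j σ)) := by
    intro j σ
    rw [lowM_monS, mom_monS, len_smul]
    rcases sg_cases σ with h | h <;> simp [h]
  rcases v with (i | i) | (j | j)
  · rw [mom_th, lowM_th, len_zero]
  · change lowM (monI i) = len (mom (monI i)); rw [mom_I, lowM_I, len_zero]
  · exact h j true
  · exact h j false

theorem split_monS {p q x : Mon n} {j : NSite n} {σ : Bool} (h : p + q = x + monS j σ) :
    (∃ p', p = p' + monS j σ ∧ p' + q = x) ∨ ∃ q', q = q' + monS j σ ∧ p + q' = x := by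
  have hv : ∃ v : Var n, ¬ IsAngle v ∧ monS j σ = mon v := by
    cases σ
    · exact ⟨vZb j, id, rfl⟩
    · exact ⟨vZ j, id, rfl⟩
  obtain ⟨v, hv, he⟩ := hv
  rw [he] at h ⊢
  by_cases h0 : cntF p v = 0
  · have h1 : cntF q v ≠ 0 := by
      intro h1
      have h2 := cntF_add_of_not_angle hv p q
      rw [h0, h1, h, cntF_add_mon hv] at h2
      simp at h2
    obtain ⟨q', rfl⟩ := exists_eq_add_mon hv h1
    exact Or.inr ⟨q', rfl, add_right_cancel (by rw [← h, add_assoc])⟩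
  · obtain ⟨p', rfl⟩ := exists_eq_add_mon hv h0
    exact Or.inl ⟨p', rfl, add_right_cancel (by rw [← h, add_right_comm])⟩

theorem near_of_mom (hg : Gap n τ₀ N τ θ₁ μ₁ θ₂ μ₂) {a j : NSite n} {σa σj : Bool}
    (hfreq : absK w.1 < N) (hlow : lowM w ≤ μ₂ * (N : ℝ) ^ 3)
    (h : mom (w + monS a σa + monS j σj) = 0) : Near N j a := by
  rw [mom_pair] at h
  refine near_or_of_signed ((signed_le_of_mom hfreq.le h).trans ?_)
  have := hg.small₂
  linarith

theorem high_of_near (hg : Gap n τ₀ N τ θ₁ μ₁ θ₂ μ₂) {a j : NSite n}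
    (ha : θ₂ * (N : ℝ) ^ tau1 d τ₀ < len a.1) (h : Near N j a) :
    θ₁ * (N : ℝ) ^ tau1 d τ₀ < len j.1 := by
  have := hg.highgap
  rcases h with h | h
  · have h1 := len_sub_le j.1 (j.1 - a.1)
    rw [sub_sub_cancel] at h1
    linarith
  · have h1 := len_sub_le (j.1 + a.1) j.1
    rw [add_sub_cancel_left] at h1
    linarith

theorem Gap.far₂ (hg : Gap n τ₀ N τ θ₁ μ₁ θ₂ μ₂) :
    100 * (N : ℝ) ^ 3 + C1 n ≤ θ₂ * (N : ℝ) ^ tau1 d τ₀ :=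
  hg.far.trans (mul_le_mul_of_nonneg_right hg.theta_le (by positivity))

theorem C1_nonneg (n : Fin b → Fin d → ℤ) : 0 ≤ C1 n := Real.iSup_nonneg fun _ => len_nonneg _

theorem mom_ne_of_high (hg : Gap n τ₀ N τ θ₁ μ₁ θ₂ μ₂) {a : NSite n} {σa : Bool}
    (ha : θ₂ * (N : ℝ) ^ tau1 d τ₀ < len a.1)
    (hfreq : absK w.1 < N) (hlow : lowM w ≤ μ₂ * (N : ℝ) ^ 3) (h : mom w + sg σa • a.1 = 0) :
    False := by
  have h1 : len (sg σa • a.1) = len (mom w) := by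
    rw [(neg_eq_of_add_eq_zero_right h).symm, len_neg]
  have h2 : len (sg σa • a.1) = len a.1 := by
    rw [len_smul]; rcases sg_cases σa with h | h <;> simp [h]
  have h3 := len_mom_le w
  have h4 := hg.small₂
  have h5 := hg.far₂
  have hC := C1_nonneg n
  have : C1 n * absK w.1 ≤ C1 n * N := mul_le_mul_of_nonneg_left hfreq.le hC
  have : (0 : ℝ) ≤ (N : ℝ) ^ 3 := by positivity
  linarith

theorem nice_of_bracket (hg : Gap n τ₀ N τ θ₁ μ₁ θ₂ μ₂) (h : Bi τ₀ N θ₂ μ₂ τ w m σ m' σ' V)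
    {p q : Mon n} (hpq : p + q = w + monS m σ + monS m' σ') (v : Var n)
    (hx : mom (p + mon v) = 0) (hy : mom (q + mon (dual v)) = 0)
    (hfx : absK (p + mon v).1 < N) (hfy : absK (q + mon (dual v)).1 < N) :
    Nice τ₀ N θ₁ μ₁ τ m V (p + mon v) := by
  have hC := C1_nonneg n
  have hN3 : (0 : ℝ) ≤ (N : ℝ) ^ 3 := by positivity
  have hfx' : absK p.1 < N := by simpa [fst_mon] using hfx
  have hfy' : absK q.1 < N := by simpa [fst_mon] using hfy
  have hself : Near N m m := Or.inl (by rw [sub_self, len_zero]; positivity)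
  have hsm := hg.small₂
  have hdual : len (mom (mon v)) = len (mom (mon (dual v))) := by
    have := mom_mon_dual v
    rw [← neg_eq_of_add_eq_zero_right this, len_neg]
  rcases split_monS hpq with ⟨p₁, rfl, h1⟩ | ⟨q₁, rfl, h1⟩ <;>
    rcases split_monS h1 with ⟨p₂, rfl, h2⟩ | ⟨q₂, rfl, h2⟩
  · -- both sites in `p`
    have hlow : lowM p₂ + lowM q = lowM w := by rw [← h2, lowM_add]
    have hwlow := h.low
    refine Or.inr ⟨p₂ + mon v, m, σ, m', σ', by abel, ⟨?_, ?_, ?_, ?_, ?_, h.pos, h.lt,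
      hg.cut_self h.cut, hg.cut_self h.cut'⟩, hself, h.near hg⟩
    · rw [← hx]; congr 1; abel
    · simpa [fst_mon] using hfx'
    · exact high_of_near hg h.high hself
    · exact high_of_near hg h.high' (Or.inl (by rw [sub_self, len_zero]; positivity))
    · rw [lowM_add, lowM_mon, hdual]
      rw [mom_add] at hy
      rw [← neg_eq_of_add_eq_zero_right hy, len_neg]
      have h3 := len_mom_le q
      have h4 : C1 n * absK q.1 ≤ C1 n * N := mul_le_mul_of_nonneg_left hfy'.le hC
      have h5 := hg.lowgap
      linarith
  · -- `m'` in `p`, `m` in `q`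
    have hlow : lowM p₁ + lowM q₂ = lowM w := by rw [← h2, lowM_add]
    have hp0 := lowM_nonneg p₁
    have hq0 := lowM_nonneg q₂
    have hwlow := h.low
    have hfp : absK p₁.1 < N := by simpa using hfx'
    have hfq : absK q₂.1 < N := by simpa using hfy'
    rcases site_cases v with ⟨j, σj, hv, hv'⟩ | ⟨hv, hv'⟩
    · rw [hv] at hx ⊢
      rw [hv'] at hy
      have hj : Near N j m := near_of_mom hg hfq (by linarith) hy
      exact Or.inr ⟨p₁, m', σ', j, σj, rfl, ⟨hx, hfp, high_of_near hg h.high'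
        (Or.inl (by rw [sub_self, len_zero]; positivity)), high_of_near hg h.high hj,
        by have := hg.mu_le; nlinarith, h.pos, h.lt, hg.cut_self h.cut', hg.cut_near h.cut hj⟩,
        h.near hg, hj⟩
    · rw [mom_add, hv, add_zero, mom_add, mom_monS] at hx
      exact (mom_ne_of_high hg h.high' hfp (by linarith) hx).elim
  · -- `m` in `p`, `m'` in `q`
    have hlow : lowM p₂ + lowM q₁ = lowM w := by rw [← h2, lowM_add]
    have hp0 := lowM_nonneg p₂
    have hq0 := lowM_nonneg q₁
    have hwlow := h.low
    have hfp : absK p₂.1 < N := by simpa using hfx'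
    rcases site_cases v with ⟨j, σj, hv, hv'⟩ | ⟨hv, hv'⟩
    · rw [hv] at hx ⊢
      have hj : Near N j m := near_of_mom hg hfp (by linarith) hx
      exact Or.inr ⟨p₂, m, σ, j, σj, rfl, ⟨hx, hfp, high_of_near hg h.high hself,
        high_of_near hg h.high hj, by have := hg.mu_le; nlinarith, h.pos, h.lt,
        hg.cut_self h.cut, hg.cut_near h.cut hj⟩, hself, hj⟩
    · rw [mom_add, hv, add_zero, mom_add, mom_monS] at hx
      exact (mom_ne_of_high hg h.high hfp (by linarith) hx).elim
  · -- both sites in `q`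
    have hlow : lowM p + lowM q₂ = lowM w := by rw [← h2, lowM_add]
    have hq0 := lowM_nonneg q₂
    have hwlow := h.low
    refine Or.inl ⟨hfx, ?_⟩
    rw [lowM_add, lowM_mon]
    rw [mom_add] at hx
    rw [← neg_eq_of_add_eq_zero_right hx, len_neg]
    have h3 := len_mom_le p
    have h4 : C1 n * absK p.1 ≤ C1 n * N := mul_le_mul_of_nonneg_left hfx'.le hC
    have h5 : 0 ≤ C1 n * N := by positivity
    linarith

theorem permM_low {Φ : Equiv.Perm (NSite n)} {y : NSite n} (hΦ : Shift N Φ m y) {x : Mon n}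
    (hx : lowM x ≤ 20 * (N : ℝ) ^ 3) : permM Φ x = x := by
  refine permM_eq_self Φ fun j hj => hΦ.low j (le_trans ?_ hx)
  have key : ∀ α : NSite n →₀ ℕ, α j ≠ 0 → len j.1 ≤ α.sum fun j a => len j.1 * (a : ℝ) := by
    intro α hα
    refine le_trans ?_ (Finset.single_le_sum (f := fun j => len j.1 * ((α j : ℕ) : ℝ))
      (fun _ _ => mul_nonneg (len_nonneg _) (Nat.cast_nonneg _)) (Finsupp.mem_support_iff.2 hα))
    have : (1 : ℝ) ≤ α j := by exact_mod_cast Nat.one_le_iff_ne_zero.2 hα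
    nlinarith [len_nonneg j.1]
  have h0 : ∀ α : NSite n →₀ ℕ, 0 ≤ α.sum fun j a => len j.1 * (a : ℝ) := fun α =>
    Finset.sum_nonneg fun _ _ => mul_nonneg (len_nonneg _) (Nat.cast_nonneg _)
  unfold lowM
  rcases hj with hj | hj
  · have := key _ hj; have := h0 x.2.2.2; linarith
  · have := key _ hj; have := h0 x.2.2.1; linarith

/-- A signed translation of sites near `m`. -/
theorem Shift.exists_sign {Φ : Equiv.Perm (NSite n)} {y a : NSite n} (hΦ : Shift N Φ m y)
    (ha : Near N a m) : ∃ e : ℤ, (e = 1 ∨ e = -1) ∧ len (a.1 - e • m.1) ≤ 5 * (N : ℝ) ^ 3 ∧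
      (Φ a).1 = a.1 + e • (y.1 - m.1) := by
  rcases ha with h | h
  · exact ⟨1, Or.inl rfl, by simpa using h, by simpa using hΦ.plus a h⟩
  · refine ⟨-1, Or.inr rfl, by simpa using h, ?_⟩
    rw [hΦ.minus a h, neg_one_smul, sub_eq_add_neg]

theorem Bi.shift (hg : Gap n τ₀ N τ θ₁ μ₁ θ₂ μ₂) {Φ : Equiv.Perm (NSite n)} {y a c : NSite n}
    {σa σc : Bool} (hΦ : Shift N Φ m y) (h : Bi τ₀ N θ₁ μ₁ τ w a σa c σc V) (ha : Near N a m)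
    (hc : Near N c m) (hm : θ₂ * (N : ℝ) ^ tau1 d τ₀ < len m.1)
    (hy : θ₂ * (N : ℝ) ^ tau1 d τ₀ < len y.1) (hV : CutV n N θ₂ μ₂ τ y.1 V) :
    Bi τ₀ N θ₁ μ₁ τ w (Φ a) σa (Φ c) σc V := by
  obtain ⟨e, he, ha1, ha2⟩ := hΦ.exists_sign ha
  obtain ⟨e', he', hc1, hc2⟩ := hΦ.exists_sign hc
  have hN3 : (0 : ℝ) ≤ (N : ℝ) ^ 3 := by positivity
  have hC := C1_nonneg n
  have hmom := h.momentum
  rw [mom_pair] at hmom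
  have hsgn : sg σa * e + sg σc * e' = 0 := by
    by_contra hne
    have h1 := signed_le_of_mom h.freq.le hmom
    have h2 : (sg σa * e + sg σc * e') • m.1 = (sg σa • a.1 + sg σc • c.1) -
        (sg σa • (a.1 - e • m.1) + sg σc • (c.1 - e' • m.1)) := by
      rw [smul_sub, smul_sub, add_smul, mul_smul, mul_smul]; abel
    have h3 := len_sub_le (sg σa • a.1 + sg σc • c.1)
        (sg σa • (a.1 - e • m.1) + sg σc • (c.1 - e' • m.1))
    have h4 := len_add_le (sg σa • (a.1 - e • m.1)) (sg σc • (c.1 - e' • m.1))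
    have hs : ∀ (σ : Bool) (x : Fin d → ℤ), len (sg σ • x) = len x := by
      intro σ x; rw [len_smul]; rcases sg_cases σ with h | h <;> simp [h]
    rw [hs, hs] at h4
    rw [← h2, len_smul] at h3
    have h5 : (1 : ℝ) ≤ |((sg σa * e + sg σc * e' : ℤ) : ℝ)| := by
      rw [← Int.cast_abs]
      exact_mod_cast Int.one_le_abs hne
    have h6 := hg.small
    have h7 := hg.far₂
    have h8 := h.low
    nlinarith [len_nonneg m.1]
  have hna : Near N (Φ a) y := by
    have : (Φ a).1 - e • y.1 = a.1 - e • m.1 := by rw [ha2, smul_sub]; abel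
    rw [← this] at ha1
    rcases he with rfl | rfl
    · exact Or.inl (by simpa using ha1)
    · exact Or.inr (by simpa using ha1)
  have hnc : Near N (Φ c) y := by
    have : (Φ c).1 - e' • y.1 = c.1 - e' • m.1 := by rw [hc2, smul_sub]; abel
    rw [← this] at hc1
    rcases he' with rfl | rfl
    · exact Or.inl (by simpa using hc1)
    · exact Or.inr (by simpa using hc1)
  refine ⟨?_, h.freq, high_of_near hg hy hna, high_of_near hg hy hnc, h.low, h.pos, h.lt,
    hg.cut_near hV hna, hg.cut_near hV hnc⟩
  rw [mom_pair, ha2, hc2]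
  calc _ = (mom w + sg σa • a.1 + sg σc • c.1) +
        (sg σa * e + sg σc * e') • (y.1 - m.1) := by
        rw [smul_add, smul_add, add_smul, mul_smul, mul_smul]; abel
    _ = 0 := by rw [hmom, hsgn, zero_smul, add_zero]

theorem Shift.map_pair (hg : Gap n τ₀ N τ θ₁ μ₁ θ₂ μ₂) {Φ : Equiv.Perm (NSite n)} {y y' : NSite n}
    (hΦ : Shift N Φ m y) (h : Bi τ₀ N θ₂ μ₂ τ w m σ m' σ' V)
    (h' : Bi τ₀ N θ₂ μ₂ τ w y σ y' σ' V) :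
    permM Φ (w + monS m σ + monS m' σ') = w + monS y σ + monS y' σ' := by
  have hself : Near N m m := Or.inl (by rw [sub_self, len_zero]; positivity)
  have hs := (h.mono hg).shift hg hΦ hself (h.near hg) h.high h'.high h'.cut
  have hm : Φ m = y := Subtype.ext (by
    rw [hΦ.plus m (by rw [sub_self, len_zero]; positivity)]; abel)
  have hm' : Φ m' = y' := by
    have h1 := hs.momentum
    have h2 := h'.momentum
    rw [hm, mom_pair] at h1
    rw [mom_pair] at h2
    have h3 : sg σ' • (Φ m').1 = sg σ' • y'.1 := add_left_cancel (h1.trans h2.symm)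
    refine Subtype.ext ?_
    rcases sg_cases σ' with h | h <;> simpa [h] using h3
  have hw : permM Φ w = w := permM_low hΦ (by
    have := h.low; have := hg.small₂; have := C1_nonneg n
    have : 0 ≤ C1 n * N := by positivity
    have : (0 : ℝ) ≤ (N : ℝ) ^ 3 := by positivity
    linarith)
  rw [map_add, map_add, permM_monS, permM_monS, hm, hm', hw]

/-- Pairs of bilinear monomials with the same cut are related by a translation of sites. -/
theorem Bi.exists_shift (hg : Gap n τ₀ N τ θ₁ μ₁ θ₂ μ₂) {y y' : NSite n}
    (h : Bi τ₀ N θ₂ μ₂ τ w m σ m' σ' V) (h' : Bi τ₀ N θ₂ μ₂ τ w y σ y' σ' V) :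
    ∃ Φ, Shift N Φ m y ∧ permM Φ (w + monS m σ + monS m' σ') = w + monS y σ + monS y' σ' := by
  obtain ⟨Φ, hΦ⟩ := QT.exists_shift (hg.far₂.trans_lt h.high) (hg.far₂.trans_lt h'.high)
  exact ⟨Φ, hΦ, hΦ.map_pair hg h h'⟩

theorem far_of_bi (hg : Gap n τ₀ N τ θ₁ μ₁ θ₂ μ₂) (h : Bi τ₀ N θ₁ μ₁ τ w m σ m' σ' V) :
    ¬ Low N (w + monS m σ + monS m' σ') := by
  rintro ⟨_, hl⟩
  have h1 := hg.far
  have h2 := h.high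
  rw [lowM_add, lowM_add, lowM_monS, lowM_monS] at hl
  have := lowM_nonneg w
  have := len_nonneg m'.1
  have := C1_nonneg n
  have : (0 : ℝ) ≤ (N : ℝ) ^ 3 := by positivity
  have : (2 : ℝ) ≤ N := by exact_mod_cast hg.two_le
  have : (0 : ℝ) < (N : ℝ) ^ 3 := by positivity
  linarith

/-- The brackets of functions with an invariant bilinear part are invariant. -/
theorem nice_invariant (hg : Gap n τ₀ N τ θ₁ μ₁ θ₂ μ₂) {O : Set (Par b)} {φ φL G : Ham n}
    (hφ : ∀ x ξ, φ x ξ = φL x ξ + G x ξ) (hL : ∀ x, ¬ Low N x → ∀ ξ, φL x ξ = 0)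
    (hG : TopInv τ₀ N θ₁ μ₁ τ O G) {Φ : Equiv.Perm (NSite n)} {y : NSite n} (hΦ : Shift N Φ m y)
    (hm : θ₂ * (N : ℝ) ^ tau1 d τ₀ < len m.1) (hy : θ₂ * (N : ℝ) ^ tau1 d τ₀ < len y.1)
    (hV : CutV n N θ₂ μ₂ τ y.1 V) (ht : ∀ u ∈ V, u ⬝ᵥ toR (y.1 - m.1) = 0) {x : Mon n}
    (hx : Nice τ₀ N θ₁ μ₁ τ m V x) {ξ : Par b} (hξ : ξ ∈ O) : φ (permM Φ x) ξ = φ x ξ := by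
  rcases hx with hx | ⟨w', a, σa, c, σc, rfl, hb, ha, hc⟩
  · rw [permM_low hΦ hx.2]
  · have hb' := hb.shift hg hΦ ha hc hm hy hV
    have hw : permM Φ w' = w' := permM_low hΦ (by
      have := hb.low; have := hg.small; have := C1_nonneg n
      have : 0 ≤ C1 n * N := by positivity
      have : (0 : ℝ) ≤ (N : ℝ) ^ 3 := by positivity
      linarith)
    rw [map_add, map_add, permM_monS, permM_monS, hw, hφ, hφ, hL _ (far_of_bi hg hb),
      hL _ (far_of_bi hg hb'), zero_add, zero_add]
    obtain ⟨e, _, _, ha2⟩ := hΦ.exists_sign ha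
    refine (hG _ _ _ _ _ _ _ _ hb hb' ?_ ξ hξ).symm
    rw [ha2, add_sub_cancel_left]
    exact orth_smul ht e

theorem topInv_poisson (hg : Gap n τ₀ N τ θ₁ μ₁ θ₂ μ₂) {O : Set (Par b)}
    {φ φL Gφ ψ ψL Gψ : Ham n} (hφ : ∀ x ξ, φ x ξ = φL x ξ + Gφ x ξ)
    (hφL : ∀ x, ¬ Low N x → ∀ ξ, φL x ξ = 0) (hGφ : TopInv τ₀ N θ₁ μ₁ τ O Gφ)
    (hφm : ∀ x, ∀ ξ ∈ O, φ x ξ ≠ 0 → mom x = 0 ∧ absK x.1 < N)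
    (hψ : ∀ x ξ, ψ x ξ = ψL x ξ + Gψ x ξ)
    (hψL : ∀ x, ¬ Low N x → ∀ ξ, ψL x ξ = 0) (hGψ : TopInv τ₀ N θ₁ μ₁ τ O Gψ)
    (hψm : ∀ x, ∀ ξ ∈ O, ψ x ξ ≠ 0 → mom x = 0 ∧ absK x.1 < N) :
    TopInv τ₀ N θ₂ μ₂ τ O (poisson φ ψ) := by
  intro w m σ m' σ' y y' V h h' ht ξ hξ
  obtain ⟨Φ, hΦ, he⟩ := h.exists_shift hg h'
  have hΦ' := hΦ.symm (hg.far₂.trans_lt h.high)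
  have he' : permM Φ.symm (w + monS y σ + monS y' σ') = w + monS m σ + monS m' σ' := by
    rw [← he, permM_symm_apply]
  have ht' : ∀ u ∈ V, u ⬝ᵥ toR (m.1 - y.1) = 0 := by
    have := orth_smul ht (-1)
    simpa using this
  -- one direction: nonzero products are preserved
  have key : ∀ {Φ : Equiv.Perm (NSite n)} {m m' y : NSite n}, Bi τ₀ N θ₂ μ₂ τ w m σ m' σ' V →
      θ₂ * (N : ℝ) ^ tau1 d τ₀ < len y.1 → CutV n N θ₂ μ₂ τ y.1 V →
      (∀ u ∈ V, u ⬝ᵥ toR (y.1 - m.1) = 0) → Shift N Φ m y → ∀ (v : Var n) (p q : Mon n),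
      p + q = w + monS m σ + monS m' σ' → φ (p + mon v) ξ * ψ (q + mon (dual v)) ξ ≠ 0 →
      φ (permM Φ (p + mon v)) ξ * ψ (permM Φ (q + mon (dual v))) ξ =
        φ (p + mon v) ξ * ψ (q + mon (dual v)) ξ := by
    intro Φ m m' y h hy hV ht hΦ v p q hpq hne
    obtain ⟨h1, h2⟩ := hφm _ ξ hξ (left_ne_zero_of_mul hne)
    obtain ⟨h3, h4⟩ := hψm _ ξ hξ (right_ne_zero_of_mul hne)
    have hn1 := nice_of_bracket hg h hpq v h1 h3 h2 h4
    have hvv : dual (dual v) = v := by rcases v with (i | i) | (j | j) <;> rfl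
    have hn2 := nice_of_bracket hg h ((add_comm q p).trans hpq) (dual v) h3 (by rwa [hvv]) h4
      (by rwa [hvv])
    rw [nice_invariant hg hφ hφL hGφ hΦ h.high hy hV ht hn1 hξ,
      nice_invariant hg hψ hψL hGψ hΦ h.high hy hV ht hn2 hξ]
  rw [← he, poisson_perm]
  refine poisson_congr fun v p q hpq => ?_
  by_cases h1 : φ (p + mon v) ξ * ψ (q + mon (dual v)) ξ = 0
  · rw [h1]
    by_contra h2
    have hmon : ∀ v : Var n, ∃ v' : Var n, permM Φ (mon v) = mon v' ∧
        permM Φ (mon (dual v)) = mon (dual v') := by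
      rintro ((i | i) | (j | j))
      · exact ⟨vTh i, map_zero _, permM_monI Φ i⟩
      · exact ⟨vI i, permM_monI Φ i, map_zero _⟩
      · exact ⟨vZ (Φ j), permM_monZ Φ j, permM_monZb Φ j⟩
      · exact ⟨vZb (Φ j), permM_monZb Φ j, permM_monZ Φ j⟩
    obtain ⟨v', e1, e2⟩ := hmon v
    have h3 := key h' h.high h.cut ht' hΦ' v' (permM Φ p) (permM Φ q)
      (by rw [← map_add, hpq, he])
    rw [← e1, ← e2, ← map_add, ← map_add, permM_symm_apply, permM_symm_apply] at h3
    have h4 := h3 (fun h0 => h2 h0.symm)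
    exact h2 (h1.symm.trans h4)
  · exact (key h h'.high h'.cut ht hΦ v p q hpq h1).symm

end Structure

/-! ### Bounded functions and brackets -/

section Bounded

variable {d b : ℕ} {n : Fin b → Fin d → ℤ} {ρ r s : ℝ} {O : Set (Par b)} {f g : Ham n}
  {A B C : ℝ}

/-- `f` is of class `C¹`, conserves momentum and its vector field is bounded by `B`. -/
structure HB (ρ : ℝ) (O : Set (Par b)) (r s : ℝ) (f : Ham n) (B : ℝ) : Prop where
  c1 : C1On O f
  momentum : ∀ ν, mom ν ≠ 0 → ∀ ξ ∈ O, f ν ξ = 0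
  bound : XN ρ r s (hat O f) ≤ ENNReal.ofReal B

theorem HB.inA (hr : 0 ≤ r) (hwt : ∀ m : NSite n, 1 ≤ weight ρ m) (h : HB ρ O r s f B) :
    InA ρ O r s f :=
  ⟨h.c1, h.momentum, by rw [XNorm_eq hr hwt]; exact h.bound.trans_lt ENNReal.ofReal_lt_top⟩

theorem InA.hb (hr : 0 ≤ r) (hwt : ∀ m : NSite n, 1 ≤ weight ρ m) (h : InA ρ O r s f)
    (hB : XNorm ρ O r s f ≤ ENNReal.ofReal B) : HB ρ O r s f B :=
  ⟨h.contDiff, h.momentum, by rwa [XNorm_eq hr hwt] at hB⟩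

theorem HB.mono (h : HB ρ O r s f A) (hAB : A ≤ B) : HB ρ O r s f B :=
  ⟨h.c1, h.momentum, h.bound.trans (ENNReal.ofReal_le_ofReal hAB)⟩

theorem HB.lt_top (h : HB ρ O r s f B) : XN ρ r s (hat O f) < ⊤ :=
  h.bound.trans_lt ENNReal.ofReal_lt_top

theorem HB.subset {O' : Set (Par b)} (hO : O' ⊆ O) (h : HB ρ O r s f B) : HB ρ O' r s f B :=
  ⟨fun ν => (h.c1 ν).mono hO, fun ν hν ξ hξ => h.momentum ν hν ξ (hO hξ),
    (XN_mono fun _ => coefNorm_mono hO _).trans h.bound⟩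

theorem XN_shrink {r' s' : ℝ} (hr : 0 < r) (hr' : r ≤ r') (hs : s ≤ s') {a : Hat n}
    (h : XN ρ r' s' a ≤ ENNReal.ofReal B) :
    XN ρ r s a ≤ ENNReal.ofReal ((r' / r) ^ 2 * B) := by
  refine (XN_scale a hr hr' hs).trans ?_
  rw [ENNReal.ofReal_mul (by positivity)]
  exact mul_le_mul' le_rfl h

theorem HB.shrink {r' s' : ℝ} (hr : 0 < r) (hr' : r ≤ r') (hs : s ≤ s') (h : HB ρ O r' s' f B) :
    HB ρ O r s f ((r' / r) ^ 2 * B) := ⟨h.c1, h.momentum, XN_shrink hr hr' hs h.bound⟩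

theorem HB.shrink_s {s' : ℝ} (hr : 0 < r) (hs : s ≤ s') (h : HB ρ O r s' f B) :
    HB ρ O r s f B := by simpa [div_self hr.ne'] using h.shrink hr le_rfl hs

/-- The part of `f` with monomials in `χ`. -/
def maskH (χ : Mon n → Prop) (f : Ham n) : Ham n :=
  fun ν ξ => open Classical in if χ ν then f ν ξ else 0

theorem maskH_pos {χ : Mon n → Prop} {ν : Mon n} (h : χ ν) : maskH χ f ν = f ν := by
  funext ξ; simp [maskH, h]

theorem maskH_neg {χ : Mon n → Prop} {ν : Mon n} (h : ¬ χ ν) : maskH χ f ν = fun _ => 0 := by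
  funext ξ; simp [maskH, h]

theorem hat_maskH_le (χ : Mon n → Prop) (f : Ham n) : hat O (maskH χ f) ≤ hat O f := by
  intro ν
  by_cases h : χ ν
  · simp [hat, maskH_pos h]
  · simp [hat, maskH_neg h]

theorem C1On.maskH (h : C1On O f) (χ : Mon n → Prop) : C1On O (maskH χ f) := by
  intro ν
  by_cases hχ : χ ν
  · rw [maskH_pos hχ]; exact h ν
  · rw [maskH_neg hχ]; exact contDiffOn_const

theorem HB.maskH (h : HB ρ O r s f B) (χ : Mon n → Prop) : HB ρ O r s (maskH χ f) B := by
  refine ⟨h.c1.maskH χ, fun ν hν ξ hξ => ?_, (XN_mono (hat_maskH_le χ f)).trans h.bound⟩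
  simp [QT.maskH, h.momentum ν hν ξ hξ]

theorem hat_add_le (hO : IsOpen O) (hf : C1On O f) (hg : C1On O g) :
    hat O (f + g) ≤ hat O f + hat O g := fun ν => coefNorm_add_le hO (hf ν) (hg ν)

theorem XN_add_le_ofReal {a c : Hat n} (hA : 0 ≤ A) (hB : 0 ≤ B)
    (ha : XN ρ r s a ≤ ENNReal.ofReal A) (hc : XN ρ r s c ≤ ENNReal.ofReal B) :
    XN ρ r s (a + c) ≤ ENNReal.ofReal (A + B) := by
  rw [ENNReal.ofReal_add hA hB]
  exact (XN_add_le ρ r s a c).trans (add_le_add ha hc)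

theorem HB.add (hO : IsOpen O) (hA : 0 ≤ A) (hB : 0 ≤ B) (hf : HB ρ O r s f A)
    (hg : HB ρ O r s g B) : HB ρ O r s (f + g) (A + B) :=
  ⟨fun ν => (hf.c1 ν).add (hg.c1 ν),
    fun ν hν ξ hξ => by simp [hf.momentum ν hν ξ hξ, hg.momentum ν hν ξ hξ],
    (XN_mono (hat_add_le hO hf.c1 hg.c1)).trans (XN_add_le_ofReal hA hB hf.bound hg.bound)⟩

theorem hat_smul (q : ℂ) (f : Ham n) : hat O (q • f) = fun ν => ‖q‖ₑ * hat O f ν := by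
  funext ν; exact coefNorm_const_mul q (f ν)

theorem C1On.smul (q : ℂ) (h : C1On O f) : C1On O (q • f) := fun ν => contDiffOn_const.mul (h ν)

theorem XN_smul_ofReal (q : ℂ) (h : XN ρ r s (hat O f) ≤ ENNReal.ofReal B) :
    XN ρ r s (hat O (q • f)) ≤ ENNReal.ofReal (‖q‖ * B) := by
  rw [hat_smul]
  refine (XN_smul_le _ _ _ _ _).trans ?_
  rw [ENNReal.ofReal_mul (norm_nonneg _), ofReal_norm]
  exact mul_le_mul' le_rfl h

theorem HB.smul (q : ℂ) (h : HB ρ O r s f B) : HB ρ O r s (q • f) (‖q‖ * B) :=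
  ⟨h.c1.smul q, fun ν hν ξ hξ => by simp [h.momentum ν hν ξ hξ], XN_smul_ofReal q h.bound⟩

theorem HB.zero : HB ρ O r s (0 : Ham n) 0 := by
  have h := XN_smul_le ρ r s 0 (0 : Hat n)
  have h0 : hat O (0 : Ham n) = fun _ => 0 := by funext ν; exact coefNorm_zero
  refine ⟨fun ν => contDiffOn_const, fun _ _ _ _ => rfl, ?_⟩
  rw [h0]
  simpa using h

variable {δ : ℝ}

theorem HB.brSummable (hO : IsOpen O) (hwt : ∀ m : NSite n, 1 ≤ weight ρ m) (hr : 0 < r)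
    (hs : 0 ≤ s) (hf : HB ρ O r s f A) (hg : HB ρ O r s g C) (ν : Mon n) {ξ : Par b}
    (hξ : ξ ∈ O) : BrSummable f g ν ξ :=
  (poisson_hat hO hf.c1 hg.c1 (hbr_ne_top hr hs hwt hf.lt_top hg.lt_top ν)).2.2 ξ hξ

theorem HB.hat_poisson_le (hO : IsOpen O) (hwt : ∀ m : NSite n, 1 ≤ weight ρ m) (hr : 0 < r)
    (hs : 0 ≤ s) (hf : HB ρ O r s f A) (hg : HB ρ O r s g C) :
    hat O (poisson f g) ≤ hbr (hat O f) (hat O g) := fun ν =>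
  (poisson_hat hO hf.c1 hg.c1 (hbr_ne_top hr hs hwt hf.lt_top hg.lt_top ν)).2.1

theorem HB.poisson (hO : IsOpen O) (hwt : ∀ m : NSite n, 1 ≤ weight ρ m) (hr : 0 < r)
    (hs : 0 ≤ s) (hδ : 0 < δ) (hδ1 : δ ≤ 1) (hA : 0 < A) (hC : 0 < C)
    (hf : HB ρ O ((1 + δ) * r) (s + δ) f A) (hg : HB ρ O ((1 + δ) * r) (s + δ) g C) :
    HB ρ O r s (poisson f g) (32 / δ * A * C) where
  c1 ν := (poisson_hat hO hf.c1 hg.c1 (hbr_ne_top (by positivity) (by positivity) hwt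
    hf.lt_top hg.lt_top ν)).1
  momentum ν hν ξ hξ := poisson_momentum (fun ν h => hf.momentum ν h ξ hξ)
    (fun ν h => hg.momentum ν h ξ hξ) hν
  bound := (XN_mono (hf.hat_poisson_le hO hwt (by positivity) (by positivity) hg)).trans
    (XN_hbr_le hr hs hδ hδ1 hA hC hf.bound hg.bound)

end Bounded

/-! ### Approximation by piecewise Töplitz functions -/

section Approx

variable {d b : ℕ} {n : Fin b → Fin d → ℤ} {ρ r s : ℝ} {O : Set (Par b)} {f g : Ham n}
  {A B C δ : ℝ} {N : ℕ} {τ₀ τ θ μ θ₁ μ₁ θ₂ μ₂ : ℝ}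

/-- `f` and a piecewise Töplitz approximation of it have the quasi-Töplitz bound `B`. -/
structure TB (ρ τ₀ : ℝ) (O : Set (Par b)) (r s : ℝ) (N : ℕ) (θ μ τ : ℝ) (f : Ham n) (B : ℝ) :
    Prop where
  hb : HB ρ O r s f B
  approx : ∃ G : Ham n, HB ρ O r s G B ∧ (∀ ν, ¬ IsBilin τ₀ N θ μ τ ν → ∀ ξ ∈ O, G ν ξ = 0) ∧
    TopInv τ₀ N θ μ τ O G ∧ XN ρ r s (hat O (defect τ₀ N θ μ τ f G)) ≤ ENNReal.ofReal B

theorem defect_eq (f G : Ham n) : defect τ₀ N θ μ τ f G =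
    (((N : ℝ) ^ (4 * d * τ) : ℝ) : ℂ) • (maskH (IsBilin τ₀ N θ μ τ) f - G) := rfl

theorem C1On.sub (hf : C1On O f) (hg : C1On O g) : C1On O (f - g) := fun ν => (hf ν).sub (hg ν)

theorem C1On.defect {G : Ham n} (hf : C1On O f) (hG : C1On O G) :
    C1On O (defect τ₀ N θ μ τ f G) := by
  rw [defect_eq]
  exact ((hf.maskH _).sub hG).smul _

theorem TB.mono (h : TB ρ τ₀ O r s N θ μ τ f A) (hAB : A ≤ B) : TB ρ τ₀ O r s N θ μ τ f B := by
  obtain ⟨G, h1, h2, h3, h4⟩ := h.approx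
  exact ⟨h.hb.mono hAB, G, h1.mono hAB, h2, h3, h4.trans (ENNReal.ofReal_le_ofReal hAB)⟩

theorem TB.subset {O' : Set (Par b)} (hO : O' ⊆ O) (h : TB ρ τ₀ O r s N θ μ τ f A) :
    TB ρ τ₀ O' r s N θ μ τ f A := by
  obtain ⟨G, h1, h2, h3, h4⟩ := h.approx
  exact ⟨h.hb.subset hO, G, h1.subset hO, fun ν hν ξ hξ => h2 ν hν ξ (hO hξ),
    fun w m σ m' σ' y y' V a1 a2 ht ξ hξ => h3 w m σ m' σ' y y' V a1 a2 ht ξ (hO hξ),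
    (XN_mono fun ν => coefNorm_mono hO _).trans h4⟩

theorem TB.shrink {r' s' : ℝ} (hr : 0 < r) (hr' : r ≤ r') (hs : s ≤ s')
    (h : TB ρ τ₀ O r' s' N θ μ τ f A) : TB ρ τ₀ O r s N θ μ τ f ((r' / r) ^ 2 * A) := by
  obtain ⟨G, h1, h2, h3, h4⟩ := h.approx
  exact ⟨h.hb.shrink hr hr' hs, G, h1.shrink hr hr' hs, h2, h3, XN_shrink hr hr' hs h4⟩

theorem TB.shrink_s {s' : ℝ} (hr : 0 < r) (hs : s ≤ s') (h : TB ρ τ₀ O r s' N θ μ τ f B) :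
    TB ρ τ₀ O r s N θ μ τ f B := by simpa [div_self hr.ne'] using h.shrink hr le_rfl hs

theorem TB.smul (q : ℂ) (h : TB ρ τ₀ O r s N θ μ τ f B) :
    TB ρ τ₀ O r s N θ μ τ (q • f) (‖q‖ * B) := by
  obtain ⟨G, h1, h2, h3, h4⟩ := h.approx
  refine ⟨h.hb.smul q, q • G, h1.smul q, fun ν hν ξ hξ => by simp [h2 ν hν ξ hξ],
    fun w m σ m' σ' y y' V a1 a2 ht ξ hξ => ?_, ?_⟩
  · simp [h3 w m σ m' σ' y y' V a1 a2 ht ξ hξ]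
  · have : defect τ₀ N θ μ τ (q • f) (q • G) = q • defect τ₀ N θ μ τ f G := by
      rw [defect_eq, defect_eq, smul_comm q]
      congr 1
      funext ν ξ
      simp only [Pi.sub_apply, Pi.smul_apply, maskH, smul_eq_mul]
      split_ifs <;> simp [mul_sub]
    rw [this]
    exact XN_smul_ofReal q h4

theorem TB.add (hO : IsOpen O) (hA : 0 ≤ A) (hB : 0 ≤ B) (hf : TB ρ τ₀ O r s N θ μ τ f A)
    (hg : TB ρ τ₀ O r s N θ μ τ g B) : TB ρ τ₀ O r s N θ μ τ (f + g) (A + B) := by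
  obtain ⟨G, h1, h2, h3, h4⟩ := hf.approx
  obtain ⟨G', h1', h2', h3', h4'⟩ := hg.approx
  refine ⟨hf.hb.add hO hA hB hg.hb, G + G', h1.add hO hA hB h1',
    fun ν hν ξ hξ => by simp [h2 ν hν ξ hξ, h2' ν hν ξ hξ],
    fun w m σ m' σ' y y' V a1 a2 ht ξ hξ => ?_, ?_⟩
  · simp [h3 w m σ m' σ' y y' V a1 a2 ht ξ hξ, h3' w m σ m' σ' y y' V a1 a2 ht ξ hξ]
  · have : defect τ₀ N θ μ τ (f + g) (G + G') =
        defect τ₀ N θ μ τ f G + defect τ₀ N θ μ τ g G' := by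
      rw [defect_eq, defect_eq, defect_eq, ← smul_add]
      congr 1
      funext ν ξ
      simp only [Pi.sub_apply, Pi.add_apply, maskH]
      split_ifs <;> ring
    rw [this]
    exact (XN_mono (hat_add_le hO (hf.hb.c1.defect h1.c1) (hg.hb.c1.defect h1'.c1))).trans
      (XN_add_le_ofReal hA hB h4 h4')

theorem TB.zero : TB ρ τ₀ O r s N θ μ τ (0 : Ham n) 0 := by
  refine ⟨HB.zero, 0, HB.zero, fun _ _ _ _ => rfl, fun _ _ _ _ _ _ _ _ _ _ _ _ _ => rfl, ?_⟩
  have : defect τ₀ N θ μ τ (0 : Ham n) 0 = 0 := by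
    funext ν ξ; simp [defect, bilinProj]
  rw [this]
  exact HB.zero.bound

theorem TB.sum (hO : IsOpen O) {ι : Type*} (S : Finset ι) {f : ι → Ham n} {A : ι → ℝ}
    (hA : ∀ i ∈ S, 0 ≤ A i) (h : ∀ i ∈ S, TB ρ τ₀ O r s N θ μ τ (f i) (A i)) :
    TB ρ τ₀ O r s N θ μ τ (∑ i ∈ S, f i) (∑ i ∈ S, A i) := by
  classical
  induction S using Finset.induction_on with
  | empty => simpa using TB.zero
  | insert a S ha ih =>
    rw [Finset.sum_insert ha, Finset.sum_insert ha]
    have h1 : ∀ i ∈ S, 0 ≤ A i := fun i hi => hA i (Finset.mem_insert_of_mem hi)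
    exact TB.add hO (hA a (Finset.mem_insert_self _ _)) (Finset.sum_nonneg h1)
      (h a (Finset.mem_insert_self _ _)) (ih h1 fun i hi => h i (Finset.mem_insert_of_mem hi))

theorem hat_defect_congr_le (χ : Mon n → Prop) {θ' μ' : ℝ} {f' G' G : Ham n}
    (h : ∀ ν ξ, defect τ₀ N θ' μ' τ f' G' ν ξ = maskH χ (defect τ₀ N θ μ τ f G) ν ξ) :
    hat O (defect τ₀ N θ' μ' τ f' G') ≤ hat O (defect τ₀ N θ μ τ f G) := by
  have : defect τ₀ N θ' μ' τ f' G' = maskH χ (defect τ₀ N θ μ τ f G) := by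
    funext ν ξ; exact h ν ξ
  rw [this]
  exact hat_maskH_le _ _

/-- Parts selected by a condition that does not distinguish sites. -/
theorem TB.maskH (hg : Gap n τ₀ N τ θ₁ μ₁ θ μ) (h : TB ρ τ₀ O r s N θ μ τ f A)
    {χ : Mon n → Prop} (hχ : ∀ (Φ : Equiv.Perm (NSite n)) ν, χ (permM Φ ν) ↔ χ ν) :
    TB ρ τ₀ O r s N θ μ τ (maskH χ f) A := by
  obtain ⟨G, h1, h2, h3, h4⟩ := h.approx
  refine ⟨h.hb.maskH χ, QT.maskH χ G, h1.maskH χ, fun ν hν ξ hξ => ?_,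
    fun w m σ m' σ' y y' V a1 a2 ht ξ hξ => ?_, (XN_mono (hat_defect_congr_le χ ?_)).trans h4⟩
  · simp [QT.maskH, h2 ν hν ξ hξ]
  · obtain ⟨Φ, _, he⟩ := a1.exists_shift hg a2
    have := hχ Φ (w + monS m σ + monS m' σ')
    rw [he] at this
    by_cases h0 : χ (w + monS m σ + monS m' σ')
    · rw [maskH_pos h0, maskH_pos (this.2 h0), h3 w m σ m' σ' y y' V a1 a2 ht ξ hξ]
    · rw [maskH_neg h0, maskH_neg fun h' => h0 (this.1 h')]
  · intro ν ξ
    simp only [defect, bilinProj, QT.maskH]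
    split_ifs <;> simp

/-- Loss of parameters. -/
theorem TB.params (hg : Gap n τ₀ N τ θ₁ μ₁ θ₂ μ₂) (h : TB ρ τ₀ O r s N θ₁ μ₁ τ f A) :
    TB ρ τ₀ O r s N θ₂ μ₂ τ f A := by
  obtain ⟨G, h1, h2, h3, h4⟩ := h.approx
  refine ⟨h.hb, QT.maskH (IsBilin τ₀ N θ₂ μ₂ τ) G, h1.maskH _, fun ν hν ξ hξ => by
    simp [QT.maskH, hν], fun w m σ m' σ' y y' V a1 a2 ht ξ hξ => ?_,
    (XN_mono (hat_defect_congr_le (IsBilin τ₀ N θ₂ μ₂ τ) ?_)).trans h4⟩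
  · rw [maskH_pos (a1.isBilin hg.ne hg.two_le), maskH_pos (a2.isBilin hg.ne hg.two_le)]
    exact h3 w m σ m' σ' y y' V (a1.mono hg) (a2.mono hg) ht ξ hξ
  · intro ν ξ
    by_cases hν : IsBilin τ₀ N θ₂ μ₂ τ ν
    · simp [defect, bilinProj, QT.maskH, hν, IsBilin.mono hg hν]
    · simp [defect, bilinProj, QT.maskH, hν]

theorem IsBilin.not_low (hg : Gap n τ₀ N τ θ₁ μ₁ θ₂ μ₂) {ν : Mon n}
    (h : IsBilin τ₀ N θ₁ μ₁ τ ν) : ¬ Low N ν := by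
  obtain ⟨w, m, σ, m', σ', ℓ, Q, Q', rfl, h⟩ := h
  rintro ⟨_, hl⟩
  have h1 := hg.far
  have h2 := h.high
  rw [lowM_add, lowM_add, lowM_monS, lowM_monS] at hl
  have := lowM_nonneg w
  have := len_nonneg m'.1
  have := C1_nonneg n
  have : (2 : ℝ) ≤ N := by exact_mod_cast hg.two_le
  have : (0 : ℝ) < (N : ℝ) ^ 3 := by positivity
  linarith

theorem IsBilin.freq {ν : Mon n} (h : IsBilin τ₀ N θ μ τ ν) : absK ν.1 < N := by
  obtain ⟨w, m, σ, m', σ', ℓ, Q, Q', rfl, h⟩ := h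
  simpa using h.freq

theorem IsBilin.momentum {ν : Mon n} (h : IsBilin τ₀ N θ μ τ ν) : mom ν = 0 := by
  obtain ⟨w, m, σ, m', σ', ℓ, Q, Q', rfl, h⟩ := h
  exact h.momentum

theorem nice_mem {m : NSite n} {V : Submodule ℝ (Fin d → ℝ)}
    (hg : Gap n τ₀ N τ θ₁ μ₁ θ₂ μ₂) {x : Mon n} (h : Nice τ₀ N θ₁ μ₁ τ m V x) :
    Low N x ∨ IsBilin τ₀ N θ₁ μ₁ τ x := by
  rcases h with h | ⟨w, a, σa, c, σc, rfl, hb, _, _⟩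
  · exact Or.inl h
  · exact Or.inr (hb.isBilin hg.ne hg.two_le)

/-- The quasi-Töplitz bound of a bracket. -/
theorem TB.poisson (hg : Gap n τ₀ N τ θ₁ μ₁ θ₂ μ₂) (hO : IsOpen O)
    (hwt : ∀ m : NSite n, 1 ≤ weight ρ m) (hr : 0 < r)
    (hs : 0 ≤ s) (hδ : 0 < δ) (hδ1 : δ ≤ 1) (hA : 0 < A) (hC : 0 < C)
    (hf : TB ρ τ₀ O ((1 + δ) * r) (s + 2 * δ) N θ₁ μ₁ τ f A)
    (hg' : TB ρ τ₀ O ((1 + δ) * r) (s + 2 * δ) N θ₁ μ₁ τ g C)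
    (hfN : ∀ ν, (N : ℝ) ≤ absK ν.1 → ∀ ξ, f ν ξ = 0)
    (hUV : (N : ℝ) ^ (4 * d * τ) * Real.exp (-(N * δ)) ≤ 1) :
    TB ρ τ₀ O r s N θ₂ μ₂ τ (poisson f g) (128 / δ * A * C) := by
  have hr' : 0 < (1 + δ) * r := by positivity
  have hs' : 0 ≤ s + δ := by positivity
  set T : ℝ := (N : ℝ) ^ (4 * d * τ) with hT
  have hT0 : 0 ≤ T := by positivity
  obtain ⟨Gf, f1, f2, f3, f4⟩ := (hf.shrink_s (s := s + δ) hr' (by linarith)).approx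
  obtain ⟨Gg, g1, g2, g3, g4⟩ := (hg'.shrink_s (s := s + δ) hr' (by linarith)).approx
  have hf0 := hf.hb.shrink_s (s := s + δ) hr' (by linarith)
  have hg0 := hg'.hb.shrink_s (s := s + δ) hr' (by linarith)
  -- the pieces
  set fa := QT.maskH (Low N) f + Gf with hfa
  set ga := QT.maskH (Low N) g + Gg with hga
  set χ : Mon n → Prop := fun ν => Low N ν ∨ IsBilin τ₀ N θ₁ μ₁ τ ν with hχ
  set fc := QT.maskH χ f with hfc
  set gc := QT.maskH χ g with hgc
  set df := defect τ₀ N θ₁ μ₁ τ f Gf with hdf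
  set dg := defect τ₀ N θ₁ μ₁ τ g Gg with hdg
  set gU := QT.maskH (fun ν => ¬ absK ν.1 < N) g with hgU
  set gN := QT.maskH (fun ν => absK ν.1 < N) g with hgN
  have hfa0 : HB ρ O ((1 + δ) * r) (s + δ) fa (2 * A) := by
    rw [two_mul]; exact (hf0.maskH _).add hO hA.le hA.le f1
  have hga0 : HB ρ O ((1 + δ) * r) (s + δ) ga (2 * C) := by
    rw [two_mul]; exact (hg0.maskH _).add hO hC.le hC.le g1
  have hmomd : ∀ {h G : Ham n}, HB ρ O ((1 + δ) * r) (s + δ) h A ∨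
      HB ρ O ((1 + δ) * r) (s + δ) h C → (∀ ν, mom ν ≠ 0 → ∀ ξ ∈ O, G ν ξ = 0) →
      ∀ ν, mom ν ≠ 0 → ∀ ξ ∈ O, defect τ₀ N θ₁ μ₁ τ h G ν ξ = 0 := by
    intro h G hh hG ν hν ξ hξ
    have : h ν ξ = 0 := by rcases hh with hh | hh <;> exact hh.momentum ν hν ξ hξ
    simp [defect, bilinProj, this, hG ν hν ξ hξ]
  have hdf0 : HB ρ O ((1 + δ) * r) (s + δ) df A :=
    ⟨hf0.c1.defect f1.c1, hmomd (Or.inl hf0) f1.momentum, f4⟩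
  have hdg0 : HB ρ O ((1 + δ) * r) (s + δ) dg C :=
    ⟨hg0.c1.defect g1.c1, hmomd (Or.inr hg0) g1.momentum, g4⟩
  have hTU : HB ρ O ((1 + δ) * r) (s + δ) ((T : ℂ) • gU) C := by
    refine ⟨(hg0.c1.maskH _).smul _, ((hg0.maskH _).smul (T : ℂ)).momentum, ?_⟩
    rw [hat_smul]
    refine (XN_smul_le _ _ _ _ _).trans ?_
    have h1 : XN ρ ((1 + δ) * r) (s + δ) (hat O gU) ≤
        ENNReal.ofReal (Real.exp (-(N * (s + 2 * δ - (s + δ))))) *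
          XN ρ ((1 + δ) * r) (s + 2 * δ) (hat O g) := by
      refine XN_ultraviolet hr' (hat_maskH_le _ _) (fun ν hν => ?_) (by linarith)
      simp only [hat, hgU]
      rw [maskH_neg (by simpa using hν), coefNorm_zero]
    refine (mul_le_mul' le_rfl h1).trans ?_
    rw [← mul_assoc, ← ofReal_norm, Complex.norm_real, Real.norm_of_nonneg hT0,
      ← ENNReal.ofReal_mul hT0]
    have h2 : T * Real.exp (-(N * (s + 2 * δ - (s + δ)))) ≤ 1 := by
      convert hUV using 4; ring
    calc _ ≤ 1 * XN ρ ((1 + δ) * r) (s + 2 * δ) (hat O g) :=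
          mul_le_mul' (ENNReal.ofReal_le_one.2 h2) le_rfl
      _ ≤ _ := by rw [one_mul]; exact hg'.hb.bound
  have hbr : ∀ {h k : Ham n} {X Y : ℝ}, HB ρ O ((1 + δ) * r) (s + δ) h X →
      HB ρ O ((1 + δ) * r) (s + δ) k Y → ∀ ν {ξ}, ξ ∈ O → BrSummable h k ν ξ :=
    fun hh hk ν ξ hξ => hh.brSummable hO hwt hr' hs' hk ν hξ
  have hpN : (1 : ℝ) ≤ N := by exact_mod_cast (one_le_two.trans hg.two_le)
  -- the decomposition of the defect
  have key : ∀ ν, IsBilin τ₀ N θ₂ μ₂ τ ν → ∀ ξ ∈ O,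
      (T : ℂ) * (QT.poisson f g ν ξ - QT.poisson fa ga ν ξ) =
        QT.poisson df gc ν ξ + QT.poisson fa dg ν ξ + QT.poisson f ((T : ℂ) • gU) ν ξ := by
    intro ν hν ξ hξ
    have e1 : g = gN + gU := by
      funext ν ξ
      by_cases h : absK ν.1 < N <;> simp [hgN, hgU, QT.maskH, h]
    have s1 : QT.poisson f g ν ξ = QT.poisson f gN ν ξ + QT.poisson f gU ν ξ := by
      conv_lhs => rw [e1]
      exact poisson_add_right (hbr hf0 (hg0.maskH _) ν hξ) (hbr hf0 (hg0.maskH _) ν hξ)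
    have s2 : QT.poisson f gN ν ξ = QT.poisson fc gc ν ξ := by
      obtain ⟨w, m, σ, m', σ', V, rfl, hb⟩ := (isBilin_iff hg ν).1 hν
      refine poisson_congr fun v p q hpq => ?_
      by_cases hk : absK (q + mon (dual v)).1 < N
      swap
      · have h1 : gN (q + mon (dual v)) ξ = 0 := by simp only [hgN]; rw [maskH_neg hk]
        have h2 : gc (q + mon (dual v)) ξ = 0 := by
          simp only [hgc]
          rw [maskH_neg]
          rintro (h | h)
          · exact hk h.1
          · exact hk h.freq
        rw [h1, h2, mul_zero, mul_zero]
      have h1 : gN (q + mon (dual v)) ξ = g (q + mon (dual v)) ξ := by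
        simp only [hgN]; rw [maskH_pos hk]
      rw [h1]
      by_cases hz : f (p + mon v) ξ * g (q + mon (dual v)) ξ = 0
      · rw [hz]
        simp only [hfc, hgc, QT.maskH]
        split_ifs <;> simp [hz]
      · have hfz := left_ne_zero_of_mul hz
        have hgz := right_ne_zero_of_mul hz
        have m1 : mom (p + mon v) = 0 := by
          by_contra h; exact hfz (hf0.momentum _ h ξ hξ)
        have m2 : mom (q + mon (dual v)) = 0 := by
          by_contra h; exact hgz (hg0.momentum _ h ξ hξ)
        have k1 : absK (p + mon v).1 < N := by
          by_contra h; exact hfz (hfN _ (not_lt.1 h) ξ)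
        have hvv : dual (dual v) = v := by rcases v with (i | i) | (j | j) <;> rfl
        have n1 := nice_mem hg (nice_of_bracket hg hb hpq v m1 m2 k1 hk)
        have n2 := nice_mem hg (nice_of_bracket hg hb ((add_comm q p).trans hpq) (dual v) m2
          (by rwa [hvv]) hk (by rwa [hvv]))
        simp only [hfc, hgc]
        rw [maskH_pos n1, maskH_pos n2]
    have hsplit : ∀ (h G : Ham n), (T : ℂ) • QT.maskH χ h =
        (T : ℂ) • (QT.maskH (Low N) h + G) + defect τ₀ N θ₁ μ₁ τ h G := by
      intro h G
      funext ν ξ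
      have hlb : ∀ ν : Mon n, IsBilin τ₀ N θ₁ μ₁ τ ν → ¬ Low N ν := fun ν => IsBilin.not_low hg
      by_cases hl : Low N ν
      · have : ¬ IsBilin τ₀ N θ₁ μ₁ τ ν := fun h' => hlb ν h' hl
        simp [QT.maskH, hχ, hl, this, defect, bilinProj]
        ring
      · by_cases hb : IsBilin τ₀ N θ₁ μ₁ τ ν
        · simp [QT.maskH, hχ, hl, hb, defect, bilinProj]
          rw [hT]; ring
        · simp [QT.maskH, hχ, hl, hb, defect, bilinProj]
          rw [hT]; ring
    have s3 : (T : ℂ) * QT.poisson fc gc ν ξ =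
        (T : ℂ) * QT.poisson fa gc ν ξ + QT.poisson df gc ν ξ := by
      rw [← poisson_smul_left, ← poisson_smul_left]
      have e : (fun ν ξ => (T : ℂ) * fc ν ξ) = (fun ν ξ => (T : ℂ) * fa ν ξ) + df := hsplit f Gf
      rw [e]
      exact poisson_add_left (hbr (hfa0.smul (T : ℂ)) (hg0.maskH _) ν hξ)
        (hbr hdf0 (hg0.maskH _) ν hξ)
    have s4 : (T : ℂ) * QT.poisson fa gc ν ξ =
        (T : ℂ) * QT.poisson fa ga ν ξ + QT.poisson fa dg ν ξ := by
      rw [← poisson_smul_right, ← poisson_smul_right]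
      have e : (fun ν ξ => (T : ℂ) * gc ν ξ) = (fun ν ξ => (T : ℂ) * ga ν ξ) + dg := hsplit g Gg
      rw [e]
      exact poisson_add_right (hbr hfa0 (hga0.smul (T : ℂ)) ν hξ) (hbr hfa0 hdg0 ν hξ)
    have s5 : QT.poisson f ((T : ℂ) • gU) ν ξ = (T : ℂ) * QT.poisson f gU ν ξ :=
      poisson_smul_right (T : ℂ) f gU ν ξ
    rw [s1, s2, s5, mul_sub, mul_add, s3, s4]
    ring
  have hmain := hf0.poisson hO hwt hr hs hδ hδ1 hA hC hg0
  have hGa := hfa0.poisson hO hwt hr hs hδ hδ1 (by positivity) (by positivity) hga0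
  have hE1 := hdf0.poisson hO hwt hr hs hδ hδ1 hA hC (hg0.maskH χ)
  have hE2 := hfa0.poisson hO hwt hr hs hδ hδ1 (by positivity) hC hdg0
  have hE3 := hf0.poisson hO hwt hr hs hδ hδ1 hA hC hTU
  have hAC : 0 < 1 / δ * A * C := by positivity
  refine ⟨hmain.mono ?_, QT.maskH (IsBilin τ₀ N θ₂ μ₂ τ) (QT.poisson fa ga),
    (hGa.maskH _).mono ?_, fun ν hν ξ _ => by simp [QT.maskH, hν],
    fun w m σ m' σ' y y' V a1 a2 ht ξ hξ => ?_, ?_⟩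
  · have : 32 / δ * A * C = 32 * (1 / δ * A * C) := by ring
    have : 128 / δ * A * C = 128 * (1 / δ * A * C) := by ring
    linarith
  · apply le_of_eq; ring
  · rw [maskH_pos (a1.isBilin hg.ne hg.two_le), maskH_pos (a2.isBilin hg.ne hg.two_le)]
    have hsupp : ∀ {h G : Ham n} {X Y : ℝ}, HB ρ O ((1 + δ) * r) (s + δ) h X →
        HB ρ O ((1 + δ) * r) (s + δ) G Y →
        (∀ ν, ¬ IsBilin τ₀ N θ₁ μ₁ τ ν → ∀ ξ ∈ O, G ν ξ = 0) →
        ∀ x, ∀ ξ ∈ O, (QT.maskH (Low N) h + G) x ξ ≠ 0 → mom x = 0 ∧ absK x.1 < N := by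
      intro h G X Y hh hG hG2 x ξ hξ hne
      by_cases hb : IsBilin τ₀ N θ₁ μ₁ τ x
      · exact ⟨hb.momentum, hb.freq⟩
      · rw [Pi.add_apply, Pi.add_apply, hG2 x hb ξ hξ, add_zero] at hne
        by_cases hl : Low N x
        · rw [maskH_pos hl] at hne
          refine ⟨?_, hl.1⟩
          by_contra hm
          exact hne (hh.momentum x hm ξ hξ)
        · rw [maskH_neg hl] at hne
          exact absurd rfl hne
    exact topInv_poisson hg (φ := fa) (φL := QT.maskH (Low N) f) (Gφ := Gf) (ψ := ga)
      (ψL := QT.maskH (Low N) g) (Gψ := Gg) (fun x ξ => rfl)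
      (fun x hx ξ => by rw [maskH_neg hx]) f3 (hsupp hf0 f1 f2) (fun x ξ => rfl)
      (fun x hx ξ => by rw [maskH_neg hx]) g3 (hsupp hg0 g1 g2) w m σ m' σ' y y' V a1 a2 ht ξ hξ
  · have hle : hat O (defect τ₀ N θ₂ μ₂ τ (QT.poisson f g)
        (QT.maskH (IsBilin τ₀ N θ₂ μ₂ τ) (QT.poisson fa ga))) ≤
        hat O (QT.poisson df gc + QT.poisson fa dg + QT.poisson f ((T : ℂ) • gU)) := by
      intro ν
      by_cases hν : IsBilin τ₀ N θ₂ μ₂ τ ν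
      · refine le_of_eq (coefNorm_congr hO fun ξ hξ => ?_)
        have := key ν hν ξ hξ
        simp only [defect, bilinProj, QT.maskH, hν, if_true]
        exact this
      · have : defect τ₀ N θ₂ μ₂ τ (QT.poisson f g)
            (QT.maskH (IsBilin τ₀ N θ₂ μ₂ τ) (QT.poisson fa ga)) ν = fun _ => 0 := by
          funext ξ; simp [defect, bilinProj, QT.maskH, hν]
        simp only [hat]
        rw [this, coefNorm_zero]
        exact zero_le
    refine (XN_mono hle).trans ?_
    have h12 := hE1.add hO (by positivity) (by positivity) hE2
    have h123 := h12.add hO (by positivity) (by positivity) hE3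
    refine h123.bound.trans (ENNReal.ofReal_le_ofReal (le_of_eq ?_))
    ring

end Approx

/-! ### Large `N` -/

section Large

variable {d b : ℕ} {n : Fin b → Fin d → ℤ}

theorem one_le_dim (hne : ∃ i, n i ≠ 0) : 1 ≤ d := by
  obtain ⟨i, hi⟩ := hne
  obtain ⟨j, -⟩ := Function.ne_iff.1 hi
  exact Nat.one_le_iff_ne_zero.2 fun h => by subst h; exact j.elim0

theorem tau_le_tau1 (hd : 1 ≤ d) {τ₀ : ℝ} (h : 0 ≤ τ₀) : 16 * (τ₀ + 1) ≤ tau1 d τ₀ := by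
  have h1 : (1 : ℝ) ≤ d := by exact_mod_cast hd
  unfold tau1
  refine mul_le_mul_of_nonneg_right ?_ (by linarith)
  calc (16 : ℝ) = (4 * 1) ^ 2 := by norm_num
    _ ≤ (4 * d : ℝ) ^ 2 := by gcongr
    _ ≤ (4 * d : ℝ) ^ (d + 1) := pow_le_pow_right₀ (by linarith) (by omega)

theorem tau_range (hd : 1 ≤ d) {τ₀ : ℝ} (h : 0 ≤ τ₀) : τ₀ ≤ tau1 d τ₀ / (4 * d) := by
  have h1 : (1 : ℝ) ≤ d := by exact_mod_cast hd
  rw [le_div_iff₀ (by linarith), tau1, mul_comm]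
  have : (4 * d : ℝ) ≤ (4 * d : ℝ) ^ (d + 1) := le_self_pow₀ (by linarith) (by omega)
  nlinarith

theorem four_d_tau_le (hd : 1 ≤ d) {τ₀ τ : ℝ} (h : τ ≤ tau1 d τ₀ / (4 * d)) :
    4 * d * τ ≤ tau1 d τ₀ := by
  have h1 : (1 : ℝ) ≤ d := by exact_mod_cast hd
  rwa [le_div_iff₀ (by linarith), mul_comm] at h

theorem gap_of_large (hne : ∃ i, n i ≠ 0) {τ₀ : ℝ} (hτ₀ : 12 < τ₀) {N : ℕ}
    (hN : 1000 + 6 * C1 n ≤ N) {τ θ₁ μ₁ θ₂ μ₂ : ℝ} (hτ : τ₀ ≤ τ) (hθ₁ : 1 / 4 ≤ θ₁)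
    (hμ₁ : μ₁ ≤ 9 / 2) (hθ : 1 / (N : ℝ) ≤ θ₂ - θ₁) (hμ : 1 / (N : ℝ) ≤ μ₁ - μ₂) :
    Gap n τ₀ N τ θ₁ μ₁ θ₂ μ₂ := by
  have hC := C1_nonneg n
  have hd := one_le_dim hne
  have hd' : (1 : ℝ) ≤ d := by exact_mod_cast hd
  set X : ℝ := (N : ℝ) with hX
  have hX0 : (1000 : ℝ) ≤ X := by linarith
  have hXC : 6 * C1 n ≤ X := by linarith
  have hXp : 0 < X := by linarith
  have hτ1 := tau_le_tau1 hd (show 0 ≤ τ₀ by linarith)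
  have e1 : X ^ (6 : ℕ) ≤ X ^ τ := by
    rw [← Real.rpow_natCast]
    exact Real.rpow_le_rpow_of_exponent_le (by linarith) (by push_cast; linarith)
  have e2 : X * X ^ τ ≤ X ^ (4 * d * τ) := by
    calc X * X ^ τ = X ^ (1 + τ) := by rw [Real.rpow_add hXp, Real.rpow_one]
      _ ≤ _ := Real.rpow_le_rpow_of_exponent_le (by linarith) (by nlinarith)
  have e3 : X ^ (6 : ℕ) ≤ X ^ tau1 d τ₀ := by
    rw [← Real.rpow_natCast]
    exact Real.rpow_le_rpow_of_exponent_le (by linarith) (by push_cast; linarith)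
  have hY : 0 < X ^ τ := by positivity
  have hZ : X ^ τ ≤ X ^ (4 * d * τ) := le_trans (by nlinarith) e2
  have hcut : C1 n * X * (6 * X ^ 3) ≤ 1 / X * X ^ τ := by
    rw [one_div, inv_mul_eq_div, le_div_iff₀ hXp]
    calc C1 n * X * (6 * X ^ 3) * X = (6 * C1 n) * X ^ 5 := by ring
      _ ≤ X * X ^ 5 := by gcongr
      _ = X ^ 6 := by ring
      _ ≤ _ := e1
  have hX2 : 1 / X * X ^ 3 = X ^ 2 := by field_simp
  have hmu0 : 0 ≤ 1 / X := by positivity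
  have hμ₂ : μ₂ ≤ μ₁ := by linarith
  have hθ₂ : θ₁ ≤ θ₂ := by linarith
  have hsep : μ₁ * X ^ τ ≤ θ₁ * X ^ (4 * d * τ) := by
    calc μ₁ * X ^ τ ≤ 9 / 2 * X ^ τ := by gcongr
      _ ≤ 1 / 4 * (X * X ^ τ) := by nlinarith
      _ ≤ θ₁ * X ^ (4 * d * τ) := by gcongr
  have hX3 : X ^ 3 ≤ X ^ 6 / 1000 := by
    have : X ^ 6 = X ^ 3 * X ^ 3 := by ring
    have h3 : (1000 : ℝ) ≤ X ^ 3 := by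
      calc (1000 : ℝ) ≤ X := hX0
        _ ≤ X ^ 3 := le_self_pow₀ (by linarith) (by norm_num)
    rw [this]; nlinarith [pow_pos hXp 3]
  refine ⟨?_, hne, hcut.trans (by gcongr), hcut.trans ?_, hsep, ?_, ?_, ?_, ?_, ?_⟩
  · have : (2 : ℝ) ≤ N := by linarith
    exact_mod_cast this
  · calc 1 / X * X ^ τ ≤ 1 / X * X ^ (4 * d * τ) := by gcongr
      _ ≤ _ := by gcongr
  · calc μ₂ * X ^ τ ≤ μ₁ * X ^ τ := by gcongr
      _ ≤ _ := hsep
      _ ≤ _ := by gcongr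
  · have : X ^ 2 ≤ (μ₁ - μ₂) * X ^ 3 := by rw [← hX2]; gcongr
    nlinarith
  · have : C1 n * X ≤ X ^ 3 / 2 := by
      have : X ^ 3 = X * X * X := by ring
      nlinarith
    nlinarith [pow_pos hXp 3]
  · have h1 : 5 * X ^ 3 ≤ (θ₂ - θ₁) * X ^ tau1 d τ₀ := by
      calc 5 * X ^ 3 ≤ 1 / X * X ^ (6 : ℕ) := by
            rw [one_div, inv_mul_eq_div, le_div_iff₀ hXp]
            have : X ^ 6 = X ^ 4 * X * X := by ring
            have h4 := pow_pos hXp 4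
            calc 5 * X ^ 3 * X = 5 * X ^ 4 := by ring
              _ ≤ X ^ 4 * X := by nlinarith
              _ ≤ X ^ 4 * X * X := le_mul_of_one_le_right (by positivity) (by linarith)
              _ = X ^ 6 := this.symm
        _ ≤ (θ₂ - θ₁) * X ^ tau1 d τ₀ := by gcongr
    linarith
  · calc 100 * X ^ 3 + C1 n ≤ 100 * X ^ 3 + X ^ 3 := by
          have : X ≤ X ^ 3 := le_self_pow₀ (by linarith) (by norm_num)
          linarith
      _ ≤ 1 / 4 * X ^ 6 := by nlinarith [pow_pos hXp 3]
      _ ≤ _ := by gcongr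

/-- Exponential smallness beats the powers of `N`. -/
theorem exists_large (κ δ : ℝ) (hδ : 0 < δ) (N₀ : ℝ) : ∃ Ns : ℕ, N₀ ≤ Ns ∧ ∀ N : ℕ, Ns ≤ N →
    (N : ℝ) ^ κ * Real.exp (-(δ * Real.sqrt N)) ≤ 1 := by
  have h1 := tendsto_rpow_mul_exp_neg_mul_atTop_nhds_zero (2 * κ) δ hδ
  have h2 : Filter.Tendsto (fun N : ℕ => Real.sqrt N) Filter.atTop Filter.atTop :=
    Real.tendsto_sqrt_atTop.comp tendsto_natCast_atTop_atTop
  have h3 := (h1.comp h2).eventually (gt_mem_nhds (zero_lt_one (α := ℝ)))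
  obtain ⟨Ns, hNs⟩ := Filter.eventually_atTop.1 h3
  refine ⟨max Ns (max 1 ⌈N₀⌉₊), ?_, fun N hN => ?_⟩
  · refine (Nat.le_ceil N₀).trans ?_
    exact_mod_cast (le_max_right _ _).trans (le_max_right _ _)
  · have h4 := hNs N ((le_max_left _ _).trans hN)
    have hN1 : 1 ≤ N := ((le_max_left _ _).trans (le_max_right _ _)).trans hN
    simp only [Function.comp] at h4
    rw [Real.rpow_mul (Real.sqrt_nonneg _)] at h4
    have h5 : Real.sqrt N ^ (2 : ℝ) = N := by
      rw [Real.rpow_two, Real.sq_sqrt (Nat.cast_nonneg _)]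
    rw [h5, neg_mul] at h4
    exact h4.le

end Large

/-! ### Lie series -/

section Lie

variable {d b : ℕ} {n : Fin b → Fin d → ℤ} {ρ R S s' : ℝ} {O : Set (Par b)} {F f : Ham n}
  {A B δ₀ : ℝ} {N : ℕ} {τ₀ τ θ μ θ' μ' : ℝ}

theorem one_add_pow_le {j i : ℕ} (hj : 0 < j) (hi : i ≤ j) (hδ₀ : 0 ≤ δ₀) (hδ₁ : δ₀ ≤ 1 / 2) :
    (1 + δ₀ / j) ^ i ≤ 2 := by
  have hj' : (0 : ℝ) < j := by exact_mod_cast hj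
  have h0 : 0 ≤ δ₀ / j := by positivity
  have h1 : (1 + δ₀ / j) ^ j ≤ Real.exp δ₀ := by
    calc (1 + δ₀ / j) ^ j ≤ Real.exp (δ₀ / j) ^ j := by
          have := Real.add_one_le_exp (δ₀ / j)
          gcongr; linarith
      _ = Real.exp δ₀ := by rw [← Real.exp_nat_mul]; congr 1; field_simp
  have h2 : Real.exp δ₀ ≤ 2 := by
    have h3 : Real.exp (1 / 2) ≤ 2 := by
      have h4 : Real.exp (1 / 2) ^ 2 = Real.exp 1 := by rw [← Real.exp_nat_mul]; norm_num
      nlinarith [Real.exp_one_lt_d9, Real.exp_pos (1 / 2)]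
    exact (Real.exp_le_exp.2 hδ₁).trans h3
  exact (pow_le_pow_right₀ (by linarith) hi).trans (h1.trans h2)

theorem iterate_TB (hne : ∃ i, n i ≠ 0) (hτ₀ : 12 < τ₀) (hO : IsOpen O)
    (hwt : ∀ m : NSite n, 1 ≤ weight ρ m) (hR : 0 < R) (hδ₀ : 0 < δ₀) (hδ₁ : δ₀ ≤ 1 / 2)
    (hS : 0 ≤ S - 2 * δ₀) (hA : 0 < A) (hB : 0 < B) (hN : 1000 + 6 * C1 n ≤ N) (hτ : τ₀ ≤ τ)
    (hF : TB ρ τ₀ O R S N θ μ τ F A) (hf : TB ρ τ₀ O R S N θ μ τ f B)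
    (hFN : ∀ ν, (N : ℝ) ≤ absK ν.1 → ∀ ξ, F ν ξ = 0) (hθ : 1 / 4 ≤ θ) (hμ : μ ≤ 9 / 2)
    {j : ℕ} (hj : 0 < j) (hθj : (j : ℝ) / N ≤ θ' - θ) (hμj : (j : ℝ) / N ≤ μ - μ')
    (hUV : (N : ℝ) ^ (4 * d * τ) * Real.exp (-(N * (δ₀ / j))) ≤ 1) :
    ∀ i : ℕ, i ≤ j → TB ρ τ₀ O (R / (1 + δ₀ / j) ^ i) (S - 2 * (δ₀ / j) * i) N
      (θ + i / j * (θ' - θ)) (μ - i / j * (μ - μ')) τ ((poisson F)^[i] f)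
      (B * (512 / (δ₀ / j) * A) ^ i) := by
  have hj' : (0 : ℝ) < j := by exact_mod_cast hj
  have hj1 : (1 : ℝ) ≤ j := by exact_mod_cast hj
  set δ := δ₀ / j with hδdef
  have hδ : 0 < δ := by positivity
  have hδle : δ ≤ δ₀ := div_le_self hδ₀.le hj1
  have hjδ : δ * j = δ₀ := by rw [hδdef]; field_simp
  have hNp : (0 : ℝ) < N := by have := C1_nonneg n; linarith
  have hstep : ∀ t : ℝ, (j : ℝ) / N ≤ t → 1 / (N : ℝ) ≤ t / j := by
    intro t ht
    rw [le_div_iff₀ hj']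
    calc 1 / (N : ℝ) * j = j / N := by ring
      _ ≤ t := ht
  have hθp : 0 ≤ θ' - θ := le_trans (by positivity) hθj
  have hμp : 0 ≤ μ - μ' := le_trans (by positivity) hμj
  intro i
  induction i with
  | zero => intro _; simpa using hf
  | succ i ih =>
    intro hi
    have hij : i ≤ j := Nat.le_of_succ_le hi
    have hij' : ((i : ℝ) + 1) ≤ j := by exact_mod_cast hi
    have ih' := ih hij
    have hpow := one_add_pow_le hj hij hδ₀.le hδ₁
    have hpow0 : 0 < (1 + δ) ^ i := by positivity
    have hpow1 : 1 ≤ (1 + δ) ^ i := one_le_pow₀ (by linarith)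
    -- the generating function on the smaller domain
    have hF1 : TB ρ τ₀ O (R / (1 + δ) ^ i) (S - 2 * δ * i) N θ μ τ F (4 * A) := by
      have h1 := hF.shrink (r := R / (1 + δ) ^ i) (s := S - 2 * δ * i) (by positivity)
        (div_le_self hR.le hpow1) (by nlinarith [Nat.cast_nonneg (α := ℝ) i])
      refine h1.mono ?_
      have : R / (R / (1 + δ) ^ i) = (1 + δ) ^ i := by field_simp
      rw [this]
      have : ((1 + δ) ^ i) ^ 2 ≤ 4 := by nlinarith
      nlinarith
    have hF2 : TB ρ τ₀ O (R / (1 + δ) ^ i) (S - 2 * δ * i) N (θ + i / j * (θ' - θ))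
        (μ - i / j * (μ - μ')) τ F (4 * A) := by
      rcases Nat.eq_zero_or_pos i with rfl | hi0
      · simpa using hF1
      · refine hF1.params (gap_of_large hne hτ₀ hN hτ hθ hμ ?_ ?_)
        · have hi1 : (1 : ℝ) ≤ i := by exact_mod_cast hi0
          have := hstep _ hθj
          calc 1 / (N : ℝ) ≤ (θ' - θ) / j := this
            _ ≤ i * ((θ' - θ) / j) := le_mul_of_one_le_left (by positivity) hi1
            _ = _ := by ring
        · have hi1 : (1 : ℝ) ≤ i := by exact_mod_cast hi0
          have := hstep _ hμj
          calc 1 / (N : ℝ) ≤ (μ - μ') / j := this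
            _ ≤ i * ((μ - μ') / j) := le_mul_of_one_le_left (by positivity) hi1
            _ = _ := by ring
    have hg : Gap n τ₀ N τ (θ + i / j * (θ' - θ)) (μ - i / j * (μ - μ'))
        (θ + ((i + 1 : ℕ) : ℝ) / j * (θ' - θ)) (μ - ((i + 1 : ℕ) : ℝ) / j * (μ - μ')) := by
      have h0 : (0 : ℝ) ≤ i / j := by positivity
      refine gap_of_large hne hτ₀ hN hτ (by nlinarith) (by nlinarith) ?_ ?_
      · refine (hstep _ hθj).trans (le_of_eq ?_)
        push_cast; field_simp; ring
      · refine (hstep _ hμj).trans (le_of_eq ?_)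
        push_cast; field_simp; ring
    have er : (1 + δ) * (R / (1 + δ) ^ (i + 1)) = R / (1 + δ) ^ i := by
      rw [pow_succ]; field_simp
    have es : S - 2 * δ * ((i + 1 : ℕ) : ℝ) + 2 * δ = S - 2 * δ * i := by push_cast; ring
    have h := TB.poisson (r := R / (1 + δ) ^ (i + 1)) (s := S - 2 * δ * ((i + 1 : ℕ) : ℝ)) (δ := δ)
      hg hO hwt (by positivity) ?_ hδ (by linarith) (A := 4 * A)
      (C := B * (512 / δ * A) ^ i) (by positivity) (by positivity)
      (by rw [er, es]; exact hF2) (by rw [er, es]; exact ih') hFN hUV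
    · rw [Function.iterate_succ_apply']
      refine h.mono (le_of_eq ?_)
      rw [pow_succ]; ring
    · push_cast
      have : δ * (i + 1) ≤ δ * j := by gcongr
      nlinarith

theorem pow_self_le_factorial {j : ℕ} : (j : ℝ) ^ j ≤ Real.exp 1 ^ j * j.factorial := by
  have h := Real.pow_div_factorial_le_exp (j : ℝ) (Nat.cast_nonneg j) j
  rw [div_le_iff₀ (by positivity)] at h
  rwa [← Real.exp_nat_mul, mul_one]

/-- Geometric decay of the terms of a Lie series. -/
theorem lieTerm_TB (hne : ∃ i, n i ≠ 0) (hτ₀ : 12 < τ₀) (hO : IsOpen O)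
    (hwt : ∀ m : NSite n, 1 ≤ weight ρ m) (hR : 0 < R) (hδ₀ : 0 < δ₀) (hδ₁ : δ₀ ≤ 1 / 2)
    (hs' : 0 ≤ s') (hS : s' ≤ S - 2 * δ₀) (hA : 0 < A) (hB : 0 < B)
    (hN : 1000 + 6 * C1 n ≤ N) (hτ : τ₀ ≤ τ) (hAδ : 512 * Real.exp 1 * A / δ₀ ≤ 1 / 4)
    (hF : TB ρ τ₀ O R S N θ μ τ F A) (hf : TB ρ τ₀ O R S N θ μ τ f B)
    (hFN : ∀ ν, (N : ℝ) ≤ absK ν.1 → ∀ ξ, F ν ξ = 0) (hθ : 1 / 4 ≤ θ) (hμ : μ ≤ 9 / 2)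
    {j : ℕ} (hj : 0 < j) (hθj : (j : ℝ) / N ≤ θ' - θ) (hμj : (j : ℝ) / N ≤ μ - μ')
    (hUV : (N : ℝ) ^ (4 * d * τ) * Real.exp (-(N * (δ₀ / j))) ≤ 1) {a : ℂ}
    (ha : ‖a‖ ≤ (j.factorial : ℝ)⁻¹) :
    TB ρ τ₀ O (R / 2) s' N θ' μ' τ (a • (poisson F)^[j] f) (4 * B * (1 / 4) ^ j) := by
  have hj' : (0 : ℝ) < j := by exact_mod_cast hj
  have h := iterate_TB hne hτ₀ hO hwt hR hδ₀ hδ₁ (hs'.trans hS) hA hB hN hτ hF hf hFN hθ hμ hj hθj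
    hμj hUV j le_rfl
  rw [div_self hj'.ne', one_mul, one_mul, add_sub_cancel, sub_sub_cancel] at h
  have hpow := one_add_pow_le hj le_rfl hδ₀.le hδ₁
  have hpow0 : 0 < (1 + δ₀ / j) ^ j := by positivity
  have hδj : 0 ≤ δ₀ / j := by positivity
  have hpow1 : 1 ≤ (1 + δ₀ / j) ^ j := one_le_pow₀ (by linarith)
  have hle : R / 2 ≤ R / (1 + δ₀ / j) ^ j := div_le_div_of_nonneg_left hR.le hpow0 hpow
  have h1 := (h.shrink (r := R / 2) (s := s') (by positivity) hle (by
    have : 2 * (δ₀ / j) * j = 2 * δ₀ := by field_simp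
    linarith)).smul a
  refine h1.mono ?_
  have hq : (R / (1 + δ₀ / j) ^ j / (R / 2)) ^ 2 ≤ 4 := by
    have : R / (1 + δ₀ / j) ^ j / (R / 2) ≤ 2 := by
      rw [div_le_iff₀ (by positivity)]
      have := div_le_self hR.le hpow1
      linarith
    have h0 : 0 ≤ R / (1 + δ₀ / j) ^ j / (R / 2) := by positivity
    nlinarith
  have hfac : (512 / (δ₀ / j) * A) ^ j ≤ (1 / 4) ^ j * j.factorial := by
    have e : 512 / (δ₀ / j) * A = 512 * A / δ₀ * j := by field_simp
    rw [e, mul_pow]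
    calc (512 * A / δ₀) ^ j * (j : ℝ) ^ j
        ≤ (512 * A / δ₀) ^ j * (Real.exp 1 ^ j * j.factorial) := by
          gcongr; exact pow_self_le_factorial
      _ = (512 * Real.exp 1 * A / δ₀) ^ j * j.factorial := by
          rw [← mul_assoc, ← mul_pow]; ring
      _ ≤ _ := by gcongr
  have hfp : (0 : ℝ) < j.factorial := by positivity
  calc ‖a‖ * ((R / (1 + δ₀ / j) ^ j / (R / 2)) ^ 2 * (B * (512 / (δ₀ / j) * A) ^ j))
      ≤ (j.factorial : ℝ)⁻¹ * (4 * (B * ((1 / 4) ^ j * j.factorial))) := by gcongr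
    _ = 4 * B * (1 / 4) ^ j := by field_simp

end Lie

/-! ### Sums of Lie series -/

section LieSum

variable {d b : ℕ} {n : Fin b → Fin d → ℤ} {ρ r s R S s' : ℝ} {O : Set (Par b)} {F f g : Ham n}
  {A B δ₀ K : ℝ} {N N₀ : ℕ} {τ₀ τ θ μ θ' μ' : ℝ}

theorem HB.congr (hO : IsOpen O) (h : HB ρ O r s f B) (hfg : ∀ ν, ∀ ξ ∈ O, g ν ξ = f ν ξ) :
    HB ρ O r s g B := by
  refine ⟨fun ν => (h.c1 ν).congr (hfg ν), fun ν hν ξ hξ => by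
    rw [hfg ν ξ hξ, h.momentum ν hν ξ hξ], ?_⟩
  have : hat O g = hat O f := by funext ν; exact coefNorm_congr hO (hfg ν)
  rw [this]; exact h.bound

theorem TB.congr (hO : IsOpen O) (h : TB ρ τ₀ O r s N θ μ τ f B)
    (hfg : ∀ ν, ∀ ξ ∈ O, g ν ξ = f ν ξ) : TB ρ τ₀ O r s N θ μ τ g B := by
  obtain ⟨G, h1, h2, h3, h4⟩ := h.approx
  refine ⟨h.hb.congr hO hfg, G, h1, h2, h3, ?_⟩
  have : hat O (defect τ₀ N θ μ τ g G) = hat O (defect τ₀ N θ μ τ f G) := by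
    funext ν
    refine coefNorm_congr hO fun ξ hξ => ?_
    simp only [defect, bilinProj, hfg ν ξ hξ]
  rw [this]; exact h4

theorem HB.tsum (hO : IsOpen O) {u : ℕ → Ham n} {C : ℕ → ℝ} (hC : ∀ j, 0 ≤ C j)
    (hCs : Summable C) (hu : ∀ j, HB ρ O r s (u j) (C j))
    (hsum : ∀ ν, ∑' j, coefNorm O (u j ν) ≠ ⊤) :
    HB ρ O r s (fun ν ξ => ∑' j, u j ν ξ) (∑' j, C j) := by
  refine ⟨fun ν => (coefNorm_tsum hO (fun j => (hu j).c1 ν) (hsum ν)).1, fun ν hν ξ hξ => ?_, ?_⟩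
  · simp [(hu _).momentum ν hν ξ hξ]
  · have h1 : hat O (fun ν ξ => ∑' j, u j ν ξ) ≤ fun ν => ∑' j, hat O (u j) ν := fun ν =>
      (coefNorm_tsum hO (fun j => (hu j).c1 ν) (hsum ν)).2
    refine (XN_mono h1).trans ((XN_tsum_le ρ r s fun j => hat O (u j)).trans ?_)
    rw [ENNReal.ofReal_tsum_of_nonneg hC hCs]
    exact ENNReal.tsum_le_tsum fun j => (hu j).bound

/-- Functions that are small at scale `N` need no approximation. -/
theorem TB.of_small (h : HB ρ O r s f A) (hAB : A ≤ B)
    (hT : (N : ℝ) ^ (4 * d * τ) * A ≤ B) : TB ρ τ₀ O r s N θ μ τ f B := by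
  have hz : HB ρ O r s (0 : Ham n) 0 := HB.zero
  have h0 : HB ρ O r s (0 : Ham n) B := ⟨hz.c1, hz.momentum, hz.bound.trans (by simp)⟩
  refine ⟨h.mono hAB, 0, h0, fun _ _ _ _ => rfl, fun _ _ _ _ _ _ _ _ _ _ _ _ _ => rfl, ?_⟩
  have h1 : defect τ₀ N θ μ τ f 0 =
      (((N : ℝ) ^ (4 * d * τ) : ℝ) : ℂ) • QT.maskH (IsBilin τ₀ N θ μ τ) f := by
    rw [defect_eq, sub_zero]
  rw [h1]
  refine (XN_smul_ofReal _ (h.maskH _).bound).trans (ENNReal.ofReal_le_ofReal ?_)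
  rwa [Complex.norm_real, Real.norm_of_nonneg (by positivity)]

/-- Quasi-Töplitz bounds for all large `N`. -/
def TBF (ρ τ₀ : ℝ) (O : Set (Par b)) (r s θ μ : ℝ) (f : Ham n) (B : ℝ) (N₀ : ℕ) : Prop :=
  ∀ N : ℕ, N₀ ≤ N → ∀ τ : ℝ, τ₀ ≤ τ → τ ≤ tau1 d τ₀ / (4 * d) → TB ρ τ₀ O r s N θ μ τ f B

theorem TBF.hb (hne : ∃ i, n i ≠ 0) (hτ₀ : 0 ≤ τ₀) (h : TBF ρ τ₀ O r s θ μ f B N₀) :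
    HB ρ O r s f B := (h N₀ le_rfl τ₀ le_rfl (tau_range (one_le_dim hne) hτ₀)).hb

theorem TBF.quasiToplitz (hne : ∃ i, n i ≠ 0) (hτ₀ : 12 < τ₀) (hr : 0 < r)
    (hwt : ∀ m : NSite n, 1 ≤ weight ρ m) (h : TBF ρ τ₀ O r s θ μ f B N₀) (hB : 0 ≤ B)
    (hθ : 1 / 2 ≤ θ) (hμ : μ ≤ 4) (K : ℝ) : QuasiToplitz ρ τ₀ O r s K θ μ f := by
  have hd := one_le_dim hne
  have hfb := h.hb hne (by linarith)
  refine ⟨hfb.inA hr.le hwt, ?_⟩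
  set Ns : ℕ := max N₀ ⌈1000 + 6 * C1 n⌉₊ with hNs
  have hNs1 : (1 : ℝ) ≤ Ns := by
    have h1 : 1000 + 6 * C1 n ≤ (Ns : ℝ) :=
      (Nat.le_ceil _).trans (by exact_mod_cast le_max_right _ _)
    have := C1_nonneg n
    linarith
  set X : ℝ := max B ((Ns : ℝ) ^ tau1 d τ₀ * B)
  refine lt_of_le_of_lt ?_ (ENNReal.ofReal_lt_top (r := X))
  refine iSup_le fun N => iSup_le fun _ => iSup_le fun τ => iSup_le fun hτ => iSup_le fun hτ' => ?_
  have hpack : ∀ {G : Ham n}, PiecewiseToplitz ρ τ₀ O r s N θ μ τ G → XN ρ r s (hat O G) ≤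
      ENNReal.ofReal X → XN ρ r s (hat O (defect τ₀ N θ μ τ f G)) ≤ ENNReal.ofReal X →
      (⨅ (G : Ham n) (_ : PiecewiseToplitz ρ τ₀ O r s N θ μ τ G), max (XNorm ρ O r s f)
        (max (XNorm ρ O r s G) (XNorm ρ O r s (defect τ₀ N θ μ τ f G)))) ≤ ENNReal.ofReal X := by
    intro G hG h1 h2
    refine iInf₂_le_of_le G hG (max_le ?_ (max_le ?_ ?_))
    · rw [XNorm_eq hr.le hwt]
      exact hfb.bound.trans (ENNReal.ofReal_le_ofReal (le_max_left _ _))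
    · rw [XNorm_eq hr.le hwt]; exact h1
    · rw [XNorm_eq hr.le hwt]; exact h2
  by_cases hN : Ns ≤ N
  · have hN' : 1000 + 6 * C1 n ≤ (N : ℝ) :=
      (Nat.le_ceil _).trans (by exact_mod_cast (le_max_right _ _).trans hN)
    have hNp : (0 : ℝ) < N := by have := C1_nonneg n; linarith
    have hinv : 1 / (N : ℝ) ≤ 1 / 4 := by
      rw [div_le_div_iff₀ hNp (by norm_num)]; have := C1_nonneg n; linarith
    have hg : Gap n τ₀ N τ (θ - 1 / 4) (μ + 1 / 2) θ μ :=
      gap_of_large hne hτ₀ hN' hτ (by linarith) (by linarith) (by linarith) (by linarith)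
    obtain ⟨G, h1, h2, h3, h4⟩ := (h N ((le_max_left _ _).trans hN) τ hτ hτ').approx
    exact hpack ⟨h1.inA hr.le hwt, h2, h3.toplitz hg⟩
      (h1.bound.trans (ENNReal.ofReal_le_ofReal (le_max_left _ _)))
      (h4.trans (ENNReal.ofReal_le_ofReal (le_max_left _ _)))
  · have hT : (N : ℝ) ^ (4 * d * τ) * B ≤ X := by
      refine le_trans ?_ (le_max_right _ _)
      refine mul_le_mul_of_nonneg_right ?_ hB
      have hNle : (N : ℝ) ≤ Ns := by exact_mod_cast (not_le.1 hN).le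
      have hd' : (1 : ℝ) ≤ d := by exact_mod_cast hd
      calc (N : ℝ) ^ (4 * d * τ) ≤ (Ns : ℝ) ^ (4 * d * τ) :=
            Real.rpow_le_rpow (Nat.cast_nonneg _) hNle (by nlinarith)
        _ ≤ _ := Real.rpow_le_rpow_of_exponent_le hNs1 (four_d_tau_le hd hτ')
    obtain ⟨G, h1, h2, h3, h4⟩ := (TB.of_small (τ₀ := τ₀) (θ := θ) (μ := μ) hfb
      (le_max_left _ _ : B ≤ X) hT).approx
    have hG0 : PiecewiseToplitz ρ τ₀ O r s N θ μ τ (0 : Ham n) :=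
      ⟨HB.zero.inA hr.le hwt, fun _ _ _ _ => rfl, fun _ _ _ _ _ => 0, fun _ _ _ _ _ _ _ _ _ _ _ _ =>
        rfl⟩
    refine hpack hG0 (HB.zero.bound.trans (by simp)) ?_
    have e1 : defect τ₀ N θ μ τ f 0 =
        (((N : ℝ) ^ (4 * d * τ) : ℝ) : ℂ) • QT.maskH (IsBilin τ₀ N θ μ τ) f := by
      rw [defect_eq, sub_zero]
    rw [e1]
    refine (XN_smul_ofReal _ (hfb.maskH _).bound).trans (ENNReal.ofReal_le_ofReal ?_)
    rwa [Complex.norm_real, Real.norm_of_nonneg (by positivity)]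

theorem TBF.mono {N₁ : ℕ} (h : TBF ρ τ₀ O r s θ μ f A N₀) (hAB : A ≤ B) (hN : N₀ ≤ N₁) :
    TBF ρ τ₀ O r s θ μ f B N₁ := fun N hN' τ h1 h2 => (h N (hN.trans hN') τ h1 h2).mono hAB

theorem TBF.add (hO : IsOpen O) {N₁ : ℕ} (hA : 0 ≤ A) (hB : 0 ≤ B)
    (hf : TBF ρ τ₀ O r s θ μ f A N₀) (hg : TBF ρ τ₀ O r s θ μ g B N₁) :
    TBF ρ τ₀ O r s θ μ (f + g) (A + B) (max N₀ N₁) := fun N hN τ h1 h2 =>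
  (hf N ((le_max_left _ _).trans hN) τ h1 h2).add hO hA hB
    (hg N ((le_max_right _ _).trans hN) τ h1 h2)

theorem TBF.smul (q : ℂ) (hf : TBF ρ τ₀ O r s θ μ f A N₀) :
    TBF ρ τ₀ O r s θ μ (q • f) (‖q‖ * A) N₀ := fun N hN τ h1 h2 => (hf N hN τ h1 h2).smul q

theorem TBF.congr (hO : IsOpen O) (hf : TBF ρ τ₀ O r s θ μ f A N₀)
    (hfg : ∀ ν, ∀ ξ ∈ O, g ν ξ = f ν ξ) : TBF ρ τ₀ O r s θ μ g A N₀ := fun N hN τ h1 h2 =>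
  (hf N hN τ h1 h2).congr hO hfg

theorem TBF.shrink {r' t : ℝ} (hr : 0 < r) (hr' : r ≤ r') (hs : s ≤ t)
    (hf : TBF ρ τ₀ O r' t θ μ f A N₀) : TBF ρ τ₀ O r s θ μ f ((r' / r) ^ 2 * A) N₀ :=
  fun N hN τ h1 h2 => (hf N hN τ h1 h2).shrink hr hr' hs

theorem TBF.params (hne : ∃ i, n i ≠ 0) (hτ₀ : 12 < τ₀) (hθ : 1 / 4 ≤ θ) (hμ : μ ≤ 9 / 2)
    (hθθ : θ < θ') (hμμ : μ' < μ) (hf : TBF ρ τ₀ O r s θ μ f A N₀) :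
    ∃ N₁, TBF ρ τ₀ O r s θ' μ' f A N₁ := by
  set X := (1000 + 6 * C1 n) + (1 / (θ' - θ) + 1 / (μ - μ')) with hX
  have hC := C1_nonneg n
  have hp1 : 0 < 1 / (θ' - θ) := one_div_pos.2 (by linarith)
  have hp2 : 0 < 1 / (μ - μ') := one_div_pos.2 (by linarith)
  refine ⟨max N₀ ⌈X⌉₊, fun N hN τ h1 h2 => ?_⟩
  have hN' : X ≤ N := (Nat.le_ceil _).trans (by exact_mod_cast (le_max_right _ _).trans hN)
  have hNp : (0 : ℝ) < N := by linarith
  refine (hf N ((le_max_left _ _).trans hN) τ h1 h2).params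
    (gap_of_large hne hτ₀ (by linarith) h1 hθ hμ ?_ ?_)
  · rw [div_le_iff₀ hNp, ← div_le_iff₀' (by linarith)]; linarith
  · rw [div_le_iff₀ hNp, ← div_le_iff₀' (by linarith)]; linarith

theorem TBF.maskH (hne : ∃ i, n i ≠ 0) (hτ₀ : 12 < τ₀) (hθ : 1 / 2 ≤ θ) (hμ : μ ≤ 4)
    (hf : TBF ρ τ₀ O r s θ μ f A N₀) {χ : Mon n → Prop}
    (hχ : ∀ (Φ : Equiv.Perm (NSite n)) ν, χ (permM Φ ν) ↔ χ ν) :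
    ∃ N₁, TBF ρ τ₀ O r s θ μ (maskH χ f) A N₁ := by
  have hC := C1_nonneg n
  refine ⟨max N₀ ⌈1000 + 6 * C1 n⌉₊, fun N hN τ h1 h2 => ?_⟩
  have hN' : 1000 + 6 * C1 n ≤ (N : ℝ) :=
    (Nat.le_ceil _).trans (by exact_mod_cast (le_max_right _ _).trans hN)
  have hNp : (0 : ℝ) < N := by linarith
  have hinv : 1 / (N : ℝ) ≤ 1 / 4 := by
    rw [div_le_div_iff₀ hNp (by norm_num)]; linarith
  exact (hf N ((le_max_left _ _).trans hN) τ h1 h2).maskH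
    (gap_of_large (θ₁ := θ - 1 / 4) (μ₁ := μ + 1 / 2) hne hτ₀ hN' h1 (by linarith) (by linarith)
      (by linarith) (by linarith)) hχ

set_option maxHeartbeats 400000 in
/-- The Lie series of a quasi-Töplitz function is quasi-Töplitz. -/
theorem lieSum_TBF (hne : ∃ i, n i ≠ 0) (hτ₀ : 12 < τ₀) (hO : IsOpen O)
    (hwt : ∀ m : NSite n, 1 ≤ weight ρ m) (hR : 0 < R) (hδ₀ : 0 < δ₀) (hδ₁ : δ₀ ≤ 1 / 2)
    (hs' : 0 ≤ s') (hS : s' ≤ S - 2 * δ₀) (hA : 0 < A) (hB : 0 < B)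
    (hAδ : 512 * Real.exp 1 * A / δ₀ ≤ 1 / 4)
    (hF : TBF ρ τ₀ O R S θ μ F A N₀) (hf : TBF ρ τ₀ O R S θ μ f B N₀)
    (hFK : ∀ ν, K < absK ν.1 → ∀ ξ, F ν ξ = 0) (hθ : 1 / 4 ≤ θ) (hμ : μ ≤ 9 / 2)
    (hθθ : θ < θ') (hμμ : μ' < μ) {a : ℕ → ℂ} (ha : ∀ j, ‖a j‖ ≤ (j.factorial : ℝ)⁻¹) :
    (∀ ν, ∑' j, coefNorm O ((a (j + 1) • (poisson F)^[j + 1] f) ν) ≠ ⊤) ∧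
      ∃ N₁, TBF ρ τ₀ O (R / 2) s' θ' μ'
        (fun ν ξ => ∑' j, (a (j + 1) • (poisson F)^[j + 1] f) ν ξ) (8 * B) N₁ := by
  have hd := one_le_dim hne
  have hC := C1_nonneg n
  have hgθ : 0 < θ' - θ := by linarith
  have hgμ : 0 < μ - μ' := by linarith
  set X : ℝ := N₀ + (1000 + 6 * C1 n) + (|K| + 1) + (1 / (θ' - θ) ^ 2 + 1 / (μ - μ') ^ 2)
  have hp1 : 0 < 1 / (θ' - θ) ^ 2 := by positivity
  have hp2 : 0 < 1 / (μ - μ') ^ 2 := by positivity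
  have hN₀0 : (0 : ℝ) ≤ N₀ := Nat.cast_nonneg _
  have hK0 := abs_nonneg K
  obtain ⟨Ns, hNsX, hNs⟩ := exists_large (tau1 d τ₀ + 1) δ₀ hδ₀ X
  have hXN : ∀ {N : ℕ}, Ns ≤ N → X ≤ N := fun hN => hNsX.trans (by exact_mod_cast hN)
  -- terms of low order at a given scale
  have hterm : ∀ (N : ℕ), Ns ≤ N → ∀ τ, τ₀ ≤ τ → τ ≤ tau1 d τ₀ / (4 * d) → ∀ j : ℕ, 0 < j →
      j * j ≤ N → ∀ c : ℂ, ‖c‖ ≤ (j.factorial : ℝ)⁻¹ →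
      TB ρ τ₀ O (R / 2) s' N θ' μ' τ (c • (poisson F)^[j] f) (4 * B * (1 / 4) ^ j) := by
    intro N hN τ h1 h2 j hj hjN c hc
    have hX := hXN hN
    have hN1 : 1000 + 6 * C1 n ≤ (N : ℝ) := by linarith
    have hN0 : N₀ ≤ N := by
      have : (N₀ : ℝ) ≤ N := by linarith
      exact_mod_cast this
    have hNp : (0 : ℝ) < N := by linarith
    have hj' : (0 : ℝ) < j := by exact_mod_cast hj
    have hsq : (j : ℝ) ≤ Real.sqrt N := by
      refine Real.le_sqrt_of_sq_le ?_
      rw [sq]; exact_mod_cast hjN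
    have hsqp : 0 < Real.sqrt N := Real.sqrt_pos.2 hNp
    have hss : Real.sqrt N * Real.sqrt N = N := Real.mul_self_sqrt hNp.le
    have hgap : ∀ t : ℝ, 0 < t → 1 / t ^ 2 ≤ N → (j : ℝ) / N ≤ t := by
      intro t ht htN
      have h3 : 1 / t ≤ Real.sqrt N := by
        refine Real.le_sqrt_of_sq_le ?_
        rw [div_pow, one_pow]; exact htN
      rw [div_le_iff₀ ht] at h3
      rw [div_le_iff₀ hNp]
      nlinarith
    refine lieTerm_TB hne hτ₀ hO hwt hR hδ₀ hδ₁ hs' hS hA hB hN1 h1 hAδ (hF N hN0 τ h1 h2)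
      (hf N hN0 τ h1 h2) (fun ν hν ξ => hFK ν ?_ ξ) hθ hμ hj (hgap _ hgθ (by linarith))
      (hgap _ hgμ (by linarith)) ?_ hc
    · have := le_abs_self K
      linarith
    · have h3 := hNs N hN
      have h4 : (N : ℝ) ^ (4 * d * τ) ≤ (N : ℝ) ^ (tau1 d τ₀ + 1) :=
        Real.rpow_le_rpow_of_exponent_le (by linarith) (by have := four_d_tau_le hd h2; linarith)
      have h5 : Real.exp (-(N * (δ₀ / j))) ≤ Real.exp (-(δ₀ * Real.sqrt N)) := by
        rw [Real.exp_le_exp, neg_le_neg_iff]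
        have : N * (δ₀ / j) = δ₀ * (N / j) := by ring
        rw [this]
        refine mul_le_mul_of_nonneg_left ?_ hδ₀.le
        rw [le_div_iff₀ hj']
        nlinarith
      exact (mul_le_mul h4 h5 (Real.exp_pos _).le (by positivity)).trans h3
  have hτr := tau_range hd (show 0 ≤ τ₀ by linarith)
  have hfhb := hf.hb hne (by linarith)
  have hFhb := hF.hb hne (by linarith)
  -- all terms
  have hHB : ∀ j (c : ℂ), ‖c‖ ≤ (j.factorial : ℝ)⁻¹ →
      HB ρ O (R / 2) s' (c • (poisson F)^[j] f) (4 * B * (1 / 4) ^ j) := by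
    intro j c hc
    rcases Nat.eq_zero_or_pos j with rfl | hj
    · have h1 := (hfhb.shrink (r := R / 2) (s := s') (by positivity) (by linarith)
        (by linarith)).smul c
      refine h1.mono ?_
      have e : R / (R / 2) = 2 := by field_simp
      rw [e]
      simp only [Nat.factorial_zero, Nat.cast_one, inv_one] at hc
      have : (0 : ℝ) ≤ 2 ^ 2 * B := by positivity
      nlinarith
    · exact (hterm (max Ns (j * j)) (le_max_left _ _) τ₀ le_rfl hτr j hj (le_max_right _ _) c hc).hb
  have hcoef : ∀ ν, ∑' j, coefNorm O ((a (j + 1) • (poisson F)^[j + 1] f) ν) ≠ ⊤ := by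
    intro ν
    have hR2 : 0 < R / 2 := by positivity
    have hF2 := hFhb.shrink (r := R / 2) (s := s') hR2 (by linarith) (by linarith)
    obtain ⟨z, q, hz, hq, hle⟩ := exists_coef_le (s := s') hR2 hwt ν
    set Y := ENNReal.ofReal (4 * (R / 2) ^ 2) * XN ρ (R / 2) s' (hat O F)
    have hY : Y ≠ ⊤ := ENNReal.mul_ne_top ENNReal.ofReal_ne_top hF2.lt_top.ne
    have hbd : ∀ j, coefNorm O ((a (j + 1) • (poisson F)^[j + 1] f) ν) ≤
        q * Y * ENNReal.ofReal (4 * B * (1 / 4) ^ j) := by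
      intro j
      have ha' : ‖a (j + 1)‖ ≤ (j.factorial : ℝ)⁻¹ := by
        refine (ha (j + 1)).trans ?_
        gcongr
        exact Nat.le_succ j
      have h1 := hHB j (a (j + 1)) ha'
      have e : a (j + 1) • (poisson F)^[j + 1] f =
          poisson F (a (j + 1) • (poisson F)^[j] f) := by
        rw [Function.iterate_succ_apply']
        funext ν ξ
        exact (poisson_smul_right _ _ _ ν ξ).symm
      rw [e]
      refine (hF2.hat_poisson_le hO hwt hR2 hs' h1 ν).trans ((hle _).trans ?_)
      rw [mul_assoc]
      refine mul_le_mul' le_rfl ((hE_hbr_pt_le hR2 hs' hwt _ _ hz hz).trans ?_)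
      rw [← mul_assoc]
      exact mul_le_mul' le_rfl h1.bound
    refine ne_top_of_le_ne_top ?_ (ENNReal.tsum_le_tsum hbd)
    rw [ENNReal.tsum_mul_left]
    refine ENNReal.mul_ne_top (ENNReal.mul_ne_top hq hY) ?_
    rw [← ENNReal.ofReal_tsum_of_nonneg (fun j => by positivity)
      ((summable_geometric_of_lt_one (by norm_num) (by norm_num)).mul_left _)]
    exact ENNReal.ofReal_ne_top
  refine ⟨hcoef, max Ns 16, fun N hN τ h1 h2 => ?_⟩
  have hNNs := (le_max_left _ _).trans hN
  have hN16 : 16 ≤ N := (le_max_right _ _).trans hN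
  set J := Nat.sqrt N with hJ
  set u : ℕ → Ham n := fun j => a (j + 1) • (poisson F)^[j + 1] f with hu
  have hgeo : Summable fun j : ℕ => 4 * B * (1 / 4 : ℝ) ^ (j + 1) := by
    have := (summable_geometric_of_lt_one (r := (1 / 4 : ℝ)) (by norm_num) (by norm_num)).mul_left
      (4 * B * (1 / 4))
    refine this.congr fun j => ?_
    rw [pow_succ]; ring
  have hgeosum : ∑' j : ℕ, 4 * B * (1 / 4 : ℝ) ^ (j + 1) = 4 * B / 3 := by
    have e : (fun j : ℕ => 4 * B * (1 / 4 : ℝ) ^ (j + 1)) =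
        fun j : ℕ => (4 * B * (1 / 4)) * (1 / 4 : ℝ) ^ j := by
      funext j; rw [pow_succ]; ring
    rw [e, tsum_mul_left, tsum_geometric_of_lt_one (by norm_num) (by norm_num)]
    ring
  have hlow : TB ρ τ₀ O (R / 2) s' N θ' μ' τ (∑ j ∈ Finset.range J, u j)
      (∑ j ∈ Finset.range J, 4 * B * (1 / 4) ^ (j + 1)) := by
    refine TB.sum hO _ (fun j _ => by positivity) fun j hj => ?_
    refine hterm N hNNs τ h1 h2 (j + 1) (Nat.succ_pos _) ?_ _ (ha _)
    have : j + 1 ≤ J := Finset.mem_range.1 hj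
    exact (Nat.mul_le_mul this this).trans (Nat.sqrt_le N)
  have hsumlow : ∑ j ∈ Finset.range J, 4 * B * (1 / 4 : ℝ) ^ (j + 1) ≤ 4 * B := by
    refine (hgeo.sum_le_tsum _ (fun j _ => by positivity)).trans ?_
    rw [hgeosum]; linarith
  have hcs : ∀ ν, ∑' j, coefNorm O (u (j + J) ν) ≠ ⊤ := fun ν =>
    ne_top_of_le_ne_top (hcoef ν) (ENNReal.tsum_comp_le_tsum_of_injective
      (add_left_injective J) fun j => coefNorm O (u j ν))
  have htail : HB ρ O (R / 2) s' (fun ν ξ => ∑' j, u (j + J) ν ξ) (4 * B * (1 / 4) ^ J) := by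
    have h4 : Summable fun j : ℕ => 4 * B * (1 / 4 : ℝ) ^ (j + J + 1) :=
      (summable_nat_add_iff (f := fun j : ℕ => 4 * B * (1 / 4 : ℝ) ^ (j + 1)) J).2 hgeo
    have h5 : ∀ j, HB ρ O (R / 2) s' (u (j + J)) (4 * B * (1 / 4) ^ (j + J + 1)) := fun j =>
      hHB (j + J + 1) (a (j + J + 1)) (ha _)
    have h3 := HB.tsum hO (u := fun j => u (j + J)) (C := fun j => 4 * B * (1 / 4) ^ (j + J + 1))
      (fun j => by positivity) h4 h5 hcs
    refine h3.mono ?_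
    have e : (fun j : ℕ => 4 * B * (1 / 4 : ℝ) ^ (j + J + 1)) =
        fun j : ℕ => (1 / 4 : ℝ) ^ J * (4 * B * (1 / 4) ^ (j + 1)) := by
      funext j; rw [add_right_comm, pow_add]; ring
    rw [e, tsum_mul_left, hgeosum]
    have : (0 : ℝ) < (1 / 4) ^ J := by positivity
    nlinarith
  have hN0 : (0 : ℝ) < N := by exact_mod_cast (by omega : 0 < N)
  have hN1 : (1 : ℝ) ≤ N := by exact_mod_cast (by omega : 1 ≤ N)
  have htailTB : TB ρ τ₀ O (R / 2) s' N θ' μ' τ (fun ν ξ => ∑' j, u (j + J) ν ξ) (4 * B) := by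
    refine TB.of_small htail ?_ ?_
    · have : (1 / 4 : ℝ) ^ J ≤ 1 := pow_le_one₀ (by norm_num) (by norm_num)
      nlinarith
    · have h3 := hNs N hNNs
      have hexp : (1 / 4 : ℝ) ^ (J + 1) ≤ Real.exp (-(δ₀ * Real.sqrt N)) := by
        have h4 : (1 / 4 : ℝ) ≤ Real.exp (-1) := by
          rw [Real.exp_neg, one_div]
          have := Real.exp_one_lt_d9
          gcongr
          linarith
        have h5 : Real.sqrt N ≤ J + 1 := by
          rw [Real.sqrt_le_left (by positivity)]
          have := (Nat.lt_succ_sqrt N).le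
          have h6 : (N : ℝ) ≤ (J + 1 : ℕ) * (J + 1 : ℕ) := by exact_mod_cast this
          push_cast at h6
          nlinarith
        calc (1 / 4 : ℝ) ^ (J + 1) ≤ Real.exp (-1) ^ (J + 1) := by gcongr
          _ = Real.exp (-((J : ℝ) + 1)) := by
              rw [← Real.exp_nat_mul]; congr 1; push_cast; ring
          _ ≤ _ := by
              rw [Real.exp_le_exp, neg_le_neg_iff]
              have := Real.sqrt_nonneg (N : ℝ)
              nlinarith
      have h6 : (N : ℝ) ^ (4 * d * τ) ≤ (N : ℝ) ^ tau1 d τ₀ :=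
        Real.rpow_le_rpow_of_exponent_le hN1 (four_d_tau_le hd h2)
      have h7 : (N : ℝ) ^ (4 * d * τ) * 4 ≤ (N : ℝ) ^ (tau1 d τ₀ + 1) := by
        rw [Real.rpow_add hN0, Real.rpow_one]
        have : (4 : ℝ) ≤ N := by exact_mod_cast (by omega : 4 ≤ N)
        gcongr
      have h8 : (1 / 4 : ℝ) ^ J = 4 * (1 / 4) ^ (J + 1) := by rw [pow_succ]; ring
      calc (N : ℝ) ^ (4 * d * τ) * (4 * B * (1 / 4) ^ J)
          = 4 * B * ((N : ℝ) ^ (4 * d * τ) * 4 * (1 / 4) ^ (J + 1)) := by rw [h8]; ring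
        _ ≤ 4 * B * ((N : ℝ) ^ (tau1 d τ₀ + 1) * Real.exp (-(δ₀ * Real.sqrt N))) := by gcongr
        _ ≤ 4 * B * 1 := by gcongr
        _ = 4 * B := mul_one _
  refine ((hlow.add hO (Finset.sum_nonneg fun j _ => by positivity) (by positivity)
    htailTB).mono (by linarith)).congr hO fun ν ξ hξ => ?_
  have hs := summable_of_coefNorm (hcoef ν) hξ
  rw [Pi.add_apply, Pi.add_apply, Finset.sum_apply, Finset.sum_apply]
  exact (hs.sum_add_tsum_nat_add J).symm

end LieSum

/-! ### Good portions and cuts -/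

section Good

variable {d b : ℕ} {n : Fin b → Fin d → ℤ} {N : ℕ} {τ₀ : ℝ}

theorem len_le_sum (x : Fin d → ℤ) : len x ≤ ∑ j, |(x j : ℝ)| := by
  rw [len]
  refine Real.sqrt_le_iff.2 ⟨Finset.sum_nonneg fun _ _ => abs_nonneg _, ?_⟩
  calc ∑ i, (x i : ℝ) ^ 2 = ∑ i, |(x i : ℝ)| ^ 2 := by simp
    _ ≤ (∑ j, |(x j : ℝ)|) ^ 2 :=
      Finset.sum_sq_le_sq_sum_of_nonneg fun _ _ => abs_nonneg _

/-- A point on `d` independent lattice hyperplanes with small data is small. -/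
theorem len_le_of_indep {v : Fin d → Fin d → ℤ} {m : Fin d → ℤ} {X : ℝ}
    (hv : LinearIndependent ℝ fun i => toR (v i)) (hvX : ∀ i j, |(v i j : ℝ)| ≤ X)
    (hmX : ∀ i, |(idot (v i) m : ℝ)| ≤ X) : len m ≤ d * (d.factorial * X ^ d) := by
  set A : Matrix (Fin d) (Fin d) ℤ := Matrix.of v with hA
  have hAm : A.mulVec m = fun i => idot (v i) m := rfl
  have hdet : A.det ≠ 0 := by
    intro h0
    have h1 : (A.map (Int.castRingHom ℝ)).det = 0 := by
      rw [← RingHom.mapMatrix_apply, ← RingHom.map_det, h0, map_zero]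
    have h2 : LinearIndependent ℝ (A.map (Int.castRingHom ℝ)).row := hv
    rw [Matrix.linearIndependent_rows_iff_isUnit, Matrix.isUnit_iff_isUnit_det, h1] at h2
    exact not_isUnit_zero h2
  have hone : (1 : ℝ) ≤ |(A.det : ℝ)| := by exact_mod_cast Int.one_le_abs hdet
  have hj : ∀ j, |(m j : ℝ)| ≤ d.factorial * X ^ d := by
    intro j
    have h1 : A.det * m j = (A.updateCol j (A.mulVec m)).det := by
      rw [← Matrix.cramer_apply, Matrix.cramer_eq_adjugate_mulVec, Matrix.mulVec_mulVec,
        Matrix.adjugate_mul, Matrix.smul_mulVec, Matrix.one_mulVec]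
      rfl
    have h2 := Matrix.det_le (A := ((A.updateCol j (A.mulVec m)).map (Int.castRingHom ℝ)))
      (abv := AbsoluteValue.abs) (x := X) fun i j' => by
        rw [Matrix.map_apply, Matrix.updateCol_apply]
        split_ifs
        · simpa [hAm] using hmX i
        · exact hvX i j'
    rw [← RingHom.mapMatrix_apply, ← RingHom.map_det, ← h1] at h2
    simp only [AbsoluteValue.abs_apply, Fintype.card_fin, nsmul_eq_mul, map_mul,
      eq_intCast] at h2
    nlinarith [abs_nonneg (m j : ℝ)]
  calc len m ≤ ∑ j, |(m j : ℝ)| := len_le_sum m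
    _ ≤ ∑ _j : Fin d, d.factorial * X ^ d := Finset.sum_le_sum fun j _ => hj j
    _ = _ := by simp

/-- The sequence of products of a far point has a large gap. -/
theorem exists_gap_index (hd : 1 ≤ d) (hτ₀ : 12 < τ₀) (hN1 : 4 * 2 ^ (4 * d) ≤ (N : ℝ))
    (hN2 : C1 n ≤ N) (hN3 : (d : ℝ) * d.factorial ≤ N) {m : Fin d → ℤ} {P : Pres d d}
    (hP : IsOptimal n N P {toR m}) (hm : (N : ℝ) ^ tau1 d τ₀ < len m)
    (hp : (P.p ⟨0, hd⟩ : ℝ) ≤ (N : ℝ) ^ τ₀) :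
    ∃ (ℓ : ℕ) (h0 : 0 < ℓ) (h : ℓ < d),
      (P.p ⟨ℓ - 1, by omega⟩ : ℝ) ≤ (N : ℝ) ^ ((4 * d : ℝ) ^ (d - 1) * (τ₀ + 1) - 1) ∧
      4 * max ((N : ℝ) ^ (4 * d * τ₀)) (2 ^ (4 * d) * (P.p ⟨ℓ - 1, by omega⟩ : ℝ) ^ (4 * d)) <
        P.p ⟨ℓ, h⟩ := by
  have hd' : (1 : ℝ) ≤ d := by exact_mod_cast hd
  have h4 : (16 : ℝ) ≤ 2 ^ (4 * d) := by
    calc (16 : ℝ) = 2 ^ (4 * 1) := by norm_num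
      _ ≤ 2 ^ (4 * d) := pow_le_pow_right₀ (by norm_num) (by omega)
  have hNone : (1 : ℝ) ≤ N := by linarith
  have hNp : (0 : ℝ) < N := by linarith
  have hmm : toR m ∈ ({toR m} : Set _) := rfl
  by_contra hcon
  push Not at hcon
  set e : ℕ → ℝ := fun i => (4 * d : ℝ) ^ i * (τ₀ + 1) - 1 with he
  have hemono : ∀ {i j : ℕ}, i ≤ j → e i ≤ e j := fun hij => by
    have : (4 * d : ℝ) ^ _ ≤ (4 * d : ℝ) ^ _ := pow_le_pow_right₀ (by linarith) hij
    simp only [he]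
    nlinarith
  have he0 : ∀ i, τ₀ ≤ e i := fun i => by
    have := hemono (Nat.zero_le i)
    simp only [he, pow_zero] at this ⊢
    linarith
  have key : ∀ (i : ℕ) (hi : i < d), (P.p ⟨i, hi⟩ : ℝ) ≤ (N : ℝ) ^ e i := by
    intro i
    induction i with
    | zero => intro hi; exact hp.trans (Real.rpow_le_rpow_of_exponent_le hNone (he0 0))
    | succ i ih =>
      intro hi
      have h1 := ih (by omega)
      have h0 : (0 : ℝ) ≤ (P.p ⟨i, by omega⟩ : ℝ) := by exact_mod_cast hP.p_nonneg hmm _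
      have h2 := hcon (i + 1) (Nat.succ_pos i) hi (h1.trans
        (Real.rpow_le_rpow_of_exponent_le hNone (hemono (by omega))))
      refine h2.trans ?_
      have h3 : (P.p ⟨i, by omega⟩ : ℝ) ^ (4 * d) ≤ (N : ℝ) ^ (4 * d * e i) := by
        have : (N : ℝ) ^ (4 * d * e i) = ((N : ℝ) ^ e i) ^ (4 * d) := by
          rw [← Real.rpow_natCast, ← Real.rpow_mul hNp.le]
          congr 1; push_cast; ring
        rw [this]
        exact pow_le_pow_left₀ h0 h1 _
      have h5 : (N : ℝ) ^ (4 * d * τ₀) ≤ (N : ℝ) ^ (4 * d * e i) :=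
        Real.rpow_le_rpow_of_exponent_le hNone (by have := he0 i; nlinarith)
      have h6 : (0 : ℝ) < (N : ℝ) ^ (4 * d * e i) := Real.rpow_pos_of_pos hNp _
      calc _ ≤ 4 * (2 ^ (4 * d) * (N : ℝ) ^ (4 * d * e i)) := by
            refine mul_le_mul_of_nonneg_left (max_le ?_ ?_) (by norm_num)
            · nlinarith
            · exact mul_le_mul_of_nonneg_left h3 (by positivity)
        _ = 4 * 2 ^ (4 * d) * (N : ℝ) ^ (4 * d * e i) := by ring
        _ ≤ N * (N : ℝ) ^ (4 * d * e i) := by gcongr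
        _ = (N : ℝ) ^ (1 + 4 * d * e i) := by rw [Real.rpow_add hNp, Real.rpow_one]
        _ ≤ _ := by
            refine Real.rpow_le_rpow_of_exponent_le hNone ?_
            simp only [he, pow_succ]
            nlinarith
  obtain ⟨E, hE⟩ : ∃ E : ℝ, E = (4 * d : ℝ) ^ (d - 1) * (τ₀ + 1) := ⟨_, rfl⟩
  have hE2 : 12 ≤ E := by have := he0 (d - 1); simp only [he, ← hE] at this; linarith
  have hmP : toR m ∈ P.toSet := by rw [hP.1.2.2]; exact hmm
  have hlen := len_le_of_indep (X := (N : ℝ) ^ E) hP.1.2.1 (fun i j => ?_) (fun i => ?_) (m := m)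
  · have h1 : len m ≤ (N : ℝ) ^ (1 + E * d) := by
      refine hlen.trans ?_
      rw [Real.rpow_add hNp, Real.rpow_one, Real.rpow_mul hNp.le, Real.rpow_natCast, ← mul_assoc]
      gcongr
    have h2 : 1 + E * d ≤ tau1 d τ₀ := by
      have : tau1 d τ₀ = (4 * d) ^ 2 * E := by
        rw [tau1, hE, ← mul_assoc, ← pow_add]
        congr 2; omega
      rw [this]
      have h3 : 12 ≤ d * E := by nlinarith
      have h4 : d * E ≤ d * (d * E) := le_mul_of_one_le_left (by linarith) hd'
      nlinarith
    exact absurd (h1.trans (Real.rpow_le_rpow_of_exponent_le hNone h2)) (not_le.2 hm)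
  · refine (abs_coord_le_len _ j).trans ((hP.1.1 i).2.le.trans ?_)
    calc C1 n * N ≤ N * N := by gcongr
      _ = (N : ℝ) ^ (2 : ℝ) := by rw [← sq]; norm_num
      _ ≤ _ := Real.rpow_le_rpow_of_exponent_le hNone (by linarith)
  · have h0 : (0 : ℝ) ≤ (P.p i : ℝ) := by exact_mod_cast hP.p_nonneg hmm _
    have h1 := key i.1 i.2
    rw [← Pres.p_eq hmP, abs_of_nonneg h0]
    refine h1.trans (Real.rpow_le_rpow_of_exponent_le hNone ?_)
    have := hemono (Nat.le_sub_one_of_lt i.2)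
    simp only [he, ← hE] at this ⊢
    linarith

theorem mem_ball_piK {k : Fin b → ℤ} (hne : ∃ i, n i ≠ 0)
    (hk : absK k < N) (h0 : piK n k ≠ 0) : piK n k ∈ ballB n N := by
  refine ⟨h0, (len_piK_le k).trans_lt ?_⟩
  have := one_le_C1 hne
  nlinarith

/-- Points near a good portion have the cut given by it. -/
theorem cutV_of_good {ℓ : ℕ} {Q : Pres d ℓ} {θ μ τ : ℝ} (hQ : IsOptimal n N Q Q.toSet)
    {x y : Fin d → ℤ} (hx : toR x ∈ Q.toSet) (hp : ∀ i, |(Q.p i : ℝ)| ≤ 1 / 2 * (N : ℝ) ^ τ)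
    (hg : ∀ v ∈ ballB n N, toR v ∉ Q.span → 4 * (N : ℝ) ^ (4 * d * τ) ≤ |(idot v x : ℝ)|)
    (hxy : len (y - x) ≤ C1 n * N)
    (hμ : C1 n * N * (C1 n * N) < (μ - 1 / 2) * (N : ℝ) ^ τ)
    (hθ : C1 n * N * (C1 n * N) < (4 - θ) * (N : ℝ) ^ (4 * d * τ))
    (hs : μ * (N : ℝ) ^ τ ≤ θ * (N : ℝ) ^ (4 * d * τ)) : CutV n N θ μ τ y Q.span := by
  have hdiff : ∀ u ∈ ballB n N, |(idot u y : ℝ) - idot u x| ≤ C1 n * N * (C1 n * N) := by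
    intro u hu
    have h1 := abs_idot_le u (y - x)
    rw [idot_sub_right] at h1
    push_cast at h1
    exact h1.trans (mul_le_mul hu.2.le hxy (len_nonneg _) ((len_nonneg u).trans hu.2.le))
  have key : ∀ u ∈ ballB n N, toR u ∉ Q.span →
      θ * (N : ℝ) ^ (4 * d * τ) < |(idot u y : ℝ)| := by
    intro u hu hu'
    have h1 := hdiff u hu
    have h2 := hg u hu hu'
    have h3 := abs_sub_abs_le_abs_sub (idot u x : ℝ) (idot u y)
    rw [abs_sub_comm] at h3
    linarith
  refine ⟨le_antisymm ?_ ?_, key⟩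
  · rw [Pres.span_eq, Submodule.span_le]
    rintro _ ⟨i, rfl⟩
    refine Submodule.subset_span ⟨_, ⟨hQ.1.1 i, ?_⟩, rfl⟩
    have h1 := hdiff _ (hQ.1.1 i)
    have h2 := hp i
    rw [Pres.p_eq hx] at h2
    have h3 := abs_sub_abs_le_abs_sub (idot (Q.v i) y : ℝ) (idot (Q.v i) x)
    linarith
  · rw [Submodule.span_le]
    rintro _ ⟨u, ⟨hu, hu2⟩, rfl⟩
    by_contra hc
    exact absurd (key u hu hc) (not_lt.2 (hu2.le.trans hs))

end Good

section FromNorm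

variable {d b : ℕ} {n : Fin b → Fin d → ℤ} {N : ℕ} {ρ τ₀ r s K θ μ τ A : ℝ} {O : Set (Par b)}
  {f : Ham n}

theorem TB.of_TNorm (hne : ∃ i, n i ≠ 0) (hr : 0 < r) (hwt : ∀ m : NSite n, 1 ≤ weight ρ m)
    (hN : 2 ≤ N) (hA : 0 < A) (hq : InA ρ O r s f)
    (hb : TNorm ρ τ₀ O r s K θ μ f ≤ ENNReal.ofReal A) (hKN : K ≤ N) (h1 : τ₀ ≤ τ)
    (h2 : τ ≤ tau1 d τ₀ / (4 * d)) : TB ρ τ₀ O r s N θ μ τ f (2 * A) := by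
  have h3 : (⨅ (G : Ham n) (_ : PiecewiseToplitz ρ τ₀ O r s N θ μ τ G),
      max (XNorm ρ O r s f) (max (XNorm ρ O r s G) (XNorm ρ O r s (defect τ₀ N θ μ τ f G)))) <
      ENNReal.ofReal (2 * A) := by
    refine lt_of_le_of_lt (le_trans ?_ hb)
      ((ENNReal.ofReal_lt_ofReal_iff (by linarith)).2 (by linarith))
    unfold TNorm
    exact le_iSup_of_le N (le_iSup_of_le hKN (le_iSup_of_le τ (le_iSup_of_le h1
      (le_iSup_of_le h2 le_rfl))))
  simp only [iInf_lt_iff, max_lt_iff] at h3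
  obtain ⟨G, hG, h4, h5, h6⟩ := h3
  refine ⟨hq.hb hr.le hwt h4.le, G, hG.mem.hb hr.le hwt h5.le, hG.bilin, hG.topInv hne hN, ?_⟩
  rw [← XNorm_eq hr.le hwt]
  exact h6.le

end FromNorm

/-! ### Small divisors -/

section Divisor

variable {d b : ℕ} {n : Fin b → Fin d → ℤ} {N : ℕ} {ρ τ₀ r s M L ε K θ μ τ γ B : ℝ}
  {O : Set (Par b)} {ω : Par b → Par b} {Ωt : NSite n → Par b → ℝ} {P : Ham n}
  {V : Submodule ℝ (Fin d → ℝ)}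

theorem diag_eq (x : NSite n) : (monZ x + monZb x : Mon n) = 0 + monS x true + monS x false := by
  rw [zero_add]; rfl

theorem bi_diag {x : NSite n} (hN : 0 < N) (hμ : 0 < μ) (h : CutV n N θ μ τ x.1 V)
    (hx : θ * (N : ℝ) ^ tau1 d τ₀ < len x.1) (h0 : 0 < Module.finrank ℝ V)
    (h1 : Module.finrank ℝ V < d) : Bi τ₀ N θ μ τ 0 x true x false V := by
  have hN' : (0 : ℝ) < N := by exact_mod_cast hN
  refine ⟨?_, ?_, hx, hx, ?_, h0, h1, h, h⟩
  · rw [mom_pair]; simp [mom, piK, sg]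
  · simpa [absK] using hN
  · have : lowM (0 : Mon n) = 0 := by simp [lowM]
    rw [this]; positivity

theorem defect_diag_le (hr : 0 < r) (hwt : ∀ m : NSite n, 1 ≤ weight ρ m) {G : Ham n}
    (hG : XN ρ r s (hat O (defect τ₀ N θ μ τ (diagQ fun j ξ => (Ωt j ξ : ℂ)) G)) ≤
      ENNReal.ofReal B) {x : NSite n} (hx : IsBilin τ₀ N θ μ τ (monZ x + monZb x)) :
    coefNorm O (fun ξ => (((N : ℝ) ^ (4 * d * τ) : ℝ) : ℂ) *
      ((Ωt x ξ : ℂ) - G (monZ x + monZb x) ξ)) ≤ ENNReal.ofReal (2 * B) := by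
  have h1 := coef_diag_le hr hwt (hat O (defect τ₀ N θ μ τ (diagQ fun j ξ => (Ωt j ξ : ℂ)) G)) x
    (s := s)
  have h2 : defect τ₀ N θ μ τ (diagQ fun j ξ => (Ωt j ξ : ℂ)) G (monZ x + monZb x) =
      fun ξ => (((N : ℝ) ^ (4 * d * τ) : ℝ) : ℂ) * ((Ωt x ξ : ℂ) - G (monZ x + monZb x) ξ) := by
    funext ξ
    simp only [defect, bilinProj, if_pos hx, diagQ, normalForm_monZZ]
  rw [hat, h2] at h1
  refine h1.trans ?_
  rw [ENNReal.ofReal_mul (by norm_num), ENNReal.ofReal_ofNat]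
  exact mul_le_mul' le_rfl hG

theorem Omega_close (hne : ∃ i, n i ≠ 0) (hN : 2 ≤ N) (hr : 0 < r)
    (hwt : ∀ m : NSite n, 1 ≤ weight ρ m) (hB : 0 ≤ B)
    (h : TB ρ τ₀ O r s N θ μ τ (diagQ fun j ξ => (Ωt j ξ : ℂ)) B) {x y : NSite n}
    (hx : Bi τ₀ N θ μ τ 0 x true x false V) (hy : Bi τ₀ N θ μ τ 0 y true y false V)
    (hxy : ∀ u ∈ V, u ⬝ᵥ toR (y.1 - x.1) = 0) {ξ : Par b} (hξ : ξ ∈ O) :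
    (N : ℝ) ^ (4 * d * τ) * |Ωt x ξ - Ωt y ξ| ≤ 4 * B := by
  obtain ⟨G, -, -, h3, h4⟩ := h.approx
  have hG := h3 _ _ _ _ _ _ _ V hx hy hxy ξ hξ
  rw [← diag_eq, ← diag_eq] at hG
  have key : ∀ z : NSite n, Bi τ₀ N θ μ τ 0 z true z false V →
      ‖(((N : ℝ) ^ (4 * d * τ) : ℝ) : ℂ) * ((Ωt z ξ : ℂ) - G (monZ z + monZb z) ξ)‖ ≤ 2 * B := by
    intro z hz
    have h5 := hz.isBilin hne hN
    rw [← diag_eq] at h5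
    have h6 := (enorm_le_coefNorm _ hξ).trans (defect_diag_le hr hwt h4 h5)
    rwa [← ofReal_norm, ENNReal.ofReal_le_ofReal_iff (by linarith)] at h6
  have h5 := key x hx
  have h6 := key y hy
  have hT : (0 : ℝ) ≤ (N : ℝ) ^ (4 * d * τ) := by positivity
  have h7 := norm_sub_le_of_le h5 h6
  rw [hG, ← mul_sub, sub_sub_sub_cancel_right, norm_mul, Complex.norm_real,
    Real.norm_of_nonneg hT, ← Complex.ofReal_sub, Complex.norm_real, Real.norm_eq_abs] at h7
  linarith

/-- The lower bounds on `K` that the KAM step needs. -/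
structure LargeK (n : Fin b → Fin d → ℤ) (τ₀ M L γ K : ℝ) : Prop where
  base : 1000 + 6 * C1 n ≤ K
  two_pow : 4 * 2 ^ (4 * d) ≤ K
  fact : (d : ℝ) * d.factorial ≤ K
  tau : 4 * tau1 d τ₀ ≤ K
  hM : M ≤ K
  hL : L ≤ K
  hγ : γ ≤ K
  hLγ : 64 * L * 4 ^ d ≤ γ * K
  C1_sq : C1 n ^ 2 ≤ K

theorem exists_largeK (n : Fin b → Fin d → ℤ) (τ₀ M L : ℝ) (hγ : 0 < γ) :
    ∃ K₀ : ℝ, 0 < K₀ ∧ ∀ K, K₀ ≤ K → LargeK n τ₀ M L γ K := by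
  have h : ∀ᶠ K in Filter.atTop, LargeK n τ₀ M L γ K := by
    filter_upwards [Filter.eventually_ge_atTop (1000 + 6 * C1 n),
      Filter.eventually_ge_atTop (4 * 2 ^ (4 * d)),
      Filter.eventually_ge_atTop ((d : ℝ) * d.factorial),
      Filter.eventually_ge_atTop (4 * tau1 d τ₀), Filter.eventually_ge_atTop M,
      Filter.eventually_ge_atTop L, Filter.eventually_ge_atTop γ,
      Filter.eventually_ge_atTop (64 * L * 4 ^ d / γ),
      Filter.eventually_ge_atTop (C1 n ^ 2)] with K h1 h2 h3 h4 h5 h6 h7 h8 h9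
    exact ⟨h1, h2, h3, h4, h5, h6, h7, by rwa [div_le_iff₀' hγ] at h8, h9⟩
  obtain ⟨K₀, hK₀⟩ := Filter.eventually_atTop.1 h
  exact ⟨max K₀ 1, lt_max_of_lt_right one_pos, fun K hK => hK₀ K ((le_max_left _ _).trans hK)⟩

/-- The lower bound for the divisors of the generating function. -/
def divBound (d : ℕ) (τ₀ γ K : ℝ) : ℝ := γ / 4 ^ d * K ^ (-(2 * d * tau1 d τ₀))

theorem len_sq_shift (x v : Fin d → ℤ) :
    len x ^ 2 - len (x + v) ^ 2 = -(2 * (idot v x : ℝ)) - len v ^ 2 := by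
  rw [len_sq, len_sq, len_sq]
  have h1 : idot (x + v) (x + v) = idot x x + 2 * idot v x + idot v v := by
    rw [idot_add_right, idot_comm (x + v) x, idot_comm (x + v) v, idot_add_right, idot_add_right,
      idot_comm x v]
    ring
  rw [h1]; push_cast; ring

theorem abs_omega_le (h : KAMHyp ρ τ₀ O r s M L ε K θ μ ω Ωt P) {ξ : Par b} (hξ : ξ ∈ O)
    (k : Fin b → ℤ) : |∑ i, ω ξ i * (k i : ℝ)| ≤ M * absK k := by
  rw [absK, Finset.mul_sum]
  refine (Finset.abs_sum_le_sum_abs _ _).trans (Finset.sum_le_sum fun i _ => ?_)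
  rw [abs_mul]
  refine mul_le_mul_of_nonneg_right ?_ (abs_nonneg _)
  have h1 := PiLp.norm_apply_le (ω ξ) i
  rw [Real.norm_eq_abs] at h1
  have := h.omega_bound ξ hξ
  linarith [norm_nonneg (fderiv ℝ ω ξ)]

/-- The exponent adapted to `p`. -/
theorem exists_tau (hN : 2 ≤ N) {p T : ℝ} (hp : 0 ≤ p) (hτ₀ : τ₀ ≤ T)
    (hpT : 2 * p ≤ (N : ℝ) ^ T) : ∃ τ, τ₀ ≤ τ ∧ τ ≤ T ∧ p ≤ 1 / 2 * (N : ℝ) ^ τ ∧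
      (N : ℝ) ^ (4 * d * τ) ≤ max ((N : ℝ) ^ (4 * d * τ₀)) (2 ^ (4 * d) * p ^ (4 * d)) ∧
      max ((N : ℝ) ^ (2 * d * τ₀)) (2 ^ (4 * d) * p ^ (2 * d)) ≤ 4 ^ d * (N : ℝ) ^ (2 * d * τ) := by
  have hN1 : (1 : ℝ) < N := by exact_mod_cast (by omega : 1 < N)
  have hNp : (0 : ℝ) < N := by linarith
  set Z := max ((N : ℝ) ^ τ₀) (2 * p) with hZ
  have hZp : 0 < Z := lt_of_lt_of_le (Real.rpow_pos_of_pos hNp _) (le_max_left _ _)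
  have hτ : (N : ℝ) ^ Real.logb N Z = Z := Real.rpow_logb hNp (by linarith) hZp
  have hpow : ∀ (k : ℕ) (x : ℝ), (N : ℝ) ^ ((k : ℝ) * x) = ((N : ℝ) ^ x) ^ k := fun k x => by
    rw [mul_comm, Real.rpow_mul hNp.le, Real.rpow_natCast]
  have h4 : ∀ x : ℝ, (N : ℝ) ^ (4 * d * x) = ((N : ℝ) ^ x) ^ (4 * d) := fun x => by
    rw [← hpow]; push_cast; rfl
  have h2 : ∀ x : ℝ, (N : ℝ) ^ (2 * d * x) = ((N : ℝ) ^ x) ^ (2 * d) := fun x => by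
    rw [← hpow]; push_cast; rfl
  refine ⟨Real.logb N Z, (Real.le_logb_iff_rpow_le hN1 hZp).2 (le_max_left _ _),
    (Real.logb_le_iff_le_rpow hN1 hZp).2 (max_le
      (Real.rpow_le_rpow_of_exponent_le hN1.le hτ₀) hpT), ?_, ?_, ?_⟩
  · rw [hτ]; have := le_max_right ((N : ℝ) ^ τ₀) (2 * p); linarith
  · rw [h4, h4, hτ, ← mul_pow]
    rcases max_choice ((N : ℝ) ^ τ₀) (2 * p) with h | h
    · rw [hZ, h]; exact le_max_left _ _
    · rw [hZ, h]; exact le_max_right _ _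
  · rw [h2, h2, hτ]
    have h0 : (0 : ℝ) ≤ (N : ℝ) ^ τ₀ := Real.rpow_nonneg hNp.le _
    refine max_le ?_ ?_
    · calc ((N : ℝ) ^ τ₀) ^ (2 * d) ≤ Z ^ (2 * d) := pow_le_pow_left₀ h0 (le_max_left _ _) _
        _ ≤ _ := le_mul_of_one_le_left (by positivity) (one_le_pow₀ (by norm_num))
    · have e : (2 : ℝ) ^ (4 * d) * p ^ (2 * d) = 4 ^ d * (2 * p) ^ (2 * d) := by
        rw [mul_pow, ← mul_assoc]
        congr 1
        rw [show (4 : ℝ) = 2 ^ 2 by norm_num, ← pow_mul, ← pow_add]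
        congr 1; ring
      rw [e]
      have : 2 * p ≤ Z := le_max_right _ _
      gcongr

theorem LargeK.one_le (hK : LargeK n τ₀ M L γ K) : 1000 ≤ K := by
  have := hK.base
  have := C1_nonneg n
  linarith

theorem divBound_le_one (hd : 1 ≤ d) (hτ₀ : 12 < τ₀) (hγ : 0 < γ) (hK : LargeK n τ₀ M L γ K) :
    divBound d τ₀ γ K ≤ 1 := by
  have h1 := hK.one_le
  have h2 := tau_le_tau1 hd (show 0 ≤ τ₀ by linarith)
  have hd' : (1 : ℝ) ≤ d := by exact_mod_cast hd
  have h3 : K ^ (-(2 * d * tau1 d τ₀)) ≤ K ^ (-1 : ℝ) :=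
    Real.rpow_le_rpow_of_exponent_le (by linarith) (by nlinarith)
  rw [Real.rpow_neg_one] at h3
  have h4 : γ / 4 ^ d ≤ K := (div_le_self hγ.le (one_le_pow₀ (by norm_num))).trans hK.hγ
  calc divBound d τ₀ γ K ≤ K * K⁻¹ := mul_le_mul h4 h3 (by positivity) (by linarith)
    _ = 1 := mul_inv_cancel₀ (by linarith)

theorem divBound_pos (hγ : 0 < γ) (hK : LargeK n τ₀ M L γ K) : 0 < divBound d τ₀ γ K := by
  have h1 := hK.one_le
  have : 0 < K := by linarith
  unfold divBound
  positivity

end Divisor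

section HighDivisor

variable {d b : ℕ} {n : Fin b → Fin d → ℤ} {ρ τ₀ r s M L ε K θ μ γ : ℝ}
  {O : Set (Par b)} {ω : Par b → Par b} {Ωt : NSite n → Par b → ℝ} {P : Ham n}

/-- Differences of frequencies at far points with a large momentum product. -/
theorem divisor_of_large_product (hd : 1 ≤ d) (hτ₀ : 12 < τ₀) (hγ : 0 < γ)
    (h : KAMHyp ρ τ₀ O r s M L ε K θ μ ω Ωt P) (hK : LargeK n τ₀ M L γ K) {ξ : Par b} (hξ : ξ ∈ O)
    {k : Fin b → ℤ} (hk : absK k ≤ K) {m m' : NSite n} (hmm : m'.1 = m.1 + piK n k)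
    (hv : K ^ 3 ≤ |(idot (piK n k) m.1 : ℝ)|) :
    divBound d τ₀ γ K ≤ |(∑ i, ω ξ i * (k i : ℝ)) + freqN Ωt m ξ - freqN Ωt m' ξ| := by
  refine (divBound_le_one hd hτ₀ hγ hK).trans ?_
  have hK1 := hK.one_le
  have hC := C1_nonneg n
  have h1 := abs_omega_le h hξ k
  have h2 := h.Omega_bound m ξ hξ
  have h3 := h.Omega_bound m' ξ hξ
  have n2 := norm_nonneg (fderiv ℝ (Ωt m) ξ)
  have n3 := norm_nonneg (fderiv ℝ (Ωt m') ξ)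
  have h4 := len_sq_shift m.1 (piK n k)
  have h5 : len (piK n k) ^ 2 ≤ K ^ 3 := by
    have h6 : len (piK n k) ≤ C1 n * K := (len_piK_le k).trans (by gcongr)
    calc len (piK n k) ^ 2 ≤ (C1 n * K) ^ 2 := pow_le_pow_left₀ (len_nonneg _) h6 2
      _ = C1 n ^ 2 * K ^ 2 := mul_pow _ _ _
      _ ≤ K * K ^ 2 := by have := hK.C1_sq; gcongr
      _ = K ^ 3 := by ring
  have h7 : M * absK k ≤ K ^ 2 := by
    have := hK.hM
    have := absK_nonneg k
    nlinarith
  have hL := hK.hL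
  have e : (∑ i, ω ξ i * (k i : ℝ)) + freqN Ωt m ξ - freqN Ωt m' ξ =
      (∑ i, ω ξ i * (k i : ℝ)) + Ωt m ξ - Ωt m' ξ - len (piK n k) ^ 2 -
        2 * (idot (piK n k) m.1 : ℝ) := by
    rw [freqN, freqN, hmm]; linarith
  have h8 : 2 * K ^ 3 - K ^ 2 - K ^ 3 - 2 * K ≤
      |(∑ i, ω ξ i * (k i : ℝ)) + freqN Ωt m ξ - freqN Ωt m' ξ| := by
    rw [e]
    have h9 := abs_sub_abs_le_abs_sub (2 * (idot (piK n k) m.1 : ℝ))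
      ((∑ i, ω ξ i * (k i : ℝ)) + Ωt m ξ - Ωt m' ξ - len (piK n k) ^ 2)
    rw [abs_sub_comm (2 * (idot (piK n k) m.1 : ℝ)), abs_mul, abs_two] at h9
    have h10 := abs_sub ((∑ i, ω ξ i * (k i : ℝ)) + Ωt m ξ - Ωt m' ξ) (len (piK n k) ^ 2)
    have h11 := abs_sub ((∑ i, ω ξ i * (k i : ℝ)) + Ωt m ξ) (Ωt m' ξ)
    have h12 := abs_add_le (∑ i, ω ξ i * (k i : ℝ)) (Ωt m ξ)
    rw [abs_of_nonneg (sq_nonneg (len (piK n k)))] at h10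
    linarith
  nlinarith

variable {N : ℕ} {τ : ℝ}

/-- The inequalities between the scale `N` next to `K` and the quasi-Töplitz parameters. -/
theorem scale_bounds (hne : ∃ i, n i ≠ 0) (hτ₀ : 12 < τ₀)
    (h : KAMHyp ρ τ₀ O r s M L ε K θ μ ω Ωt P) (hK : LargeK n τ₀ M L γ K) (hKN : K < N)
    (hNK : (N : ℝ) ≤ K + 1) (hτ : τ₀ ≤ τ) :
    C1 n * N * (C1 n * N) < (μ - 1 / 2) * (N : ℝ) ^ τ ∧
    C1 n * N * (C1 n * N) < (4 - θ) * (N : ℝ) ^ (4 * d * τ) ∧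
    μ * (N : ℝ) ^ τ ≤ θ * (N : ℝ) ^ (4 * d * τ) ∧
    θ * (N : ℝ) ^ tau1 d τ₀ + C1 n * N ≤ 4 * (N : ℝ) ^ tau1 d τ₀ := by
  have hd := one_le_dim hne
  have hd' : (1 : ℝ) ≤ d := by exact_mod_cast hd
  have hK1 := hK.one_le
  have hC := one_le_C1 hne
  have hNp : (0 : ℝ) < N := by linarith
  have hθ := h.theta_mem
  have hμ := h.mu_mem
  have hNN : C1 n * N * (C1 n * N) ≤ 5 * K ^ 4 := by
    calc C1 n * N * (C1 n * N) = C1 n ^ 2 * (N : ℝ) ^ 2 := by ring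
      _ ≤ K * (2 * K) ^ 2 := by
          have := hK.C1_sq
          gcongr; linarith
      _ ≤ 5 * K ^ 4 := by
          have : 0 < K ^ 3 := by positivity
          nlinarith
  have hmono : ∀ {x y : ℝ}, 0 ≤ x → x ≤ y → K ^ x ≤ (N : ℝ) ^ y := fun {x y} hx hxy =>
    (Real.rpow_le_rpow (by linarith) hKN.le hx).trans
      (Real.rpow_le_rpow_of_exponent_le (by linarith) hxy)
  have hθpow : 5 * K ^ 4 < (4 - θ) * (N : ℝ) ^ (4 * d * τ₀) :=
    h.theta_gap.trans_le (mul_le_mul_of_nonneg_left (hmono (by positivity) le_rfl)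
      (by linarith [hθ.2]))
  have hmulτ : 4 * d * τ₀ ≤ 4 * d * τ := mul_le_mul_of_nonneg_left hτ (by positivity)
  refine ⟨?_, ?_, ?_, ?_⟩
  · exact hNN.trans_lt (h.mu_gap.trans_le (mul_le_mul_of_nonneg_left (hmono (by linarith) hτ)
      (by linarith [hμ.1])))
  · exact hNN.trans_lt (hθpow.trans_le (mul_le_mul_of_nonneg_left
      (Real.rpow_le_rpow_of_exponent_le (by linarith) hmulτ) (by linarith [hθ.2])))
  · have hN6 : 1000 + 6 * C1 n ≤ (N : ℝ) := hK.base.trans hKN.le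
    have hinv : 1 / (N : ℝ) ≤ 1 / 4 := by
      rw [div_le_div_iff₀ hNp (by norm_num)]; linarith
    exact (gap_of_large (θ₁ := θ - 1 / 4) (μ₁ := μ + 1 / 2) hne hτ₀ hN6 hτ (by linarith [hθ.1])
      (by linarith [hμ.2]) (by linarith) (by linarith)).sep₂
  · have h1 := four_d_tau_le hd (tau_range hd (show 0 ≤ τ₀ by linarith))
    have h2 : (4 - θ) * (N : ℝ) ^ (4 * d * τ₀) ≤ (4 - θ) * (N : ℝ) ^ tau1 d τ₀ :=
      mul_le_mul_of_nonneg_left (Real.rpow_le_rpow_of_exponent_le (by linarith) h1)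
        (by linarith [hθ.2])
    have h3 : C1 n * N ≤ C1 n * N * (C1 n * N) :=
      le_mul_of_one_le_right (by positivity) (by nlinarith)
    linarith

/-- Comparison of the divisor at a good point with the one chosen in its good portion. -/
theorem divisor_of_good (hne : ∃ i, n i ≠ 0) (hτ₀ : 12 < τ₀) (hr : 0 < r) (hL : 0 < L) (hγ : 0 < γ)
    (hwt : ∀ m : NSite n, 1 ≤ weight ρ m)
    (h : KAMHyp ρ τ₀ O r s M L ε K θ μ ω Ωt P) (hK : LargeK n τ₀ M L γ K) (hKN : K < N)
    (hNK : (N : ℝ) ≤ K + 1) {ℓ : ℕ} {Q : Pres d ℓ} (h0 : 0 < ℓ) (hℓ : ℓ < d)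
    (hQ : IsOptimal n N Q Q.toSet) (hτ : τ₀ ≤ τ) (hτ' : τ ≤ tau1 d τ₀ / (4 * d))
    (hp : ∀ i, |(Q.p i : ℝ)| ≤ 1 / 2 * (N : ℝ) ^ τ)
    (hpτ : (N : ℝ) ^ (4 * d * τ) ≤
      max ((N : ℝ) ^ (4 * d * τ₀)) (2 ^ (4 * d) * |(Q.lastP : ℝ)| ^ (4 * d)))
    {m m' y y' : NSite n} (hm : m ∈ goodPortion n τ₀ N Q) (hy : y ∈ goodPortion n τ₀ N Q)
    {k : Fin b → ℤ} (hk : absK k ≤ K) (hkQ : toR (piK n k) ∈ Q.span)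
    (hmm : m'.1 = m.1 + piK n k) (hyy : y'.1 = y.1 + piK n k) {ξ : Par b} (hξ : ξ ∈ O) :
    (N : ℝ) ^ (4 * d * τ) * |((∑ i, ω ξ i * (k i : ℝ)) + freqN Ωt m ξ - freqN Ωt m' ξ) -
      ((∑ i, ω ξ i * (k i : ℝ)) + freqN Ωt y ξ - freqN Ωt y' ξ)| ≤ 16 * L := by
  obtain ⟨b1, b2, b3, b4⟩ := scale_bounds hne hτ₀ h hK hKN hNK hτ
  have hK1 := hK.one_le
  have hN2 : 2 ≤ N := by
    have : (2 : ℝ) ≤ N := by linarith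
    exact_mod_cast this
  have hTB := TB.of_TNorm hne hr hwt hN2 hL h.Omega_qt.1 h.Omega_qt_bound hKN.le hτ hτ'
  have hfin : Module.finrank ℝ Q.span = ℓ := finrank_span_of_indep hQ.1.2.1
  have hkN : len (piK n k) ≤ C1 n * N := (len_piK_le k).trans
    (mul_le_mul_of_nonneg_left (hk.trans hKN.le) (C1_nonneg n))
  have hμ := h.mu_mem
  have bi : ∀ x ∈ goodPortion n τ₀ N Q, ∀ z : NSite n, len (z.1 - x.1) ≤ C1 n * N →
      Bi τ₀ N θ μ τ 0 z true z false Q.span := by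
    intro x hx z hz
    refine bi_diag (by omega) (by linarith [hμ.1]) (cutV_of_good hQ hx.1 hp (fun v hv hv' => ?_) hz
      b1 b2 b3) ?_ (by omega) (by omega)
    · have h1 := hx.2.2 v hv hv'
      have h2 : (idot v x.1 : ℝ) = ∑ j, (v j : ℝ) * (x.1 j : ℝ) := idot_cast _ _
      rw [h2]
      linarith
    · have h1 := hx.2.1
      have h2 := len_sub_le z.1 (z.1 - x.1)
      rw [sub_sub_cancel] at h2
      linarith
  have hC : 0 ≤ C1 n * N := mul_nonneg (C1_nonneg n) (Nat.cast_nonneg _)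
  have bm := bi m hm m (by rw [sub_self, len_zero]; exact hC)
  have bm' := bi m hm m' (by rw [hmm, add_sub_cancel_left]; exact hkN)
  have by' := bi y hy y (by rw [sub_self, len_zero]; exact hC)
  have by'' := bi y hy y' (by rw [hyy, add_sub_cancel_left]; exact hkN)
  have horth := (Pres.orth_of_toSet_eq (x := m.1) (y := y.1) hm.1 hy.1 rfl).2
  have c1 := Omega_close hne hN2 hr hwt (by linarith) hTB bm by' horth hξ
  have c2 := Omega_close hne hN2 hr hwt (by linarith) hTB bm' by''
    (by rw [hmm, hyy, add_sub_add_right_eq_sub]; exact horth) hξ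
  have hdot : (idot (piK n k) y.1 : ℝ) = idot (piK n k) m.1 := by
    have := horth _ hkQ
    rw [toR_sub, dotProduct_sub, ← idot_cast, ← idot_cast] at this
    linarith
  have s1 := len_sq_shift m.1 (piK n k)
  have s2 := len_sq_shift y.1 (piK n k)
  rw [hdot] at s2
  have e : ((∑ i, ω ξ i * (k i : ℝ)) + freqN Ωt m ξ - freqN Ωt m' ξ) -
      ((∑ i, ω ξ i * (k i : ℝ)) + freqN Ωt y ξ - freqN Ωt y' ξ) =
      (Ωt m ξ - Ωt y ξ) - (Ωt m' ξ - Ωt y' ξ) := by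
    simp only [freqN, hmm, hyy]; linarith
  rw [e]
  have hT : (0 : ℝ) ≤ (N : ℝ) ^ (4 * d * τ) := by positivity
  calc _ ≤ (N : ℝ) ^ (4 * d * τ) * (|Ωt m ξ - Ωt y ξ| + |Ωt m' ξ - Ωt y' ξ|) :=
        mul_le_mul_of_nonneg_left (abs_sub _ _) hT
    _ ≤ 16 * L := by linarith

end HighDivisor

section LowerBound

variable {d b : ℕ} {n : Fin b → Fin d → ℤ} {ρ τ₀ r s M L ε K θ μ γ : ℝ}
  {O : Set (Par b)} {ω : Par b → Par b} {Ωt : NSite n → Par b → ℝ} {P : Ham n}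
  {mg : ℕ → (ℓ : ℕ) → Pres d ℓ → NSite n}

theorem notMem_range_of_len {x : Fin d → ℤ} (h : C1 n < len x) : x ∉ Set.range n := by
  rintro ⟨i, rfl⟩
  exact absurd (len_le_C1 (n := n) i) (not_le.2 h)

/-- A divisor close to a controlled one. -/
theorem le_abs_of_compare (hd : 1 ≤ d) (hτ₀ : 12 < τ₀) (hγ : 0 < γ) (hL : 0 < L)
    (hK : LargeK n τ₀ M L γ K) {N : ℕ} {τ X Dm Dy : ℝ} (hKN : K < N) (hNK : (N : ℝ) ≤ K + 1)
    (hτ : τ₀ ≤ τ) (hτ' : τ ≤ tau1 d τ₀ / (4 * d))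
    (hgood : 2 * γ / max ((N : ℝ) ^ (2 * d * τ₀)) X < |Dy|)
    (hX : max ((N : ℝ) ^ (2 * d * τ₀)) X ≤ 4 ^ d * (N : ℝ) ^ (2 * d * τ))
    (hcomp : (N : ℝ) ^ (4 * d * τ) * |Dm - Dy| ≤ 16 * L) : divBound d τ₀ γ K ≤ |Dm| := by
  have hd' : (1 : ℝ) ≤ d := by exact_mod_cast hd
  have hK1 := hK.one_le
  have hKp : 0 < K := by linarith
  have hNp : (0 : ℝ) < N := by linarith
  have hN1 : (1 : ℝ) ≤ N := by linarith
  have hST : (N : ℝ) ^ (4 * d * τ) = (N : ℝ) ^ (2 * d * τ) * (N : ℝ) ^ (2 * d * τ) := by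
    rw [← Real.rpow_add hNp]; congr 1; ring
  have hSp : 0 < (N : ℝ) ^ (2 * d * τ) := Real.rpow_pos_of_pos hNp _
  have hdτ : τ ≤ d * τ := le_mul_of_one_le_left (by linarith) hd'
  have hSK : K ≤ (N : ℝ) ^ (2 * d * τ) := by
    refine hKN.le.trans ?_
    conv_lhs => rw [← Real.rpow_one (N : ℝ)]
    exact Real.rpow_le_rpow_of_exponent_le hN1 (by linarith)
  have hSup : (N : ℝ) ^ (2 * d * τ) ≤ K ^ (2 * d * tau1 d τ₀) := by
    have h1 := four_d_tau_le hd hτ'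
    have h2 : (N : ℝ) ≤ K ^ (2 : ℝ) := by
      have : K ^ (2 : ℝ) = K * K := by rw [← sq]; norm_num
      rw [this]; nlinarith
    have h3 := tau_le_tau1 hd (show 0 ≤ τ₀ by linarith)
    have h4 : tau1 d τ₀ ≤ d * tau1 d τ₀ := le_mul_of_one_le_left (by linarith) hd'
    calc (N : ℝ) ^ (2 * d * τ) ≤ (K ^ (2 : ℝ)) ^ (2 * d * τ) :=
          Real.rpow_le_rpow hNp.le h2 (by linarith)
      _ = K ^ (2 * (2 * d * τ)) := by rw [← Real.rpow_mul hKp.le]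
      _ ≤ _ := Real.rpow_le_rpow_of_exponent_le (by linarith) (by linarith)
  rw [hST] at hcomp
  generalize (N : ℝ) ^ (2 * d * τ) = S at *
  have g1 : 2 * γ / (4 ^ d * S) ≤ |Dy| := by
    refine le_trans ?_ hgood.le
    exact div_le_div_of_nonneg_left (by linarith) (lt_of_lt_of_le (Real.rpow_pos_of_pos hNp _)
      (le_max_left _ _)) hX
  have g2 : |Dm - Dy| ≤ γ / (4 ^ d * S) := by
    rw [le_div_iff₀ (by positivity)]
    have h1 : 16 * L * 4 ^ d ≤ γ * S := by
      have := hK.hLγ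
      have h2 : γ * K ≤ γ * S := by gcongr
      have h3 : 0 ≤ L * 4 ^ d := by positivity
      linarith
    have h2 : S * (S * |Dm - Dy| * 4 ^ d) ≤ S * γ := by
      calc S * (S * |Dm - Dy| * 4 ^ d) = S * S * |Dm - Dy| * 4 ^ d := by ring
        _ ≤ 16 * L * 4 ^ d := by gcongr
        _ ≤ S * γ := by linarith
    have h3 := le_of_mul_le_mul_left h2 hSp
    linarith
  have g3 : γ / (4 ^ d * S) ≤ |Dm| := by
    have h1 := abs_sub_abs_le_abs_sub Dy Dm
    rw [abs_sub_comm] at h1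
    have h2 : 2 * γ / (4 ^ d * S) = 2 * (γ / (4 ^ d * S)) := by ring
    linarith
  refine le_trans ?_ g3
  rw [divBound, Real.rpow_neg hKp.le, ← div_eq_mul_inv, div_div]
  exact div_le_div_of_nonneg_left hγ.le (by positivity) (by gcongr)

set_option maxHeartbeats 800000 in
/-- Divisors `⟨ω, k⟩ + Ω_m - Ω_{m'}` at far points. -/
theorem divisor_high (hne : ∃ i, n i ≠ 0) (hτ₀ : 12 < τ₀) (hr : 0 < r) (hL : 0 < L) (hγ : 0 < γ)
    (hwt : ∀ m : NSite n, 1 ≤ weight ρ m) (h : KAMHyp ρ τ₀ O r s M L ε K θ μ ω Ωt P)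
    (hK : LargeK n τ₀ M L γ K) (hmg : IsChoice τ₀ mg) {ξ : Par b}
    (hξ : InOplus τ₀ γ K O ω Ωt mg ξ) {k : Fin b → ℤ} (hk : absK k ≤ K) {m m' : NSite n}
    (hmm : m'.1 = m.1 + piK n k) (hmne : m ≠ m')
    (hmax : 8 * K ^ tau1 d τ₀ < max (len m.1) (len m'.1)) :
    divBound d τ₀ γ K ≤ |(∑ i, ω ξ i * (k i : ℝ)) + freqN Ωt m ξ - freqN Ωt m' ξ| := by
  have hd := one_le_dim hne
  have hd' : (1 : ℝ) ≤ d := by exact_mod_cast hd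
  have hK1 := hK.one_le
  have hKp : 0 < K := by linarith
  have hC := one_le_C1 hne
  have hτ1 := tau_le_tau1 hd (show 0 ≤ τ₀ by linarith)
  by_cases hv : K ^ 3 ≤ |(idot (piK n k) m.1 : ℝ)|
  · exact divisor_of_large_product hd hτ₀ hγ h hK hξ.mem hk hmm hv
  rw [not_le] at hv
  set N : ℕ := ⌊K⌋₊ + 1 with hN
  have hKN : K < N := by rw [hN]; push_cast; exact Nat.lt_floor_add_one K
  have hNK : (N : ℝ) ≤ K + 1 := by
    rw [hN]; push_cast; linarith [Nat.floor_le hKp.le]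
  have hNp : (0 : ℝ) < N := by linarith
  have hN1 : (1 : ℝ) ≤ N := by linarith
  have hN2 : 2 ≤ N := by
    have : (2 : ℝ) ≤ N := by linarith
    exact_mod_cast this
  have hv0 : piK n k ≠ 0 := fun h0 => hmne (Subtype.ext (by rw [hmm, h0, add_zero]))
  have hk0 : k ≠ 0 := fun h0 => hv0 (by simp [h0, piK])
  have hvB : piK n k ∈ ballB n N := mem_ball_piK hne (hk.trans_lt hKN) hv0
  have hCK : C1 n * K ≤ K ^ tau1 d τ₀ := by
    calc C1 n * K ≤ K * K := by have := hK.base; gcongr; linarith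
      _ = K ^ (2 : ℝ) := by rw [← sq]; norm_num
      _ ≤ _ := Real.rpow_le_rpow_of_exponent_le (by linarith) (by linarith)
  have hKτ : 0 < K ^ tau1 d τ₀ := Real.rpow_pos_of_pos hKp _
  have hlen : 7 * K ^ tau1 d τ₀ < len m.1 := by
    have h1 : len (piK n k) ≤ C1 n * K := (len_piK_le k).trans (by gcongr)
    have h2 : len m'.1 ≤ len m.1 + len (piK n k) := by rw [hmm]; exact len_add_le _ _
    rcases lt_max_iff.1 hmax with h3 | h3 <;> linarith [C1_nonneg n]
  have hNτ : (N : ℝ) ^ tau1 d τ₀ ≤ 3 / 2 * K ^ tau1 d τ₀ := by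
    have h1 : (N : ℝ) ≤ K * Real.exp (1 / K) := by
      have := Real.add_one_le_exp (1 / K)
      have h2 : K * (1 / K + 1) ≤ K * Real.exp (1 / K) := by gcongr
      rw [mul_add, mul_one_div_cancel hKp.ne'] at h2
      linarith
    calc (N : ℝ) ^ tau1 d τ₀ ≤ (K * Real.exp (1 / K)) ^ tau1 d τ₀ :=
          Real.rpow_le_rpow hNp.le h1 (by linarith)
      _ = Real.exp (1 / K * tau1 d τ₀) * K ^ tau1 d τ₀ := by
          rw [Real.mul_rpow hKp.le (Real.exp_pos _).le, ← Real.exp_mul, mul_comm]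
      _ ≤ 3 / 2 * K ^ tau1 d τ₀ := by
          refine mul_le_mul_of_nonneg_right ?_ (by positivity)
          have h2 : 1 / K * tau1 d τ₀ ≤ 1 / 4 := by
            rw [one_div_mul_eq_div, div_le_div_iff₀ hKp (by norm_num)]
            linarith [hK.tau]
          refine (Real.exp_le_exp.2 h2).trans ?_
          have h3 := Real.exp_bound_div_one_sub_of_interval (x := 1 / 4) (by norm_num) (by norm_num)
          norm_num at h3 ⊢
          linarith
  have hlenN : 4 * (N : ℝ) ^ tau1 d τ₀ < len m.1 := by linarith
  obtain ⟨R, hR⟩ := exists_optimal hne hN2 m.1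
  have hmm0 : toR m.1 ∈ ({toR m.1} : Set _) := rfl
  have hmR : toR m.1 ∈ R.toSet := by rw [hR.1.2.2]; exact hmm0
  have hKτ₀ : K ^ 3 ≤ (N : ℝ) ^ τ₀ := by
    calc K ^ 3 ≤ (N : ℝ) ^ 3 := by gcongr
      _ = (N : ℝ) ^ (3 : ℝ) := by norm_num
      _ ≤ _ := Real.rpow_le_rpow_of_exponent_le hN1 (by linarith)
  have hp0 : (R.p ⟨0, hd⟩ : ℝ) ≤ (N : ℝ) ^ τ₀ := by
    by_contra hc
    rw [not_le] at hc
    have h1 := hR.mem_span_of_lt hd hvB ((hv.trans_le hKτ₀).trans hc)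
    have h2 : (R.take (Nat.zero_le d)).span = ⊥ := by
      rw [Pres.span_eq]; simp
    rw [h2, Submodule.mem_bot] at h1
    exact hv0 (toR_injective (h1.trans (by funext j; simp [toR])))
  obtain ⟨ℓ, h0, hℓ, hpℓ, hgap⟩ := exists_gap_index hd hτ₀ (hK.two_pow.trans hKN.le)
    (by have := hK.base; linarith) (hK.fact.trans hKN.le) hR
    (show (N : ℝ) ^ tau1 d τ₀ < len m.1 by
      have : 0 < (N : ℝ) ^ tau1 d τ₀ := Real.rpow_pos_of_pos hNp _
      linarith) hp0
  set Q := R.take hℓ.le with hQdef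
  have hQ : IsOptimal n N Q Q.toSet := hR.take hmm0 hℓ.le
  have hlast : Q.lastP = R.p ⟨ℓ - 1, by omega⟩ := by
    rw [Pres.lastP, dif_pos h0]; rfl
  have hpnn : (0 : ℝ) ≤ (R.p ⟨ℓ - 1, by omega⟩ : ℝ) := by exact_mod_cast hR.p_nonneg hmm0 _
  set p : ℝ := (R.p ⟨ℓ - 1, by omega⟩ : ℝ) with hpdef
  have hlastp : |(Q.lastP : ℝ)| = p := by rw [hlast, abs_of_nonneg hpnn]
  have hpT : 2 * p < (N : ℝ) ^ (tau1 d τ₀ / (4 * d)) := by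
    obtain ⟨E, hE⟩ : ∃ E : ℝ, E = (4 * d : ℝ) ^ (d - 1) * (τ₀ + 1) := ⟨_, rfl⟩
    have hE0 : 0 ≤ E := by rw [hE]; positivity
    have e1 : tau1 d τ₀ / (4 * d) = 4 * d * E := by
      have : tau1 d τ₀ = (4 * d) ^ 2 * E := by
        rw [tau1, hE, ← mul_assoc, ← pow_add]
        congr 2; omega
      rw [this]; field_simp
    rw [← hE] at hpℓ
    calc 2 * p ≤ 2 * (N : ℝ) ^ (E - 1) := by linarith
      _ < N * (N : ℝ) ^ (E - 1) :=
          mul_lt_mul_of_pos_right (by linarith) (Real.rpow_pos_of_pos hNp _)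
      _ = (N : ℝ) ^ E := by
          have h1 := Real.rpow_add hNp 1 (E - 1)
          rw [Real.rpow_one] at h1
          rw [← h1]
          congr 1; ring
      _ ≤ _ := by
          rw [e1]
          exact Real.rpow_le_rpow_of_exponent_le hN1 (by nlinarith)
  obtain ⟨τ, hτ, hτ', t1, t2, t3⟩ := exists_tau (d := d) hN2 hpnn
    (tau_range hd (show 0 ≤ τ₀ by linarith)) hpT.le
  have hmgood : m ∈ goodPortion n τ₀ N Q := by
    refine ⟨mem_toSet_take hℓ.le hmR, hlenN, fun v hv hv' => ?_⟩
    rw [hlastp]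
    by_contra hc
    rw [not_le] at hc
    exact hv' (hR.mem_span_of_lt hℓ hv (by rw [idot_cast]; exact hc.trans hgap))
  have hygood := hmg N ℓ Q ⟨m, hmgood⟩
  set y := mg N ℓ Q with hydef
  have hkQ : toR (piK n k) ∈ Q.span := by
    refine hR.mem_span_of_lt hℓ hvB (hv.trans_le (hKτ₀.trans ?_) |>.trans hgap)
    have h1 : (N : ℝ) ^ τ₀ ≤ (N : ℝ) ^ (4 * d * τ₀) :=
      Real.rpow_le_rpow_of_exponent_le hN1 (by nlinarith)
    have h2 := le_max_left ((N : ℝ) ^ (4 * d * τ₀)) (2 ^ (4 * d) * p ^ (4 * d))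
    have h3 : 0 < (N : ℝ) ^ (4 * d * τ₀) := Real.rpow_pos_of_pos hNp _
    linarith
  have hNτ1 : (N : ℝ) ≤ (N : ℝ) ^ tau1 d τ₀ := by
    conv_lhs => rw [← Real.rpow_one (N : ℝ)]
    exact Real.rpow_le_rpow_of_exponent_le hN1 (by linarith)
  have hyn : y.1 + piK n k ∉ Set.range n := by
    refine notMem_range_of_len ?_
    have h1 := hygood.2.1
    have h2 := len_sub_le (y.1 + piK n k) (piK n k)
    rw [add_sub_cancel_right] at h2
    have h3 : len (piK n k) ≤ C1 n * K := (len_piK_le k).trans (by gcongr)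
    have h4 : K ^ tau1 d τ₀ ≤ (N : ℝ) ^ tau1 d τ₀ :=
      Real.rpow_le_rpow hKp.le hKN.le (by linarith)
    have h5 := hK.base
    linarith
  have hNupper : (N : ℝ) ≤ 2 * K ^ (tau1 d τ₀ / τ₀) := by
    have h1 : (1 : ℝ) ≤ tau1 d τ₀ / τ₀ := by
      rw [le_div_iff₀ (by linarith)]; linarith
    have h2 : K ≤ K ^ (tau1 d τ₀ / τ₀) := by
      conv_lhs => rw [← Real.rpow_one K]
      exact Real.rpow_le_rpow_of_exponent_le (by linarith) h1
    linarith
  have hgood := hξ.good N hKN.le hNupper ℓ Q h0 hℓ hQ (by rw [hlastp]; linarith) ⟨m, hmgood⟩ k hk hk0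
    ⟨y.1 + piK n k, hyn⟩ rfl
  rw [hlastp] at hgood
  have hcomp := divisor_of_good hne hτ₀ hr hL hγ hwt h hK hKN hNK h0 hℓ hQ hτ hτ' (fun i => ?_)
    (by rw [hlastp]; exact t2) hmgood hygood hk hkQ hmm
    (show (⟨y.1 + piK n k, hyn⟩ : NSite n).1 = y.1 + piK n k from rfl) hξ.mem
  · exact le_abs_of_compare hd hτ₀ hγ hL hK hKN hNK hτ hτ' hgood t3 hcomp
  · have h1 := hR.p_nonneg hmm0 (Fin.castLE hℓ.le i)
    have h2 : R.p (Fin.castLE hℓ.le i) ≤ R.p ⟨ℓ - 1, by omega⟩ :=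
      hR.p_mono hmm0 (by rw [Fin.le_def]; exact Nat.le_sub_one_of_lt i.2)
    have h3 : (Q.p i : ℝ) = (R.p (Fin.castLE hℓ.le i) : ℝ) := rfl
    have h4 : (R.p (Fin.castLE hℓ.le i) : ℝ) ≤ p := by rw [hpdef]; exact_mod_cast h2
    rw [h3, abs_of_nonneg (by exact_mod_cast h1)]
    exact h4.trans t1

/-- The monomials of the generating function. -/
def FMon (K : ℝ) (ν : Mon n) : Prop :=
  deg ν ≤ 2 ∧ absK ν.1 ≤ K ∧ ¬ (ν.1 = 0 ∧ ν.2.2.1 = ν.2.2.2)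

theorem momKL_diffAB (ν : Mon n) : momKL ν.1 (diffAB ν) = mom ν := by
  rw [momKL, mom, diffAB, Finsupp.sum_sub_index (by intros; rw [sub_smul]),
    Finsupp.sum_mapRange_index (by simp), Finsupp.sum_mapRange_index (by simp), add_sub_assoc]

theorem absL_nonneg (l : NSite n →₀ ℤ) : 0 ≤ absL l :=
  Finset.sum_nonneg fun _ _ => abs_nonneg _

theorem absL_diffAB_le (ν : Mon n) : absL (diffAB ν) ≤ deg ν := by
  classical
  set S := ν.2.2.1.support ∪ ν.2.2.2.support
  have h1 : absL (diffAB ν) = ∑ j ∈ S, |diffAB ν j| := by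
    refine Finsupp.sum_of_support_subset _ (fun j hj => ?_) _ (by simp)
    rw [Finset.mem_union, Finsupp.mem_support_iff, Finsupp.mem_support_iff]
    by_contra hc
    push Not at hc
    exact Finsupp.mem_support_iff.1 hj (by simp [diffAB, hc.1, hc.2])
  have h2 : (ν.2.2.1.sum fun _ a => a) = ∑ j ∈ S, ν.2.2.1 j :=
    Finsupp.sum_of_support_subset _ Finset.subset_union_left _ (by simp)
  have h3 : (ν.2.2.2.sum fun _ a => a) = ∑ j ∈ S, ν.2.2.2 j :=
    Finsupp.sum_of_support_subset _ Finset.subset_union_right _ (by simp)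
  rw [h1, deg, h2, h3]
  push_cast
  have h4 : ∑ j ∈ S, |diffAB ν j| ≤ ∑ j ∈ S, ((ν.2.2.1 j : ℤ) + ν.2.2.2 j) :=
    Finset.sum_le_sum fun j _ => by
      have : diffAB ν j = (ν.2.2.1 j : ℤ) - ν.2.2.2 j := by simp [diffAB]
      rw [this, abs_le]
      constructor <;> linarith [(ν.2.2.1 j).cast_nonneg (α := ℤ), (ν.2.2.2 j).cast_nonneg (α := ℤ)]
  rw [Finset.sum_add_distrib] at h4
  have h5 : (0 : ℤ) ≤ ∑ i, (ν.2.1 i : ℤ) := Finset.sum_nonneg fun _ _ => Nat.cast_nonneg _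
  linarith

theorem eq_of_absL_zero {ν : Mon n} (h : absL (diffAB ν) = 0) : ν.2.2.1 = ν.2.2.2 := by
  have h1 : ∀ j, diffAB ν j = 0 := by
    intro j
    by_contra hj
    have h2 := (Finset.sum_eq_zero_iff_of_nonneg (fun j _ => abs_nonneg (diffAB ν j))).1 h j
      (Finsupp.mem_support_iff.2 hj)
    exact hj (abs_eq_zero.1 h2)
  ext j
  have := h1 j
  simp only [diffAB, Finsupp.coe_sub, Pi.sub_apply, Finsupp.mapRange_apply] at this
  omega

theorem divisor_single_sub (k : Fin b → ℤ) (m m' : NSite n) (ξ : Par b) :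
    divisor ω Ωt k (Finsupp.single m 1 - Finsupp.single m' 1) ξ =
      (∑ i, ω ξ i * (k i : ℝ)) + freqN Ωt m ξ - freqN Ωt m' ξ := by
  rw [divisor, Finsupp.sum_sub_index (by intros; push_cast; ring),
    Finsupp.sum_single_index (by simp), Finsupp.sum_single_index (by simp)]
  push_cast; ring

/-- Lower bound for all divisors of the generating function. -/
theorem divBound_le (hne : ∃ i, n i ≠ 0) (hτ₀ : 12 < τ₀) (hr : 0 < r) (hL : 0 < L) (hγ : 0 < γ)
    (hwt : ∀ m : NSite n, 1 ≤ weight ρ m) (h : KAMHyp ρ τ₀ O r s M L ε K θ μ ω Ωt P)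
    (hK : LargeK n τ₀ M L γ K) (hmg : IsChoice τ₀ mg) {ξ : Par b}
    (hξ : InOplus τ₀ γ K O ω Ωt mg ξ) {ν : Mon n} (hν : FMon K ν) (hmom : mom ν = 0) :
    divBound d τ₀ γ K ≤ |divisor ω Ωt ν.1 (diffAB ν) ξ| := by
  have hd := one_le_dim hne
  have hd' : (1 : ℝ) ≤ d := by exact_mod_cast hd
  have hK1 := hK.one_le
  have hτ1 := tau_le_tau1 hd (show 0 ≤ τ₀ by linarith)
  obtain ⟨hdeg, hk, hres⟩ := hν
  have hle := absL_diffAB_le ν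
  have h0 := absL_nonneg (diffAB ν)
  have hmom' : momKL ν.1 (diffAB ν) = 0 := (momKL_diffAB ν).trans hmom
  have hdiv : γ / 4 ^ d ≤ 2 * γ :=
    (div_le_self hγ.le (one_le_pow₀ (by norm_num))).trans (by linarith)
  have hB2 : divBound d τ₀ γ K ≤ 2 * γ * K ^ (-(2 * d * tau1 d τ₀)) :=
    mul_le_mul_of_nonneg_right hdiv (Real.rpow_nonneg (by linarith) _)
  have hB1 : divBound d τ₀ γ K ≤ 2 * γ * K ^ (-τ₀) := by
    refine hB2.trans (mul_le_mul_of_nonneg_left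
      (Real.rpow_le_rpow_of_exponent_le (by linarith) ?_) (by linarith))
    nlinarith
  have hcases : absL (diffAB ν) = 0 ∨ absL (diffAB ν) = 1 ∨ absL (diffAB ν) = 2 := by
    have : (deg ν : ℤ) ≤ 2 := by exact_mod_cast hdeg
    omega
  rcases hcases with h1 | h1 | h1
  · have h2 := eq_of_absL_zero h1
    have hk0 : ν.1 ≠ 0 := fun h3 => hres ⟨h3, h2⟩
    have h3 := hξ.zeroth ν.1 0 hk (Or.inl hk0)
    have h4 : diffAB ν = 0 := by rw [diffAB, h2, sub_self]
    rw [h4, divisor, Finsupp.sum_zero_index]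
    push_cast at h3
    exact hB1.trans h3.le
  · exact hB1.trans (hξ.first ν.1 _ hk h1 hmom').le
  · by_cases hfar : ∀ m m' : NSite n, diffAB ν = Finsupp.single m 1 - Finsupp.single m' 1 →
        max (len m.1) (len m'.1) ≤ 8 * K ^ tau1 d τ₀
    · exact hB2.trans (hξ.second ν.1 _ hk h1 hmom' hfar).le
    · push Not at hfar
      obtain ⟨m, m', hl, hmax⟩ := hfar
      rw [hl, momKL, Finsupp.sum_sub_index (by intros; rw [sub_smul]),
        Finsupp.sum_single_index (by simp), Finsupp.sum_single_index (by simp), one_smul,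
        one_smul] at hmom'
      rw [hl, divisor_single_sub]
      refine divisor_high hne hτ₀ hr hL hγ hwt h hK hmg hξ hk ?_ ?_ hmax
      · have := sub_eq_zero.1 ((add_sub_assoc _ _ _).trans hmom')
        rw [← this, add_comm]
      · rintro rfl
        rw [sub_self] at hl
        rw [hl] at h1
        simp [absL] at h1

end LowerBound

/-! ### Regularity of the divisors -/

section DivisorReg

variable {d b : ℕ} {n : Fin b → Fin d → ℤ} {ρ τ₀ r s M L ε K θ μ γ Λ : ℝ}
  {O : Set (Par b)} {ω : Par b → Par b} {Ωt : NSite n → Par b → ℝ} {P : Ham n}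
  {mg : ℕ → (ℓ : ℕ) → Pres d ℓ → NSite n} {Q Q' : NSite n → Par b → ℂ}

/-- The divisor of the monomial `ν` for complex corrections `Q` of the normal frequencies. -/
def divC (ω : Par b → Par b) (Q : NSite n → Par b → ℂ) (ν : Mon n) (ξ : Par b) : ℂ :=
  ((∑ i, ω ξ i * (ν.1 i : ℝ) : ℝ) : ℂ) +
    (diffAB ν).sum fun j a => (((len j.1 ^ 2 : ℝ) : ℂ) + Q j ξ) * (a : ℂ)

theorem divC_ofReal (ν : Mon n) (ξ : Par b) : divC ω (fun j ξ => (Ωt j ξ : ℂ)) ν ξ =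
    (divisor ω Ωt ν.1 (diffAB ν) ξ : ℂ) := by
  simp only [divC, divisor, Finsupp.sum, freqN]
  push_cast
  rfl

theorem absL_cast (l : NSite n →₀ ℤ) : ((absL l : ℤ) : ℝ) = l.sum fun _ a => |(a : ℝ)| := by
  simp [absL, Finsupp.sum]

/-- `⟨·, k⟩` as a continuous linear map. -/
def pairK (k : Fin b → ℤ) : Par b →L[ℝ] ℂ :=
  ∑ i, (k i : ℝ) • (Complex.ofRealCLM.comp (EuclideanSpace.proj i : Par b →L[ℝ] ℝ))

theorem pairK_apply (k : Fin b → ℤ) (x : Par b) :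
    pairK k x = ((∑ i, x i * (k i : ℝ) : ℝ) : ℂ) := by
  simp [pairK, mul_comm]

theorem norm_pairK_le (k : Fin b → ℤ) : ‖pairK k‖ ≤ absK k := by
  refine ContinuousLinearMap.opNorm_le_bound _ (absK_nonneg k) fun x => ?_
  rw [pairK_apply, Complex.norm_real, Real.norm_eq_abs, absK, Finset.sum_mul]
  refine (Finset.abs_sum_le_sum_abs _ _).trans (Finset.sum_le_sum fun i _ => ?_)
  rw [abs_mul, mul_comm]
  exact mul_le_mul_of_nonneg_left (PiLp.norm_apply_le x i) (abs_nonneg _)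

theorem contDiffOn_divC (hω : ContDiffOn ℝ 1 ω O) {ν : Mon n}
    (hQ : ∀ j ∈ (diffAB ν).support, ContDiffOn ℝ 1 (Q j) O) : ContDiffOn ℝ 1 (divC ω Q ν) O := by
  have h1 : ContDiffOn ℝ 1 (fun ξ => pairK ν.1 (ω ξ)) O :=
    (pairK ν.1).contDiff.comp_contDiffOn hω
  have h2 : ContDiffOn ℝ 1 (fun ξ => ∑ j ∈ (diffAB ν).support,
      (((len j.1 ^ 2 : ℝ) : ℂ) + Q j ξ) * (diffAB ν j : ℂ)) O :=
    ContDiffOn.sum fun j hj => (contDiffOn_const.add (hQ j hj)).mul contDiffOn_const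
  refine (h1.add h2).congr fun ξ _ => ?_
  simp only [divC, pairK_apply, Finsupp.sum, Pi.add_apply]

theorem norm_fderiv_divC_le (hO : IsOpen O) (hω : ContDiffOn ℝ 1 ω O)
    (hM : ∀ ξ ∈ O, ‖ω ξ‖ + ‖fderiv ℝ ω ξ‖ ≤ M) {ν : Mon n}
    (hQ : ∀ j ∈ (diffAB ν).support, ContDiffOn ℝ 1 (Q j) O)
    (hΛ : ∀ j ∈ (diffAB ν).support, ∀ ξ ∈ O, ‖fderiv ℝ (Q j) ξ‖ ≤ Λ) {ξ : Par b} (hξ : ξ ∈ O) :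
    ‖fderiv ℝ (divC ω Q ν) ξ‖ ≤ M * absK ν.1 + Λ * absL (diffAB ν) := by
  have hωd : DifferentiableAt ℝ ω ξ :=
    (hω.differentiableOn (by simp)).differentiableAt (hO.mem_nhds hξ)
  have h1 : HasFDerivAt (fun ξ => pairK ν.1 (ω ξ)) ((pairK ν.1).comp (fderiv ℝ ω ξ)) ξ :=
    (pairK ν.1).hasFDerivAt.comp ξ hωd.hasFDerivAt
  have h2 : HasFDerivAt (fun ξ => ∑ j ∈ (diffAB ν).support,
      (((len j.1 ^ 2 : ℝ) : ℂ) + Q j ξ) * (diffAB ν j : ℂ))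
      (∑ j ∈ (diffAB ν).support, (diffAB ν j : ℂ) • fderiv ℝ (Q j) ξ) ξ :=
    HasFDerivAt.fun_sum fun j hj =>
      ((diffAt hO (hQ j hj) hξ).hasFDerivAt.const_add _).mul_const _
  have h3 : divC ω Q ν = fun ξ => pairK ν.1 (ω ξ) + ∑ j ∈ (diffAB ν).support,
      (((len j.1 ^ 2 : ℝ) : ℂ) + Q j ξ) * (diffAB ν j : ℂ) := by
    funext ξ; simp only [divC, pairK_apply, Finsupp.sum]
  rw [h3, (h1.fun_add h2).fderiv]
  refine (norm_add_le _ _).trans (add_le_add ?_ ?_)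
  · refine (ContinuousLinearMap.opNorm_comp_le _ _).trans ?_
    rw [mul_comm]
    have := hM ξ hξ
    exact mul_le_mul (by linarith [norm_nonneg (ω ξ)]) (norm_pairK_le _) (norm_nonneg _)
      (by linarith [norm_nonneg (ω ξ), norm_nonneg (fderiv ℝ ω ξ)])
  · refine (norm_sum_le _ _).trans ?_
    rw [absL_cast, Finsupp.sum, Finset.mul_sum]
    refine Finset.sum_le_sum fun j hj => ?_
    rw [norm_smul, mul_comm]
    have : ‖((diffAB ν j : ℤ) : ℂ)‖ = |((diffAB ν j : ℤ) : ℝ)| := Complex.norm_intCast _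
    rw [this]
    exact mul_le_mul_of_nonneg_right (hΛ j hj ξ hξ) (abs_nonneg _)

theorem coefNorm_divC_sub_le (hO : IsOpen O) {ν : Mon n} {C : ℝ} (hC : 0 ≤ C)
    (hQ : ∀ j ∈ (diffAB ν).support, ContDiffOn ℝ 1 (Q j) O)
    (hQ' : ∀ j ∈ (diffAB ν).support, ContDiffOn ℝ 1 (Q' j) O)
    (h : ∀ j ∈ (diffAB ν).support, coefNorm O (fun ξ => Q j ξ - Q' j ξ) ≤ ENNReal.ofReal C) :
    coefNorm O (fun ξ => divC ω Q ν ξ - divC ω Q' ν ξ) ≤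
      ENNReal.ofReal (C * absL (diffAB ν)) := by
  have e : (fun ξ => divC ω Q ν ξ - divC ω Q' ν ξ) = fun ξ => ∑ j ∈ (diffAB ν).support,
      (diffAB ν j : ℂ) * (Q j ξ - Q' j ξ) := by
    funext ξ
    simp only [divC, Finsupp.sum, add_sub_add_left_eq_sub, ← Finset.sum_sub_distrib]
    exact Finset.sum_congr rfl fun j _ => by ring
  rw [e]
  refine (coefNorm_sum_le hO _ fun j hj => contDiffOn_const.mul ((hQ j hj).sub (hQ' j hj))).trans ?_
  rw [absL_cast, Finsupp.sum, Finset.mul_sum, ENNReal.ofReal_sum_of_nonneg fun j _ => by positivity]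
  refine Finset.sum_le_sum fun j hj => ?_
  rw [coefNorm_const_mul, mul_comm C, ENNReal.ofReal_mul (abs_nonneg _)]
  refine mul_le_mul' (le_of_eq ?_) (h j hj)
  rw [← ofReal_norm, Complex.norm_intCast]

theorem coefNorm_inv_le (hO : IsOpen O) {g : Par b → ℂ} (hg : ContDiffOn ℝ 1 g O) {η : ℝ}
    (hη : 0 < η) (h : ∀ ξ ∈ O, η ≤ ‖g ξ‖) (hΛ : ∀ ξ ∈ O, ‖fderiv ℝ g ξ‖ ≤ Λ) :
    ContDiffOn ℝ 1 (fun ξ => (g ξ)⁻¹) O ∧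
      coefNorm O (fun ξ => (g ξ)⁻¹) ≤ ENNReal.ofReal (1 / η + Λ / η ^ 2) := by
  have hne : ∀ ξ ∈ O, g ξ ≠ 0 := fun ξ hξ h0 => by
    have := h ξ hξ; rw [h0, norm_zero] at this; linarith
  refine ⟨hg.inv hne, coefNorm_le fun ξ hξ => ?_⟩
  have h1 : HasFDerivAt (fun ξ => (g ξ)⁻¹) _ ξ :=
    (hasFDerivAt_inv' (𝕜 := ℝ) (hne ξ hξ)).comp ξ (diffAt hO hg hξ).hasFDerivAt
  have hi : ‖(g ξ)⁻¹‖ ≤ 1 / η := by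
    rw [norm_inv, one_div]; exact inv_anti₀ hη (h ξ hξ)
  have h2 : ‖fderiv ℝ (fun ξ => (g ξ)⁻¹) ξ‖ ≤ Λ / η ^ 2 := by
    have hΛ0 : 0 ≤ Λ := (norm_nonneg _).trans (hΛ ξ hξ)
    rw [h1.fderiv]
    refine ContinuousLinearMap.opNorm_le_bound _ (by positivity) fun x => ?_
    simp only [ContinuousLinearMap.comp_apply, ContinuousLinearMap.neg_apply,
      ContinuousLinearMap.mulLeftRight_apply, norm_neg, norm_mul]
    have h3 : ‖fderiv ℝ g ξ x‖ ≤ Λ * ‖x‖ :=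
      (ContinuousLinearMap.le_opNorm _ _).trans (by gcongr; exact hΛ ξ hξ)
    calc ‖(g ξ)⁻¹‖ * ‖fderiv ℝ g ξ x‖ * ‖(g ξ)⁻¹‖ ≤ 1 / η * (Λ * ‖x‖) * (1 / η) := by gcongr
      _ = Λ / η ^ 2 * ‖x‖ := by field_simp
  rw [ENNReal.ofReal_add (by positivity) (le_trans (norm_nonneg _) h2), ← ofReal_norm,
    ← ofReal_norm]
  exact add_le_add (ENNReal.ofReal_le_ofReal hi) (ENNReal.ofReal_le_ofReal h2)

/-- An open set on which the divisors of the generating function are bounded below. -/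
def Oreg (O : Set (Par b)) (ω : Par b → Par b) (Ωt : NSite n → Par b → ℝ) (K η : ℝ) :
    Set (Par b) :=
  interior {ξ | ξ ∈ O ∧ ∀ ν : Mon n, FMon K ν → mom ν = 0 →
    η ≤ |divisor ω Ωt ν.1 (diffAB ν) ξ|}

theorem Oreg_subset {η : ℝ} : Oreg O ω Ωt K η ⊆ O := fun _ hξ => (interior_subset hξ).1

theorem FMon.absL_le {ν : Mon n} (h : FMon K ν) : (absL (diffAB ν) : ℝ) ≤ 2 := by
  have h1 : absL (diffAB ν) ≤ 2 := (absL_diffAB_le ν).trans (by exact_mod_cast h.1)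
  exact_mod_cast h1

theorem KAMHyp.divC_reg (h : KAMHyp ρ τ₀ O r s M L ε K θ μ ω Ωt P) (hM : 0 < M) (hL : 0 < L)
    {ν : Mon n} (hν : FMon K ν) :
    ContDiffOn ℝ 1 (divC ω (fun j ξ => (Ωt j ξ : ℂ)) ν) O ∧
      ∀ ξ ∈ O, ‖fderiv ℝ (divC ω (fun j ξ => (Ωt j ξ : ℂ)) ν) ξ‖ ≤ M * K + 2 * L := by
  have hQ : ∀ j, ContDiffOn ℝ 1 (fun ξ => (Ωt j ξ : ℂ)) O := fun j =>
    Complex.ofRealCLM.contDiff.comp_contDiffOn (h.Omega_contDiff j)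
  refine ⟨contDiffOn_divC h.omega_contDiff fun j _ => hQ j, fun ξ hξ => ?_⟩
  refine (norm_fderiv_divC_le h.isOpen h.omega_contDiff h.omega_bound (fun j _ => hQ j) (Λ := L)
    (fun j _ ξ hξ => ?_) hξ).trans ?_
  · have h1 : DifferentiableAt ℝ (Ωt j) ξ :=
      ((h.Omega_contDiff j).differentiableOn (by simp)).differentiableAt (h.isOpen.mem_nhds hξ)
    have h2 : HasFDerivAt (fun ξ => (Ωt j ξ : ℂ)) (Complex.ofRealCLM.comp (fderiv ℝ (Ωt j) ξ)) ξ :=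
      Complex.ofRealCLM.hasFDerivAt.comp ξ h1.hasFDerivAt
    rw [h2.fderiv]
    refine (ContinuousLinearMap.opNorm_comp_le _ _).trans ?_
    rw [Complex.ofRealCLM_norm, one_mul]
    have := h.Omega_bound j ξ hξ
    linarith [abs_nonneg (Ωt j ξ)]
  · have h1 := hν.absL_le
    have h2 := hν.2.1
    nlinarith

theorem Oplus_subset_Oreg (hne : ∃ i, n i ≠ 0) (hτ₀ : 12 < τ₀) (hr : 0 < r) (hM : 0 < M)
    (hL : 0 < L) (hγ : 0 < γ) (hwt : ∀ m : NSite n, 1 ≤ weight ρ m)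
    (h : KAMHyp ρ τ₀ O r s M L ε K θ μ ω Ωt P) (hK : LargeK n τ₀ M L γ K)
    (hmg : IsChoice τ₀ mg) :
    Oplus τ₀ γ K O ω Ωt mg ⊆ Oreg O ω Ωt K (divBound d τ₀ γ K / 2) := by
  intro ξ hξ
  have hδ := divBound_pos hγ hK
  have hK1 := hK.one_le
  obtain ⟨e, he, hball⟩ := Metric.isOpen_iff.1 h.isOpen ξ hξ.mem
  have hΛ : 0 < M * K + 2 * L := by nlinarith
  set q := min e (divBound d τ₀ γ K / (2 * (M * K + 2 * L)))
  have hq : 0 < q := lt_min he (by positivity)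
  rw [Oreg, mem_interior]
  refine ⟨Metric.ball ξ q, fun ζ hζ => ?_, Metric.isOpen_ball, Metric.mem_ball_self hq⟩
  have hsub : Metric.ball ξ q ⊆ O := (Metric.ball_subset_ball (min_le_left _ _)).trans hball
  refine ⟨hsub hζ, fun ν hν hmom => ?_⟩
  have h1 := divBound_le hne hτ₀ hr hL hγ hwt h hK hmg hξ hν hmom
  obtain ⟨h2, h3⟩ := h.divC_reg hM hL hν
  have h4 := (convex_ball ξ q).norm_image_sub_le_of_norm_fderiv_le
    (fun x hx => diffAt h.isOpen h2 (hsub hx)) (fun x hx => h3 x (hsub hx))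
    (Metric.mem_ball_self hq) hζ
  rw [divC_ofReal, divC_ofReal, ← Complex.ofReal_sub, Complex.norm_real, Real.norm_eq_abs] at h4
  have h5 : ‖ζ - ξ‖ ≤ divBound d τ₀ γ K / (2 * (M * K + 2 * L)) := by
    rw [← dist_eq_norm]; exact (Metric.mem_ball.1 hζ).le.trans (min_le_right _ _)
  have h6 : (M * K + 2 * L) * ‖ζ - ξ‖ ≤ divBound d τ₀ γ K / 2 := by
    calc _ ≤ (M * K + 2 * L) * (divBound d τ₀ γ K / (2 * (M * K + 2 * L))) := by gcongr
      _ = _ := by field_simp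
  have h7 := abs_sub_abs_le_abs_sub (divisor ω Ωt ν.1 (diffAB ν) ξ)
    (divisor ω Ωt ν.1 (diffAB ν) ζ)
  rw [abs_sub_comm] at h7
  linarith

end DivisorReg

/-! ### The generating function is quasi-Töplitz -/

section Pairs

variable {d b : ℕ} {n : Fin b → Fin d → ℤ} {N : ℕ} {τ₀ τ θ μ θ₁ μ₁ K : ℝ} {w : Mon n}
  {m m' y y' : NSite n} {σ σ' : Bool} {V : Submodule ℝ (Fin d → ℝ)} {ω : Par b → Par b}
  {Q : NSite n → Par b → ℂ}

theorem deg_add (ν ν' : Mon n) : deg (ν + ν') = deg ν + deg ν' := by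
  have h : ∀ α β : NSite n →₀ ℕ, ((α + β).sum fun _ a => a) =
      (α.sum fun _ a => a) + β.sum fun _ a => a := fun α β =>
    Finsupp.sum_add_index' (by simp) (by simp)
  simp only [deg, Prod.snd_add, Prod.fst_add, h, Pi.add_apply, Finset.sum_add_distrib]
  ring

theorem deg_monS (j : NSite n) (σ : Bool) : deg (monS j σ : Mon n) = 1 := by
  cases σ <;> simp [deg, monS, monZ, monZb, Finsupp.sum_single_index]

theorem eq_of_deg_zero (h : deg w = 0) : w = (w.1, 0, 0, 0) := by
  have hs : ∀ α : NSite n →₀ ℕ, (α.sum fun _ a => a) = 0 → α = 0 := by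
    intro α hα
    ext j
    by_contra hj
    have := Finset.sum_eq_zero_iff.1 hα j (Finsupp.mem_support_iff.2 hj)
    exact hj this
  simp only [deg] at h
  have h1 : (∑ i, w.2.1 i) = 0 := by omega
  have h2 := hs w.2.2.1 (by omega)
  have h3 := hs w.2.2.2 (by omega)
  have h4 : w.2.1 = 0 := by
    funext i
    exact Finset.sum_eq_zero_iff.1 h1 i (Finset.mem_univ i)
  exact Prod.ext rfl (Prod.ext h4 (Prod.ext h2 h3))

theorem diffAB_add (ν ν' : Mon n) : diffAB (ν + ν') = diffAB ν + diffAB ν' := by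
  ext j
  simp only [diffAB, Prod.snd_add, Prod.fst_add, Finsupp.coe_sub, Finsupp.coe_add, Pi.add_apply,
    Pi.sub_apply, Finsupp.mapRange_apply]
  push_cast; ring

theorem diffAB_monS (j : NSite n) (σ : Bool) :
    diffAB (monS j σ) = Finsupp.single j (sg σ) := by
  classical
  ext i
  cases σ <;> simp [diffAB, monS, monZ, monZb, sg, Finsupp.single_apply, apply_ite]

theorem diffAB_pair (hw : deg w = 0) : diffAB (w + monS m σ + monS m' σ') =
    Finsupp.single m (sg σ) + Finsupp.single m' (sg σ') := by
  rw [diffAB_add, diffAB_add, diffAB_monS, diffAB_monS, eq_of_deg_zero hw]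
  simp [diffAB]

theorem deg_low_of_pair (h : deg (w + monS m σ + monS m' σ') ≤ 2) : deg w = 0 := by
  rw [deg_add, deg_add, deg_monS, deg_monS] at h; omega

theorem support_pair (hw : deg w = 0) {j : NSite n}
    (hj : j ∈ (diffAB (w + monS m σ + monS m' σ')).support) : j = m ∨ j = m' := by
  classical
  rw [diffAB_pair hw, Finsupp.mem_support_iff, Finsupp.add_apply, Finsupp.single_apply,
    Finsupp.single_apply] at hj
  by_contra hc
  push Not at hc
  exact hj (by rw [if_neg (Ne.symm hc.1), if_neg (Ne.symm hc.2), add_zero])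

/-- `∑ |j|² (α_j - β_j)`. -/
def lenS (ν : Mon n) : ℝ := (diffAB ν).sum fun j a => len j.1 ^ 2 * (a : ℝ)

theorem lenS_pair (hw : deg w = 0) : lenS (w + monS m σ + monS m' σ') =
    sg σ * len m.1 ^ 2 + sg σ' * len m'.1 ^ 2 := by
  rw [lenS, diffAB_pair hw, Finsupp.sum_add_index' (by simp) (by intros; push_cast; ring),
    Finsupp.sum_single_index (by simp), Finsupp.sum_single_index (by simp)]
  ring

theorem divC_eq_lenS (ν : Mon n) (ξ : Par b) : divC ω Q ν ξ =
    ((∑ i, ω ξ i * (ν.1 i : ℝ) : ℝ) : ℂ) + (lenS ν : ℂ) +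
      (diffAB ν).sum fun j a => Q j ξ * (a : ℂ) := by
  simp only [divC, lenS, Finsupp.sum, add_mul, Finset.sum_add_distrib]
  push_cast
  ring

theorem corr_pair (hw : deg w = 0) (ξ : Par b) :
    ((diffAB (w + monS m σ + monS m' σ')).sum fun j a => Q j ξ * (a : ℂ)) =
      Q m ξ * (sg σ : ℂ) + Q m' ξ * (sg σ' : ℂ) := by
  rw [diffAB_pair hw, Finsupp.sum_add_index' (by simp) (by intros; push_cast; ring),
    Finsupp.sum_single_index (by simp), Finsupp.sum_single_index (by simp)]

theorem FMon.permM (Φ : Equiv.Perm (NSite n)) (ν : Mon n) :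
    FMon K (QT.permM Φ ν) ↔ FMon K ν := by
  have : (QT.permM Φ ν).2.2.1 = (QT.permM Φ ν).2.2.2 ↔ ν.2.2.1 = ν.2.2.2 := by
    rw [permM_eq]; exact (Finsupp.domCongr Φ).injective.eq_iff
  simp only [FMon, deg_permM, permM_fst, this]

theorem Bi.diag (hN : 0 < N) (hμ : 0 < μ) (h : Bi τ₀ N θ μ τ w m σ m' σ' V) :
    Bi τ₀ N θ μ τ 0 m true m false V ∧ Bi τ₀ N θ μ τ 0 m' true m' false V :=
  ⟨bi_diag hN hμ h.cut h.high h.pos h.lt, bi_diag hN hμ h.cut' h.high' h.pos h.lt⟩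

/-- For small differences of squares, these depend on the cut only. -/
theorem lenS_eq_of_small (hne : ∃ i, n i ≠ 0) (hd : 1 ≤ d) (hN : 1000 + 6 * C1 n ≤ N)
    (hτ₀ : 12 < τ₀) (hτ : τ₀ ≤ τ) (hτ' : τ ≤ tau1 d τ₀ / (4 * d)) (hθ : 1 / 2 ≤ θ)
    (h : Bi τ₀ N θ μ τ w m σ m' σ' V) (h' : Bi τ₀ N θ μ τ w y σ y' σ' V)
    (ht : ∀ u ∈ V, u ⬝ᵥ toR (y.1 - m.1) = 0) (hw : deg w = 0)
    (hs : |lenS (w + monS m σ + monS m' σ')| ≤ (N : ℝ) ^ (4 * d * τ) / 2) :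
    lenS (w + monS y σ + monS y' σ') = lenS (w + monS m σ + monS m' σ') := by
  have hC := one_le_C1 hne
  have hNp : (0 : ℝ) < N := by linarith
  have hd' : (1 : ℝ) ≤ d := by exact_mod_cast hd
  set T := (N : ℝ) ^ (4 * d * τ) with hT
  rw [lenS_pair hw] at hs ⊢
  rw [lenS_pair hw]
  have hT4 : (N : ℝ) ^ 4 ≤ T := by
    rw [hT, ← Real.rpow_natCast]
    exact Real.rpow_le_rpow_of_exponent_le (by linarith) (by push_cast; nlinarith)
  have hTp : 0 < T := Real.rpow_pos_of_pos hNp _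
  have hm := h.momentum
  have hy := h'.momentum
  rw [mom_pair] at hm hy
  have hmw : mom w = piK n w.1 := by
    rw [eq_of_deg_zero hw]; simp [mom]
  rw [hmw] at hm hy
  by_cases hσ : σ = σ'
  · exfalso
    subst hσ
    have h1 : len m.1 ^ 2 ≤ |(sg σ : ℝ) * len m.1 ^ 2 + sg σ * len m'.1 ^ 2| := by
      have h0 : |((sg σ : ℤ) : ℝ)| = 1 := by rcases sg_cases σ with h | h <;> simp [h]
      rw [← mul_add, abs_mul, h0, one_mul,
        abs_of_nonneg (add_nonneg (sq_nonneg (len m.1)) (sq_nonneg (len m'.1)))]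
      linarith [sq_nonneg (len m'.1)]
    have h2 := h.high
    have h3 : T ≤ (N : ℝ) ^ tau1 d τ₀ :=
      Real.rpow_le_rpow_of_exponent_le (by linarith) (four_d_tau_le hd hτ')
    have h4 : 1 / 2 * T ≤ θ * (N : ℝ) ^ tau1 d τ₀ := by gcongr
    have h6 : (1000 : ℝ) ≤ T := by
      have : (1000 : ℝ) ≤ (N : ℝ) ^ 4 := by
        calc (1000 : ℝ) ≤ N := by linarith
          _ ≤ (N : ℝ) ^ 4 := le_self_pow₀ (by linarith) (by norm_num)
      linarith
    nlinarith
  · have hsum : sg σ' = -sg σ := by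
      cases σ <;> cases σ' <;> simp_all [sg]
    have hss : sg σ * sg σ = 1 := by rcases sg_cases σ with h | h <;> simp [h]
    rw [hsum] at hm hy hs ⊢
    have solve : ∀ x x' : Fin d → ℤ, piK n w.1 + sg σ • x + (-sg σ) • x' = 0 →
        x' = x + sg σ • piK n w.1 := by
      intro x x' hx
      have h1 : sg σ • x' = piK n w.1 + sg σ • x := by
        rw [neg_smul, ← sub_eq_add_neg, sub_eq_zero] at hx; exact hx.symm
      have h2 : sg σ • sg σ • x' = sg σ • (piK n w.1 + sg σ • x) := by rw [h1]
      rw [smul_smul, hss, one_smul, smul_add, smul_smul, hss, one_smul] at h2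
      rw [h2, add_comm]
    set v := sg σ • piK n w.1 with hv
    have hm' := solve _ _ hm
    have hy' := solve _ _ hy
    have hform : ∀ x : Fin d → ℤ, ((sg σ : ℤ) : ℝ) * len x ^ 2 + ((-sg σ : ℤ) : ℝ) *
        len (x + v) ^ 2 = sg σ * (-(2 * (idot v x : ℝ)) - len v ^ 2) := by
      intro x
      rw [← len_sq_shift]; push_cast; ring
    rw [hm', hform] at hs ⊢
    rw [hy', hform]
    have hvl : len v ≤ C1 n * N := by
      have h1 : len v = len (piK n w.1) := by
        rw [hv, len_smul]; rcases sg_cases σ with h | h <;> simp [h]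
      rw [h1]
      exact (len_piK_le _).trans (mul_le_mul_of_nonneg_left h.freq.le (by linarith))
    have hvV : toR v ∈ V := by
      by_cases h0 : piK n w.1 = 0
      · have : toR v = 0 := by rw [hv, h0, smul_zero]; funext j; simp [toR]
        rw [this]; exact V.zero_mem
      have hB := mem_ball_piK hne h.freq h0
      have h1 : toR (piK n w.1) ∈ V := by
        by_contra hc
        have h2 := h.cut.2 _ hB hc
        have h3 : |(idot v m.1 : ℝ)| = |(idot (piK n w.1) m.1 : ℝ)| := by
          rcases sg_cases σ with h | h <;> simp [hv, h, idot_neg_left]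
        rw [← h3] at h2
        rw [abs_mul] at hs
        have : |((sg σ : ℤ) : ℝ)| = 1 := by rcases sg_cases σ with h | h <;> simp [h]
        rw [this, one_mul] at hs
        have h4 := abs_sub_abs_le_abs_sub (-(2 * (idot v m.1 : ℝ))) (len v ^ 2)
        rw [abs_neg, abs_mul, abs_two, abs_of_nonneg (sq_nonneg (len v))] at h4
        have h5 : len v ^ 2 ≤ T / 4 := by
          calc len v ^ 2 ≤ (C1 n * N) ^ 2 := pow_le_pow_left₀ (len_nonneg _) hvl 2
            _ ≤ (N / 6 * N) ^ 2 := by gcongr; linarith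
            _ = (N : ℝ) ^ 4 / 36 := by ring
            _ ≤ T / 4 := by linarith
        have h6 : 1 / 2 * T ≤ θ * T := by gcongr
        linarith
      have : toR v = ((sg σ : ℤ) : ℝ) • toR (piK n w.1) := by funext j; simp [hv, toR]
      rw [this]; exact V.smul_mem _ h1
    have hdot : (idot v y.1 : ℝ) = idot v m.1 := by
      have := ht _ hvV
      rw [toR_sub, dotProduct_sub, ← idot_cast, ← idot_cast] at this
      linarith
    rw [hdot]

end Pairs

section Quotient

variable {b : ℕ} {O : Set (Par b)} {Λ η : ℝ}

theorem coefNorm_quot_le (hO : IsOpen O) {p E : Par b → ℂ} (hp : ContDiffOn ℝ 1 p O)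
    (hE : ContDiffOn ℝ 1 E O) (hη : 0 < η) (h : ∀ ξ ∈ O, η ≤ ‖E ξ‖)
    (hΛ : ∀ ξ ∈ O, ‖fderiv ℝ E ξ‖ ≤ Λ) :
    ContDiffOn ℝ 1 (fun ξ => p ξ / (Complex.I * E ξ)) O ∧
      coefNorm O (fun ξ => p ξ / (Complex.I * E ξ)) ≤
        ENNReal.ofReal (1 / η + Λ / η ^ 2) * coefNorm O p := by
  obtain ⟨h1, h2⟩ := coefNorm_inv_le hO hE hη h hΛ
  have e : (fun ξ => p ξ / (Complex.I * E ξ)) = fun ξ => -Complex.I * ((E ξ)⁻¹ * p ξ) := by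
    funext ξ
    rw [div_eq_mul_inv, mul_inv, Complex.inv_I]; ring
  rw [e]
  refine ⟨contDiffOn_const.mul (h1.mul hp), ?_⟩
  rw [coefNorm_const_mul]
  have : ‖-Complex.I‖ₑ = 1 := by rw [← ofReal_norm]; simp
  rw [this, one_mul]
  exact (coefNorm_mul_le hO h1 hp).trans (mul_le_mul' h2 le_rfl)

end Quotient

section GenF

variable {d b : ℕ} {n : Fin b → Fin d → ℤ} {N : ℕ} {ρ τ₀ τ r s M L ε K θ μ γ η B : ℝ}
  {O U : Set (Par b)} {ω : Par b → Par b} {Ωt : NSite n → Par b → ℝ} {P G : Ham n}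
  {g : NSite n → Par b → ℂ} {ν : Mon n} {V : Submodule ℝ (Fin d → ℝ)}

/-- Divisors of class `C¹` that are bounded below. -/
structure DivReg (U : Set (Par b)) (ω : Par b → Par b) (Ωt : NSite n → Par b → ℝ)
    (K M L η : ℝ) : Prop where
  isOpen : IsOpen U
  omega : ContDiffOn ℝ 1 ω U
  omega_le : ∀ ξ ∈ U, ‖ω ξ‖ + ‖fderiv ℝ ω ξ‖ ≤ M
  Omega : ∀ j, ContDiffOn ℝ 1 (fun ξ => (Ωt j ξ : ℂ)) U
  fderiv_le : ∀ ν : Mon n, FMon K ν → ∀ ξ ∈ U,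
    ‖fderiv ℝ (divC ω (fun j ξ => (Ωt j ξ : ℂ)) ν) ξ‖ ≤ M * K + 2 * L
  near_lenS : ∀ ν : Mon n, FMon K ν → ∀ ξ ∈ U,
    |lenS ν| ≤ ‖divC ω (fun j ξ => (Ωt j ξ : ℂ)) ν ξ‖ + (M * K + 2 * L)
  lower : ∀ ν : Mon n, FMon K ν → mom ν = 0 → ∀ ξ ∈ U,
    η ≤ ‖divC ω (fun j ξ => (Ωt j ξ : ℂ)) ν ξ‖

theorem KAMHyp.divReg (h : KAMHyp ρ τ₀ O r s M L ε K θ μ ω Ωt P) (hM : 0 < M) (hL : 0 < L) :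
    DivReg (Oreg O ω Ωt K η) ω Ωt K M L η where
  isOpen := isOpen_interior
  omega := h.omega_contDiff.mono Oreg_subset
  omega_le ξ hξ := h.omega_bound ξ (Oreg_subset hξ)
  Omega j := Complex.ofRealCLM.contDiff.comp_contDiffOn ((h.Omega_contDiff j).mono Oreg_subset)
  fderiv_le ν hν ξ hξ := (h.divC_reg hM hL hν).2 ξ (Oreg_subset hξ)
  near_lenS ν hν ξ hξ := by
    have h1 := divC_eq_lenS (ω := ω) (Q := fun j ξ => (Ωt j ξ : ℂ)) ν ξ
    have h2 : ‖(diffAB ν).sum fun j a => (Ωt j ξ : ℂ) * (a : ℂ)‖ ≤ 2 * L := by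
      refine (norm_sum_le _ _).trans ?_
      have h3 : ∑ j ∈ (diffAB ν).support, ‖(Ωt j ξ : ℂ) * ((diffAB ν j : ℤ) : ℂ)‖ ≤
          L * absL (diffAB ν) := by
        rw [absL_cast, Finsupp.sum, Finset.mul_sum]
        refine Finset.sum_le_sum fun j _ => ?_
        rw [norm_mul, Complex.norm_real, Complex.norm_intCast, Real.norm_eq_abs]
        have := h.Omega_bound j ξ (Oreg_subset hξ)
        exact mul_le_mul_of_nonneg_right (by linarith [norm_nonneg (fderiv ℝ (Ωt j) ξ)])
          (abs_nonneg _)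
      have := hν.absL_le
      nlinarith
    have h3 := abs_omega_le h (Oreg_subset hξ) ν.1
    have h4 : M * absK ν.1 ≤ M * K := mul_le_mul_of_nonneg_left hν.2.1 hM.le
    have e : (lenS ν : ℂ) = divC ω (fun j ξ => (Ωt j ξ : ℂ)) ν ξ -
        ((∑ i, ω ξ i * (ν.1 i : ℝ) : ℝ) : ℂ) - (diffAB ν).sum fun j a => (Ωt j ξ : ℂ) * (a : ℂ) := by
      rw [h1]; ring
    have h5 : ‖(lenS ν : ℂ)‖ = |lenS ν| := by rw [Complex.norm_real, Real.norm_eq_abs]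
    rw [← h5, e]
    refine (norm_sub_le _ _).trans ?_
    have h6 := norm_sub_le (divC ω (fun j ξ => (Ωt j ξ : ℂ)) ν ξ)
      ((∑ i, ω ξ i * (ν.1 i : ℝ) : ℝ) : ℂ)
    rw [Complex.norm_real, Real.norm_eq_abs] at h6
    linarith
  lower ν hν hmom ξ hξ := by
    rw [divC_ofReal, Complex.norm_real, Real.norm_eq_abs]
    exact (interior_subset hξ).2 ν hν hmom

theorem genF_of_FMon (hν : FMon K ν) (ξ : Par b) : genF ω Ωt K P ν ξ =
    P ν ξ / (Complex.I * divC ω (fun j ξ => (Ωt j ξ : ℂ)) ν ξ) := by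
  rw [divC_ofReal]; exact if_pos hν

theorem genF_of_not (hν : ¬ FMon K ν) (ξ : Par b) : genF ω Ωt K P ν ξ = 0 := if_neg hν

theorem DivReg.contDiff (hD : DivReg U ω Ωt K M L η) (ν : Mon n) :
    ContDiffOn ℝ 1 (divC ω (fun j ξ => (Ωt j ξ : ℂ)) ν) U :=
  contDiffOn_divC hD.omega fun j _ => hD.Omega j

theorem XN_le_of_hat_le {f : Ham n} {c A : ℝ} (hc : 0 ≤ c)
    (h : ∀ ν, hat U f ν ≤ ENNReal.ofReal c * hat U G ν)
    (hG : XN ρ r s (hat U G) ≤ ENNReal.ofReal A) :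
    XN ρ r s (hat U f) ≤ ENNReal.ofReal (c * A) := by
  refine (XN_mono h).trans ((XN_smul_le _ _ _ _ _).trans ?_)
  rw [ENNReal.ofReal_mul hc]
  exact mul_le_mul' le_rfl hG

theorem genF_HB (hD : DivReg U ω Ωt K M L η) (hη : 0 < η) {c : ℝ}
    (hc : 1 / η + (M * K + 2 * L) / η ^ 2 ≤ c) (hΛ : 0 ≤ M * K + 2 * L)
    (hP : HB ρ U r s P B) : HB ρ U r s (genF ω Ωt K P) (c * B) := by
  have key : ∀ ν, ContDiffOn ℝ 1 (genF ω Ωt K P ν) U ∧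
      hat U (genF ω Ωt K P) ν ≤ ENNReal.ofReal c * hat U P ν := by
    intro ν
    by_cases hν : FMon K ν
    · by_cases hmom : mom ν = 0
      · obtain ⟨h1, h2⟩ := coefNorm_quot_le hD.isOpen (hP.c1 ν) (hD.contDiff ν) hη
          (hD.lower ν hν hmom) (hD.fderiv_le ν hν)
        have e : genF ω Ωt K P ν = fun ξ => P ν ξ / (Complex.I *
            divC ω (fun j ξ => (Ωt j ξ : ℂ)) ν ξ) := funext fun ξ => genF_of_FMon hν ξ
        rw [hat, e]
        exact ⟨h1, h2.trans (mul_le_mul' (ENNReal.ofReal_le_ofReal hc) le_rfl)⟩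
      · have e : ∀ ξ ∈ U, genF ω Ωt K P ν ξ = 0 := fun ξ hξ => by
          rw [genF_of_FMon hν, hP.momentum ν hmom ξ hξ, zero_div]
        refine ⟨contDiffOn_const.congr e, ?_⟩
        rw [hat, coefNorm_congr hD.isOpen e, coefNorm_zero]
        exact zero_le
    · have e : genF ω Ωt K P ν = fun _ => 0 := funext fun ξ => genF_of_not hν ξ
      rw [hat, e, coefNorm_zero]
      exact ⟨contDiffOn_const, zero_le⟩
  refine ⟨fun ν => (key ν).1, fun ν hmom ξ hξ => ?_, XN_le_of_hat_le ?_ (fun ν => (key ν).2) hP.bound⟩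
  · by_cases hν : FMon K ν
    · rw [genF_of_FMon hν, hP.momentum ν hmom ξ hξ, zero_div]
    · exact genF_of_not hν ξ
  · exact le_trans (by positivity) hc

/-- The approximate divisors. -/
theorem approx_divisor (hD : DivReg U ω Ωt K M L η) (hL : 0 < L) (hM : 0 < M) (hη : 0 < η)
    (hr : 0 < r) (hwt : ∀ m : NSite n, 1 ≤ weight ρ m) (hN : 1000 + 6 * C1 n ≤ N) (hμ : 0 < μ)
    (hτ : 0 ≤ τ) (hne : ∃ i, n i ≠ 0)
    (hT : 16 * L ≤ η * (N : ℝ) ^ (4 * d * τ)) {G : Ham n} (h1 : HB ρ U r s G (2 * L))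
    (h4 : XN ρ r s (hat U (defect τ₀ N θ μ τ (diagQ fun j ξ => (Ωt j ξ : ℂ)) G)) ≤
      ENNReal.ofReal (2 * L)) {w : Mon n} {m m' : NSite n} {σ σ' : Bool}
    (hbi : Bi τ₀ N θ μ τ w m σ m' σ' V) (hν : FMon K (w + monS m σ + monS m' σ'))
    (hmom : mom (w + monS m σ + monS m' σ') = 0) :
    ContDiffOn ℝ 1 (divC ω (fun j => G (monZ j + monZb j)) (w + monS m σ + monS m' σ')) U ∧
    (∀ ξ ∈ U, η / 2 ≤ ‖divC ω (fun j => G (monZ j + monZb j)) (w + monS m σ + monS m' σ') ξ‖) ∧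
    (∀ ξ ∈ U, ‖fderiv ℝ (divC ω (fun j => G (monZ j + monZb j)) (w + monS m σ + monS m' σ')) ξ‖ ≤
      M * K + 8 * L) ∧
    coefNorm U (fun ξ => (((N : ℝ) ^ (4 * d * τ) : ℝ) : ℂ) *
      (divC ω (fun j => G (monZ j + monZb j)) (w + monS m σ + monS m' σ') ξ -
        divC ω (fun j ξ => (Ωt j ξ : ℂ)) (w + monS m σ + monS m' σ') ξ)) ≤
      ENNReal.ofReal (8 * L) := by
  have hCn := C1_nonneg n
  have hNp : (0 : ℝ) < N := by linarith
  have hN2 : 2 ≤ N := by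
    have : (2 : ℝ) ≤ N := by linarith
    exact_mod_cast this
  set T := (N : ℝ) ^ (4 * d * τ) with hTdef
  have hTp : 0 < T := Real.rpow_pos_of_pos hNp _
  have hw := deg_low_of_pair hν.1
  set ν := w + monS m σ + monS m' σ' with hνdef
  have hTenorm : ‖((T : ℝ) : ℂ)‖ₑ = ENNReal.ofReal T := by
    rw [← ofReal_norm, Complex.norm_real, Real.norm_of_nonneg hTp.le]
  have hbil : ∀ j ∈ (diffAB ν).support, IsBilin τ₀ N θ μ τ (monZ j + monZb j) := by
    intro j hj
    obtain ⟨b1, b2⟩ := hbi.diag (by omega) hμ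
    rcases support_pair hw hj with rfl | rfl
    · have := b1.isBilin hne hN2; rwa [← diag_eq] at this
    · have := b2.isBilin hne hN2; rwa [← diag_eq] at this
  have hclose : ∀ j ∈ (diffAB ν).support, coefNorm U (fun ξ => G (monZ j + monZb j) ξ -
      (Ωt j ξ : ℂ)) ≤ ENNReal.ofReal (4 * L / T) := by
    intro j hj
    have h5 := defect_diag_le hr hwt h4 (hbil j hj)
    rw [coefNorm_const_mul, hTenorm] at h5
    have e : coefNorm U (fun ξ => G (monZ j + monZb j) ξ - (Ωt j ξ : ℂ)) =
        coefNorm U (fun ξ => (Ωt j ξ : ℂ) - G (monZ j + monZb j) ξ) := by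
      rw [← coefNorm_neg]; simp
    rw [e, ENNReal.ofReal_div_of_pos hTp]
    rw [ENNReal.le_div_iff_mul_le (Or.inl (by simpa using hTp)) (Or.inl ENNReal.ofReal_ne_top),
      mul_comm]
    refine h5.trans (ENNReal.ofReal_le_ofReal (by linarith))
  have hsub := coefNorm_divC_sub_le (ω := ω) hD.isOpen (ν := ν) (by positivity)
    (fun j _ => h1.c1 _) (fun j _ => hD.Omega j) hclose
  have hsub' : coefNorm U (fun ξ => divC ω (fun j => G (monZ j + monZb j)) ν ξ -
      divC ω (fun j ξ => (Ωt j ξ : ℂ)) ν ξ) ≤ ENNReal.ofReal (8 * L / T) := by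
    refine hsub.trans (ENNReal.ofReal_le_ofReal ?_)
    have h6 := hν.absL_le
    calc 4 * L / T * absL (diffAB ν) ≤ 4 * L / T * 2 := by gcongr
      _ = 8 * L / T := by ring
  refine ⟨contDiffOn_divC hD.omega fun j _ => h1.c1 _, fun ξ hξ => ?_, fun ξ hξ => ?_, ?_⟩
  · have h6 := (enorm_le_coefNorm _ hξ).trans hsub'
    rw [← ofReal_norm, ENNReal.ofReal_le_ofReal_iff (by positivity)] at h6
    have h7 := hD.lower ν hν hmom ξ hξ
    have h8 : 8 * L / T ≤ η / 2 := by rw [div_le_iff₀ hTp]; linarith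
    have h9 := norm_sub_norm_le (divC ω (fun j ξ => (Ωt j ξ : ℂ)) ν ξ)
      (divC ω (fun j => G (monZ j + monZb j)) ν ξ)
    rw [norm_sub_rev] at h9
    linarith
  · refine (norm_fderiv_divC_le hD.isOpen hD.omega hD.omega_le (fun j _ => h1.c1 _) (Λ := 4 * L)
      (fun j _ ξ hξ => ?_) hξ).trans ?_
    · have h6 := (coef_diag_le (s := s) hr hwt (hat U G) j).trans
        (mul_le_mul' le_rfl h1.bound)
      have h7 := (le_add_self.trans (le_coefNorm (G (monZ j + monZb j)) hξ)).trans h6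
      have h8 : (2 : ℝ≥0∞) * ENNReal.ofReal (2 * L) = ENNReal.ofReal (4 * L) := by
        rw [show 4 * L = 2 * (2 * L) by ring, ENNReal.ofReal_mul (q := 2 * L) zero_le_two,
          ENNReal.ofReal_ofNat]
      rw [h8, ← ofReal_norm, ENNReal.ofReal_le_ofReal_iff (by positivity)] at h7
      exact h7
    · have h6 := hν.absL_le
      have h7 := hν.2.1
      have h8 : M * absK ν.1 ≤ M * K := by gcongr
      nlinarith
  · rw [coefNorm_const_mul, hTenorm]
    refine (mul_le_mul' le_rfl hsub').trans ?_
    rw [← ENNReal.ofReal_mul hTp.le]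
    refine ENNReal.ofReal_le_ofReal (le_of_eq ?_)
    field_simp

open Classical in
/-- The piecewise Töplitz approximation of the generating function. -/
def genFApprox (τ₀ : ℝ) (N : ℕ) (θ μ τ K : ℝ) (ω : Par b → Par b) (G : Ham n) (g : NSite n → Par b → ℂ) : Ham n := fun ν ξ =>
  if IsBilin τ₀ N θ μ τ ν ∧ FMon K ν ∧ |lenS ν| ≤ (N : ℝ) ^ (4 * d * τ) / 2 then
    G ν ξ / (Complex.I * divC ω g ν ξ) else 0

theorem genFApprox_topInv {θ₁ μ₁ : ℝ} (hg : Gap n τ₀ N τ θ₁ μ₁ θ μ) (hne : ∃ i, n i ≠ 0)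
    (hN : 1000 + 6 * C1 n ≤ N) (hτ₀ : 12 < τ₀) (hτ : τ₀ ≤ τ) (hτ' : τ ≤ tau1 d τ₀ / (4 * d))
    (hθ : 1 / 2 ≤ θ) (hμ : 0 < μ) (hG : TopInv τ₀ N θ μ τ U G) {G' : Ham n}
    (hG' : TopInv τ₀ N θ μ τ U G') :
    TopInv τ₀ N θ μ τ U (genFApprox τ₀ N θ μ τ K ω G fun j => G' (monZ j + monZb j)) := by
  intro w m σ m' σ' y y' V h h' ht ξ hξ
  have hd := one_le_dim hne
  obtain ⟨Φ, _, he⟩ := h.exists_shift hg h'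
  have hF : FMon K (w + monS y σ + monS y' σ') ↔ FMon K (w + monS m σ + monS m' σ') := by
    rw [← he]; exact FMon.permM Φ _
  have hb := h.isBilin hne hg.two_le
  have hb' := h'.isBilin hne hg.two_le
  simp only [genFApprox]
  by_cases hν : FMon K (w + monS m σ + monS m' σ')
  · have hw := deg_low_of_pair hν.1
    have ht' : ∀ u ∈ V, u ⬝ᵥ toR (m.1 - y.1) = 0 := by
      have := orth_smul ht (-1)
      simpa using this
    have hlen : |lenS (w + monS m σ + monS m' σ')| ≤ (N : ℝ) ^ (4 * d * τ) / 2 ∨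
        |lenS (w + monS y σ + monS y' σ')| ≤ (N : ℝ) ^ (4 * d * τ) / 2 →
        lenS (w + monS y σ + monS y' σ') = lenS (w + monS m σ + monS m' σ') := by
      rintro (hs | hs)
      · exact lenS_eq_of_small hne hd hN hτ₀ hτ hτ' hθ h h' ht hw hs
      · exact (lenS_eq_of_small hne hd hN hτ₀ hτ hτ' hθ h' h ht' hw hs).symm
    by_cases hs : |lenS (w + monS m σ + monS m' σ')| ≤ (N : ℝ) ^ (4 * d * τ) / 2
    · have e := hlen (Or.inl hs)
      have hs' : |lenS (w + monS y σ + monS y' σ')| ≤ (N : ℝ) ^ (4 * d * τ) / 2 := by rwa [e]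
      rw [if_pos ⟨hb, hν, hs⟩, if_pos ⟨hb', hF.2 hν, hs'⟩, hG w m σ m' σ' y y' V h h' ht ξ hξ]
      have hNp : 0 < N := by have := hg.two_le; omega
      obtain ⟨d1, d2⟩ := h.diag hNp hμ
      obtain ⟨d3, d4⟩ := h'.diag hNp hμ
      have g1 := hG' _ _ _ _ _ _ _ V d1 d3 ht ξ hξ
      have g2 := hG' _ _ _ _ _ _ _ V d2 d4 (by
        rw [shift_snd h.momentum h'.momentum]; exact orth_smul ht _) ξ hξ
      rw [← diag_eq, ← diag_eq] at g1 g2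
      congr 2
      rw [divC_eq_lenS, divC_eq_lenS, corr_pair hw, corr_pair hw, e, g1, g2]
      simp
    · have hs' : ¬ |lenS (w + monS y σ + monS y' σ')| ≤ (N : ℝ) ^ (4 * d * τ) / 2 := fun h0 =>
        hs (by rw [← hlen (Or.inr h0)]; exact h0)
      rw [if_neg fun h => hs h.2.2, if_neg fun h => hs' h.2.2]
  · rw [if_neg fun h => hν h.2.1, if_neg fun h => hν (hF.1 h.2.1)]

/-- The generating function at scale `N`. -/
theorem genF_TB (hD : DivReg U ω Ωt K M L η) (hne : ∃ i, n i ≠ 0) (hL : 0 < L) (hM : 0 < M)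
    (hη : 0 < η) (hK : 0 < K) (hr : 0 < r) (hwt : ∀ m : NSite n, 1 ≤ weight ρ m)
    (hN : 1000 + 6 * C1 n ≤ N) (hτ₀ : 12 < τ₀) (hτ : τ₀ ≤ τ) (hτ' : τ ≤ tau1 d τ₀ / (4 * d))
    (hθ : 1 / 2 ≤ θ) (hμ : 0 < μ) (hμ' : μ ≤ 4) (hT : 16 * L ≤ η * (N : ℝ) ^ (4 * d * τ))
    (hT' : 16 * (M * K + 8 * L) ≤ (N : ℝ) ^ (4 * d * τ)) {c : ℝ}
    (hc : 1 / (η / 2) + (M * K + 8 * L) / (η / 2) ^ 2 ≤ c) (hB : 0 ≤ B)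
    (hΩ : TB ρ τ₀ U r s N θ μ τ (diagQ fun j ξ => (Ωt j ξ : ℂ)) (2 * L))
    (hP : TB ρ τ₀ U r s N θ μ τ P B) :
    TB ρ τ₀ U r s N θ μ τ (genF ω Ωt K P) ((c + 8 * L * c ^ 2 + 5) * B) := by
  have hCn := C1_nonneg n
  have hNp : (0 : ℝ) < N := by linarith
  have hinv : 1 / (N : ℝ) ≤ 1 / 4 := by
    rw [div_le_div_iff₀ hNp (by norm_num)]; linarith
  have hg : Gap n τ₀ N τ (θ - 1 / 4) (μ + 1 / 2) θ μ :=
    gap_of_large hne hτ₀ hN hτ (by linarith) (by linarith) (by linarith) (by linarith)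
  have hc0 : 0 < c := lt_of_lt_of_le (by positivity) hc
  obtain ⟨GΩ, o1, o2, o3, o4⟩ := hΩ.approx
  obtain ⟨G, p1, p2, p3, p4⟩ := hP.approx
  have hcη : 1 / η + (M * K + 2 * L) / η ^ 2 ≤ c := by
    refine le_trans (add_le_add ?_ ?_) hc
    · exact one_div_le_one_div_of_le (by positivity) (by linarith)
    · gcongr <;> linarith
  have hle1 : c ≤ c + 8 * L * c ^ 2 + 5 := by
    have : 0 ≤ 8 * L * c ^ 2 := by positivity
    linarith
  set T := (N : ℝ) ^ (4 * d * τ) with hTdef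
  have hTp : 0 < T := Real.rpow_pos_of_pos hNp _
  set g : NSite n → Par b → ℂ := fun j => GΩ (monZ j + monZb j) with hgdef
  set GF := genFApprox τ₀ N θ μ τ K ω G g with hGF
  have hGF1 : ∀ {ν : Mon n}, (IsBilin τ₀ N θ μ τ ν ∧ FMon K ν ∧ |lenS ν| ≤ T / 2) →
      GF ν = fun ξ => G ν ξ / (Complex.I * divC ω g ν ξ) := fun hν => funext fun ξ => if_pos hν
  have hGF0 : ∀ {ν : Mon n}, ¬ (IsBilin τ₀ N θ μ τ ν ∧ FMon K ν ∧ |lenS ν| ≤ T / 2) →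
      GF ν = fun _ => 0 := fun hν => funext fun ξ => if_neg hν
  have happ : ∀ {ν : Mon n}, IsBilin τ₀ N θ μ τ ν → FMon K ν → ContDiffOn ℝ 1 (divC ω g ν) U ∧
      (∀ ξ ∈ U, η / 2 ≤ ‖divC ω g ν ξ‖) ∧
      (∀ ξ ∈ U, ‖fderiv ℝ (divC ω g ν) ξ‖ ≤ M * K + 8 * L) ∧
      coefNorm U (fun ξ => ((T : ℝ) : ℂ) * (divC ω g ν ξ -
        divC ω (fun j ξ => (Ωt j ξ : ℂ)) ν ξ)) ≤ ENNReal.ofReal (8 * L) := by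
    intro ν hν hF
    have hmom := hν.momentum
    obtain ⟨w, m, σ, m', σ', V, rfl, hbi⟩ := (isBilin_iff hg ν).1 hν
    exact approx_divisor hD hL hM hη hr hwt hN hμ (by linarith) hne hT o1 o4 hbi hF hmom
  have hGFhat : ∀ ν, ContDiffOn ℝ 1 (GF ν) U ∧ hat U GF ν ≤ ENNReal.ofReal c * hat U G ν := by
    intro ν
    by_cases hν : IsBilin τ₀ N θ μ τ ν ∧ FMon K ν ∧ |lenS ν| ≤ T / 2
    · obtain ⟨a1, a2, a3, _⟩ := happ hν.1 hν.2.1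
      obtain ⟨b1, b2⟩ := coefNorm_quot_le hD.isOpen (p1.c1 ν) a1 (by positivity) a2 a3
      rw [hat, hGF1 hν]
      exact ⟨b1, b2.trans (mul_le_mul' (ENNReal.ofReal_le_ofReal hc) le_rfl)⟩
    · rw [hat, hGF0 hν, coefNorm_zero]
      exact ⟨contDiffOn_const, zero_le⟩
  refine ⟨(genF_HB hD hη hcη (by positivity) hP.hb).mono (mul_le_mul_of_nonneg_right hle1 hB), GF,
    ⟨fun ν => (hGFhat ν).1, fun ν hmom ξ hξ => ?_, ?_⟩, fun ν hν ξ _ => ?_, ?_, ?_⟩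
  · by_cases hν : IsBilin τ₀ N θ μ τ ν ∧ FMon K ν ∧ |lenS ν| ≤ T / 2
    · rw [hGF1 hν]
      simp only [p1.momentum ν hmom ξ hξ, zero_div]
    · rw [hGF0 hν]
  · exact (XN_le_of_hat_le hc0.le (fun ν => (hGFhat ν).2) p1.bound).trans
      (ENNReal.ofReal_le_ofReal (mul_le_mul_of_nonneg_right hle1 hB))
  · rw [hGF0 fun h => hν h.1]
  · exact genFApprox_topInv hg hne hN hτ₀ hτ hτ' hθ hμ p3 o3
  · have key : ∀ ν, hat U (defect τ₀ N θ μ τ (genF ω Ωt K P) GF) ν ≤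
        ENNReal.ofReal c * hat U (defect τ₀ N θ μ τ P G) ν +
          (ENNReal.ofReal (8 * L * c ^ 2) * hat U G ν + ENNReal.ofReal 5 * hat U P ν) := by
      intro ν
      by_cases hν : IsBilin τ₀ N θ μ τ ν ∧ FMon K ν
      swap
      · have e : defect τ₀ N θ μ τ (genF ω Ωt K P) GF ν = fun _ => 0 := by
          funext ξ
          have h1 : GF ν ξ = 0 := by rw [hGF0 fun h => hν ⟨h.1, h.2.1⟩]
          rw [defect, h1, sub_zero, bilinProj]
          split_ifs with hb
          · rw [genF_of_not fun h => hν ⟨hb, h⟩, mul_zero]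
          · exact mul_zero _
        rw [hat, e, coefNorm_zero]; exact zero_le
      obtain ⟨hb, hF⟩ := hν
      have hmom := hb.momentum
      have hPd : defect τ₀ N θ μ τ P G ν = fun ξ => ((T : ℝ) : ℂ) * (P ν ξ - G ν ξ) := by
        funext ξ; rw [defect, bilinProj, if_pos hb]
      have hDC := hD.contDiff ν
      have hP1 := hP.hb.c1 ν
      by_cases hs : |lenS ν| ≤ T / 2
      · obtain ⟨a1, a2, a3, a4⟩ := happ hb hF
        have hGne : ∀ ξ ∈ U, divC ω g ν ξ ≠ 0 := fun ξ hξ h0 => by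
          have := a2 ξ hξ; rw [h0, norm_zero] at this; linarith
        have hDne : ∀ ξ ∈ U, divC ω (fun j ξ => (Ωt j ξ : ℂ)) ν ξ ≠ 0 := fun ξ hξ h0 => by
          have := hD.lower ν hF hmom ξ hξ; rw [h0, norm_zero] at this; linarith
        have hTPG : ContDiffOn ℝ 1 (fun ξ => ((T : ℝ) : ℂ) * (P ν ξ - G ν ξ)) U :=
          contDiffOn_const.mul (hP1.sub (p1.c1 ν))
        obtain ⟨q1, q2⟩ := coefNorm_quot_le hD.isOpen hTPG hDC hη (hD.lower ν hF hmom)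
          (hD.fderiv_le ν hF)
        obtain ⟨q3, q4⟩ := coefNorm_quot_le hD.isOpen (p1.c1 ν) a1 (by positivity) a2 a3
        obtain ⟨q5, q6⟩ := coefNorm_inv_le hD.isOpen hDC hη (hD.lower ν hF hmom)
          (hD.fderiv_le ν hF)
        have hTD : ContDiffOn ℝ 1 (fun ξ => ((T : ℝ) : ℂ) * (divC ω g ν ξ -
            divC ω (fun j ξ => (Ωt j ξ : ℂ)) ν ξ)) U := contDiffOn_const.mul (a1.sub hDC)
        have e : ∀ ξ ∈ U, defect τ₀ N θ μ τ (genF ω Ωt K P) GF ν ξ =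
            ((T : ℝ) : ℂ) * (P ν ξ - G ν ξ) / (Complex.I *
              divC ω (fun j ξ => (Ωt j ξ : ℂ)) ν ξ) +
            G ν ξ / (Complex.I * divC ω g ν ξ) * ((((T : ℝ) : ℂ) * (divC ω g ν ξ -
              divC ω (fun j ξ => (Ωt j ξ : ℂ)) ν ξ)) *
              (divC ω (fun j ξ => (Ωt j ξ : ℂ)) ν ξ)⁻¹) := by
          intro ξ hξ
          rw [defect, bilinProj, if_pos hb, genF_of_FMon hF, hGF1 ⟨hb, hF, hs⟩]
          have h1 := hGne ξ hξ
          have h2 := hDne ξ hξ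
          have h3 := Complex.I_ne_zero
          field_simp
          ring
        rw [hat, coefNorm_congr hD.isOpen e]
        refine (coefNorm_add_le hD.isOpen q1 (q3.mul (hTD.mul q5))).trans (add_le_add ?_ ?_)
        · refine q2.trans (mul_le_mul' (ENNReal.ofReal_le_ofReal hcη) ?_)
          rw [hat, hPd]
        · refine le_trans ?_ le_self_add
          refine (coefNorm_mul_le hD.isOpen q3 (hTD.mul q5)).trans ?_
          refine (mul_le_mul' (q4.trans (mul_le_mul' (ENNReal.ofReal_le_ofReal hc) le_rfl))
            ((coefNorm_mul_le hD.isOpen hTD q5).trans (mul_le_mul' a4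
              (q6.trans (ENNReal.ofReal_le_ofReal hcη))))).trans (le_of_eq ?_)
          have h8 : ENNReal.ofReal (8 * L * c ^ 2) =
              ENNReal.ofReal c * (ENNReal.ofReal (8 * L) * ENNReal.ofReal c) := by
            rw [← ENNReal.ofReal_mul (by positivity), ← ENNReal.ofReal_mul hc0.le]
            congr 1; ring
          rw [h8, hat]; ring
      · rw [not_le] at hs
        refine le_trans ?_ (le_add_self.trans le_add_self)
        have hE : ContDiffOn ℝ 1 (fun ξ => (((T : ℝ) : ℂ))⁻¹ *
            divC ω (fun j ξ => (Ωt j ξ : ℂ)) ν ξ) U := contDiffOn_const.mul hDC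
        have hTn : ‖(((T : ℝ) : ℂ))⁻¹‖ = T⁻¹ := by
          rw [norm_inv, Complex.norm_real, Real.norm_of_nonneg hTp.le]
        have hTne : ((T : ℝ) : ℂ) ≠ 0 := by exact_mod_cast hTp.ne'
        have hMK : 0 < M * K := by positivity
        have hlow : ∀ ξ ∈ U, (1 / 4 : ℝ) ≤ ‖(((T : ℝ) : ℂ))⁻¹ *
            divC ω (fun j ξ => (Ωt j ξ : ℂ)) ν ξ‖ := fun ξ hξ => by
          rw [norm_mul, hTn, inv_mul_eq_div, le_div_iff₀ hTp]
          have := hD.near_lenS ν hF ξ hξ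
          linarith
        have hder : ∀ ξ ∈ U, ‖fderiv ℝ (fun ξ => (((T : ℝ) : ℂ))⁻¹ *
            divC ω (fun j ξ => (Ωt j ξ : ℂ)) ν ξ) ξ‖ ≤ 1 / 16 := fun ξ hξ => by
          rw [fderiv_const_mul (diffAt hD.isOpen hDC hξ), norm_smul, hTn, inv_mul_eq_div,
            div_le_iff₀ hTp]
          have := hD.fderiv_le ν hF ξ hξ
          linarith
        obtain ⟨q1, q2⟩ := coefNorm_quot_le hD.isOpen hP1 hE (by norm_num) hlow hder
        have e : defect τ₀ N θ μ τ (genF ω Ωt K P) GF ν = fun ξ => P ν ξ / (Complex.I *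
            ((((T : ℝ) : ℂ))⁻¹ * divC ω (fun j ξ => (Ωt j ξ : ℂ)) ν ξ)) := by
          funext ξ
          have h1 : GF ν ξ = 0 := by rw [hGF0 fun h => absurd h.2.2 (not_le.2 hs)]
          rw [defect, bilinProj, if_pos hb, genF_of_FMon hF, h1, sub_zero]
          change ((T : ℝ) : ℂ) * _ = _
          rw [mul_left_comm Complex.I, div_eq_mul_inv (P ν ξ), div_eq_mul_inv (P ν ξ),
            mul_inv (((T : ℝ) : ℂ))⁻¹, inv_inv]
          ring
        rw [hat, e]
        refine q2.trans (mul_le_mul' (ENNReal.ofReal_le_ofReal (by norm_num)) le_rfl)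
    refine (XN_mono key).trans ?_
    have e : (c + 8 * L * c ^ 2 + 5) * B = c * B + (8 * L * c ^ 2 * B + 5 * B) := by ring
    have h8 : 0 ≤ 8 * L * c ^ 2 := by positivity
    rw [e]
    have hs : ∀ {q A : ℝ} {a : Hat n}, 0 ≤ q → XN ρ r s a ≤ ENNReal.ofReal A →
        XN ρ r s (fun ν => ENNReal.ofReal q * a ν) ≤ ENNReal.ofReal (q * A) := by
      intro q A a hq ha
      refine (XN_smul_le _ _ _ _ _).trans ?_
      rw [ENNReal.ofReal_mul hq]; exact mul_le_mul' le_rfl ha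
    exact XN_add_le_ofReal (by positivity) (by positivity) (hs hc0.le p4)
      (XN_add_le_ofReal (by positivity) (by positivity) (hs h8 p1.bound)
        (hs (by norm_num) hP.hb.bound))

end GenF

section Step

variable {d b : ℕ} {n : Fin b → Fin d → ℤ} {N₀ : ℕ} {ρ τ₀ r s s' M L ε K θ μ θ' μ' γ η A B : ℝ}
  {O U : Set (Par b)} {ω : Par b → Par b} {Ωt : NSite n → Par b → ℝ} {F f g P : Ham n} {ξ : Par b}

theorem normalForm_brSummable (w : Fin b → Par b → ℂ) (W : NSite n → Par b → ℂ) (g : Ham n)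
    (ν : Mon n) (ξ : Par b) : BrSummable (normalForm w W) g ν ξ := by
  have hI : ∀ (v : Mon n) i, normalForm w W v ξ ≠ 0 → v.2.1 i ≠ 0 → v = monI i := by
    intro v i h h1
    by_contra hv
    refine h (normalForm_zero _ _ _ _ (fun i' e => ?_) (fun j e => h1 (by simp [e, monZ, monZb])))
    have hi : i ≠ i' := by rintro rfl; exact hv e
    exact h1 (by simp [e, monI, hi])
  have hZ : ∀ (v : Mon n) j, normalForm w W v ξ ≠ 0 → v.2.2.1 j ≠ 0 ∨ v.2.2.2 j ≠ 0 →
      v = monZ j + monZb j := by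
    intro v j h h1
    by_contra hv
    refine h (normalForm_zero _ _ _ _ (fun i e => by simp [e, monI] at h1) (fun j' e => ?_))
    have hj : j' ≠ j := by rintro rfl; exact hv e
    simp [e, monZ, monZb, hj.symm] at h1
  have key : ∀ {D G : Ham n} (m₀ : Mon n), (∀ v, D v ξ ≠ 0 → v = m₀) →
      Summable fun p : {p : Mon n × Mon n // p.1 + p.2 = ν} => D p.1.1 ξ * G p.1.2 ξ := by
    intro D G m₀ h
    refine summable_of_hasFiniteSupport (Set.Subsingleton.finite fun p hp q hq => ?_)
    have h1 := h _ (left_ne_zero_of_mul hp)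
    have h2 := h _ (left_ne_zero_of_mul hq)
    have h3 := p.2.trans q.2.symm
    rw [h1, h2] at h3
    exact Subtype.ext (Prod.ext (h1.trans h2.symm) (add_left_cancel h3))
  refine ⟨fun i => key 0 fun v hv => ?_, fun i => key 0 fun v hv => absurd ?_ hv,
    fun j => key (monZ j) fun v hv => ?_, fun j => key (monZb j) fun v hv => ?_, ?_⟩
  · have := hI _ i (right_ne_zero_of_mul hv) (by simp [monI])
    exact add_right_cancel (this.trans (zero_add _).symm)
  · unfold dTheta
    by_cases h : v.1 i = 0
    · simp [h]
    · rw [normalForm_zero, mul_zero]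
      · rintro i' rfl; exact h rfl
      · rintro j rfl; exact h (by simp [monZ, monZb])
  · exact add_right_cancel (hZ _ j (right_ne_zero_of_mul hv) (Or.inr (by simp [monZb])))
  · exact add_right_cancel ((hZ _ j (right_ne_zero_of_mul hv) (Or.inl (by simp [monZ]))).trans
      (add_comm _ _))
  · refine summable_of_hasFiniteSupport ((ν.2.2.1.support ∪ ν.2.2.2.support).finite_toSet.subset ?_)
    intro j hj
    rw [Function.mem_support, mulH_dZb_normalForm, mulH_dZ_normalForm] at hj
    by_contra h
    rw [Finset.mem_coe, Finset.mem_union, not_or, Finsupp.notMem_support_iff,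
      Finsupp.notMem_support_iff] at h
    exact hj (by simp [h.1, h.2])

theorem TBF.subset {O' : Set (Par b)} (hO : O' ⊆ O) (h : TBF ρ τ₀ O r s θ μ f B N₀) :
    TBF ρ τ₀ O' r s θ μ f B N₀ := fun N hN τ h1 h2 => (h N hN τ h1 h2).subset hO

theorem DivReg.poisson_genF_Nham (hD : DivReg U ω Ωt K M L η) (hη : 0 < η)
    (hmom : ∀ ν, mom ν ≠ 0 → ∀ ξ ∈ U, P ν ξ = 0) (hξ : ξ ∈ U) (ν : Mon n) :
    poisson (genF ω Ωt K P) (Nham ω Ωt) ν ξ = -maskH (FMon K) P ν ξ := by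
  rw [poisson_antisymm, poisson_Nham, ← divC_ofReal]
  by_cases h : FMon K ν
  · rw [genF_of_FMon h, maskH_pos h]
    by_cases hP : P ν ξ = 0
    · simp [hP]
    · have h1 := hD.lower ν h (by by_contra h2; exact hP (hmom ν h2 ξ hξ)) ξ hξ
      have h2 : divC ω (fun j ξ => (Ωt j ξ : ℂ)) ν ξ ≠ 0 := norm_pos_iff.1 (hη.trans_le h1)
      have h3 := Complex.I_ne_zero
      field_simp
  · rw [genF_of_not h, maskH_neg h]; simp

theorem DivReg.resonant_part (hD : DivReg U ω Ωt K M L η) (hη : 0 < η) (hK : 0 ≤ K)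
    (hmom : ∀ ν, mom ν ≠ 0 → ∀ ξ ∈ U, P ν ξ = 0) (hξ : ξ ∈ U) (ν : Mon n) :
    P ν ξ - avgR P ν ξ - maskH (FMon K) P ν ξ =
      maskH (fun ν => ¬ (deg ν ≤ 2 ∧ absK ν.1 ≤ K ∧ ν ≠ 0)) P ν ξ := by
  classical
  by_cases hν : ν = 0
  · subst hν
    have h1 : avgR P 0 ξ = 0 := normalForm_zero _ _ _ _
      (fun i h => by simpa [monI] using congrFun (congrArg (fun ν : Mon n => ν.2.1) h) i)
      (fun j h => by
        simpa [monZ, monZb] using DFunLike.congr_fun (congrArg (fun ν : Mon n => ν.2.2.1) h) j)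
    rw [h1, maskH_neg (fun h => h.2.2 ⟨rfl, rfl⟩), maskH_pos (fun h => h.2.2 rfl)]
    simp
  · have h1 := genF_homological ω Ωt K hK P ξ (fun v a1 a2 a3 a4 h0 => by
      have h2 := hD.lower v ⟨a1, a2, a3⟩ (by by_contra h2; exact a4 (hmom v h2 ξ hξ)) ξ hξ
      rw [divC_ofReal, h0] at h2
      simp at h2
      linarith) ν hν
    have h2 := hD.poisson_genF_Nham hη hmom hξ ν
    rw [poisson_antisymm, h1] at h2
    have h3 : maskH (FMon K) P ν ξ = truncR K P ν ξ - avgR P ν ξ := by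
      linear_combination h2
    rw [h3]
    by_cases h : deg ν ≤ 2 ∧ absK ν.1 ≤ K
    · rw [maskH_neg (fun h' => h' ⟨h.1, h.2, hν⟩), truncR, if_pos h]; ring
    · rw [maskH_pos (fun h' => h ⟨h'.1, h'.2.1⟩), truncR, if_neg h]; ring

/-- The iterated brackets of `F` with a function of finite norm have finite norm on a smaller
domain. -/
theorem exists_HB_iterate (hO : IsOpen U) (hwt : ∀ m : NSite n, 1 ≤ weight ρ m) (hr : 0 < r)
    (hs : 0 < s) (hF : HB ρ U r s F A) (hf : HB ρ U r s f B) (j : ℕ) :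
    ∃ r' s' B' : ℝ, 0 < r' ∧ r' ≤ r ∧ 0 < s' ∧ s' ≤ s ∧ HB ρ U r' s' ((poisson F)^[j] f) B' := by
  induction j with
  | zero => exact ⟨r, s, B, hr, le_rfl, hs, le_rfl, hf⟩
  | succ j ih =>
    obtain ⟨r', s', B', h1, h2, h3, h4, h5⟩ := ih
    set δ := min 1 (s' / 2)
    have hδ : 0 < δ := lt_min one_pos (by linarith)
    have hδ1 : δ ≤ 1 := min_le_left _ _
    have hδ2 : δ ≤ s' / 2 := min_le_right _ _
    have hr2 : (1 + δ) * (r' / 2) ≤ r' := by nlinarith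
    have key := HB.poisson hO hwt (by linarith : 0 < r' / 2) (by linarith : 0 ≤ s' / 2) hδ hδ1
      (lt_max_of_lt_left one_pos) (lt_max_of_lt_left one_pos)
      ((hF.shrink (by positivity) (hr2.trans h2) (by linarith)).mono (le_max_right 1 _))
      ((h5.shrink (by positivity) hr2 (by linarith)).mono (le_max_right 1 _))
    rw [← Function.iterate_succ_apply' (poisson F)] at key
    exact ⟨r' / 2, s' / 2, _, by linarith, by linarith, by linarith, by linarith, key⟩

theorem iterate_poisson_add {H E : Ham n} (hO : IsOpen U) (hwt : ∀ m : NSite n, 1 ≤ weight ρ m)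
    (hr : 0 < r) (hs : 0 < s) (hF : HB ρ U r s F A) (hP : HB ρ U r s P B) (hE : HB ρ U r s E B)
    (hξ : ξ ∈ U) (hH : ∀ ν, BrSummable F H ν ξ) (hHE : ∀ ν, poisson F H ν ξ = E ν ξ)
    (j : ℕ) (ν : Mon n) : (poisson F)^[j + 1] (H + P) ν ξ =
      (poisson F)^[j] E ν ξ + (poisson F)^[j + 1] P ν ξ := by
  induction j generalizing ν with
  | zero =>
    change poisson F (H + P) ν ξ = E ν ξ + poisson F P ν ξ
    rw [poisson_add_right (hH ν) (hF.brSummable hO hwt hr hs.le hP ν hξ), hHE]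
  | succ j ih =>
    have hb : ∀ {f : Ham n}, HB ρ U r s f B → ∀ i, BrSummable F ((poisson F)^[i] f) ν ξ := by
      intro f hf i
      obtain ⟨r', s', B', h1, h2, h3, h4, h5⟩ := exists_HB_iterate hO hwt hr hs hF hf i
      exact (hF.shrink h1 h2 h4).brSummable hO hwt h1 h3.le h5 ν hξ
    rw [Function.iterate_succ_apply' _ (j + 1) (H + P), Function.iterate_succ_apply' _ j E,
      Function.iterate_succ_apply' _ (j + 1) P,
      ← poisson_add_right (hb hE j) (hb hP (j + 1))]
    exact poisson_congr fun v p q _ => by rw [ih]; rfl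

theorem diagQ_coeff (P : Ham n) (ν : Mon n) (ξ : Par b) :
    diagQ (fun j => P (monZ j + monZb j)) ν ξ =
      maskH (fun ν => ∃ j, ν = monZ j + monZb j) P ν ξ := by
  by_cases h : ∃ j, ν = monZ j + monZb j
  · rw [maskH_pos h]
    obtain ⟨j, rfl⟩ := h
    exact normalForm_monZZ _ _ _ _
  · rw [maskH_neg h]
    by_cases h1 : ∃ i, ν = monI i
    · obtain ⟨i, rfl⟩ := h1
      exact normalForm_monI _ _ _ _
    · exact normalForm_zero _ _ _ _ (not_exists.1 h1) (not_exists.1 h)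

theorem diagQ_OmegaPlus (Ωt : NSite n → Par b → ℝ) (P : Ham n) :
    diagQ (OmegaPlus Ωt P) = diagQ (fun j ξ => (Ωt j ξ : ℂ)) +
      diagQ (fun j => P (monZ j + monZb j)) := by
  classical
  funext ν ξ
  simp only [diagQ, normalForm, OmegaPlus, Pi.add_apply, ite_self, Finset.sum_const_zero, zero_add,
    ← Finset.sum_add_distrib]
  exact Finset.sum_congr rfl fun j _ => by split_ifs <;> simp

end Step

section Constants

variable {d b : ℕ} {n : Fin b → Fin d → ℤ} {ρ τ₀ r s s' M L ε K θ μ θ' μ' γ : ℝ}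
  {O U : Set (Par b)} {ω : Par b → Par b} {Ωt : NSite n → Par b → ℝ} {P : Ham n} {ξ : Par b}

/-- The loss in the norm of the generating function. -/
def genConst (d : ℕ) (τ₀ γ K : ℝ) : ℝ :=
  11595 * (2 * 4 ^ d / γ) ^ 4 * K ^ (8 * d * tau1 d τ₀ + 5)

theorem genConst_bound (hd : 1 ≤ d) (hτ₀ : 12 < τ₀) (hM : 0 < M) (hL : 0 < L) (hγ : 0 < γ)
    (hK : LargeK n τ₀ M L γ K) :
    ∃ c : ℝ, 1 / (divBound d τ₀ γ K / 2 / 2) +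
        (M * K + 8 * L) / (divBound d τ₀ γ K / 2 / 2) ^ 2 ≤ c ∧
      c + 8 * L * c ^ 2 + 5 ≤ genConst d τ₀ γ K := by
  have hK1 : 1 ≤ K := by have := hK.one_le; linarith
  have hK0 : 0 < K := by linarith
  have hp := divBound_pos hγ hK
  have h1 := divBound_le_one hd hτ₀ hγ hK
  set η := divBound d τ₀ γ K / 2 with hη
  have hη0 : 0 < η := by positivity
  set y := 1 / η with hy
  have hy1 : 1 ≤ y := by rw [hy, le_div_iff₀ hη0]; linarith
  have hyK : y ^ 4 * K ^ 5 = (2 * 4 ^ d / γ) ^ 4 * K ^ (8 * d * tau1 d τ₀ + 5) := by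
    have e1 : y = 2 * 4 ^ d / γ * K ^ (2 * d * tau1 d τ₀) := by
      rw [hy, hη, divBound, Real.rpow_neg hK0.le]
      field_simp
    have e2 : (K ^ (2 * d * tau1 d τ₀)) ^ 4 * K ^ 5 = K ^ (8 * d * tau1 d τ₀ + 5) := by
      rw [Real.rpow_add hK0, ← Real.rpow_natCast, ← Real.rpow_mul hK0.le]
      norm_num
      left
      ring_nf
    rw [e1, mul_pow, mul_assoc, e2]
  have hΛ : M * K + 8 * L ≤ 9 * K ^ 2 := by nlinarith [hK.hM, hK.hL]
  refine ⟨38 * (K ^ 2 * y ^ 2), ?_, ?_⟩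
  · have e : 1 / (η / 2) + (M * K + 8 * L) / (η / 2) ^ 2 =
        2 * y + 4 * (M * K + 8 * L) * y ^ 2 := by
      rw [hy]; field_simp; ring
    rw [e]
    have hK2 : 1 ≤ K ^ 2 := one_le_pow₀ hK1
    have a1 : y ≤ K ^ 2 * y ^ 2 := by nlinarith [mul_le_mul hK2 (le_refl (y ^ 2)) (by positivity) (by positivity)]
    have a2 := mul_le_mul_of_nonneg_right hΛ (by positivity : 0 ≤ y ^ 2)
    linarith
  · have hy2 : 1 ≤ y ^ 2 := one_le_pow₀ hy1
    have b1 : K ^ 2 * y ^ 2 ≤ K ^ 5 * y ^ 4 := mul_le_mul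
      (pow_le_pow_right₀ hK1 (by norm_num)) (pow_le_pow_right₀ hy1 (by norm_num)) (by positivity)
      (by positivity)
    have b2 : L * (K ^ 4 * y ^ 4) ≤ K ^ 5 * y ^ 4 := by
      have := mul_le_mul_of_nonneg_right hK.hL (by positivity : 0 ≤ K ^ 4 * y ^ 4)
      linarith
    have b3 : 1 ≤ K ^ 5 * y ^ 4 := one_le_mul_of_one_le_of_one_le (one_le_pow₀ hK1)
      (one_le_pow₀ hy1)
    have e : genConst d τ₀ γ K = 11595 * (K ^ 5 * y ^ 4) := by
      rw [genConst, mul_assoc, ← hyK]; ring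
    rw [e]
    have e2 : 8 * L * (38 * (K ^ 2 * y ^ 2)) ^ 2 = 11552 * (L * (K ^ 4 * y ^ 4)) := by ring
    rw [e2]
    linarith

theorem genConst_pos (hK : 0 < K) (hγ : 0 < γ) : 0 < genConst d τ₀ γ K := by
  unfold genConst; positivity

theorem genConst_mul_le (hd : 1 ≤ d) (hτ₀ : 12 < τ₀) (hγ : 0 < γ) (hK : 1 ≤ K) :
    genConst d τ₀ γ K * K ^ (-(3 * tau1 d τ₀ ^ 2 / τ₀)) ≤ 11595 * (2 * 4 ^ d / γ) ^ 4 := by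
  have hK0 : 0 < K := by linarith
  rw [genConst, mul_assoc, ← Real.rpow_add hK0]
  refine mul_le_of_le_one_right (by positivity) (Real.rpow_le_one_of_one_le_of_nonpos hK ?_)
  have hd' : (1 : ℝ) ≤ d := by exact_mod_cast hd
  have h1 : 16 * d ≤ tau1 d τ₀ / τ₀ := by
    rw [le_div_iff₀ (by linarith), tau1]
    have h2 : 16 * (d : ℝ) ≤ (4 * d : ℝ) ^ (d + 1) := by
      calc 16 * (d : ℝ) ≤ (4 * d : ℝ) ^ 2 := by nlinarith
        _ ≤ _ := pow_le_pow_right₀ (by linarith) (by omega)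
    nlinarith
  have h2 := tau_le_tau1 hd (by linarith : (0 : ℝ) ≤ τ₀)
  have e : 3 * tau1 d τ₀ ^ 2 / τ₀ = 3 * (tau1 d τ₀ * (tau1 d τ₀ / τ₀)) := by ring
  rw [e]
  have h3 := mul_le_mul_of_nonneg_left h1 (by linarith : 0 ≤ tau1 d τ₀)
  nlinarith

theorem KAMHyp.exists_TBF (h : KAMHyp ρ τ₀ O r s M L ε K θ μ ω Ωt P) (hne : ∃ i, n i ≠ 0)
    (hτ₀ : 12 < τ₀) (hr : 0 < r) (hM : 0 < M) (hL : 0 < L) (hγ : 0 < γ) (hε : 0 < ε)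
    (hwt : ∀ m : NSite n, 1 ≤ weight ρ m) (hK : LargeK n τ₀ M L γ K) :
    ∃ N₀ : ℕ, let U := Oreg O ω Ωt K (divBound d τ₀ γ K / 2)
      TBF ρ τ₀ U r s θ μ P (2 * ε) N₀ ∧
      TBF ρ τ₀ U r s θ μ (diagQ fun j ξ => (Ωt j ξ : ℂ)) (2 * L) N₀ ∧
      TBF ρ τ₀ U r s θ μ (genF ω Ωt K P) (genConst d τ₀ γ K * (2 * ε)) N₀ := by
  have hd := one_le_dim hne
  have hd' : (1 : ℝ) ≤ d := by exact_mod_cast hd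
  have hK1 := hK.one_le
  set η := divBound d τ₀ γ K / 2 with hη
  have hη0 : 0 < η := half_pos (divBound_pos hγ hK)
  have hC := C1_nonneg n
  have hMK : 0 < M * K := by positivity
  have hLη : 0 < 16 * L / η := by positivity
  obtain ⟨c, hc, hc'⟩ := genConst_bound hd hτ₀ hM hL hγ hK
  set X := (1000 + 6 * C1 n) + K + 16 * L / η + 16 * (M * K + 8 * L) with hX
  have hN : ∀ N : ℕ, ⌈X⌉₊ ≤ N → X ≤ N := fun N hN => (Nat.le_ceil _).trans (by exact_mod_cast hN)
  have hP : TBF ρ τ₀ (Oreg O ω Ωt K η) r s θ μ P (2 * ε) ⌈X⌉₊ := fun N hN' τ h1 h2 => by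
    have := hN N hN'
    exact (TB.of_TNorm hne hr hwt (by exact_mod_cast (by linarith : (2 : ℝ) ≤ N)) hε h.P_qt.1
      h.P_bound (by linarith) h1 h2).subset Oreg_subset
  have hQ : TBF ρ τ₀ (Oreg O ω Ωt K η) r s θ μ (diagQ fun j ξ => (Ωt j ξ : ℂ)) (2 * L) ⌈X⌉₊ :=
    fun N hN' τ h1 h2 => by
      have := hN N hN'
      exact (TB.of_TNorm hne hr hwt (by exact_mod_cast (by linarith : (2 : ℝ) ≤ N)) hL
        h.Omega_qt.1 h.Omega_qt_bound (by linarith) h1 h2).subset Oreg_subset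
  refine ⟨⌈X⌉₊, hP, hQ, fun N hN' τ h1 h2 => ?_⟩
  have hNX := hN N hN'
  have hN1 : (1 : ℝ) ≤ N := by linarith
  have hNT : (N : ℝ) ≤ (N : ℝ) ^ (4 * d * τ) := by
    conv_lhs => rw [← Real.rpow_one (N : ℝ)]
    exact Real.rpow_le_rpow_of_exponent_le hN1 (by nlinarith)
  refine (genF_TB (h.divReg hM hL) hne hL hM hη0 (by linarith) hr hwt (by linarith) hτ₀ h1 h2
    h.theta_mem.1.le (by linarith [h.mu_mem.1]) h.mu_mem.2.le ?_ (by linarith) hc (by linarith)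
    (hQ N hN' τ h1 h2) (hP N hN' τ h1 h2)).mono (mul_le_mul_of_nonneg_right hc' (by linarith))
  rw [← div_le_iff₀' hη0]
  linarith

theorem exists_compat (hd : 1 ≤ d) (hτ₀ : 12 < τ₀) (hθ : θ < θ') (hμ : μ' < μ) :
    ∃ K₁ : ℝ, K ≤ K₁ ∧ ∀ K', K₁ ≤ K' → Compat d τ₀ θ μ K' θ' μ' := by
  have hd' : (1 : ℝ) ≤ d := by exact_mod_cast hd
  refine ⟨max K (max 1 (max (16 / (μ - μ') + 1) (4 * μ' / (θ' - θ) + 1))), le_max_left _ _,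
    fun K' hK' => ?_⟩
  simp only [max_le_iff] at hK'
  obtain ⟨-, h1, h2, h3⟩ := hK'
  have hK0 : 0 < K' := by linarith
  constructor
  · have e : K' ^ (3 / 2 : ℝ) = K' * Real.sqrt K' := by
      rw [Real.sqrt_eq_rpow, ← Real.rpow_one_add' hK0.le (by norm_num)]; norm_num
    have h4 : 16 < (μ - μ') * K' := by rw [← div_lt_iff₀' (by linarith)]; linarith
    have h5 : 4 < Real.sqrt ((μ - μ') * K') := by
      rw [Real.lt_sqrt (by norm_num)]; linarith
    rw [Real.sqrt_mul (by linarith)] at h5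
    rw [e]
    nlinarith
  · have h4 : 4 * μ' < (θ' - θ) * K' := by rw [← div_lt_iff₀' (by linarith)]; linarith
    have h5 : K' ^ (5 : ℕ) ≤ K' ^ (4 * d * τ₀ - 1) := by
      rw [← Real.rpow_natCast]
      exact Real.rpow_le_rpow_of_exponent_le h1 (by push_cast; nlinarith)
    calc 4 * μ' * K' ^ 4 < (θ' - θ) * K' * K' ^ 4 := by gcongr
      _ = (θ' - θ) * K' ^ 5 := by ring
      _ ≤ _ := mul_le_mul_of_nonneg_left h5 (by linarith)

end Constants

section Conclusion

variable {d b : ℕ} {n : Fin b → Fin d → ℤ} {N₀ : ℕ} {ρ τ₀ r s s' R M L ε K θ μ θ' μ' γ η A B δ₀ : ℝ}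
  {O U : Set (Par b)} {ω : Par b → Par b} {Ωt : NSite n → Par b → ℝ} {P : Ham n} {ξ : Par b}

/-- The Lie series of `𝒩 + P` converges, and the new perturbation is approximately Töplitz. -/
theorem DivReg.lieExp_TBF (hD : DivReg U ω Ωt K M L η) (hη : 0 < η) (hK : 0 ≤ K)
    (hne : ∃ i, n i ≠ 0) (hτ₀ : 12 < τ₀) (hwt : ∀ m : NSite n, 1 ≤ weight ρ m) (hR : 0 < R)
    (hδ₀ : 0 < δ₀) (hδ₁ : δ₀ ≤ 1 / 2) (hs' : 0 ≤ s') (hS : s' ≤ s - 2 * δ₀) (hA : 0 < A)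
    (hB : 0 < B) (hAδ : 512 * Real.exp 1 * A / δ₀ ≤ 1 / 4) (hθ : 1 / 2 ≤ θ) (hμ : μ ≤ 4)
    (hF : TBF ρ τ₀ U R s θ μ (genF ω Ωt K P) A N₀) (hP : TBF ρ τ₀ U R s θ μ P B N₀)
    (hθθ : θ < θ') (hμμ : μ' < μ) :
    (∀ ξ ∈ U, ∀ ν : Mon n, Summable fun j => lieTerm (genF ω Ωt K P) (Nham ω Ωt + P) j ν ξ) ∧
      ∃ B' N₁, 0 ≤ B' ∧ TBF ρ τ₀ U (R / 2) s' θ' μ' (Pplus ω Ωt K P) B' N₁ := by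
  have hO := hD.isOpen
  have hs0 : 0 < s := by linarith
  have hs'0 : s' ≤ s := by linarith
  have hPb := hP.hb hne (by linarith)
  have hFb := hF.hb hne (by linarith)
  set F := genF ω Ωt K P with hFdef
  obtain ⟨N₁, hE₁⟩ := hP.maskH hne hτ₀ hθ hμ (FMon.permM (n := n) (K := K))
  obtain ⟨N₂, hW⟩ := hP.maskH hne hτ₀ hθ hμ
    (χ := fun ν => ¬ (deg ν ≤ 2 ∧ absK ν.1 ≤ K ∧ ν ≠ 0)) (fun Φ ν => by
      rw [deg_permM, permM_fst, ne_eq, EmbeddingLike.map_eq_zero_iff])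
  set E : Ham n := (-1 : ℂ) • maskH (FMon K) P with hEdef
  have hE : TBF ρ τ₀ U R s θ μ E B (max N₀ N₁) := by
    have := (hE₁.smul (-1)).mono (B := B) (by simp) (le_max_right N₀ N₁)
    exact this
  have hF' := hF.mono le_rfl (le_max_left N₀ N₁)
  have hFK : ∀ ν, K < absK ν.1 → ∀ ξ, F ν ξ = 0 := fun ν hν ξ =>
    genF_of_not (fun h => absurd h.2.1 (not_le.2 hν)) ξ
  have ha : ∀ j : ℕ, ‖((j.factorial : ℂ))⁻¹‖ ≤ (j.factorial : ℝ)⁻¹ := fun j => by simp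
  have ha' : ∀ j : ℕ, ‖(((j + 1).factorial : ℂ))⁻¹‖ ≤ (j.factorial : ℝ)⁻¹ := fun j => by
    rw [norm_inv, Complex.norm_natCast]
    exact inv_anti₀ (by exact_mod_cast j.factorial_pos)
      (by exact_mod_cast Nat.factorial_le (Nat.le_succ j))
  obtain ⟨c₁, N₃, hS₁⟩ := lieSum_TBF hne hτ₀ hO hwt hR hδ₀ hδ₁ hs' hS hA hB hAδ hF hP hFK
    (by linarith) (by linarith) hθθ hμμ ha
  obtain ⟨c₂, N₄, hS₂⟩ := lieSum_TBF hne hτ₀ hO hwt hR hδ₀ hδ₁ hs' hS hA hB hAδ hF' hE hFK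
    (by linarith) (by linarith) hθθ hμμ ha'
  have hstep : ∀ ξ ∈ U, ∀ (j : ℕ) (ν : Mon n), (poisson F)^[j + 1] (Nham ω Ωt + P) ν ξ =
      (poisson F)^[j] E ν ξ + (poisson F)^[j + 1] P ν ξ := fun ξ hξ j ν =>
    iterate_poisson_add hO hwt hR hs0 hFb hPb (hE.hb hne (by linarith)) hξ
      (fun ν => (normalForm_brSummable _ _ F ν ξ).swap)
      (fun ν => (hD.poisson_genF_Nham hη hPb.momentum hξ ν).trans (by simp [hEdef])) j ν
  have hterm : ∀ ξ ∈ U, ∀ (j : ℕ) (ν : Mon n), lieTerm F (Nham ω Ωt + P) (j + 1) ν ξ =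
      (((j + 1).factorial : ℂ))⁻¹ * (poisson F)^[j] E ν ξ +
        ((((j + 1).factorial : ℂ))⁻¹ • (poisson F)^[j + 1] P) ν ξ := fun ξ hξ j ν => by
    rw [lieTerm, hstep ξ hξ, mul_add]; rfl
  have hsP : ∀ ξ ∈ U, ∀ ν, Summable fun j : ℕ =>
      ((((j + 1).factorial : ℂ))⁻¹ • (poisson F)^[j + 1] P) ν ξ := fun ξ hξ ν =>
    summable_of_coefNorm (c₁ ν) hξ
  have hsE : ∀ ξ ∈ U, ∀ ν, Summable fun j : ℕ =>
      ((((j + 1 + 1).factorial : ℂ))⁻¹ • (poisson F)^[j + 1] E) ν ξ := fun ξ hξ ν =>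
    summable_of_coefNorm (c₂ ν) hξ
  have hsE' : ∀ ξ ∈ U, ∀ ν, Summable fun j : ℕ =>
      (((j + 1).factorial : ℂ))⁻¹ * (poisson F)^[j] E ν ξ := fun ξ hξ ν =>
    (summable_nat_add_iff 1).1 (hsE ξ hξ ν)
  have hsum : ∀ ξ ∈ U, ∀ ν : Mon n, Summable fun j => lieTerm F (Nham ω Ωt + P) j ν ξ :=
    fun ξ hξ ν => (summable_nat_add_iff 1).1
      (((hsE' ξ hξ ν).add (hsP ξ hξ ν)).congr fun j => (hterm ξ hξ j ν).symm)
  obtain ⟨N₅, hW'⟩ := (hW.shrink (half_pos hR) (by linarith) hs'0).params hne hτ₀ (by linarith)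
    (by linarith) hθθ hμμ
  have hq : 0 ≤ (R / (R / 2)) ^ 2 * B := by positivity
  refine ⟨hsum, _, _, ?_, ((hW'.add hO hq (by positivity) (hS₁.add hO (by positivity)
    (by positivity) hS₂)).congr hO fun ν ξ hξ => ?_)⟩
  · positivity
  · have h0 : lieTerm F (Nham ω Ωt + P) 0 ν ξ = Nham ω Ωt ν ξ + P ν ξ := by
      simp [lieTerm]
    have e1 : ∑' j : ℕ, lieTerm F (Nham ω Ωt + P) (j + 1) ν ξ =
        (E ν ξ + ∑' j : ℕ, ((((j + 1 + 1).factorial : ℂ))⁻¹ • (poisson F)^[j + 1] E) ν ξ) +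
          ∑' j : ℕ, ((((j + 1).factorial : ℂ))⁻¹ • (poisson F)^[j + 1] P) ν ξ := by
      rw [tsum_congr fun j => hterm ξ hξ j ν, (hsE' ξ hξ ν).tsum_add (hsP ξ hξ ν),
        (hsE' ξ hξ ν).tsum_eq_zero_add]
      simp
    have e2 := hD.resonant_part hη hK hPb.momentum hξ ν
    have e3 : E ν ξ = -maskH (FMon K) P ν ξ := by simp [hEdef]
    change lieExp F (Nham ω Ωt + P) ν ξ - (Nham ω Ωt ν ξ + avgR P ν ξ) = _
    rw [lieExp, (hsum ξ hξ ν).tsum_eq_zero_add, h0, e1, e3]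
    simp only [Pi.add_apply]
    rw [← e2]
    ring

/-- The diagonal part of the new normal form is approximately Töplitz. -/
theorem diagQ_OmegaPlus_TBF (hO : IsOpen U) (hne : ∃ i, n i ≠ 0) (hτ₀ : 12 < τ₀) (hL : 0 ≤ L)
    (hB : 0 ≤ B) (hθ : 1 / 2 ≤ θ) (hμ : μ ≤ 4)
    (hQ : TBF ρ τ₀ U r s θ μ (diagQ fun j ξ => (Ωt j ξ : ℂ)) L N₀)
    (hP : TBF ρ τ₀ U r s θ μ P B N₀) :
    ∃ N₁, TBF ρ τ₀ U r s θ μ (diagQ (OmegaPlus Ωt P)) (L + B) N₁ := by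
  obtain ⟨N₁, h⟩ := hP.maskH hne hτ₀ hθ hμ (χ := fun ν => ∃ j, ν = monZ j + monZb j) (fun Φ ν => by
    constructor
    · rintro ⟨j, hj⟩
      refine ⟨Φ.symm j, (permM Φ).injective ?_⟩
      simp [hj]
    · rintro ⟨j, rfl⟩
      exact ⟨Φ j, by simp⟩)
  refine ⟨_, (hQ.add hO hL hB h).congr hO fun ν ξ _ => ?_⟩
  rw [diagQ_OmegaPlus, Pi.add_apply, Pi.add_apply, diagQ_coeff]
  rfl

end Conclusion

end QT

end

theorem proposition2 {d b : ℕ} (n : Fin b → Fin d → ℤ) (hn : Function.Injective n)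
    (hzero : ∃ i, n i = 0) (hne : ∃ i, n i ≠ 0)
    (τ₀ : ℝ) (hτ₀ : max ((d : ℝ) + b) 12 < τ₀)
    (M L γ : ℝ) (hM : 0 < M) (hL : 0 < L) (hLM : L * M < 1 / 2) (hγ : 0 < γ) :
    ∃ K₀ : ℝ, 0 < K₀ ∧ ∀ s s' : ℝ, 0 < s' → s' < s → ∃ c : ℝ, 0 < c ∧
      ∀ (ρ r ε K θ μ : ℝ) (O : Set (QT.Par b)) (ω : QT.Par b → QT.Par b)
        (Ωt : QT.NSite n → QT.Par b → ℝ) (P : QT.Ham n)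
        (mg : ℕ → (ℓ : ℕ) → QT.Pres d ℓ → QT.NSite n),
        0 < ρ → 0 < r → 0 < ε → K₀ ≤ K →
        ε ≤ c * (γ ^ 2 * K ^ (-(3 * QT.tau1 d τ₀ ^ 2 / τ₀))) ^ 3 →
        QT.KAMHyp ρ τ₀ O r s M L ε K θ μ ω Ωt P →
        QT.IsChoice τ₀ mg →
        (∀ ξ ∈ QT.Oplus τ₀ γ K O ω Ωt mg, ∀ ν : QT.Mon n,
          Summable fun j => QT.lieTerm (QT.genF ω Ωt K P) (QT.Nham ω Ωt + P) j ν ξ) ∧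
        ∀ θ' μ' : ℝ, θ < θ' → θ' < 4 → 1 / 2 < μ' → μ' < μ →
          (∃ K₁ : ℝ, K ≤ K₁ ∧ ∀ K' : ℝ, K₁ ≤ K' → QT.Compat d τ₀ θ μ K' θ' μ') ∧
          ∀ K' : ℝ, K ≤ K' → QT.Compat d τ₀ θ μ K' θ' μ' →
            QT.QuasiToplitz ρ τ₀ (QT.Oplus τ₀ γ K O ω Ωt mg) (ε ^ (1 / 3 : ℝ) * r / 4) s' K' θ' μ'
              (QT.Pplus ω Ωt K P) ∧
            QT.QuasiToplitz ρ τ₀ (QT.Oplus τ₀ γ K O ω Ωt mg) (ε ^ (1 / 3 : ℝ) * r / 4) s' K' θ' μ'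
              (QT.diagQ (QT.OmegaPlus Ωt P)) := by
  have hd := QT.one_le_dim hne
  have hτ : 12 < τ₀ := (le_max_right _ _).trans_lt hτ₀
  obtain ⟨K₀, hK₀, hLarge⟩ := QT.exists_largeK n τ₀ M L hγ
  refine ⟨K₀, hK₀, fun s s' hs' hss => ?_⟩
  set δ₀ := min (1 / 2) ((s - s') / 2) with hδdef
  have hδ : 0 < δ₀ := lt_min (by norm_num) (by linarith)
  have hδ1 : δ₀ ≤ 1 / 2 := min_le_left _ _
  have hδ2 : δ₀ ≤ (s - s') / 2 := min_le_right _ _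
  set A := δ₀ / (2048 * Real.exp 1) with hAdef
  have hA : 0 < A := by positivity
  set C : ℝ := 11595 * (2 * 4 ^ d / γ) ^ 4 with hCdef
  have hC : 0 < C := by positivity
  set c := min (1 / γ ^ 2) (A / (8 * C * γ ^ 2)) with hcdef
  have hc : 0 < c := lt_min (by positivity) (by positivity)
  refine ⟨c ^ 3, by positivity, ?_⟩
  intro ρ r ε K θ μ O ω Ωt P mg hρ hr hε hK hεc h hmg
  have hK' := hLarge K hK
  have hK1 : 1 ≤ K := by have := hK'.one_le; linarith
  have hwt := QT.one_le_weight hzero hρ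
  set η := QT.divBound d τ₀ γ K / 2 with hηdef
  have hη : 0 < η := half_pos (QT.divBound_pos hγ hK')
  have hsub := QT.Oplus_subset_Oreg hne hτ hr hM hL hγ hwt h hK' hmg
  obtain ⟨N₀, hP, hQ, hF⟩ := h.exists_TBF hne hτ hr hM hL hγ hε hwt hK'
  have hD := h.divReg (η := η) hM hL
  set e := ε ^ (1 / 3 : ℝ) with hedef
  have he : 0 < e := Real.rpow_pos_of_pos hε _
  have he3 : e ^ 3 = ε := by
    rw [hedef, ← Real.rpow_natCast, ← Real.rpow_mul hε.le]; norm_num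
  set κ := K ^ (-(3 * QT.tau1 d τ₀ ^ 2 / τ₀)) with hκ
  have hκ0 : 0 < κ := Real.rpow_pos_of_pos (by linarith) _
  have hec : e ≤ c * (γ ^ 2 * κ) := by
    refine le_of_pow_le_pow_left₀ (n := 3) (by norm_num) (by positivity) ?_
    rw [he3, mul_pow]; exact hεc
  have hκ1 : κ ≤ 1 := by
    refine Real.rpow_le_one_of_one_le_of_nonpos hK1 ?_
    have : 0 ≤ 3 * QT.tau1 d τ₀ ^ 2 / τ₀ := by positivity
    linarith
  have he1 : e ≤ 1 := by
    have h1 : c * γ ^ 2 ≤ 1 := by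
      rw [← le_div_iff₀ (by positivity)]; exact min_le_left _ _
    calc e ≤ c * (γ ^ 2 * κ) := hec
      _ = (c * γ ^ 2) * κ := by ring
      _ ≤ 1 := mul_le_one₀ h1 hκ0.le hκ1
  have hR : 0 < e * r / 2 := by positivity
  have hRr : e * r / 2 ≤ r := by nlinarith
  have hAF : (r / (e * r / 2)) ^ 2 * (QT.genConst d τ₀ γ K * (2 * ε)) ≤ A := by
    have h1 : (r / (e * r / 2)) ^ 2 * (QT.genConst d τ₀ γ K * (2 * ε)) =
        8 * QT.genConst d τ₀ γ K * e := by
      rw [← he3]; field_simp; ring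
    have h2 : c * (8 * C * γ ^ 2) ≤ A := by
      rw [← le_div_iff₀ (by positivity)]; exact min_le_right _ _
    have h3 := QT.genConst_mul_le hd hτ hγ hK1
    have h4 := QT.genConst_pos (d := d) (τ₀ := τ₀) (by linarith : 0 < K) hγ
    calc _ = 8 * QT.genConst d τ₀ γ K * e := h1
      _ ≤ 8 * QT.genConst d τ₀ γ K * (c * (γ ^ 2 * κ)) := by gcongr
      _ = 8 * c * γ ^ 2 * (QT.genConst d τ₀ γ K * κ) := by ring
      _ ≤ 8 * c * γ ^ 2 * C := by gcongr
      _ = c * (8 * C * γ ^ 2) := by ring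
      _ ≤ A := h2
  have hAδ : 512 * Real.exp 1 * A / δ₀ ≤ 1 / 4 := by
    have := Real.exp_pos 1
    rw [hAdef]
    refine le_of_eq ?_
    field_simp
    norm_num
  have hFR := (hF.shrink hR hRr le_rfl).mono hAF le_rfl
  have hPR := hP.shrink hR hRr le_rfl
  have hB : 0 < (r / (e * r / 2)) ^ 2 * (2 * ε) := by positivity
  have hstep : ∀ {θ' μ' : ℝ}, θ < θ' → μ' < μ → _ := fun hθ hμ =>
    hD.lieExp_TBF hη (by linarith) hne hτ hwt hR hδ hδ1 hs'.le (by linarith) hA hB hAδ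
      h.theta_mem.1.le h.mu_mem.2.le hFR hPR hθ hμ
  refine ⟨fun ξ hξ ν => (hstep (lt_add_one θ) (sub_one_lt μ)).1 ξ (hsub hξ) ν, ?_⟩
  intro θ' μ' hθ hθ' hμ' hμ
  refine ⟨QT.exists_compat hd hτ hθ hμ, fun K' _ _ => ?_⟩
  have hR2 : e * r / 2 / 2 = e * r / 4 := by ring
  have hθ'' : 1 / 2 ≤ θ' := by linarith [h.theta_mem.1]
  have hμ'' : μ' ≤ 4 := by linarith [h.mu_mem.2]
  constructor
  · obtain ⟨B', N₁, hB', hT⟩ := (hstep hθ hμ).2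
    rw [hR2] at hT
    exact (hT.subset hsub).quasiToplitz hne hτ (by positivity) hwt hB' hθ'' hμ'' K'
  · obtain ⟨N₁, hT⟩ := QT.diagQ_OmegaPlus_TBF hD.isOpen hne hτ (by positivity) (by positivity)
      h.theta_mem.1.le h.mu_mem.2.le hQ hP
    obtain ⟨N₂, hT⟩ := (hT.shrink (by positivity : 0 < e * r / 4) (by nlinarith) hss.le).params
      hne hτ (by linarith [h.theta_mem.1]) (by linarith [h.mu_mem.2]) hθ hμ
    exact (hT.subset hsub).quasiToplitz hne hτ (by positivity) hwt (by positivity) hθ'' hμ'' K'
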